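/- **Conventions.** Manifolds are smooth, finite-dimensional, Hausdorff and second countable. A hyperKähler structure on a manifold is a Riemannian metric $g$ with three orthogonal complex structures $I_1,I_2,I_3$ that are covariantly constant for the Levi-Civita connection and satisfy $I_1I_2=-I_2I_1=I_3$. Put $\omega_r(\cdot,\cdot)=g(\cdot,I_r\cdot)$ and $\omega=\omega_1i+\omega_2j+\omega_3k$. For 1-forms, $(\zeta_1\odot\zeta_2)(a,b)=\zeta_1(a)\zeta_2(b)+\zeta_1(b)\zeta_2(a)$ and $(\zeta_1\wedge\zeta_2)(a,b)=\zeta_1(a)\zeta_2(b)-\zeta_1(b)\zeta_2(a)$. For a complex structure $I_r$ and a real function $f$, $i\partial_r\bar\partial_rf=-\tfrac12d(df\circ I_r)$; a function $\rho$ is a hyperKähler potential if $i\partial_r\bar\partial_r\rho=\omega_r$ for $r=1,2,3$. An action $x\mapsto L_x$ of $\mathbb H^*$ on a hyperKähler manifold is permuting if $L_x^*g=|x|^2g$, $L_x^*\omega=x\omega\bar x$, and $I_1Y_1=I_2Y_2=I_3Y_3=-Y_0$, where $Y_0,Y_1,Y_2,Y_3$ are the vector fields generated by $1,i,j,k$.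 The vector field of a circle action is the one generated by $t\mapsto e^{it}$, and $S^1\subset\mathbb H^*$ are the unit complex numbers $a+bi$. **Construction.** Let $S^1_r$ act isometrically on a hyperKähler manifold $(\tilde M,\tilde g,\tilde\omega)$ with $L_z^*\tilde\omega=z\tilde\omega\bar z$ (so it fixes $I_1$ and rotates $I_2,I_3$). Let $K_r$ be its vector field, $w=\|K_r\|^2$, let $\tilde\rho$ be a momentum map, $d\tilde\rho=-\imath_{K_r}\tilde\omega_1$, and suppose that $v=-\frac{w+2\tilde\rho}4$ is everywhere positive. Let $P\to\tilde M$ be a principal $S^1_0$-bundle with vector field $K_0$ and connection $\xi\in\Omega^1(P)$, $\xi(K_0)=1$, with curvature form $F_\xi$ on $\tilde M$ (the pull-back of $F_\xi$ to $P$ is $d\xi$). Let the $S^1_r$-action be extended to $P$ so that it commutes with $S^1_0$ and its vector field on $P$ is $\hat K_r+2vK_0$, where $\hat K_r$ is the horizontal lift of $K_r$. Let $S^1_r$ act on $\mathbb H^*\times P$ by $z\cdot(x,p)=(xz,\bar zp)$ and put $\mathcal H(\tilde M)=\mathbb H^*\times_{S^1_r}P$, the orbit space. Put $\eta=\imath_{K_r}\tilde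 g+\imath_{K_r}\tilde\omega$. **Theorem.** (1) $\mathcal H(\tilde M)$ is a smooth manifold such that the projection $\mathbb H^*\times P\to\mathcal H(\tilde M)$ is a submersion. There is a hyperKähler structure on it whose metric and 2-form $\omega$ have the pull-backs $$(4v+w)\,\mathrm{Re}\,dx\otimes d\bar x-\mathrm{Re}\bigl(\bar x\,dx\,i\odot(2\xi+\eta)\bigr)+|x|^2\bigl(\tilde g+v^{-1}\xi^2\bigr),$$ $$\tfrac{4v+w}2\,dx\wedge d\bar x+x\tilde\omega\bar x-2\,\mathrm{Im}(dx\,i\,\bar x)\wedge\xi-\mathrm{Im}(dx\,i\wedge\eta\,\bar x)$$ to $\mathbb H^*\times P$ if and only if $$F_\xi=i\,\partial_1\bar\partial_1\tilde\rho-\tilde\omega_1 .$$ (2) In that case left multiplication on $\mathbb H^*$ induces a permuting $\mathbb H^*$-action on $\mathcal H(\tilde M)$, which induces a transitive action on the 2-sphere $\{a_1I_1+a_2I_2+a_3I_3:|a|=1\}$ of complex structures, and $\rho=-\frac{4v+w}2|x|^2$ is a hyperKähler potential on $\mathcal H(\tilde M)$. (3) Conversely, let $M$ be a hyperKähler manifold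 with a permuting $\mathbb H^*$-action and an isometric triholomorphic $S^1_0$-action that commutes with it and has a momentum map $\mu:M\to\mathrm{Im}\,\mathbb H$, $d\mu=-\imath_{K_0}\omega$, with $\mu(xm)=x\mu(m)\bar x$. Suppose that $S^1_0$ acts freely on $P=\mu^{-1}(-i)$. Then $M_0=M\setminus\mu^{-1}(0)$ is open, and it is dense if $S^1_0$ acts trivially on no connected component of $M$. Further, $P$ is a submanifold of $M$, $P\to\tilde M=P/S^1_0$ is a principal bundle onto a smooth manifold, and there are the hyperKähler structure on $\tilde M$ obtained by hyperKähler reduction at the level $-i$, a momentum map $\tilde\rho$ and a connection $\xi$ which, with the $S^1_r$-actions on $P$ and $\tilde M$ given by $S^1\subset\mathbb H^*$, satisfy all assumptions of the construction and $F_\xi=i\partial_1\bar\partial_1\tilde\rho-\tilde\omega_1$, such that $(x,p)\mapsto xp$ induces a diffeomorphism of $\mathcal H(\tilde M)$ onto $M_0$ that carries the hyperKähler structure of (1) to that of $M_0$. -/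

import Mathlib

open scoped Manifold ContDiff Quaternion
open Bundle

noncomputable section

namespace HyperkahlerInduction

/-! ### Tensors on a manifold and their coordinate expressions

All manifolds are modelled on a normed space `E` by `𝓘(ℝ, E)`, so they have no boundary. -/

section Tensors

variable {E : Type*} [NormedAddCommGroup E] [NormedSpace ℝ E]
  {M : Type*} [TopologicalSpace M] [ChartedSpace E M]

/-- The differential of the inverse of the preferred chart at `m`, at the point `y` of the
target of that chart. -/
def dChartSymm (m : M) (y : E) :
    E →L[ℝ] TangentSpace 𝓘(ℝ, E) ((extChartAt 𝓘(ℝ, E) m).symm y) :=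
  mfderiv 𝓘(ℝ, E) 𝓘(ℝ, E) (extChartAt 𝓘(ℝ, E) m).symm y

/-- The differential of the preferred chart at `m`, at the point `m'` of its source. -/
def dChart (m m' : M) : TangentSpace 𝓘(ℝ, E) m' →L[ℝ] E :=
  mfderiv 𝓘(ℝ, E) 𝓘(ℝ, E) (extChartAt 𝓘(ℝ, E) m) m'

/-- A 1-form in the coordinates of the preferred chart at `m`. -/
def oneFormCoord (α : (m : M) → TangentSpace 𝓘(ℝ, E) m →L[ℝ] ℝ) (m : M) (y : E) : E →L[ℝ] ℝ :=
  (α ((extChartAt 𝓘(ℝ, E) m).symm y)).comp (dChartSymm m y)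

/-- The exterior derivative of a 1-form, computed at `m` in the preferred chart at `m`:
`dα(u, v) = ∂_u (α(v)) - ∂_v (α(u))` for `u`, `v` constant in coordinates. -/
def extDerivOne (α : (m : M) → TangentSpace 𝓘(ℝ, E) m →L[ℝ] ℝ) (m : M)
    (u v : TangentSpace 𝓘(ℝ, E) m) : ℝ :=
  fderiv ℝ (oneFormCoord α m) (extChartAt 𝓘(ℝ, E) m m) (dChart m m u) (dChart m m v)
    - fderiv ℝ (oneFormCoord α m) (extChartAt 𝓘(ℝ, E) m m) (dChart m m v) (dChart m m u)

/-- A field of bilinear forms in the coordinates of the preferred chart at `m`. -/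
def bilinCoord
    (g : (m : M) → TangentSpace 𝓘(ℝ, E) m →L[ℝ] TangentSpace 𝓘(ℝ, E) m →L[ℝ] ℝ)
    (m : M) (y : E) (a b : E) : ℝ :=
  g ((extChartAt 𝓘(ℝ, E) m).symm y) (dChartSymm m y a) (dChartSymm m y b)

/-- A field of endomorphisms of the tangent spaces in the coordinates of the preferred chart
at `m`. -/
def endCoord (J : (m : M) → TangentSpace 𝓘(ℝ, E) m →L[ℝ] TangentSpace 𝓘(ℝ, E) m)
    (m : M) (y : E) (a : E) : E :=
  dChart m ((extChartAt 𝓘(ℝ, E) m).symm y)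
    (J ((extChartAt 𝓘(ℝ, E) m).symm y) (dChartSymm m y a))

/-- The Christoffel symbol of the first kind of the metric `g` at `m`, in the preferred chart at
`m`: `Γ(a, b, c) = g(∇_a b, c)` for the Levi-Civita connection `∇` and vector fields `a`, `b`, `c`
that are constant in the coordinates. -/
def christoffel
    (g : (m : M) → TangentSpace 𝓘(ℝ, E) m →L[ℝ] TangentSpace 𝓘(ℝ, E) m →L[ℝ] ℝ)
    (m : M) (a b c : E) : ℝ :=
  (1 / 2) * (fderiv ℝ (fun y => bilinCoord g m y b c) (extChartAt 𝓘(ℝ, E) m m) a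
    + fderiv ℝ (fun y => bilinCoord g m y a c) (extChartAt 𝓘(ℝ, E) m m) b
    - fderiv ℝ (fun y => bilinCoord g m y a b) (extChartAt 𝓘(ℝ, E) m m) c)

/-- A field `J` of `g`-orthogonal complex structures is covariantly constant for the Levi-Civita
connection of `g`: `g((∇_a J) b, c) = g(∇_a (J b), c) - g(J (∇_a b), c) = 0`, where
`g(∇_a (J b), c) = g((∂_a J) b, c) + Γ(a, J b, c)` and `- g(J (∇_a b), c) = g(∇_a b, J c)`
because `J` is `g`-skew. -/
def IsParallel
    (g : (m : M) → TangentSpace 𝓘(ℝ, E) m →L[ℝ] TangentSpace 𝓘(ℝ, E) m →L[ℝ] ℝ)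
    (J : (m : M) → TangentSpace 𝓘(ℝ, E) m →L[ℝ] TangentSpace 𝓘(ℝ, E) m) : Prop :=
  ∀ (m : M) (a b c : E),
    bilinCoord g m (extChartAt 𝓘(ℝ, E) m m)
        (fderiv ℝ (fun y => endCoord J m y b) (extChartAt 𝓘(ℝ, E) m m) a) c
      + christoffel g m a (endCoord J m (extChartAt 𝓘(ℝ, E) m m) b) c
      + christoffel g m a b (endCoord J m (extChartAt 𝓘(ℝ, E) m m) c) = 0

end Tensors

/-! ### HyperKähler structures -/

section Hyperkahler

/-- A hyperKähler structure on `M`: a Riemannian metric with three orthogonal, covariantly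
constant complex structures `I₁ = J 0`, `I₂ = J 1`, `I₃ = J 2` such that `I₁ I₂ = - I₂ I₁ = I₃`. -/
structure HyperkahlerStructure (E : Type*) [NormedAddCommGroup E] [NormedSpace ℝ E]
    (M : Type*) [TopologicalSpace M] [ChartedSpace E M] [IsManifold 𝓘(ℝ, E) ∞ M] where
  metric : ContMDiffRiemannianMetric 𝓘(ℝ, E) ∞ E (fun m : M => TangentSpace 𝓘(ℝ, E) m)
  J : Fin 3 → (m : M) → TangentSpace 𝓘(ℝ, E) m →L[ℝ] TangentSpace 𝓘(ℝ, E) m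
  contMDiff_J : ∀ r, ContMDiff 𝓘(ℝ, E) (𝓘(ℝ, E).prod 𝓘(ℝ, E →L[ℝ] E)) ∞
    (fun m : M => TotalSpace.mk' (E →L[ℝ] E)
      (E := fun m : M => TangentSpace 𝓘(ℝ, E) m →L[ℝ] TangentSpace 𝓘(ℝ, E) m) m (J r m))
  J_sq : ∀ r m u, J r m (J r m u) = -u
  J_mul : ∀ m u, J 0 m (J 1 m u) = J 2 m u
  J_mul_swap : ∀ m u, J 1 m (J 0 m u) = -J 2 m u
  metric_J : ∀ r m u v, metric.inner m (J r m u) (J r m v) = metric.inner m u v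
  parallel : ∀ r, IsParallel metric.inner (J r)

variable {E : Type*} [NormedAddCommGroup E] [NormedSpace ℝ E]
  {M : Type*} [TopologicalSpace M] [ChartedSpace E M] [IsManifold 𝓘(ℝ, E) ∞ M]

namespace HyperkahlerStructure

variable (S : HyperkahlerStructure E M)

/-- The symplectic forms `ω_r(u, v) = g(u, I_r v)`. -/
def omega (r : Fin 3) (m : M) (u v : TangentSpace 𝓘(ℝ, E) m) : ℝ :=
  S.metric.inner m u (S.J r m v)

/-- The 2-form `ω = ω₁ i + ω₂ j + ω₃ k` with values in the imaginary quaternions. -/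
def omegaQ (m : M) (u v : TangentSpace 𝓘(ℝ, E) m) : ℍ[ℝ] :=
  ⟨0, S.omega 0 m u v, S.omega 1 m u v, S.omega 2 m u v⟩

/-- The real 2-form `i ∂_r ∂̄_r f` of a real function `f`, for the complex structure `I_r`. As
`df ∘ I_r = i (∂_r - ∂̄_r) f`, it is `- (1/2) d (df ∘ I_r)`. -/
def iddbar (r : Fin 3) (f : M → ℝ) (m : M) (u v : TangentSpace 𝓘(ℝ, E) m) : ℝ :=
  -(1 / 2) * extDerivOne (fun m => (mvfderiv 𝓘(ℝ, E) f m).comp (S.J r m)) m u v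

/-- A hyperKähler potential: a smooth function that is a Kähler potential for every one of the
three complex structures. -/
def IsHyperkahlerPotential (f : M → ℝ) : Prop :=
  ContMDiff 𝓘(ℝ, E) 𝓘(ℝ, ℝ) ∞ f ∧ ∀ r m u v, S.iddbar r f m u v = S.omega r m u v

/-- The complex structure `a₁ I₁ + a₂ I₂ + a₃ I₃`, for `a` in the unit sphere. -/
def sphereJ (a : EuclideanSpace ℝ (Fin 3)) (m : M) (u : TangentSpace 𝓘(ℝ, E) m) :
    TangentSpace 𝓘(ℝ, E) m :=
  a 0 • S.J 0 m u + a 1 • S.J 1 m u + a 2 • S.J 2 m u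

end HyperkahlerStructure

end Hyperkahler

/-! ### Group actions -/

/-- A smooth left action of a Lie group on a manifold. -/
structure SmoothAction {EG : Type*} [NormedAddCommGroup EG] [NormedSpace ℝ EG]
    {HG : Type*} [TopologicalSpace HG] (IG : ModelWithCorners ℝ EG HG)
    (G : Type*) [Group G] [TopologicalSpace G] [ChartedSpace HG G]
    (E : Type*) [NormedAddCommGroup E] [NormedSpace ℝ E]
    (M : Type*) [TopologicalSpace M] [ChartedSpace E M] where
  act : G → M → M
  one_act : ∀ m, act 1 m = m
  mul_act : ∀ g h m, act (g * h) m = act g (act h m)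
  contMDiff_act : ContMDiff (IG.prod 𝓘(ℝ, E)) 𝓘(ℝ, E) ∞ (fun z : G × M => act z.1 z.2)

/-- Smooth actions of the circle group. -/
abbrev CircleAction (E : Type*) [NormedAddCommGroup E] [NormedSpace ℝ E]
    (M : Type*) [TopologicalSpace M] [ChartedSpace E M] :=
  SmoothAction (𝓡 1) Circle E M

/-- Smooth actions of the group `ℍ*` of nonzero quaternions. -/
abbrev QuatAction (E : Type*) [NormedAddCommGroup E] [NormedSpace ℝ E]
    (M : Type*) [TopologicalSpace M] [ChartedSpace E M] :=
  SmoothAction 𝓘(ℝ, ℍ[ℝ]) (ℍ[ℝ])ˣ E M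

/-- The quaternion `i`. -/
def qi : ℍ[ℝ] := ⟨0, 1, 0, 0⟩

/-- The quaternion `j`. -/
def qj : ℍ[ℝ] := ⟨0, 0, 1, 0⟩

/-- The quaternion `k`. -/
def qk : ℍ[ℝ] := ⟨0, 0, 0, 1⟩

/-- The inclusion of the circle group in `ℍ*`, as the unit complex numbers `a + b i`. -/
def circleToQuat : Circle →* (ℍ[ℝ])ˣ :=
  (Units.map (Quaternion.ofComplex : ℂ →* ℍ[ℝ])).comp Circle.toUnits

section Actions

variable {E : Type*} [NormedAddCommGroup E] [NormedSpace ℝ E]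
  {M : Type*} [TopologicalSpace M] [ChartedSpace E M]

/-- The differential at `m` of the action of a group element. -/
def SmoothAction.push {EG : Type*} [NormedAddCommGroup EG] [NormedSpace ℝ EG]
    {HG : Type*} [TopologicalSpace HG] {IG : ModelWithCorners ℝ EG HG}
    {G : Type*} [Group G] [TopologicalSpace G] [ChartedSpace HG G]
    (A : SmoothAction IG G E M) (g : G) (m : M) :
    TangentSpace 𝓘(ℝ, E) m →L[ℝ] TangentSpace 𝓘(ℝ, E) (A.act g m) :=
  mfderiv 𝓘(ℝ, E) 𝓘(ℝ, E) (A.act g) m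

/-- The vector field generated by a circle action: the velocity at `t = 0` of `exp(i t) · m`. -/
def SmoothAction.circleField (A : CircleAction E M) (m : M) : TangentSpace 𝓘(ℝ, E) m :=
  mfderiv 𝓘(ℝ, ℝ) 𝓘(ℝ, E) (fun t : ℝ => A.act (Circle.exp t) m) 0 (1 : ℝ)

/-- The vector field generated by an element `a` of the Lie algebra `T₁ ℍ* = ℍ` for an action of
`ℍ*`: the image of `a` under the differential at `1` of the orbit map `x ↦ x · m`. -/
def SmoothAction.quatField (A : QuatAction E M) (a : ℍ[ℝ]) (m : M) : TangentSpace 𝓘(ℝ, E) m :=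
  mfderiv 𝓘(ℝ, ℍ[ℝ]) 𝓘(ℝ, E) (fun x : (ℍ[ℝ])ˣ => A.act x m) 1 a

variable [IsManifold 𝓘(ℝ, E) ∞ M]

/-- A permuting action of `ℍ*` on a hyperKähler manifold: `(L_x)^* g = |x|² g`,
`(L_x)^* ω = x ω x̄`, and `I₁ Y₁ = I₂ Y₂ = I₃ Y₃ = - Y₀` for the vector fields `Y₀, Y₁, Y₂, Y₃`
generated by `1, i, j, k`. -/
structure IsPermuting (S : HyperkahlerStructure E M) (A : QuatAction E M) : Prop where
  metric_push : ∀ x m u v, S.metric.inner (A.act x m) (A.push x m u) (A.push x m v)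
    = ‖(x : ℍ[ℝ])‖ ^ 2 * S.metric.inner m u v
  omega_push : ∀ x m u v, S.omegaQ (A.act x m) (A.push x m u) (A.push x m v)
    = (x : ℍ[ℝ]) * S.omegaQ m u v * star (x : ℍ[ℝ])
  field_i : ∀ m, S.J 0 m (A.quatField qi m) = -A.quatField 1 m
  field_j : ∀ m, S.J 1 m (A.quatField qj m) = -A.quatField 1 m
  field_k : ∀ m, S.J 2 m (A.quatField qk m) = -A.quatField 1 m

/-- The diffeomorphism `L_x` maps the complex structure `I_a` to `I_b`. -/
def MapsComplexStructure (S : HyperkahlerStructure E M) (A : QuatAction E M) (x : (ℍ[ℝ])ˣ)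
    (a b : EuclideanSpace ℝ (Fin 3)) : Prop :=
  ∀ m u, A.push x m (S.sphereJ a m u) = S.sphereJ b (A.act x m) (A.push x m u)

/-- The action of `ℍ*` induces a transitive action on the 2-sphere of complex structures. -/
def IsTransitiveOnComplexStructures (S : HyperkahlerStructure E M) (A : QuatAction E M) : Prop :=
  (∀ x, ∀ a : EuclideanSpace ℝ (Fin 3), ‖a‖ = 1 →
      ∃ b : EuclideanSpace ℝ (Fin 3), ‖b‖ = 1 ∧ MapsComplexStructure S A x a b) ∧
  (∀ a b : EuclideanSpace ℝ (Fin 3), ‖a‖ = 1 → ‖b‖ = 1 → ∃ x, MapsComplexStructure S A x a b)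

/-- An isometric circle action with `(L_z)^* ω = z ω z̄`: it fixes `I₁` and rotates `I₂, I₃`. -/
structure IsRotating (S : HyperkahlerStructure E M) (A : CircleAction E M) : Prop where
  metric_push : ∀ z m u v, S.metric.inner (A.act z m) (A.push z m u) (A.push z m v)
    = S.metric.inner m u v
  omega_push : ∀ z m u v, S.omegaQ (A.act z m) (A.push z m u) (A.push z m v)
    = (circleToQuat z : ℍ[ℝ]) * S.omegaQ m u v * star (circleToQuat z : ℍ[ℝ])

/-- An isometric circle action that preserves the three complex structures. -/
structure IsTriholomorphic (S : HyperkahlerStructure E M) (A : CircleAction E M) : Prop where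
  metric_push : ∀ z m u v, S.metric.inner (A.act z m) (A.push z m u) (A.push z m v)
    = S.metric.inner m u v
  J_push : ∀ r z m u, A.push z m (S.J r m u) = S.J r (A.act z m) (A.push z m u)

/-- A momentum map for the form `ω₁`: `dρ = - ι_K ω₁`. -/
structure IsMomentumMapOne (S : HyperkahlerStructure E M) (A : CircleAction E M)
    (ρ : M → ℝ) : Prop where
  contMDiff : ContMDiff 𝓘(ℝ, E) 𝓘(ℝ, ℝ) ∞ ρ
  deriv_eq : ∀ m u, mvfderiv 𝓘(ℝ, E) ρ m u = -S.omega 0 m (A.circleField m) u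

/-- A hyperKähler momentum map, with values in the imaginary quaternions: `dμ = - ι_K ω`. -/
structure IsHyperkahlerMomentumMap (S : HyperkahlerStructure E M) (A : CircleAction E M)
    (μ : M → ℍ[ℝ]) : Prop where
  re_eq : ∀ m, (μ m).re = 0
  contMDiff : ContMDiff 𝓘(ℝ, E) 𝓘(ℝ, ℍ[ℝ]) ∞ μ
  deriv_eq : ∀ m u, mvfderiv 𝓘(ℝ, E) μ m u = -S.omegaQ m (A.circleField m) u

end Actions

/-! ### Circle bundles with connection -/

section Bundles

variable {E : Type*} [NormedAddCommGroup E] [NormedSpace ℝ E]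
  {M : Type*} [TopologicalSpace M] [ChartedSpace E M]
  {F : Type*} [NormedAddCommGroup F] [NormedSpace ℝ F]
  {P : Type*} [TopologicalSpace P] [ChartedSpace F P]

/-- A principal circle bundle: a surjective submersion whose fibres are the orbits of a free
circle action on the total space. (Local triviality follows, by means of local sections of the
submersion.) -/
structure IsPrincipalCircleBundle (A : CircleAction F P) (pr : P → M) : Prop where
  contMDiff : ContMDiff 𝓘(ℝ, F) 𝓘(ℝ, E) ∞ pr
  surjective : Function.Surjective pr
  submersion : ∀ p, Function.Surjective (mfderiv 𝓘(ℝ, F) 𝓘(ℝ, E) pr p)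
  free : ∀ z p, A.act z p = p → z = 1
  fibre : ∀ p q, pr p = pr q ↔ ∃ z, A.act z p = q

/-- A connection form for a circle action: an invariant 1-form `ξ` with `ξ(K) = 1` (the Lie
algebra of the circle is identified with `ℝ`). -/
structure IsConnection [IsManifold 𝓘(ℝ, F) ∞ P] (A : CircleAction F P)
    (ξ : (p : P) → TangentSpace 𝓘(ℝ, F) p →L[ℝ] ℝ) : Prop where
  contMDiff : ContMDiff 𝓘(ℝ, F) (𝓘(ℝ, F).prod 𝓘(ℝ, F →L[ℝ] ℝ)) ∞
    (fun p : P => TotalSpace.mk' (F →L[ℝ] ℝ)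
      (E := fun p : P => TangentSpace 𝓘(ℝ, F) p →L[ℝ] ℝ) p (ξ p))
  invariant : ∀ z p u, ξ (A.act z p) (A.push z p u) = ξ p u
  field : ∀ p, ξ p (A.circleField p) = 1

/-- The 2-form `Φ` on the base is the curvature form of the connection `ξ`: `dξ = pr^* Φ`. (As `pr`
is a surjective submersion, `Φ` is determined by `ξ`.) -/
def IsCurvatureForm (pr : P → M) (ξ : (p : P) → TangentSpace 𝓘(ℝ, F) p →L[ℝ] ℝ)
    (Φ : (m : M) → TangentSpace 𝓘(ℝ, E) m → TangentSpace 𝓘(ℝ, E) m → ℝ) : Prop :=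
  ∀ p u v, extDerivOne ξ p u v
    = Φ (pr p) (mfderiv 𝓘(ℝ, F) 𝓘(ℝ, E) pr p u) (mfderiv 𝓘(ℝ, F) 𝓘(ℝ, E) pr p v)

end Bundles

/-! ### The construction -/

/-- The data of the construction: a hyperKähler manifold `M` with a rotating circle action `rot`
and a momentum map `rho` of it, a principal circle bundle `proj : P → M` (with circle action
`princ`) with a connection `xi`, and a lift of the action `rot` to an action `lift` on `P` that
commutes with `princ`. -/
structure InductionData
    (E : Type*) [NormedAddCommGroup E] [NormedSpace ℝ E]
    (M : Type*) [TopologicalSpace M] [ChartedSpace E M] [IsManifold 𝓘(ℝ, E) ∞ M]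
    (F : Type*) [NormedAddCommGroup F] [NormedSpace ℝ F]
    (P : Type*) [TopologicalSpace P] [ChartedSpace F P] [IsManifold 𝓘(ℝ, F) ∞ P] where
  hk : HyperkahlerStructure E M
  rot : CircleAction E M
  isRotating : IsRotating hk rot
  rho : M → ℝ
  isMomentumMap : IsMomentumMapOne hk rot rho
  proj : P → M
  princ : CircleAction F P
  isPrincipal : IsPrincipalCircleBundle (E := E) princ proj
  xi : (p : P) → TangentSpace 𝓘(ℝ, F) p →L[ℝ] ℝ
  isConnection : IsConnection princ xi
  lift : CircleAction F P
  lift_comm : ∀ z z' p, lift.act z (princ.act z' p) = princ.act z' (lift.act z p)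
  proj_lift : ∀ z p, proj (lift.act z p) = rot.act z (proj p)

namespace InductionData

variable {E : Type*} [NormedAddCommGroup E] [NormedSpace ℝ E]
  {M : Type*} [TopologicalSpace M] [ChartedSpace E M] [IsManifold 𝓘(ℝ, E) ∞ M]
  {F : Type*} [NormedAddCommGroup F] [NormedSpace ℝ F]
  {P : Type*} [TopologicalSpace P] [ChartedSpace F P] [IsManifold 𝓘(ℝ, F) ∞ P]
  (D : InductionData E M F P)

/-- The vector field `K_r` on `M` generated by the rotating action. -/
def Kr (m : M) : TangentSpace 𝓘(ℝ, E) m := D.rot.circleField m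

/-- `w = |K_r|²`. -/
def w (m : M) : ℝ := D.hk.metric.inner m (D.Kr m) (D.Kr m)

/-- `v = - (w + 2 ρ) / 4`. -/
def v (m : M) : ℝ := -(D.w m + 2 * D.rho m) / 4

/-- The vector field `Y₁` on `P` generated by the lifted action equals `K̂_r + 2 v K₀`, where `K̂_r`
is the horizontal lift of `K_r`. As `Y₁` projects to `K_r`, only its vertical part, which is
`ξ(Y₁) K₀`, has to be prescribed. -/
def IsNormalized : Prop := ∀ p, D.xi p (D.lift.circleField p) = 2 * D.v (D.proj p)

/-- The quaternion-valued 1-form `η = ι_{K_r} g + ι_{K_r} ω` on `M`. -/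
def eta (m : M) (u : TangentSpace 𝓘(ℝ, E) m) : ℍ[ℝ] :=
  (D.hk.metric.inner m (D.Kr m) u : ℍ[ℝ]) + D.hk.omegaQ m (D.Kr m) u

/-- The equation `F_ξ = i ∂₁ ∂̄₁ ρ - ω₁` for the curvature form of `ξ`. -/
def CurvatureEquation : Prop :=
  IsCurvatureForm (E := E) D.proj D.xi
    (fun m a b => D.hk.iddbar 0 D.rho m a b - D.hk.omega 0 m a b)

/-- The tangent spaces of `ℍ* × P`. -/
abbrev TangentHP (z : (ℍ[ℝ])ˣ × P) := TangentSpace (𝓘(ℝ, ℍ[ℝ]).prod 𝓘(ℝ, F)) z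

/-- The quaternion-valued 1-form `dx` on `ℍ* × P`. -/
def dx (z : (ℍ[ℝ])ˣ × P) (a : TangentHP (F := F) z) : ℍ[ℝ] :=
  mvfderiv (𝓘(ℝ, ℍ[ℝ]).prod 𝓘(ℝ, F)) (fun z : (ℍ[ℝ])ˣ × P => (z.1 : ℍ[ℝ])) z a

/-- The component in `TP` of a tangent vector of `ℍ* × P`. -/
def toTP (z : (ℍ[ℝ])ˣ × P) (a : TangentHP (F := F) z) : TangentSpace 𝓘(ℝ, F) z.2 :=
  mfderiv (𝓘(ℝ, ℍ[ℝ]).prod 𝓘(ℝ, F)) 𝓘(ℝ, F) (Prod.snd : (ℍ[ℝ])ˣ × P → P) z a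

/-- The projection to `TM` of a tangent vector of `ℍ* × P`. -/
def toTM (z : (ℍ[ℝ])ˣ × P) (a : TangentHP (F := F) z) :
    TangentSpace 𝓘(ℝ, E) (D.proj z.2) :=
  mfderiv 𝓘(ℝ, F) 𝓘(ℝ, E) D.proj z.2 (toTP z a)

/-- The pull-back of the connection form to `ℍ* × P`. -/
def xiHP (z : (ℍ[ℝ])ˣ × P) (a : TangentHP (F := F) z) : ℝ := D.xi z.2 (toTP z a)

/-- The pull-back of `η` to `ℍ* × P`. -/
def etaHP (z : (ℍ[ℝ])ˣ × P) (a : TangentHP (F := F) z) : ℍ[ℝ] :=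
  D.eta (D.proj z.2) (D.toTM z a)

/-- The symmetric tensor
`(4v + w) Re (dx ⊗ dx̄) - Re (x̄ dx i ⊙ (2ξ + η)) + |x|² (g + v⁻¹ ξ²)` on `ℍ* × P`, where
`(ζ₁ ⊙ ζ₂)(a, b) = ζ₁(a) ζ₂(b) + ζ₁(b) ζ₂(a)`. -/
def metricHP (z : (ℍ[ℝ])ˣ × P) (a b : TangentHP (F := F) z) : ℝ :=
  (4 * D.v (D.proj z.2) + D.w (D.proj z.2)) * (dx z a * star (dx z b)).re
    - (star (z.1 : ℍ[ℝ]) * dx z a * qi * ((2 * D.xiHP z b : ℝ) + D.etaHP z b)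
        + star (z.1 : ℍ[ℝ]) * dx z b * qi * ((2 * D.xiHP z a : ℝ) + D.etaHP z a)).re
    + ‖(z.1 : ℍ[ℝ])‖ ^ 2 * (D.hk.metric.inner (D.proj z.2) (D.toTM z a) (D.toTM z b)
        + (D.v (D.proj z.2))⁻¹ * (D.xiHP z a * D.xiHP z b))

/-- The 2-form
`(4v + w)/2 dx ∧ dx̄ + x ω x̄ - 2 Im (dx i x̄) ∧ ξ - Im (dx i ∧ η x̄)` on `ℍ* × P`, where
`(ζ₁ ∧ ζ₂)(a, b) = ζ₁(a) ζ₂(b) - ζ₁(b) ζ₂(a)`. -/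
def omegaHP (z : (ℍ[ℝ])ˣ × P) (a b : TangentHP (F := F) z) : ℍ[ℝ] :=
  ((4 * D.v (D.proj z.2) + D.w (D.proj z.2)) / 2)
      • (dx z a * star (dx z b) - dx z b * star (dx z a))
    + (z.1 : ℍ[ℝ]) * D.hk.omegaQ (D.proj z.2) (D.toTM z a) (D.toTM z b) * star (z.1 : ℍ[ℝ])
    - (2 : ℝ) • (D.xiHP z b • (dx z a * qi * star (z.1 : ℍ[ℝ])).im
        - D.xiHP z a • (dx z b * qi * star (z.1 : ℍ[ℝ])).im)
    - (dx z a * qi * D.etaHP z b * star (z.1 : ℍ[ℝ])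
        - dx z b * qi * D.etaHP z a * star (z.1 : ℍ[ℝ])).im

/-- Two points of `ℍ* × P` in the same orbit of the circle action `z · (x, p) = (x z, z̄ p)`. -/
def SameOrbit (a b : (ℍ[ℝ])ˣ × P) : Prop :=
  ∃ z : Circle, b = (a.1 * circleToQuat z, D.lift.act z⁻¹ a.2)

/-- The orbit equivalence relation on `ℍ* × P`. -/
def orbitSetoid : Setoid ((ℍ[ℝ])ˣ × P) where
  r := D.SameOrbit
  iseqv := by
    refine ⟨fun a => ⟨1, by simp [D.lift.one_act]⟩, ?_, ?_⟩
    · rintro a b ⟨z, rfl⟩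
      exact ⟨z⁻¹, by simp [← D.lift.mul_act, D.lift.one_act]⟩
    · rintro a b c ⟨z, rfl⟩ ⟨z', rfl⟩
      exact ⟨z * z', by simp [← D.lift.mul_act, mul_assoc, mul_comm]⟩

/-- The orbit space `ℋ(M) = ℍ* ×_{S¹} P`, with the quotient topology. -/
abbrev OrbitSpace : Type _ := Quotient D.orbitSetoid

section Quotient

variable {E' : Type*} [NormedAddCommGroup E'] [NormedSpace ℝ E']
  {N : Type*} [TopologicalSpace N] [ChartedSpace E' N]

/-- The map `q` is a smooth submersion on `ℍ* × P` whose nonempty fibres are the circle orbits, so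
that it identifies the quotient manifold `ℋ(M) = ℍ* ×_{S¹} P` with its range, an open submanifold
of `N`. -/
structure IsQuotientMap (q : (ℍ[ℝ])ˣ × P → N) : Prop where
  contMDiff : ContMDiff (𝓘(ℝ, ℍ[ℝ]).prod 𝓘(ℝ, F)) 𝓘(ℝ, E') ∞ q
  submersion : ∀ z, Function.Surjective (mfderiv (𝓘(ℝ, ℍ[ℝ]).prod 𝓘(ℝ, F)) 𝓘(ℝ, E') q z)
  fibre : ∀ a b, q a = q b ↔ D.SameOrbit a b

/-- The pull-backs by `q` of the metric and of the 2-form `ω` of a hyperKähler structure on `N` are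
the tensors `metricHP` and `omegaHP`. -/
def IsInduced [IsManifold 𝓘(ℝ, E') ∞ N] (q : (ℍ[ℝ])ˣ × P → N)
    (S : HyperkahlerStructure E' N) : Prop :=
  ∀ (z : (ℍ[ℝ])ˣ × P) (a b : TangentHP (F := F) z),
    S.metric.inner (q z) (mfderiv (𝓘(ℝ, ℍ[ℝ]).prod 𝓘(ℝ, F)) 𝓘(ℝ, E') q z a)
        (mfderiv (𝓘(ℝ, ℍ[ℝ]).prod 𝓘(ℝ, F)) 𝓘(ℝ, E') q z b) = D.metricHP z a b ∧
    S.omegaQ (q z) (mfderiv (𝓘(ℝ, ℍ[ℝ]).prod 𝓘(ℝ, F)) 𝓘(ℝ, E') q z a)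
        (mfderiv (𝓘(ℝ, ℍ[ℝ]).prod 𝓘(ℝ, F)) 𝓘(ℝ, E') q z b) = D.omegaHP z a b

end Quotient

end InductionData

/-! ### HyperKähler reduction -/

/-- The hyperKähler structure `S'` on `M'` is the hyperKähler reduction of `(M, S)` by the circle
action `A` at the level set `P = μ⁻¹(c)`, a submanifold of `M` with a principal circle bundle
`pr : P → M'` given by the restricted action `A'`: the forms `ω` and `pr^* ω'` agree on `P`, and the
metrics agree on the orthogonal complement in `TP` of the orbits. -/
structure IsReduction
    {E : Type*} [NormedAddCommGroup E] [NormedSpace ℝ E]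
    {M : Type*} [TopologicalSpace M] [ChartedSpace E M] [IsManifold 𝓘(ℝ, E) ∞ M]
    (S : HyperkahlerStructure E M) (A : CircleAction E M) (μ : M → ℍ[ℝ]) (c : ℍ[ℝ])
    {F : Type*} [NormedAddCommGroup F] [NormedSpace ℝ F] [ChartedSpace F {m : M // μ m = c}]
    {E' : Type*} [NormedAddCommGroup E'] [NormedSpace ℝ E']
    {M' : Type*} [TopologicalSpace M'] [ChartedSpace E' M'] [IsManifold 𝓘(ℝ, E') ∞ M']
    (S' : HyperkahlerStructure E' M') (A' : CircleAction F {m : M // μ m = c})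
    (pr : {m : M // μ m = c} → M') : Prop where
  contMDiff_val : ContMDiff 𝓘(ℝ, F) 𝓘(ℝ, E) ∞ (Subtype.val : {m : M // μ m = c} → M)
  immersion : ∀ p, Function.Injective
    (mfderiv 𝓘(ℝ, F) 𝓘(ℝ, E) (Subtype.val : {m : M // μ m = c} → M) p)
  act_val : ∀ z p, (A'.act z p : M) = A.act z (p : M)
  principal : IsPrincipalCircleBundle (E := E') A' pr
  omega_eq : ∀ (p : {m : M // μ m = c}) u v,
    S'.omegaQ (pr p) (mfderiv 𝓘(ℝ, F) 𝓘(ℝ, E') pr p u) (mfderiv 𝓘(ℝ, F) 𝓘(ℝ, E') pr p v)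
      = S.omegaQ (p : M) (mfderiv 𝓘(ℝ, F) 𝓘(ℝ, E) Subtype.val p u)
          (mfderiv 𝓘(ℝ, F) 𝓘(ℝ, E) Subtype.val p v)
  metric_eq : ∀ (p : {m : M // μ m = c}) u v,
    S.metric.inner (p : M) (mfderiv 𝓘(ℝ, F) 𝓘(ℝ, E) Subtype.val p u) (A.circleField (p : M)) = 0 →
    S.metric.inner (p : M) (mfderiv 𝓘(ℝ, F) 𝓘(ℝ, E) Subtype.val p v) (A.circleField (p : M)) = 0 →
    S'.metric.inner (pr p) (mfderiv 𝓘(ℝ, F) 𝓘(ℝ, E') pr p u) (mfderiv 𝓘(ℝ, F) 𝓘(ℝ, E') pr p v)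
      = S.metric.inner (p : M) (mfderiv 𝓘(ℝ, F) 𝓘(ℝ, E) Subtype.val p u)
          (mfderiv 𝓘(ℝ, F) 𝓘(ℝ, E) Subtype.val p v)

end HyperkahlerInduction

end

open HyperkahlerInduction

universe u

noncomputable section

open scoped Manifold ContDiff Quaternion Topology
open Bundle Filter Set

set_option linter.unusedSectionVars false
set_option synthInstance.maxHeartbeats 200000

namespace HyperkahlerInduction

/-! ### Plots and pull-backs -/

section Plots

variable {E : Type*} [NormedAddCommGroup E] [NormedSpace ℝ E]
  {M : Type*} [TopologicalSpace M] [ChartedSpace E M]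
  {V : Type*} [NormedAddCommGroup V] [NormedSpace ℝ V]
  {W : Type*} [NormedAddCommGroup W] [NormedSpace ℝ W]

/-- The differential of a map from a normed space to a manifold. -/
def plotD (φ : V → M) (y : V) : V →L[ℝ] TangentSpace 𝓘(ℝ, E) (φ y) :=
  mfderiv 𝓘(ℝ, V) 𝓘(ℝ, E) φ y

/-- The pull-back of a 1-form by a map from a normed space. -/
def pullOne (α : (m : M) → TangentSpace 𝓘(ℝ, E) m →L[ℝ] ℝ) (φ : V → M) (y : V) : V →L[ℝ] ℝ :=
  (α (φ y)).comp (plotD φ y)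

/-- The pull-back of a 2-tensor by a map from a normed space. -/
def pullTwo (β : (m : M) → TangentSpace 𝓘(ℝ, E) m →L[ℝ] TangentSpace 𝓘(ℝ, E) m →L[ℝ] ℝ)
    (φ : V → M) (y a b : V) : ℝ :=
  β (φ y) (plotD φ y a) (plotD φ y b)

/-- The pull-back of a 2-tensor as a continuous bilinear map. -/
def pullTwoL (β : (m : M) → TangentSpace 𝓘(ℝ, E) m →L[ℝ] TangentSpace 𝓘(ℝ, E) m →L[ℝ] ℝ)
    (φ : V → M) (y : V) : V →L[ℝ] V →L[ℝ] ℝ :=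
  ((plotD φ y).precomp ℝ).comp ((β (φ y)).comp (plotD φ y))

theorem pullOne_apply (α : (m : M) → TangentSpace 𝓘(ℝ, E) m →L[ℝ] ℝ) (φ : V → M) (y a : V) :
    pullOne α φ y a = α (φ y) (plotD φ y a) := rfl

/-- A 1-form with smooth coordinate expressions. -/
def SmoothOne (α : (m : M) → TangentSpace 𝓘(ℝ, E) m →L[ℝ] ℝ) : Prop :=
  ∀ m a, ContDiffAt ℝ ∞ (fun y => pullOne α (extChartAt 𝓘(ℝ, E) m).symm y a)
    (extChartAt 𝓘(ℝ, E) m m)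

/-- A 2-tensor with smooth coordinate expressions. -/
def SmoothTwo (β : (m : M) → TangentSpace 𝓘(ℝ, E) m →L[ℝ] TangentSpace 𝓘(ℝ, E) m →L[ℝ] ℝ) :
    Prop :=
  ∀ m a b, ContDiffAt ℝ ∞ (fun y => pullTwo β (extChartAt 𝓘(ℝ, E) m).symm y a b)
    (extChartAt 𝓘(ℝ, E) m m)

theorem plotD_comp {φ : V → M} {f : W → V} {y : W}
    (hφ : MDifferentiableAt 𝓘(ℝ, V) 𝓘(ℝ, E) φ (f y)) (hf : DifferentiableAt ℝ f y) (a : W) :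
    plotD (E := E) (φ ∘ f) y a = plotD (E := E) φ (f y) (fderiv ℝ f y a) := by
  have := mfderiv_comp y hφ hf.mdifferentiableAt
  unfold plotD
  rw [this, mfderiv_eq_fderiv]
  rfl

theorem pullOne_congr (α : (m : M) → TangentSpace 𝓘(ℝ, E) m →L[ℝ] ℝ) {φ ψ : V → M} {u : V}
    (h : φ =ᶠ[𝓝 u] ψ) : pullOne α φ u = pullOne α ψ u := by
  have h1 : φ u = ψ u := h.eq_of_nhds
  have h2 : mfderiv 𝓘(ℝ, V) 𝓘(ℝ, E) φ u = mfderiv 𝓘(ℝ, V) 𝓘(ℝ, E) ψ u := h.mfderiv_eq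
  unfold pullOne plotD
  rw [h2, h1]

theorem pullTwo_congr
    (β : (m : M) → TangentSpace 𝓘(ℝ, E) m →L[ℝ] TangentSpace 𝓘(ℝ, E) m →L[ℝ] ℝ)
    {φ ψ : V → M} {u : V} (h : φ =ᶠ[𝓝 u] ψ) : pullTwo β φ u = pullTwo β ψ u := by
  have h1 : φ u = ψ u := h.eq_of_nhds
  have h2 : mfderiv 𝓘(ℝ, V) 𝓘(ℝ, E) φ u = mfderiv 𝓘(ℝ, V) 𝓘(ℝ, E) ψ u := h.mfderiv_eq
  unfold pullTwo plotD
  rw [h2, h1]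

end Plots

section Calculus

variable {E : Type*} [NormedAddCommGroup E] [NormedSpace ℝ E]
  {M : Type*} [TopologicalSpace M] [ChartedSpace E M] [IsManifold 𝓘(ℝ, E) ∞ M]
  [FiniteDimensional ℝ E]
  {V : Type*} [NormedAddCommGroup V] [NormedSpace ℝ V]

theorem contDiffAt_clm_of_apply {G : Type*} [NormedAddCommGroup G] [NormedSpace ℝ G]
    {f : V → E →L[ℝ] G} {u : V} (h : ∀ a, ContDiffAt ℝ ∞ (fun y => f y a) u) :
    ContDiffAt ℝ ∞ f u := by
  let d := Module.finrank ℝ E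
  have hd : d = Module.finrank ℝ (Fin d → ℝ) := (Module.finrank_fin_fun ℝ).symm
  let e₁ := ContinuousLinearEquiv.ofFinrankEq hd
  let e₂ := (e₁.arrowCongr (1 : G ≃L[ℝ] G)).trans (ContinuousLinearEquiv.piRing (Fin d))
  rw [← Function.id_comp f, ← e₂.symm_comp_self]
  exact e₂.symm.contDiff.contDiffAt.comp u (contDiffAt_pi.mpr fun i => h _)

theorem mdifferentiableAt_extChartAt_symm {m : M} {y : E}
    (hy : y ∈ (extChartAt 𝓘(ℝ, E) m).target) :
    MDifferentiableAt 𝓘(ℝ, E) 𝓘(ℝ, E) (extChartAt 𝓘(ℝ, E) m).symm y := by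
  have : IsManifold 𝓘(ℝ, E) 1 M := IsManifold.of_le (n := ∞) (by simp)
  have h := mdifferentiableWithinAt_extChartAt_symm (I := 𝓘(ℝ, E)) hy
  simpa [mdifferentiableWithinAt_univ] using h

theorem contMDiffAt_extChartAt_symm (m : M) :
    ContMDiffAt 𝓘(ℝ, E) 𝓘(ℝ, E) ∞ (extChartAt 𝓘(ℝ, E) m).symm (extChartAt 𝓘(ℝ, E) m m) :=
  (contMDiffOn_extChartAt_symm m).contMDiffAt (extChartAt_target_mem_nhds m)

/-- A plot written in the preferred chart at one of its points. -/
theorem contDiffAt_chart_comp {φ : V → M} {u : V}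
    (hφ : ContMDiffAt 𝓘(ℝ, V) 𝓘(ℝ, E) ∞ φ u) :
    ContDiffAt ℝ ∞ (extChartAt 𝓘(ℝ, E) (φ u) ∘ φ) u := by
  rw [← contMDiffAt_iff_contDiffAt]
  exact (contMDiffAt_extChartAt (I := 𝓘(ℝ, E)) (n := ∞) (x := φ u)).comp u hφ

theorem eventually_eq_chart {φ : V → M} {u : V} (hφ : ContinuousAt φ u) :
    ∀ᶠ y in 𝓝 u, φ =ᶠ[𝓝 y]
      (extChartAt 𝓘(ℝ, E) (φ u)).symm ∘ (extChartAt 𝓘(ℝ, E) (φ u) ∘ φ) := by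
  have h : ∀ᶠ y in 𝓝 u, φ y ∈ (extChartAt 𝓘(ℝ, E) (φ u)).source :=
    hφ (extChartAt_source_mem_nhds (I := 𝓘(ℝ, E)) (φ u))
  filter_upwards [h.eventually_nhds] with y hy
  filter_upwards [hy] with z hz
  exact ((extChartAt 𝓘(ℝ, E) (φ u)).left_inv hz).symm

theorem eventually_differentiable_chart {φ : V → M} {u : V}
    (hφ : ContMDiffAt 𝓘(ℝ, V) 𝓘(ℝ, E) ∞ φ u) :
    ∀ᶠ y in 𝓝 u, DifferentiableAt ℝ (extChartAt 𝓘(ℝ, E) (φ u) ∘ φ) y ∧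
      MDifferentiableAt 𝓘(ℝ, E) 𝓘(ℝ, E) (extChartAt 𝓘(ℝ, E) (φ u)).symm
        ((extChartAt 𝓘(ℝ, E) (φ u) ∘ φ) y) := by
  have h1 := ((contDiffAt_chart_comp hφ).of_le (m := 1) (by simp)).eventually (by simp)
  have h2 : ∀ᶠ y in 𝓝 u, φ y ∈ (extChartAt 𝓘(ℝ, E) (φ u)).source :=
    hφ.continuousAt (extChartAt_source_mem_nhds (I := 𝓘(ℝ, E)) (φ u))
  filter_upwards [h1, h2] with y hy hy2
  exact ⟨hy.differentiableAt (by simp),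
    mdifferentiableAt_extChartAt_symm ((extChartAt 𝓘(ℝ, E) (φ u)).map_source hy2)⟩

theorem pullOne_eventuallyEq (α : (m : M) → TangentSpace 𝓘(ℝ, E) m →L[ℝ] ℝ) {φ : V → M} {u : V}
    (hφ : ContMDiffAt 𝓘(ℝ, V) 𝓘(ℝ, E) ∞ φ u) :
    pullOne α φ =ᶠ[𝓝 u] fun y =>
      (pullOne α (extChartAt 𝓘(ℝ, E) (φ u)).symm ((extChartAt 𝓘(ℝ, E) (φ u) ∘ φ) y)).comp
        (fderiv ℝ (extChartAt 𝓘(ℝ, E) (φ u) ∘ φ) y) := by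
  filter_upwards [eventually_eq_chart (E := E) hφ.continuousAt, eventually_differentiable_chart hφ]
    with y h1 h2
  rw [pullOne_congr α h1]
  ext a
  rw [pullOne_apply, plotD_comp h2.2 h2.1]
  rfl

theorem pullTwo_eventuallyEq
    (β : (m : M) → TangentSpace 𝓘(ℝ, E) m →L[ℝ] TangentSpace 𝓘(ℝ, E) m →L[ℝ] ℝ)
    {φ : V → M} {u : V} (hφ : ContMDiffAt 𝓘(ℝ, V) 𝓘(ℝ, E) ∞ φ u) :
    ∀ᶠ y in 𝓝 u, ∀ a b, pullTwo β φ y a b =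
      pullTwoL β (extChartAt 𝓘(ℝ, E) (φ u)).symm ((extChartAt 𝓘(ℝ, E) (φ u) ∘ φ) y)
        (fderiv ℝ (extChartAt 𝓘(ℝ, E) (φ u) ∘ φ) y a)
        (fderiv ℝ (extChartAt 𝓘(ℝ, E) (φ u) ∘ φ) y b) := by
  filter_upwards [eventually_eq_chart (E := E) hφ.continuousAt, eventually_differentiable_chart hφ]
    with y h1 h2 a b
  rw [pullTwo_congr β h1, pullTwo, plotD_comp h2.2 h2.1, plotD_comp h2.2 h2.1]
  rfl

theorem SmoothOne.contDiffAt_chart {α : (m : M) → TangentSpace 𝓘(ℝ, E) m →L[ℝ] ℝ}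
    (hα : SmoothOne α) (m : M) :
    ContDiffAt ℝ ∞ (pullOne α (extChartAt 𝓘(ℝ, E) m).symm) (extChartAt 𝓘(ℝ, E) m m) :=
  contDiffAt_clm_of_apply (hα m)

theorem SmoothTwo.contDiffAt_chart
    {β : (m : M) → TangentSpace 𝓘(ℝ, E) m →L[ℝ] TangentSpace 𝓘(ℝ, E) m →L[ℝ] ℝ}
    (hβ : SmoothTwo β) (m : M) :
    ContDiffAt ℝ ∞ (pullTwoL β (extChartAt 𝓘(ℝ, E) m).symm) (extChartAt 𝓘(ℝ, E) m m) :=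
  contDiffAt_clm_of_apply fun a => contDiffAt_clm_of_apply fun b => hβ m a b

theorem contDiffAt_pullOne {α : (m : M) → TangentSpace 𝓘(ℝ, E) m →L[ℝ] ℝ} (hα : SmoothOne α)
    {φ : V → M} {u : V} (hφ : ContMDiffAt 𝓘(ℝ, V) 𝓘(ℝ, E) ∞ φ u) :
    ContDiffAt ℝ ∞ (pullOne α φ) u := by
  refine ContDiffAt.congr_of_eventuallyEq ?_ (pullOne_eventuallyEq α hφ)
  have h := contDiffAt_chart_comp (E := E) hφ
  exact ((hα.contDiffAt_chart (φ u)).comp u h).clm_comp (h.fderiv_right (m := ∞) (by simp))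

theorem contDiffAt_pullTwo
    {β : (m : M) → TangentSpace 𝓘(ℝ, E) m →L[ℝ] TangentSpace 𝓘(ℝ, E) m →L[ℝ] ℝ}
    (hβ : SmoothTwo β) {φ : V → M} {u : V} (hφ : ContMDiffAt 𝓘(ℝ, V) 𝓘(ℝ, E) ∞ φ u) (a b : V) :
    ContDiffAt ℝ ∞ (fun y => pullTwo β φ y a b) u := by
  have e := (pullTwo_eventuallyEq β hφ).mono fun y hy => hy a b
  refine ContDiffAt.congr_of_eventuallyEq ?_ e
  have h := contDiffAt_chart_comp (E := E) hφ
  have h' := h.fderiv_right (m := ∞) (by simp)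
  exact (((hβ.contDiffAt_chart (φ u)).comp u h).clm_apply (h'.clm_apply contDiffAt_const)).clm_apply
    (h'.clm_apply contDiffAt_const)

theorem dChart_plotD {φ : V → M} {u : V} (hφ : ContMDiffAt 𝓘(ℝ, V) 𝓘(ℝ, E) ∞ φ u) (a : V) :
    dChart (φ u) (φ u) (plotD (E := E) φ u a) = fderiv ℝ (extChartAt 𝓘(ℝ, E) (φ u) ∘ φ) u a := by
  have h := mfderiv_comp u (contMDiffAt_extChartAt (I := 𝓘(ℝ, E)) (n := ∞) (x := φ u)
    |>.mdifferentiableAt (by simp)) (hφ.mdifferentiableAt (by simp))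
  rw [mfderiv_eq_fderiv] at h
  rw [h]
  rfl

theorem two_le_infty : (2 : WithTop ℕ∞) ≤ ∞ := ENat.LEInfty.out

/-- The exterior derivative of a 1-form on a normed space. -/
def dOne (A : V → V → ℝ) (u a b : V) : ℝ :=
  fderiv ℝ (fun y => A y b) u a - fderiv ℝ (fun y => A y a) u b

/-- The exterior derivative of a 2-form on a normed space. -/
def dTwo (B : V → V → V → ℝ) (u a b c : V) : ℝ :=
  fderiv ℝ (fun y => B y b c) u a + fderiv ℝ (fun y => B y c a) u b
    + fderiv ℝ (fun y => B y a b) u c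

/-- The exterior derivative of a 2-form, computed in the preferred charts. -/
def extDerivTwo (β : (m : M) → TangentSpace 𝓘(ℝ, E) m →L[ℝ] TangentSpace 𝓘(ℝ, E) m →L[ℝ] ℝ)
    (m : M) (u v w : TangentSpace 𝓘(ℝ, E) m) : ℝ :=
  dTwo (pullTwo β (extChartAt 𝓘(ℝ, E) m).symm) (extChartAt 𝓘(ℝ, E) m m)
    (dChart m m u) (dChart m m v) (dChart m m w)

theorem dOne_congr {A A' : V → V → ℝ} {u : V} (h : ∀ᶠ y in 𝓝 u, ∀ a, A y a = A' y a) (a b : V) :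
    dOne A u a b = dOne A' u a b := by
  have h' : ∀ c, (fun y => A y c) =ᶠ[𝓝 u] fun y => A' y c := fun c => h.mono fun y hy => hy c
  simp only [dOne, (h' _).fderiv_eq]

theorem dTwo_congr {B B' : V → V → V → ℝ} {u : V}
    (h : ∀ᶠ y in 𝓝 u, ∀ a b, B y a b = B' y a b) (a b c : V) :
    dTwo B u a b c = dTwo B' u a b c := by
  have h' : ∀ c d, (fun y => B y c d) =ᶠ[𝓝 u] fun y => B' y c d :=
    fun c d => h.mono fun y hy => hy c d
  simp only [dTwo, (h' _ _).fderiv_eq]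

theorem dOne_pull {A : E → E →L[ℝ] ℝ} {f : V → E} {u : V} (hf : ContDiffAt ℝ ∞ f u)
    (hA : DifferentiableAt ℝ A (f u)) (a b : V) :
    dOne (fun y a => A (f y) (fderiv ℝ f y a)) u a b
      = dOne (fun y a => A y a) (f u) (fderiv ℝ f u a) (fderiv ℝ f u b) := by
  have h1 : HasFDerivAt f (fderiv ℝ f u) u := (hf.differentiableAt (by simp)).hasFDerivAt
  have h2 : HasFDerivAt (fderiv ℝ f) (fderiv ℝ (fderiv ℝ f) u) u :=
    ((hf.fderiv_right (m := ∞) (by simp)).differentiableAt (by simp)).hasFDerivAt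
  have hs : IsSymmSndFDerivAt ℝ f u := hf.isSymmSndFDerivAt (by simpa using! two_le_infty)
  have h3 : ∀ c, HasFDerivAt (fun y => A (f y) (fderiv ℝ f y c)) _ u := fun c =>
    (hA.hasFDerivAt.comp u h1).clm_apply (h2.clm_apply (hasFDerivAt_const c u))
  have h4 : ∀ c, HasFDerivAt (fun y => A y c) _ (f u) := fun c =>
    hA.hasFDerivAt.clm_apply (hasFDerivAt_const c (f u))
  simp only [dOne, (h3 _).fderiv, (h4 _).fderiv]
  simp [hs.eq a b]

theorem dTwo_pull {B : E → E →L[ℝ] E →L[ℝ] ℝ} {f : V → E} {u : V} (hf : ContDiffAt ℝ ∞ f u)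
    (hB : DifferentiableAt ℝ B (f u)) (hskew : ∀ a b, B (f u) a b = - B (f u) b a) (a b c : V) :
    dTwo (fun y a b => B (f y) (fderiv ℝ f y a) (fderiv ℝ f y b)) u a b c
      = dTwo (fun y a b => B y a b) (f u) (fderiv ℝ f u a) (fderiv ℝ f u b)
        (fderiv ℝ f u c) := by
  have h1 : HasFDerivAt f (fderiv ℝ f u) u := (hf.differentiableAt (by simp)).hasFDerivAt
  have h2 : HasFDerivAt (fderiv ℝ f) (fderiv ℝ (fderiv ℝ f) u) u :=
    ((hf.fderiv_right (m := ∞) (by simp)).differentiableAt (by simp)).hasFDerivAt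
  have hs : IsSymmSndFDerivAt ℝ f u := hf.isSymmSndFDerivAt (by simpa using! two_le_infty)
  have h3 : ∀ c d, HasFDerivAt (fun y => B (f y) (fderiv ℝ f y c) (fderiv ℝ f y d)) _ u :=
    fun c d => ((hB.hasFDerivAt.comp u h1).clm_apply
      (h2.clm_apply (hasFDerivAt_const c u))).clm_apply (h2.clm_apply (hasFDerivAt_const d u))
  have h4 : ∀ c d, HasFDerivAt (fun y => B y c d) _ (f u) := fun c d =>
    (hB.hasFDerivAt.clm_apply (hasFDerivAt_const c (f u))).clm_apply (hasFDerivAt_const d (f u))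
  simp only [dTwo, (h3 _ _).fderiv, (h4 _ _).fderiv]
  simp [hs.eq b a, hs.eq c a, hs.eq c b]
  rw [hskew (fderiv ℝ (fderiv ℝ f) u a b), hskew (fderiv ℝ (fderiv ℝ f) u a c),
    hskew (fderiv ℝ (fderiv ℝ f) u b c)]
  ring

theorem dOne_clm {A : V → V →L[ℝ] ℝ} {u : V} (hA : DifferentiableAt ℝ A u) (a b : V) :
    dOne (fun y a => A y a) u a b = fderiv ℝ A u a b - fderiv ℝ A u b a := by
  have h4 : ∀ c, HasFDerivAt (fun y => A y c) _ u := fun c =>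
    hA.hasFDerivAt.clm_apply (hasFDerivAt_const c u)
  simp [dOne, (h4 _).fderiv]

theorem dOne_pullOne {α : (m : M) → TangentSpace 𝓘(ℝ, E) m →L[ℝ] ℝ} (hα : SmoothOne α)
    {φ : V → M} {u : V} (hφ : ContMDiffAt 𝓘(ℝ, V) 𝓘(ℝ, E) ∞ φ u) (a b : V) :
    dOne (fun y a => pullOne α φ y a) u a b
      = extDerivOne α (φ u) (plotD φ u a) (plotD φ u b) := by
  have hd : DifferentiableAt ℝ (pullOne α (extChartAt 𝓘(ℝ, E) (φ u)).symm)
      ((extChartAt 𝓘(ℝ, E) (φ u) ∘ φ) u) :=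
    (hα.contDiffAt_chart (φ u)).differentiableAt (by simp)
  have e := dOne_congr (A := fun y a => pullOne α φ y a)
    (A' := fun y a => pullOne α (extChartAt 𝓘(ℝ, E) (φ u)).symm
      ((extChartAt 𝓘(ℝ, E) (φ u) ∘ φ) y) (fderiv ℝ (extChartAt 𝓘(ℝ, E) (φ u) ∘ φ) y a))
    ((pullOne_eventuallyEq α hφ).mono fun y hy a => by rw [hy]; rfl) a b
  rw [e, dOne_pull (contDiffAt_chart_comp hφ) hd, dOne_clm hd, ← dChart_plotD hφ,
    ← dChart_plotD hφ]
  rfl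

theorem dTwo_pullTwo
    {β : (m : M) → TangentSpace 𝓘(ℝ, E) m →L[ℝ] TangentSpace 𝓘(ℝ, E) m →L[ℝ] ℝ}
    (hβ : SmoothTwo β) (hskew : ∀ m u v, β m u v = - β m v u)
    {φ : V → M} {u : V} (hφ : ContMDiffAt 𝓘(ℝ, V) 𝓘(ℝ, E) ∞ φ u) (a b c : V) :
    dTwo (pullTwo β φ) u a b c
      = extDerivTwo β (φ u) (plotD φ u a) (plotD φ u b) (plotD φ u c) := by
  rw [dTwo_congr (pullTwo_eventuallyEq β hφ),
    dTwo_pull (contDiffAt_chart_comp hφ) ((hβ.contDiffAt_chart (φ u)).differentiableAt (by simp))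
      (fun a b => hskew _ _ _),
    ← dChart_plotD hφ, ← dChart_plotD hφ, ← dChart_plotD hφ]
  rfl

end Calculus

/-! ### Smooth sections of tensor bundles in coordinates -/

section Sections

variable {E : Type*} [NormedAddCommGroup E] [NormedSpace ℝ E] [FiniteDimensional ℝ E]
  {M : Type*} [TopologicalSpace M] [ChartedSpace E M] [IsManifold 𝓘(ℝ, E) ∞ M]

theorem contMDiffAt_iff_chart {G : Type*} [NormedAddCommGroup G] [NormedSpace ℝ G] {f : M → G}
    {m : M} : ContMDiffAt 𝓘(ℝ, E) 𝓘(ℝ, G) ∞ f m ↔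
      ContDiffAt ℝ ∞ (f ∘ (extChartAt 𝓘(ℝ, E) m).symm) (extChartAt 𝓘(ℝ, E) m m) := by
  constructor
  · intro h
    rw [← contMDiffAt_iff_contDiffAt]
    exact ContMDiffAt.comp_of_eq h (contMDiffAt_extChartAt_symm m) (by simp)
  · intro h
    rw [← contMDiffAt_iff_contDiffAt] at h
    have h2 := h.comp m (contMDiffAt_extChartAt (I := 𝓘(ℝ, E)) (n := ∞) (x := m))
    refine h2.congr_of_eventuallyEq ?_
    filter_upwards [extChartAt_source_mem_nhds (I := 𝓘(ℝ, E)) m] with x hx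
    simp only [Function.comp]
    rw [(extChartAt 𝓘(ℝ, E) m).left_inv hx]

theorem trivializationAt_symmL_eq {m : M} {y : E} (hy : y ∈ (extChartAt 𝓘(ℝ, E) m).target) (a : E) :
    (trivializationAt E (TangentSpace 𝓘(ℝ, E)) m).symm ((extChartAt 𝓘(ℝ, E) m).symm y) a
      = dChartSymm m y a := by
  have : IsManifold 𝓘(ℝ, E) 1 M := IsManifold.of_le (n := ∞) (by simp)
  have hx : (extChartAt 𝓘(ℝ, E) m).symm y ∈ (chartAt E m).source := by
    simpa using (extChartAt 𝓘(ℝ, E) m).map_target hy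
  have h := TangentBundle.symmL_trivializationAt (I := 𝓘(ℝ, E)) hx
  have h2 : (trivializationAt E (TangentSpace 𝓘(ℝ, E)) m).symmL ℝ
      ((extChartAt 𝓘(ℝ, E) m).symm y) a =
      (trivializationAt E (TangentSpace 𝓘(ℝ, E)) m).symm ((extChartAt 𝓘(ℝ, E) m).symm y) a := by
    exact Trivialization.symmL_apply (R := ℝ) _ (by simpa using hx) a
  rw [← h2, h, dChartSymm]
  have h3 : extChartAt 𝓘(ℝ, E) m ((extChartAt 𝓘(ℝ, E) m).symm y) = y :=
    (extChartAt 𝓘(ℝ, E) m).right_inv hy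
  simp only [modelWithCornersSelf_coe, range_id, mfderivWithin_univ]
  rw [h3]

theorem trivializationAt_continuousLinearMapAt_eq {m x : M} (hx : x ∈ (chartAt E m).source)
    (a : TangentSpace 𝓘(ℝ, E) x) :
    (trivializationAt E (TangentSpace 𝓘(ℝ, E)) m).continuousLinearMapAt ℝ x a
      = dChart m x a := by
  have : IsManifold 𝓘(ℝ, E) 1 M := IsManifold.of_le (n := ∞) (by simp)
  rw [TangentBundle.continuousLinearMapAt_trivializationAt (I := 𝓘(ℝ, E)) hx]
  rfl

theorem eventually_mem_target (m : M) :
    ∀ᶠ y in 𝓝 (extChartAt 𝓘(ℝ, E) m m), y ∈ (extChartAt 𝓘(ℝ, E) m).target :=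
  extChartAt_target_mem_nhds m

theorem contMDiff_iff_smoothTwo
    {β : (m : M) → TangentSpace 𝓘(ℝ, E) m →L[ℝ] TangentSpace 𝓘(ℝ, E) m →L[ℝ] ℝ} :
    ContMDiff 𝓘(ℝ, E) (𝓘(ℝ, E).prod 𝓘(ℝ, E →L[ℝ] E →L[ℝ] ℝ)) ∞
      (fun m : M => TotalSpace.mk' (E →L[ℝ] E →L[ℝ] ℝ)
        (E := fun m : M => TangentSpace 𝓘(ℝ, E) m →L[ℝ] TangentSpace 𝓘(ℝ, E) m →L[ℝ] ℝ) m (β m))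
      ↔ SmoothTwo β := by
  have key : ∀ m : M, ∀ a b : E, (fun y => ContinuousLinearMap.inCoordinates E
      (TangentSpace 𝓘(ℝ, E)) (E →L[ℝ] ℝ) (fun m : M => TangentSpace 𝓘(ℝ, E) m →L[ℝ] ℝ)
        m ((extChartAt 𝓘(ℝ, E) m).symm y) m ((extChartAt 𝓘(ℝ, E) m).symm y)
        (β ((extChartAt 𝓘(ℝ, E) m).symm y)) a b) =ᶠ[𝓝 (extChartAt 𝓘(ℝ, E) m m)]
      fun y => pullTwo β (extChartAt 𝓘(ℝ, E) m).symm y a b := by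
    intro m a b
    filter_upwards [eventually_mem_target m] with y hy
    have hx : (extChartAt 𝓘(ℝ, E) m).symm y ∈
        (trivializationAt E (TangentSpace 𝓘(ℝ, E)) m).baseSet := by
      simpa using (extChartAt 𝓘(ℝ, E) m).map_target hy
    have := inCoordinates_apply_eq₂ (𝕜 := ℝ) (F₁ := E) (F₂ := E) (F₃ := ℝ)
      (E₁ := TangentSpace 𝓘(ℝ, E) (M := M)) (E₂ := TangentSpace 𝓘(ℝ, E) (M := M))
      (E₃ := Bundle.Trivial M ℝ) (x₀ := m) (ϕ := β ((extChartAt 𝓘(ℝ, E) m).symm y))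
      (v := a) (w := b) hx hx (by simp)
    refine this.trans ?_
    rw [trivializationAt_symmL_eq hy, trivializationAt_symmL_eq hy]
    simp
    rfl
  constructor
  · intro h m a b
    have h1 := ((contMDiffAt_hom_bundle _).1 (h m)).2
    rw [contMDiffAt_iff_chart] at h1
    exact ((h1.clm_apply contDiffAt_const).clm_apply contDiffAt_const).congr_of_eventuallyEq
      (key m a b).symm
  · intro h m
    refine (contMDiffAt_hom_bundle _).2 ⟨contMDiffAt_id, ?_⟩
    rw [contMDiffAt_iff_chart]
    exact contDiffAt_clm_of_apply fun a => contDiffAt_clm_of_apply fun b =>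
      (h m a b).congr_of_eventuallyEq (key m a b)

theorem contMDiff_iff_smoothOne {α : (m : M) → TangentSpace 𝓘(ℝ, E) m →L[ℝ] ℝ} :
    ContMDiff 𝓘(ℝ, E) (𝓘(ℝ, E).prod 𝓘(ℝ, E →L[ℝ] ℝ)) ∞
      (fun m : M => TotalSpace.mk' (E →L[ℝ] ℝ)
        (E := fun m : M => TangentSpace 𝓘(ℝ, E) m →L[ℝ] ℝ) m (α m)) ↔ SmoothOne α := by
  have key : ∀ m : M, ∀ a : E, (fun y => ContinuousLinearMap.inCoordinates E
      (TangentSpace 𝓘(ℝ, E)) ℝ (Bundle.Trivial M ℝ)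
        m ((extChartAt 𝓘(ℝ, E) m).symm y) m ((extChartAt 𝓘(ℝ, E) m).symm y)
        (α ((extChartAt 𝓘(ℝ, E) m).symm y)) a) =ᶠ[𝓝 (extChartAt 𝓘(ℝ, E) m m)]
      fun y => pullOne α (extChartAt 𝓘(ℝ, E) m).symm y a := by
    intro m a
    filter_upwards [eventually_mem_target m] with y hy
    have hx : (extChartAt 𝓘(ℝ, E) m).symm y ∈
        (trivializationAt E (TangentSpace 𝓘(ℝ, E)) m).baseSet := by
      simpa using (extChartAt 𝓘(ℝ, E) m).map_target hy
    have e : (trivializationAt E (TangentSpace 𝓘(ℝ, E)) m).symmL ℝ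
        ((extChartAt 𝓘(ℝ, E) m).symm y) a = dChartSymm m y a :=
      (Trivialization.symmL_apply (R := ℝ) _ hx a).trans (trivializationAt_symmL_eq hy a)
    calc _ = (trivializationAt ℝ (Bundle.Trivial M ℝ) m).continuousLinearMapAt ℝ
          ((extChartAt 𝓘(ℝ, E) m).symm y) (α ((extChartAt 𝓘(ℝ, E) m).symm y)
          ((trivializationAt E (TangentSpace 𝓘(ℝ, E)) m).symmL ℝ
            ((extChartAt 𝓘(ℝ, E) m).symm y) a)) := rfl
      _ = _ := by
        rw [e]
        simp
        rfl
  constructor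
  · intro h m a
    have h1 := ((contMDiffAt_hom_bundle _).1 (h m)).2
    rw [contMDiffAt_iff_chart] at h1
    exact (h1.clm_apply contDiffAt_const).congr_of_eventuallyEq (key m a).symm
  · intro h m
    refine (contMDiffAt_hom_bundle _).2 ⟨contMDiffAt_id, ?_⟩
    rw [contMDiffAt_iff_chart]
    exact contDiffAt_clm_of_apply fun a => (h m a).congr_of_eventuallyEq (key m a)

/-- A field of endomorphisms with smooth coordinate expressions. -/
def SmoothEnd (J : (m : M) → TangentSpace 𝓘(ℝ, E) m →L[ℝ] TangentSpace 𝓘(ℝ, E) m) : Prop :=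
  ∀ m a, ContDiffAt ℝ ∞ (fun y => endCoord J m y a) (extChartAt 𝓘(ℝ, E) m m)

theorem contMDiff_iff_smoothEnd
    {J : (m : M) → TangentSpace 𝓘(ℝ, E) m →L[ℝ] TangentSpace 𝓘(ℝ, E) m} :
    ContMDiff 𝓘(ℝ, E) (𝓘(ℝ, E).prod 𝓘(ℝ, E →L[ℝ] E)) ∞
      (fun m : M => TotalSpace.mk' (E →L[ℝ] E)
        (E := fun m : M => TangentSpace 𝓘(ℝ, E) m →L[ℝ] TangentSpace 𝓘(ℝ, E) m) m (J m))
      ↔ SmoothEnd J := by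
  have key : ∀ m : M, ∀ a : E, (fun y => ContinuousLinearMap.inCoordinates E
      (TangentSpace 𝓘(ℝ, E)) E (TangentSpace 𝓘(ℝ, E))
        m ((extChartAt 𝓘(ℝ, E) m).symm y) m ((extChartAt 𝓘(ℝ, E) m).symm y)
        (J ((extChartAt 𝓘(ℝ, E) m).symm y)) a) =ᶠ[𝓝 (extChartAt 𝓘(ℝ, E) m m)]
      fun y => endCoord J m y a := by
    intro m a
    filter_upwards [eventually_mem_target m] with y hy
    have hx' : (extChartAt 𝓘(ℝ, E) m).symm y ∈ (chartAt E m).source := by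
      simpa using (extChartAt 𝓘(ℝ, E) m).map_target hy
    have hx : (extChartAt 𝓘(ℝ, E) m).symm y ∈
        (trivializationAt E (TangentSpace 𝓘(ℝ, E)) m).baseSet := by
      simpa using hx'
    rw [endCoord, ← trivializationAt_continuousLinearMapAt_eq hx',
      ← trivializationAt_symmL_eq hy, ← Trivialization.symmL_apply (R := ℝ) _ hx]
    rfl
  constructor
  · intro h m a
    have h1 := ((contMDiffAt_hom_bundle _).1 (h m)).2
    rw [contMDiffAt_iff_chart] at h1
    exact (h1.clm_apply contDiffAt_const).congr_of_eventuallyEq (key m a).symm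
  · intro h m
    refine (contMDiffAt_hom_bundle _).2 ⟨contMDiffAt_id, ?_⟩
    rw [contMDiffAt_iff_chart]
    exact contDiffAt_clm_of_apply fun a => (h m a).congr_of_eventuallyEq (key m a)

end Sections

/-! ### Closed forms and parallel complex structures -/

section Flat

variable {E : Type*} [NormedAddCommGroup E] [NormedSpace ℝ E]

/-- An algebraic version of the integrability of an almost complex structure which belongs to an
almost hyperhermitian structure with closed forms: `P r a b c` stands for `g((∇_a I_r) b, c)`. -/
theorem eq_zero_of_cyclic {P₁ P₂ P₃ : E → E → E → ℝ} {I₁ I₂ I₃ : E → E}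
    (hI₁ : Function.Surjective I₁) (hI₂ : Function.Surjective I₂)
    (h12 : ∀ b, I₁ (I₂ b) = I₃ b) (h21 : ∀ b, I₂ (I₁ b) = -I₃ b)
    (hneg : ∀ a b c, P₁ a b (-c) = - P₁ a b c)
    (s₁ : ∀ a b c, P₁ a b c = - P₁ a c b)
    (s₂ : ∀ a b c, P₂ a b c = - P₂ a c b) (s₃ : ∀ a b c, P₃ a b c = - P₃ a c b)
    (c₁ : ∀ a b c, P₁ a b c + P₁ b c a + P₁ c a b = 0)
    (c₂ : ∀ a b c, P₂ a b c + P₂ b c a + P₂ c a b = 0)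
    (c₃ : ∀ a b c, P₃ a b c + P₃ b c a + P₃ c a b = 0)
    (r21 : ∀ a b c, - P₃ a b c = P₂ a (I₁ b) c - P₁ a b (I₂ c))
    (r31 : ∀ a b c, P₂ a b c = P₃ a (I₁ b) c - P₁ a b (I₃ c)) (a b c : E) : P₁ a b c = 0 := by
  have n2 : ∀ b c e, P₁ (I₁ b) c (I₂ e) + P₁ b c (I₁ (I₂ e)) - P₁ (I₁ c) b (I₂ e)
      - P₁ c b (I₁ (I₂ e)) = 0 := by
    intro b c e
    have e1 := r21 e b (I₁ c)
    have e2 := r31 e b c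
    rw [h21, hneg] at e1
    rw [h12]
    linarith [r21 (I₁ b) c e, r31 b c e, r21 (I₁ c) b e, r31 c b e, e1, e2,
      c₃ (I₁ b) c e, s₃ c (I₁ b) e, c₃ b (I₁ c) e, s₃ (I₁ c) b e, c₂ (I₁ b) (I₁ c) e,
      s₂ (I₁ c) (I₁ b) e, c₂ b c e, s₂ c b e]
  have n : ∀ b c e, P₁ (I₁ b) c e + P₁ b c (I₁ e) - P₁ (I₁ c) b e - P₁ c b (I₁ e) = 0 := by
    intro b c e
    obtain ⟨e, rfl⟩ := hI₂ e
    exact n2 b c e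
  have q : ∀ b c e, P₁ (I₁ b) c e + P₁ (I₁ c) e b - P₁ (I₁ e) b c = 0 := by
    intro b c e
    linarith [n b c e, c₁ b c (I₁ e), s₁ c b (I₁ e), s₁ (I₁ c) e b]
  obtain ⟨a, rfl⟩ := hI₁ a
  linarith [q a b c, q b c a, q c a b]

/-- The Christoffel symbol of the first kind of a metric on a normed space. -/
def flatChristoffel (G : E → E →L[ℝ] E →L[ℝ] ℝ) (y a b c : E) : ℝ :=
  (1 / 2) * (fderiv ℝ (fun y => G y b c) y a + fderiv ℝ (fun y => G y a c) y b
    - fderiv ℝ (fun y => G y a b) y c)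

/-- The covariant derivative of a field of skew endomorphisms. -/
def flatNabla (G : E → E →L[ℝ] E →L[ℝ] ℝ) (J : E → E →L[ℝ] E) (y a b c : E) : ℝ :=
  G y (fderiv ℝ (fun y => J y b) y a) c + flatChristoffel G y a (J y b) c
    + flatChristoffel G y a b (J y c)

variable {G : E → E →L[ℝ] E →L[ℝ] ℝ} {y : E}

theorem fderiv_clm_apply_const {F : Type*} [NormedAddCommGroup F] [NormedSpace ℝ F]
    {J : E → E →L[ℝ] F} (hJ : DifferentiableAt ℝ J y) (a b : E) :
    fderiv ℝ (fun y => J y b) y a = fderiv ℝ J y a b := by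
  have h : HasFDerivAt (fun y => J y b) _ y := hJ.hasFDerivAt.clm_apply (hasFDerivAt_const b y)
  simp [h.fderiv]

theorem fderiv_clm_apply_const₂ (hG : DifferentiableAt ℝ G y) (a b c : E) :
    fderiv ℝ (fun y => G y b c) y a = fderiv ℝ G y a b c := by
  have h : HasFDerivAt (fun y => G y b c) _ y :=
    (hG.hasFDerivAt.clm_apply (hasFDerivAt_const b y)).clm_apply (hasFDerivAt_const c y)
  simp [h.fderiv]

theorem fderiv_form {J : E → E →L[ℝ] E} (hG : DifferentiableAt ℝ G y)
    (hJ : DifferentiableAt ℝ J y) (a b c : E) :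
    fderiv ℝ (fun y => G y b (J y c)) y a = fderiv ℝ G y a b (J y c) + G y b (fderiv ℝ J y a c) := by
  have h : HasFDerivAt (fun y => G y b (J y c)) _ y :=
    (hG.hasFDerivAt.clm_apply (hasFDerivAt_const b y)).clm_apply
      (hJ.hasFDerivAt.clm_apply (hasFDerivAt_const c y))
  simp [h.fderiv]
  ring

theorem flatNabla_eq {J : E → E →L[ℝ] E} (hG : DifferentiableAt ℝ G y)
    (hJ : DifferentiableAt ℝ J y) (a b c : E) :
    flatNabla G J y a b c = G y (fderiv ℝ J y a b) c
      + (1 / 2) * (fderiv ℝ G y a (J y b) c + fderiv ℝ G y (J y b) a c - fderiv ℝ G y c a (J y b))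
      + (1 / 2) * (fderiv ℝ G y a b (J y c) + fderiv ℝ G y b a (J y c)
        - fderiv ℝ G y (J y c) a b) := by
  simp only [flatNabla, flatChristoffel, fderiv_clm_apply_const hJ, fderiv_clm_apply_const₂ hG]

theorem fderiv_symm (hG : DifferentiableAt ℝ G y) (hs : ∀ᶠ z in 𝓝 y, ∀ b c, G z b c = G z c b)
    (a b c : E) : fderiv ℝ G y a b c = fderiv ℝ G y a c b := by
  rw [← fderiv_clm_apply_const₂ hG, ← fderiv_clm_apply_const₂ hG]
  rw [Filter.EventuallyEq.fderiv_eq (f := fun z => G z c b) (hs.mono fun z hz => hz b c)]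

/-- The forms `g(b, J c)` are skew. -/
theorem fderiv_form_skew {J : E → E →L[ℝ] E}
    (hk : ∀ᶠ z in 𝓝 y, ∀ b c, G z b (J z c) = - G z c (J z b)) (a b c : E) :
    fderiv ℝ (fun y => G y b (J y c)) y a = - fderiv ℝ (fun y => G y c (J y b)) y a := by
  rw [Filter.EventuallyEq.fderiv_eq (f := fun z => - G z c (J z b)) (hk.mono fun z hz => hz b c)]
  rw [fderiv_fun_neg]
  simp

theorem flatNabla_skew {J : E → E →L[ℝ] E} (hG : DifferentiableAt ℝ G y)
    (hJ : DifferentiableAt ℝ J y) (hs : ∀ᶠ z in 𝓝 y, ∀ b c, G z b c = G z c b)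
    (hk : ∀ᶠ z in 𝓝 y, ∀ b c, G z b (J z c) = - G z c (J z b)) (a b c : E) :
    flatNabla G J y a b c = - flatNabla G J y a c b := by
  have h := fderiv_form_skew hk a c b
  rw [fderiv_form hG hJ, fderiv_form hG hJ] at h
  rw [flatNabla_eq hG hJ, flatNabla_eq hG hJ]
  have s0 := hs.self_of_nhds
  have s := fderiv_symm hG hs
  linarith [s0 (fderiv ℝ J y a b) c, s0 (fderiv ℝ J y a c) b, s a (J y b) c, s a (J y c) b,
    s (J y b) a c, s (J y c) a b, s c a (J y b), s b a (J y c)]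

theorem flatNabla_cyclic {J : E → E →L[ℝ] E} (hG : DifferentiableAt ℝ G y)
    (hJ : DifferentiableAt ℝ J y) (hs : ∀ᶠ z in 𝓝 y, ∀ b c, G z b c = G z c b)
    (hk : ∀ᶠ z in 𝓝 y, ∀ b c, G z b (J z c) = - G z c (J z b)) (a b c : E) :
    flatNabla G J y a b c + flatNabla G J y b c a + flatNabla G J y c a b
      = - dTwo (fun y b c => G y b (J y c)) y a b c := by
  have h1 := fderiv_form_skew hk a b c
  have h2 := fderiv_form_skew hk b c a
  have h3 := fderiv_form_skew hk c a b
  have s0 := hs.self_of_nhds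
  have s := fderiv_symm hG hs
  simp only [dTwo]
  rw [h1, h2, h3]
  simp only [fderiv_form hG hJ]
  rw [flatNabla_eq hG hJ, flatNabla_eq hG hJ, flatNabla_eq hG hJ]
  rw [s0 (fderiv ℝ J y a b) c, s0 (fderiv ℝ J y b c) a, s0 (fderiv ℝ J y c a) b]
  linarith [s a (J y b) c, s (J y b) a c, s c a (J y b), s a b (J y c), s b a (J y c),
    s (J y c) a b, s b (J y c) a, s (J y c) b a, s a b (J y c), s b c (J y a), s c b (J y a),
    s (J y a) b c, s c (J y a) b, s (J y a) c b, s b c (J y a), s c a (J y b), s a c (J y b),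
    s (J y b) c a]

theorem flatNabla_mul {J K L : E → E →L[ℝ] E} {ε : ℝ} (hG : DifferentiableAt ℝ G y)
    (hJ : DifferentiableAt ℝ J y) (hK : DifferentiableAt ℝ K y) (hL : DifferentiableAt ℝ L y)
    (hk : ∀ b c, G y (J y b) c = - G y b (J y c))
    (h : ∀ᶠ z in 𝓝 y, ∀ b, J z (K z b) = ε • L z b) (h' : ∀ b, K y (J y b) = -(ε • L y b))
    (a b c : E) :
    ε * flatNabla G L y a b c = flatNabla G J y a (K y b) c - flatNabla G K y a b (J y c) := by
  have h0 := h.self_of_nhds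
  have e1 : fderiv ℝ (fun z => J z (K z b)) y a = ε • fderiv ℝ L y a b := by
    rw [Filter.EventuallyEq.fderiv_eq (f := fun z => ε • L z b) (h.mono fun z hz => hz b)]
    have : HasFDerivAt (fun z => ε • L z b) _ y :=
      (hL.hasFDerivAt.clm_apply (hasFDerivAt_const b y)).const_smul ε
    simp [this.fderiv]
  have e2 : HasFDerivAt (fun z => J z (K z b)) _ y :=
    hJ.hasFDerivAt.clm_apply (hK.hasFDerivAt.clm_apply (hasFDerivAt_const b y))
  rw [e2.fderiv] at e1
  simp only [add_apply, ContinuousLinearMap.comp_apply,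
    ContinuousLinearMap.flip_apply, zero_apply, map_zero, zero_add] at e1
  have e3 := congrArg (fun w => G y w c) e1
  simp only [map_add, map_smul, add_apply, smul_apply,
    smul_eq_mul] at e3
  rw [hk] at e3
  rw [flatNabla_eq hG hL, flatNabla_eq hG hJ, flatNabla_eq hG hK]
  simp only [h0, h', map_neg, map_smul, neg_apply,
    smul_apply, smul_eq_mul]
  linarith

/-- An almost hyperhermitian structure with closed forms is covariantly constant. -/
theorem flatNabla_eq_zero {J : Fin 3 → E → E →L[ℝ] E} (hG : DifferentiableAt ℝ G y)
    (hJ : ∀ r, DifferentiableAt ℝ (J r) y)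
    (hs : ∀ᶠ z in 𝓝 y, ∀ b c, G z b c = G z c b)
    (hsq : ∀ᶠ z in 𝓝 y, ∀ r b, J r z (J r z b) = - b)
    (hmul : ∀ᶠ z in 𝓝 y, ∀ b, J 0 z (J 1 z b) = J 2 z b)
    (hmul' : ∀ᶠ z in 𝓝 y, ∀ b, J 1 z (J 0 z b) = - J 2 z b)
    (hk : ∀ᶠ z in 𝓝 y, ∀ r b c, G z b (J r z c) = - G z c (J r z b))
    (hd : ∀ r a b c, dTwo (fun y b c => G y b (J r y c)) y a b c = 0) (r : Fin 3) (a b c : E) :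
    flatNabla G (J r) y a b c = 0 := by
  have hsurj : ∀ r, Function.Surjective (J r y) := fun r b =>
    ⟨- J r y b, by rw [map_neg, hsq.self_of_nhds, neg_neg]⟩
  have hcyc : ∀ r a b c, flatNabla G (J r) y a b c + flatNabla G (J r) y b c a
      + flatNabla G (J r) y c a b = 0 := fun r a b c => by
    rw [flatNabla_cyclic hG (hJ r) hs (hk.mono fun z hz => hz r), hd, neg_zero]
  have hsk := fun r => flatNabla_skew hG (hJ r) hs (hk.mono fun z hz => hz r)
  have hk0 : ∀ r b c, G y (J r y b) c = - G y b (J r y c) := fun r b c => by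
    rw [hs.self_of_nhds, hk.self_of_nhds]
  have hneg : ∀ r a b c, flatNabla G (J r) y a b (-c) = - flatNabla G (J r) y a b c := by
    intro r a b c
    rw [flatNabla_eq hG (hJ r), flatNabla_eq hG (hJ r)]
    simp only [map_neg, neg_apply]
    ring
  have m12 : ∀ᶠ z in 𝓝 y, ∀ b, J 1 z (J 2 z b) = J 0 z b := by
    filter_upwards [hsq, hmul, hmul'] with z z1 z2 z3 b
    have := z3 (J 1 z b)
    rw [z2] at this
    rw [this, ← z2, z1, map_neg, neg_neg]
  have m21 : ∀ᶠ z in 𝓝 y, ∀ b, J 2 z (J 1 z b) = - J 0 z b := by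
    filter_upwards [hsq, hmul] with z z1 z2 b
    rw [← z2, z1, map_neg]
  have m02 : ∀ᶠ z in 𝓝 y, ∀ b, J 0 z (J 2 z b) = - J 1 z b := by
    filter_upwards [hsq, hmul] with z z1 z2 b
    rw [← z2, z1]
  have m20 : ∀ᶠ z in 𝓝 y, ∀ b, J 2 z (J 0 z b) = J 1 z b := by
    filter_upwards [hsq, hmul, hmul'] with z z1 z2 z3 b
    rw [← z2, z3, map_neg, ← z2, z1, neg_neg]
  have rp : ∀ r s t, (∀ᶠ z in 𝓝 y, ∀ b, J r z (J s z b) = J t z b) →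
      (∀ᶠ z in 𝓝 y, ∀ b, J s z (J r z b) = - J t z b) → ∀ a b c, flatNabla G (J t) y a b c
        = flatNabla G (J r) y a (J s y b) c - flatNabla G (J s) y a b (J r y c) := by
    intro r s t h h' a b c
    have := flatNabla_mul (ε := 1) hG (hJ r) (hJ s) (hJ t) (hk0 r)
      (h.mono fun z hz b => by rw [hz, one_smul]) (fun b => by rw [h'.self_of_nhds, one_smul]) a b c
    rwa [one_mul] at this
  have rm : ∀ r s t, (∀ᶠ z in 𝓝 y, ∀ b, J r z (J s z b) = - J t z b) →
      (∀ᶠ z in 𝓝 y, ∀ b, J s z (J r z b) = J t z b) → ∀ a b c, - flatNabla G (J t) y a b c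
        = flatNabla G (J r) y a (J s y b) c - flatNabla G (J s) y a b (J r y c) := by
    intro r s t h h' a b c
    have := flatNabla_mul (ε := -1) hG (hJ r) (hJ s) (hJ t) (hk0 r)
      (h.mono fun z hz b => by rw [hz, neg_smul, one_smul])
      (fun b => by rw [h'.self_of_nhds, neg_smul, one_smul, neg_neg]) a b c
    rwa [neg_one_mul] at this
  fin_cases r
  · exact eq_zero_of_cyclic (hsurj 0) (hsurj 1) hmul.self_of_nhds hmul'.self_of_nhds (hneg 0)
      (hsk 0) (hsk 1) (hsk 2) (hcyc 0) (hcyc 1) (hcyc 2) (rm 1 0 2 hmul' hmul)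
      (rp 2 0 1 m20 m02) a b c
  · exact eq_zero_of_cyclic (hsurj 1) (hsurj 2) m12.self_of_nhds m21.self_of_nhds (hneg 1)
      (hsk 1) (hsk 2) (hsk 0) (hcyc 1) (hcyc 2) (hcyc 0) (rm 2 1 0 m21 m12)
      (rp 0 1 2 hmul hmul') a b c
  · exact eq_zero_of_cyclic (hsurj 2) (hsurj 0) m20.self_of_nhds m02.self_of_nhds (hneg 2)
      (hsk 2) (hsk 0) (hsk 1) (hcyc 2) (hcyc 0) (hcyc 1) (rm 0 2 1 m02 m20)
      (rp 1 2 0 m12 m21) a b c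

end Flat

/-! ### HyperKähler structures and closed forms -/

section Forms

variable {E : Type*} [NormedAddCommGroup E] [NormedSpace ℝ E] [FiniteDimensional ℝ E]
  {M : Type*} [TopologicalSpace M] [ChartedSpace E M] [IsManifold 𝓘(ℝ, E) ∞ M]

theorem dChartSymm_dChart {m : M} {y : E} (hy : y ∈ (extChartAt 𝓘(ℝ, E) m).target)
    (u : TangentSpace 𝓘(ℝ, E) ((extChartAt 𝓘(ℝ, E) m).symm y)) :
    dChartSymm m y (dChart m ((extChartAt 𝓘(ℝ, E) m).symm y) u) = u := by
  have : IsManifold 𝓘(ℝ, E) 1 M := IsManifold.of_le (n := ∞) (by simp)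
  have h := mfderivWithin_extChartAt_symm_comp_mfderiv_extChartAt (I := 𝓘(ℝ, E)) hy
  simp only [modelWithCornersSelf_coe, range_id, mfderivWithin_univ] at h
  exact congrArg (fun L => L u) h

theorem dChart_dChartSymm {m : M} {y : E} (hy : y ∈ (extChartAt 𝓘(ℝ, E) m).target) (u : E) :
    dChart m ((extChartAt 𝓘(ℝ, E) m).symm y) (dChartSymm m y u) = u := by
  have : IsManifold 𝓘(ℝ, E) 1 M := IsManifold.of_le (n := ∞) (by simp)
  have h := mfderiv_extChartAt_comp_mfderivWithin_extChartAt_symm (I := 𝓘(ℝ, E)) hy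
  simp only [modelWithCornersSelf_coe, range_id, mfderivWithin_univ] at h
  exact congrArg (fun L => L u) h

/-- A field of endomorphisms in coordinates, as a continuous linear map. -/
def endCoordL (J : (m : M) → TangentSpace 𝓘(ℝ, E) m →L[ℝ] TangentSpace 𝓘(ℝ, E) m)
    (m : M) (y : E) : E →L[ℝ] E :=
  (dChart m ((extChartAt 𝓘(ℝ, E) m).symm y)).comp
    ((J ((extChartAt 𝓘(ℝ, E) m).symm y)).comp (dChartSymm m y))

/-- The bilinear form `g(u, J v)`. -/
def formOf (g : (m : M) → TangentSpace 𝓘(ℝ, E) m →L[ℝ] TangentSpace 𝓘(ℝ, E) m →L[ℝ] ℝ)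
    (J : (m : M) → TangentSpace 𝓘(ℝ, E) m →L[ℝ] TangentSpace 𝓘(ℝ, E) m) (m : M) :
    TangentSpace 𝓘(ℝ, E) m →L[ℝ] TangentSpace 𝓘(ℝ, E) m →L[ℝ] ℝ :=
  ((J m).precomp ℝ).comp (g m)

variable {g : (m : M) → TangentSpace 𝓘(ℝ, E) m →L[ℝ] TangentSpace 𝓘(ℝ, E) m →L[ℝ] ℝ}
  {J : (m : M) → TangentSpace 𝓘(ℝ, E) m →L[ℝ] TangentSpace 𝓘(ℝ, E) m}

theorem pullTwo_formOf {m : M} {y : E} (hy : y ∈ (extChartAt 𝓘(ℝ, E) m).target) (a b : E) :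
    pullTwo (formOf g J) (extChartAt 𝓘(ℝ, E) m).symm y a b
      = pullTwoL g (extChartAt 𝓘(ℝ, E) m).symm y a (endCoordL J m y b) := by
  have := dChartSymm_dChart hy (J ((extChartAt 𝓘(ℝ, E) m).symm y) (dChartSymm m y b))
  exact congrArg (fun v => g ((extChartAt 𝓘(ℝ, E) m).symm y) (dChartSymm m y a) v) this.symm

theorem SmoothEnd.contDiffAt_chart (hJ : SmoothEnd J) (m : M) :
    ContDiffAt ℝ ∞ (endCoordL J m) (extChartAt 𝓘(ℝ, E) m m) :=
  contDiffAt_clm_of_apply (hJ m)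

theorem smoothTwo_formOf (hg : SmoothTwo g) (hJ : SmoothEnd J) : SmoothTwo (formOf g J) := by
  intro m a b
  have h : ContDiffAt ℝ ∞ (fun y => pullTwoL g (extChartAt 𝓘(ℝ, E) m).symm y a (endCoordL J m y b))
      (extChartAt 𝓘(ℝ, E) m m) :=
    ((hg.contDiffAt_chart m).clm_apply contDiffAt_const).clm_apply
      ((hJ.contDiffAt_chart m).clm_apply contDiffAt_const)
  exact h.congr_of_eventuallyEq ((eventually_mem_target m).mono fun y hy => pullTwo_formOf hy a b)

theorem extDerivTwo_formOf (m : M) (u v w : TangentSpace 𝓘(ℝ, E) m) :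
    extDerivTwo (formOf g J) m u v w =
      dTwo (fun y b c => pullTwoL g (extChartAt 𝓘(ℝ, E) m).symm y b (endCoordL J m y c))
        (extChartAt 𝓘(ℝ, E) m m) (dChart m m u) (dChart m m v) (dChart m m w) :=
  dTwo_congr ((eventually_mem_target m).mono fun _ hy a b => pullTwo_formOf hy a b) _ _ _

theorem isParallel_iff : IsParallel g J ↔ ∀ m a b c,
    flatNabla (pullTwoL g (extChartAt 𝓘(ℝ, E) m).symm) (endCoordL J m)
      (extChartAt 𝓘(ℝ, E) m m) a b c = 0 := Iff.rfl

theorem endCoordL_comp {K : (m : M) → TangentSpace 𝓘(ℝ, E) m →L[ℝ] TangentSpace 𝓘(ℝ, E) m}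
    {m : M} {y : E} (hy : y ∈ (extChartAt 𝓘(ℝ, E) m).target) (a : E) :
    endCoordL J m y (endCoordL K m y a)
      = dChart m ((extChartAt 𝓘(ℝ, E) m).symm y) (J ((extChartAt 𝓘(ℝ, E) m).symm y)
        (K ((extChartAt 𝓘(ℝ, E) m).symm y) (dChartSymm m y a))) := by
  have := dChartSymm_dChart hy (K ((extChartAt 𝓘(ℝ, E) m).symm y) (dChartSymm m y a))
  exact congrArg (fun v => dChart m ((extChartAt 𝓘(ℝ, E) m).symm y)
    (J ((extChartAt 𝓘(ℝ, E) m).symm y) v)) this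

theorem isInvertible_of_pos {B : E →L[ℝ] E →L[ℝ] ℝ} (h : ∀ v, v ≠ 0 → 0 < B v v) :
    B.IsInvertible := by
  have hinj : Function.Injective (B : E →ₗ[ℝ] (E →L[ℝ] ℝ)) := by
    rw [injective_iff_map_eq_zero]
    intro v hv
    by_contra hne
    have h1 := h v hne
    have h2 : B v = 0 := hv
    simp [h2] at h1
  have hd : Module.finrank ℝ E = Module.finrank ℝ (E →L[ℝ] ℝ) := by
    rw [← LinearEquiv.finrank_eq (LinearMap.toContinuousLinearMap (𝕜 := ℝ) (E := E) (F' := ℝ))]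
    exact (Subspace.dual_finrank_eq (K := ℝ) (V := E)).symm
  let e := LinearEquiv.ofInjectiveOfFinrankEq (B : E →ₗ[ℝ] (E →L[ℝ] ℝ)) hinj hd
  refine ⟨e.toContinuousLinearEquiv, ?_⟩
  ext v w
  rfl

theorem inverse_apply_self {B : E →L[ℝ] E →L[ℝ] ℝ} (h : B.IsInvertible) (v : E) :
    B.inverse (B v) = v := by
  obtain ⟨e, rfl⟩ := h
  simp

theorem contDiffAt_inverse_apply {G : E → E →L[ℝ] E →L[ℝ] ℝ} {w : E → E →L[ℝ] ℝ} {x : E}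
    (hG : ContDiffAt ℝ ∞ G x) (hw : ContDiffAt ℝ ∞ w x) (h : (G x).IsInvertible) :
    ContDiffAt ℝ ∞ (fun y => (G y).inverse (w y)) x := by
  obtain ⟨e, he⟩ := h
  have hi : ContDiffAt ℝ ∞ ContinuousLinearMap.inverse (G x) := he ▸ contDiffAt_map_inverse e
  exact (hi.comp x hG).clm_apply hw

theorem isVonNBounded_of_pos {B : E →L[ℝ] E →L[ℝ] ℝ} (h : ∀ v, v ≠ 0 → 0 < B v v) :
    Bornology.IsVonNBounded ℝ {v | B v v < 1} := by
  have hc : Continuous fun v : E => B v v := B.continuous.clm_apply continuous_id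
  obtain ⟨c, hc0, hc⟩ := (isCompact_sphere (0 : E) 1).exists_forall_le' hc.continuousOn (a := 0)
    fun v hv => h v fun h0 => by simp [h0] at hv
  rw [NormedSpace.isVonNBounded_iff, isBounded_iff_forall_norm_le]
  refine ⟨Real.sqrt (1 / c), fun v hv => Real.le_sqrt_of_sq_le ?_⟩
  rcases eq_or_ne v 0 with rfl | hne
  · simp [hc0.le]
  · have h1 := hc (‖v‖⁻¹ • v) (by simp [norm_smul, hne])
    have hn : 0 < ‖v‖ := norm_pos_iff.2 hne
    simp only [map_smul, smul_apply, smul_eq_mul] at h1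
    have h2 : c * ‖v‖ ^ 2 ≤ B v v := by
      have := mul_le_mul_of_nonneg_right h1 (sq_nonneg ‖v‖)
      calc _ ≤ _ := this
        _ = B v v := by field_simp
    rw [le_div_iff₀ hc0]
    have h3 : B v v < 1 := hv
    linarith

theorem dChart_self (m : M) (u : TangentSpace 𝓘(ℝ, E) m) : dChart m m u = u := by
  have : IsManifold 𝓘(ℝ, E) 1 M := IsManifold.of_le (n := ∞) (by simp)
  rw [dChart, mfderiv_extChartAt_self]
  rfl

theorem smoothEnd_of_formOf (hg : SmoothTwo g) (hpos : ∀ m v, v ≠ 0 → 0 < g m v v)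
    (hω : SmoothTwo (formOf g J)) (hskew : ∀ m u v, formOf g J m u v = - formOf g J m v u)
    (hsymm : ∀ m u v, g m u v = g m v u) : SmoothEnd J := by
  intro m a
  set x := extChartAt 𝓘(ℝ, E) m m with hx
  let G := pullTwoL g (extChartAt 𝓘(ℝ, E) m).symm
  let W := pullTwoL (formOf g J) (extChartAt 𝓘(ℝ, E) m).symm
  have hinv : ∀ y ∈ (extChartAt 𝓘(ℝ, E) m).target, (G y).IsInvertible := by
    intro y hy
    refine isInvertible_of_pos fun v hv => ?_
    refine hpos ((extChartAt 𝓘(ℝ, E) m).symm y) (dChartSymm m y v) fun h0 => hv ?_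
    rw [← dChart_dChartSymm hy v, h0, map_zero]
  have hG : ContDiffAt ℝ ∞ G x := hg.contDiffAt_chart m
  have hW : ContDiffAt ℝ ∞ W x := hω.contDiffAt_chart m
  have h0 : ContDiffAt ℝ ∞ (fun y => - W y a) x := (hW.clm_apply contDiffAt_const).neg
  have h1 := contDiffAt_inverse_apply hG h0 (hinv x (mem_extChartAt_target m))
  refine h1.congr_of_eventuallyEq ?_
  filter_upwards [eventually_mem_target m] with y hy
  have h2 : - W y a = G y (endCoordL J m y a) := by
    ext b
    have h3 := pullTwo_formOf (g := g) (J := J) hy b a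
    have h4 : W y a b = - W y b a :=
      hskew ((extChartAt 𝓘(ℝ, E) m).symm y) (dChartSymm m y a) (dChartSymm m y b)
    have h5 : G y (endCoordL J m y a) b = G y b (endCoordL J m y a) :=
      hsymm ((extChartAt 𝓘(ℝ, E) m).symm y) (dChartSymm m y _) (dChartSymm m y b)
    rw [neg_apply, h4, neg_neg, h5]
    exact h3
  rw [h2, inverse_apply_self (hinv y hy)]
  rfl

variable (S : HyperkahlerStructure E M)

/-- The forms `ω_r` as fields of continuous bilinear forms. -/
def HyperkahlerStructure.omegaL (r : Fin 3) :
    (m : M) → TangentSpace 𝓘(ℝ, E) m →L[ℝ] TangentSpace 𝓘(ℝ, E) m →L[ℝ] ℝ :=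
  formOf S.metric.inner (S.J r)

theorem HyperkahlerStructure.omegaL_apply (r : Fin 3) (m : M) (u v : TangentSpace 𝓘(ℝ, E) m) :
    S.omegaL r m u v = S.omega r m u v := rfl

theorem HyperkahlerStructure.metric_J_right (r : Fin 3) (m : M) (u v : TangentSpace 𝓘(ℝ, E) m) :
    S.metric.inner m u (S.J r m v) = - S.metric.inner m (S.J r m u) v := by
  rw [← S.metric_J r m u, S.J_sq, map_neg]

theorem HyperkahlerStructure.omega_skew (r : Fin 3) (m : M) (u v : TangentSpace 𝓘(ℝ, E) m) :
    S.omega r m u v = - S.omega r m v u := by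
  rw [omega, S.metric_J_right, S.metric.symm]
  rfl

theorem HyperkahlerStructure.smoothTwo_metric : SmoothTwo S.metric.inner :=
  contMDiff_iff_smoothTwo.1 S.metric.contMDiff

theorem HyperkahlerStructure.smoothTwo_omegaL (r : Fin 3) : SmoothTwo (S.omegaL r) :=
  smoothTwo_formOf S.smoothTwo_metric (contMDiff_iff_smoothEnd.1 (S.contMDiff_J r))

/-- The forms of a hyperKähler structure are closed. -/
theorem HyperkahlerStructure.extDerivTwo_omegaL (r : Fin 3) (m : M)
    (u v w : TangentSpace 𝓘(ℝ, E) m) : extDerivTwo (S.omegaL r) m u v w = 0 := by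
  have hG : DifferentiableAt ℝ (pullTwoL S.metric.inner (extChartAt 𝓘(ℝ, E) m).symm)
      (extChartAt 𝓘(ℝ, E) m m) := (S.smoothTwo_metric.contDiffAt_chart m).differentiableAt (by simp)
  have hJ : DifferentiableAt ℝ (endCoordL (S.J r) m) (extChartAt 𝓘(ℝ, E) m m) :=
    ((contMDiff_iff_smoothEnd.1 (S.contMDiff_J r)).contDiffAt_chart m).differentiableAt (by simp)
  have h := flatNabla_cyclic hG hJ
    (Filter.Eventually.of_forall fun z b c => S.metric.symm _ _ _)
    ((eventually_mem_target m).mono fun y hy b c => by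
      rw [← pullTwo_formOf hy, ← pullTwo_formOf hy]
      exact S.omega_skew r _ _ _) (dChart m m u) (dChart m m v) (dChart m m w)
  rw [isParallel_iff.1 (S.parallel r), isParallel_iff.1 (S.parallel r),
    isParallel_iff.1 (S.parallel r)] at h
  rw [omegaL, extDerivTwo_formOf]
  linarith

/-- A hyperKähler structure from a metric and three anticommuting orthogonal complex structures
whose forms are smooth and closed. -/
def HyperkahlerStructure.ofForms
    (g : (m : M) → TangentSpace 𝓘(ℝ, E) m →L[ℝ] TangentSpace 𝓘(ℝ, E) m →L[ℝ] ℝ)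
    (J : Fin 3 → (m : M) → TangentSpace 𝓘(ℝ, E) m →L[ℝ] TangentSpace 𝓘(ℝ, E) m)
    (hsymm : ∀ m u v, g m u v = g m v u) (hpos : ∀ m v, v ≠ 0 → 0 < g m v v)
    (hg : SmoothTwo g) (hω : ∀ r, SmoothTwo (formOf g (J r)))
    (J_sq : ∀ r m u, J r m (J r m u) = -u) (J_mul : ∀ m u, J 0 m (J 1 m u) = J 2 m u)
    (J_mul_swap : ∀ m u, J 1 m (J 0 m u) = -J 2 m u)
    (metric_J : ∀ r m u v, g m (J r m u) (J r m v) = g m u v)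
    (hd : ∀ r m u v w, extDerivTwo (formOf g (J r)) m u v w = 0) : HyperkahlerStructure E M where
  metric :=
    { inner := g
      symm := hsymm
      pos := hpos
      isVonNBounded := fun m => isVonNBounded_of_pos (E := E) (B := g m) (hpos m)
      contMDiff := contMDiff_iff_smoothTwo.2 hg }
  J := J
  contMDiff_J := fun r => contMDiff_iff_smoothEnd.2 <| by
    have hskew : ∀ m u v, g m u (J r m v) = - g m v (J r m u) := fun m u v => by
      rw [← metric_J r m u, J_sq, map_neg, hsymm]
    exact smoothEnd_of_formOf hg hpos (hω r) hskew hsymm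
  J_sq := J_sq
  J_mul := J_mul
  J_mul_swap := J_mul_swap
  metric_J := metric_J
  parallel := fun r => by
    have hskew : ∀ r m u v, g m u (J r m v) = - g m v (J r m u) := fun r m u v => by
      rw [← metric_J r m u, J_sq, map_neg, hsymm]
    have hJ := fun r => smoothEnd_of_formOf hg hpos (hω r) (hskew r) hsymm
    rw [isParallel_iff]
    intro m a b c
    refine flatNabla_eq_zero (J := fun r => endCoordL (J r) m)
      ((hg.contDiffAt_chart m).differentiableAt (by simp))
      (fun r => ((hJ r).contDiffAt_chart m).differentiableAt (by simp))
      (Filter.Eventually.of_forall fun z b c => hsymm _ _ _) ?_ ?_ ?_ ?_ ?_ r a b c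
    · refine (eventually_mem_target m).mono fun y hy r b => ?_
      rw [endCoordL_comp hy, J_sq, map_neg, dChart_dChartSymm hy]
    · refine (eventually_mem_target m).mono fun y hy b => ?_
      rw [endCoordL_comp hy, J_mul]
      rfl
    · refine (eventually_mem_target m).mono fun y hy b => ?_
      rw [endCoordL_comp hy, J_mul_swap, map_neg]
      rfl
    · refine (eventually_mem_target m).mono fun y hy r b c => ?_
      rw [← pullTwo_formOf hy, ← pullTwo_formOf hy]
      exact hskew r _ _ _
    · intro r a b c
      have h : ∀ u v w : TangentSpace 𝓘(ℝ, E) m,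
          dTwo (fun y b c => pullTwoL g (extChartAt 𝓘(ℝ, E) m).symm y b (endCoordL (J r) m y c))
            (extChartAt 𝓘(ℝ, E) m m) u v w = 0 := by
        intro u v w
        have e := extDerivTwo_formOf (g := g) (J := J r) m u v w
        rw [hd, dChart_self, dChart_self, dChart_self] at e
        exact e.symm
      exact h a b c

end Forms

section InverseFunction

variable {V W : Type*} [NormedAddCommGroup V] [NormedSpace ℝ V] [FiniteDimensional ℝ V]
  [NormedAddCommGroup W] [NormedSpace ℝ W] [FiniteDimensional ℝ W]

/-- The inverse function theorem, with a smooth inverse on the whole target. -/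
theorem exists_openPartialHomeomorph_of_fderiv {f : V → W} {U : Set V} (hU : IsOpen U)
    (hf : ContDiffOn ℝ ∞ f U) {x : V} (hx : x ∈ U) (hb : Function.Bijective (fderiv ℝ f x)) :
    ∃ h : OpenPartialHomeomorph V W, x ∈ h.source ∧ h.source ⊆ U ∧ (h : V → W) = f ∧
      ContDiffOn ℝ ∞ h.symm h.target := by
  have : CompleteSpace V := FiniteDimensional.complete ℝ V
  let e : V ≃L[ℝ] W := (LinearEquiv.ofBijective (fderiv ℝ f x : V →ₗ[ℝ] W) hb).toContinuousLinearEquiv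
  have he : (e : V →L[ℝ] W) = fderiv ℝ f x := by ext v; rfl
  have hfx : ContDiffAt ℝ ∞ f x := hf.contDiffAt (hU.mem_nhds hx)
  have hd : HasFDerivAt f (e : V →L[ℝ] W) x := by
    rw [he]; exact (hfx.differentiableAt (by simp)).hasFDerivAt
  let h₀ := hfx.toOpenPartialHomeomorph f hd (by simp)
  let O : Set V := U ∩ fderiv ℝ f ⁻¹' (range ((↑) : (V ≃L[ℝ] W) → V →L[ℝ] W))
  have hO : IsOpen O :=
    (hf.continuousOn_fderiv_of_isOpen hU (by simp)).isOpen_inter_preimage hU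
      ContinuousLinearEquiv.isOpen
  refine ⟨h₀.restrOpen O hO, ?_, ?_, rfl, ?_⟩
  · exact ⟨hfx.mem_toOpenPartialHomeomorph_source hd (by simp), hx, e, he⟩
  · exact fun y hy => hy.2.1
  · intro y hy
    have hy' := (h₀.restrOpen O hO).map_target hy
    obtain ⟨hyU, e', he'⟩ := hy'.2
    have hfy : ContDiffAt ℝ ∞ f ((h₀.restrOpen O hO).symm y) := hf.contDiffAt (hU.mem_nhds hyU)
    refine ((h₀.restrOpen O hO).contDiffAt_symm (f₀' := e') hy ?_ hfy).contDiffWithinAt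
    rw [he']
    exact (hfy.differentiableAt (by simp)).hasFDerivAt

end InverseFunction

section ManifoldInverse

variable {V : Type*} [NormedAddCommGroup V] [NormedSpace ℝ V] [FiniteDimensional ℝ V]
  {H : Type*} [TopologicalSpace H] {I : ModelWithCorners ℝ V H} [I.Boundaryless]
  {Q : Type*} [TopologicalSpace Q] [ChartedSpace H Q] [IsManifold I ∞ Q]
  {V' : Type*} [NormedAddCommGroup V'] [NormedSpace ℝ V'] [FiniteDimensional ℝ V']
  {H' : Type*} [TopologicalSpace H'] {I' : ModelWithCorners ℝ V' H'} [I'.Boundaryless]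
  {Q' : Type*} [TopologicalSpace Q'] [ChartedSpace H' Q'] [IsManifold I' ∞ Q']

variable (I) in
/-- The preferred extended chart of a manifold without boundary, as a partial homeomorphism. -/
def extChartHomeomorph (q : Q) : OpenPartialHomeomorph Q V where
  toPartialEquiv := extChartAt I q
  open_source := isOpen_extChartAt_source q
  open_target := isOpen_extChartAt_target q
  continuousOn_toFun := continuousOn_extChartAt q
  continuousOn_invFun := continuousOn_extChartAt_symm q

theorem contMDiffAt_extChartAt_symm' {q : Q} {y : V} (hy : y ∈ (extChartAt I q).target) :
    ContMDiffAt 𝓘(ℝ, V) I ∞ (extChartAt I q).symm y :=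
  (contMDiffOn_extChartAt_symm q).contMDiffAt ((isOpen_extChartAt_target q).mem_nhds hy)

theorem hasMFDerivAt_extChartAt_symm_self (q : Q) :
    HasMFDerivAt 𝓘(ℝ, V) I (extChartAt I q).symm (extChartAt I q q)
      (ContinuousLinearMap.id ℝ V) := by
  have : IsManifold I 1 Q := IsManifold.of_le (n := ∞) (by simp)
  have h := (contMDiffAt_extChartAt_symm' (I := I) (mem_extChartAt_target q)).mdifferentiableAt
    (by simp)
  have h2 := mfderivWithin_range_extChartAt_symm (I := I) (x := q)
  rw [I.range_eq_univ, mfderivWithin_univ] at h2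
  have := h.hasMFDerivAt
  rw [h2] at this
  exact this

/-- The inverse function theorem on manifolds. -/
theorem exists_openPartialHomeomorph_of_mfderiv {f : Q → Q'} {U : Set Q} (hU : IsOpen U)
    (hf : ContMDiffOn I I' ∞ f U) {q : Q} (hq : q ∈ U)
    (hb : Function.Bijective (mfderiv I I' f q)) :
    ∃ h : OpenPartialHomeomorph Q Q', q ∈ h.source ∧ h.source ⊆ U ∧ EqOn h f h.source ∧
      ContMDiffOn I' I ∞ h.symm h.target := by
  let e := extChartHomeomorph I q
  let e' := extChartHomeomorph I' (f q)
  let O : Set Q := U ∩ f ⁻¹' e'.source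
  have hO : IsOpen O := hf.continuousOn.isOpen_inter_preimage hU e'.open_source
  let O' : Set V := e.target ∩ e.symm ⁻¹' O
  have hO' : IsOpen O' := e.symm.isOpen_inter_preimage hO
  have hqO : e q ∈ O' := by
    have : q ∈ e.source := mem_extChartAt_source q
    refine ⟨e.map_source this, ?_⟩
    change e.symm (e q) ∈ O
    rw [e.left_inv this]
    exact ⟨hq, mem_extChartAt_source (f q)⟩
  have hfO : ContDiffOn ℝ ∞ (e' ∘ f ∘ e.symm) O' := by
    rw [← contMDiffOn_iff_contDiffOn]
    refine (contMDiffOn_extChartAt (x := f q)).comp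
      (hf.comp ((contMDiffOn_extChartAt_symm q).mono inter_subset_left) ?_) ?_
    · exact fun y hy => hy.2.1
    · intro y hy
      have : f (e.symm y) ∈ (extChartAt I' (f q)).source := hy.2.2
      rwa [extChartAt_source] at this
  have hb' : Function.Bijective (fderiv ℝ (e' ∘ f ∘ e.symm) (e q)) := by
    have hmd : MDifferentiableAt I I' f q :=
      (hf.contMDiffAt (hU.mem_nhds hq)).mdifferentiableAt (by simp)
    have := hmd.mfderiv
    rw [I.range_eq_univ, fderivWithin_univ] at this
    rw [this] at hb
    exact hb
  obtain ⟨h, hqh, hhO, hhf, hhs⟩ := exists_openPartialHomeomorph_of_fderiv hO' hfO hqO hb'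
  refine ⟨(e.trans h).trans e'.symm, ?_, ?_, ?_, ?_⟩
  · refine ⟨⟨mem_extChartAt_source q, hqh⟩, ?_⟩
    change h (e q) ∈ e'.target
    rw [hhf]
    change e' (f (e.symm (e q))) ∈ e'.target
    exact e'.map_source (hhO hqh).2.2
  · intro z hz
    have hz1 : z ∈ e.source := hz.1.1
    have : e.symm (e z) ∈ U := (hhO hz.1.2).2.1
    rwa [e.left_inv hz1] at this
  · intro z hz
    have hz1 : z ∈ e.source := hz.1.1
    have h2 : f (e.symm (e z)) ∈ e'.source := (hhO hz.1.2).2.2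
    change e'.symm (h (e z)) = f z
    rw [hhf]
    change e'.symm (e' (f (e.symm (e z)))) = f z
    rw [e'.left_inv h2, e.left_inv hz1]
  · have hsub : ∀ z ∈ ((e.trans h).trans e'.symm).target, z ∈ e'.source ∧ e' z ∈ h.target ∧
        h.symm (e' z) ∈ e.target := by
      intro z hz
      exact ⟨hz.1, hz.2.1, hz.2.2⟩
    refine (contMDiffOn_extChartAt_symm q).comp (ContMDiffOn.comp (t := h.target)
      (contMDiffOn_iff_contDiffOn.2 hhs) ((contMDiffOn_extChartAt (x := f q)).mono ?_) ?_) ?_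
    · intro z hz
      have := (hsub z hz).1
      simpa [extChartAt_source] using (show z ∈ (extChartAt I' (f q)).source from this)
    · intro z hz
      exact (hsub z hz).2.1
    · intro z hz
      exact (hsub z hz).2.2

/-- A local parametrization that is affine in the preferred chart. -/
theorem exists_affine_plot (q : Q) (R : V' →L[ℝ] V) :
    ∃ (σ : V' → Q) (U : Set V'), IsOpen U ∧ (0 : V') ∈ U ∧ σ 0 = q ∧
      ContMDiffOn 𝓘(ℝ, V') I ∞ σ U ∧ HasMFDerivAt 𝓘(ℝ, V') I σ 0 R := by
  let c : V' → V := fun y => extChartAt I q q + R y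
  have hc : ContDiff ℝ ∞ c := contDiff_const.add R.contDiff
  have hc0 : c 0 = extChartAt I q q := by simp [c]
  have h1 := hasMFDerivAt_extChartAt_symm_self (I := I) q
  rw [← hc0] at h1
  have h2 : HasMFDerivAt 𝓘(ℝ, V') 𝓘(ℝ, V) c 0 R :=
    (R.hasFDerivAt.const_add _).hasMFDerivAt
  refine ⟨fun y => (extChartAt I q).symm (c y), c ⁻¹' (extChartAt I q).target,
    (isOpen_extChartAt_target q).preimage hc.continuous, ?_, ?_, ?_, HasMFDerivAt.comp 0 h1 h2⟩
  · change c 0 ∈ (extChartAt I q).target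
    rw [hc0]; exact mem_extChartAt_target q
  · simp only [hc0]; exact extChartAt_to_inv q
  · exact (contMDiffOn_extChartAt_symm q).comp hc.contMDiff.contMDiffOn (fun y hy => hy)

/-- A submersion has local sections. -/
theorem exists_local_section {f : Q → Q'} (hf : ContMDiff I I' ∞ f) (q : Q)
    (hs : Function.Surjective (mfderiv I I' f q)) :
    ∃ (s : Q' → Q) (O : Set Q'), IsOpen O ∧ f q ∈ O ∧ s (f q) = q ∧ ContMDiffOn I' I ∞ s O ∧
      ∀ n ∈ O, f (s n) = n := by
  obtain ⟨R, hR⟩ := (mfderiv I I' f q : V →L[ℝ] V').toLinearMap.exists_rightInverse_of_surjective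
    (LinearMap.range_eq_top.2 hs)
  let R' : V' →L[ℝ] V := LinearMap.toContinuousLinearMap R
  have hR' : ∀ y, (mfderiv I I' f q : V →L[ℝ] V') (R' y) = y := fun y => LinearMap.congr_fun hR y
  obtain ⟨σ, U, hU, h0, hσ0, hσ, hdσ⟩ := exists_affine_plot (I := I) q R'
  have hfσ : ContMDiffOn 𝓘(ℝ, V') I' ∞ (f ∘ σ) U := hf.comp_contMDiffOn hσ
  have hb : Function.Bijective (mfderiv 𝓘(ℝ, V') I' (f ∘ σ) 0) := by
    have h1 : HasMFDerivAt I I' f (σ 0) (mfderiv I I' f (σ 0)) :=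
      ((hf (σ 0)).mdifferentiableAt (by simp)).hasMFDerivAt
    have h2 := HasMFDerivAt.comp 0 h1 hdσ
    rw [h2.mfderiv]
    have : ∀ y : V', ((mfderiv I I' f (σ 0)).comp R' : V' →L[ℝ] V') y = y := by
      rw [hσ0]; exact hR'
    refine ⟨fun a b hab => ?_, fun b => ⟨b, this b⟩⟩
    exact (this a).symm.trans (Eq.trans hab (this b))
  obtain ⟨h, hh0, hhU, hhf, hhs⟩ := exists_openPartialHomeomorph_of_mfderiv hU hfσ h0 hb
  have hq : h 0 = f q := by rw [hhf hh0]; simp [hσ0]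
  have hqt : f q ∈ h.target := hq ▸ h.map_source hh0
  have hsq : h.symm (f q) = 0 := by rw [← hq]; exact h.left_inv hh0
  refine ⟨fun n => σ (h.symm n), h.target, h.open_target, hqt, by simp only [hsq, hσ0],
    ContMDiffOn.comp (g := σ) hσ hhs fun n hn => hhU (h.map_target hn), fun n hn => ?_⟩
  have := hhf (h.map_target hn)
  rw [h.right_inv hn] at this
  exact this.symm

end ManifoldInverse

section CircleFlow

variable {V : Type*} [NormedAddCommGroup V] [NormedSpace ℝ V]
  {H : Type*} [TopologicalSpace H]

/-- A smooth action of the circle on a manifold with an arbitrary model. -/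
structure CircleFlow (I : ModelWithCorners ℝ V H) (Q : Type*) [TopologicalSpace Q]
    [ChartedSpace H Q] where
  act : Circle → Q → Q
  one_act : ∀ q, act 1 q = q
  mul_act : ∀ z z' q, act (z * z') q = act z (act z' q)
  contMDiff_act : ContMDiff ((𝓡 1).prod I) I ∞ (fun z : Circle × Q => act z.1 z.2)

namespace CircleFlow

variable {I : ModelWithCorners ℝ V H} {Q : Type*} [TopologicalSpace Q] [ChartedSpace H Q]
  (A : CircleFlow I Q)

/-- The vector field that generates the action. -/
def gen (q : Q) : TangentSpace I q :=
  mfderiv 𝓘(ℝ, ℝ) I (fun t : ℝ => A.act (Circle.exp t) q) 0 (1 : ℝ)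

theorem inv_act (z : Circle) (q : Q) : A.act z⁻¹ (A.act z q) = q := by
  rw [← A.mul_act, inv_mul_cancel, A.one_act]

theorem contMDiff_act_left (z : Circle) : ContMDiff I I ∞ (A.act z) :=
  A.contMDiff_act.comp (contMDiff_const.prodMk contMDiff_id)

theorem contMDiff_orbit (q : Q) :
    ContMDiff 𝓘(ℝ, ℝ) I ∞ (fun t : ℝ => A.act (Circle.exp t) q) :=
  A.contMDiff_act.comp (contMDiff_circleExp.prodMk contMDiff_const)

theorem continuous_act : Continuous (fun z : Circle × Q => A.act z.1 z.2) :=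
  A.contMDiff_act.continuous

theorem hasMFDerivAt_orbit (q : Q) (t : ℝ) :
    HasMFDerivAt 𝓘(ℝ, ℝ) I (fun t : ℝ => A.act (Circle.exp t) q) t
      ((mfderiv I I (A.act (Circle.exp t)) q).comp
        (ContinuousLinearMap.toSpanSingleton ℝ (A.gen q))) := by
  have h0 : HasMFDerivAt 𝓘(ℝ, ℝ) I (fun s : ℝ => A.act (Circle.exp s) q) (t - t)
      (ContinuousLinearMap.toSpanSingleton ℝ (A.gen q)) := by
    rw [sub_self]
    have := ((A.contMDiff_orbit q 0).mdifferentiableAt (by simp)).hasMFDerivAt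
    refine this.congr_mfderiv ?_
    refine ContinuousLinearMap.ext_ring ?_
    exact (one_smul ℝ (A.gen q)).symm
  have h1 : HasMFDerivAt 𝓘(ℝ, ℝ) 𝓘(ℝ, ℝ) (fun s : ℝ => s - t) t (ContinuousLinearMap.id ℝ ℝ) :=
    ((hasFDerivAt_id t).sub_const t).hasMFDerivAt
  have h2 := HasMFDerivAt.comp (f := fun s : ℝ => s - t) t h0 h1
  have h3 : HasMFDerivAt I I (A.act (Circle.exp t)) (A.act (Circle.exp (t - t)) q)
      (mfderiv I I (A.act (Circle.exp t)) q) := by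
    have : A.act (Circle.exp (t - t)) q = q := by simp [A.one_act]
    rw [this]
    exact ((A.contMDiff_act_left (Circle.exp t) q).mdifferentiableAt (by simp)).hasMFDerivAt
  have h4 := HasMFDerivAt.comp t h3 h2
  refine h4.congr_of_eventuallyEq (Eventually.of_forall fun s => ?_)
  simp only [Function.comp_apply]
  rw [← A.mul_act, ← Circle.exp_add]
  congr 2
  ring_nf

end CircleFlow

/-- A differentiable curve with vanishing velocity is constant. -/
theorem eq_of_mfderiv_eq_zero {I : ModelWithCorners ℝ V H} {Q : Type*} [TopologicalSpace Q]
    [ChartedSpace H Q] [IsManifold I ∞ Q] [T2Space Q] {γ : ℝ → Q}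
    (hγ : ∀ t, HasMFDerivAt 𝓘(ℝ, ℝ) I γ t 0) (t : ℝ) : γ t = γ 0 := by
  have : IsManifold I 1 Q := IsManifold.of_le (n := ∞) (by simp)
  have hcont : Continuous γ := continuous_iff_continuousAt.2 fun t => (hγ t).continuousAt
  have hclopen : IsClopen {t | γ t = γ 0} := by
    refine ⟨isClosed_eq hcont continuous_const, isOpen_iff_mem_nhds.2 fun s hs => ?_⟩
    have hO : γ ⁻¹' (chartAt H (γ s)).source ∈ 𝓝 s :=
      hcont.continuousAt.preimage_mem_nhds (chart_source_mem_nhds H (γ s))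
    obtain ⟨ε, hε, hb⟩ := Metric.mem_nhds_iff.1 hO
    refine Filter.mem_of_superset (Metric.ball_mem_nhds s hε) fun r hr => ?_
    have hd : ∀ r ∈ Metric.ball s ε, HasFDerivAt (extChartAt I (γ s) ∘ γ) (0 : ℝ →L[ℝ] V) r := by
      intro r hr
      have := hasMFDerivAt_iff_hasFDerivAt.1
        (HasMFDerivAt.comp r (hasMFDerivAt_extChartAt (I := I) (hb hr)) (hγ r))
      exact this.congr_fderiv (ContinuousLinearMap.comp_zero _)
    have heq := (convex_ball s ε).is_const_of_fderivWithin_eq_zero (𝕜 := ℝ)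
      (fun r hr => (hd r hr).differentiableAt.differentiableWithinAt)
      (fun r hr => by
        rw [fderivWithin_of_isOpen Metric.isOpen_ball hr, (hd r hr).fderiv])
      hr (Metric.mem_ball_self hε)
    have h1 : γ r = γ s := (extChartAt I (γ s)).injOn (by rw [extChartAt_source]; exact hb hr)
      (mem_extChartAt_source (γ s)) heq
    exact h1.trans hs
  have := hclopen.eq_univ ⟨0, rfl⟩
  exact this.ge (mem_univ t)

end CircleFlow

section Slices

theorem exists_prod_equiv {V X : Type*} [NormedAddCommGroup V] [NormedSpace ℝ V]
    [FiniteDimensional ℝ V] [NormedAddCommGroup X] [NormedSpace ℝ X] [FiniteDimensional ℝ X]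
    (hX : Module.finrank ℝ X + 1 = Module.finrank ℝ V) {g : V} (hg : g ≠ 0) :
    ∃ Λ : (ℝ × X) ≃L[ℝ] V, Λ (1, 0) = g := by
  obtain ⟨C, hC⟩ := Submodule.exists_isCompl (ℝ ∙ g)
  have hd : Module.finrank ℝ X = Module.finrank ℝ C := by
    have h1 := Submodule.finrank_add_eq_of_isCompl hC
    rw [finrank_span_singleton hg] at h1
    omega
  let e1 : ℝ ≃ₗ[ℝ] (ℝ ∙ g) := LinearEquiv.toSpanNonzeroSingleton ℝ V g hg
  let e2 : X ≃ₗ[ℝ] C := LinearEquiv.ofFinrankEq X C hd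
  let e : (ℝ × X) ≃ₗ[ℝ] V := (e1.prodCongr e2).trans (Submodule.prodEquivOfIsCompl _ _ hC)
  refine ⟨e.toContinuousLinearEquiv, ?_⟩
  change e (1, 0) = g
  simp [e, e1]

variable {V : Type*} [NormedAddCommGroup V] [NormedSpace ℝ V] [FiniteDimensional ℝ V]
  {H : Type*} [TopologicalSpace H] {I : ModelWithCorners ℝ V H} [I.Boundaryless]
  {Q : Type*} [TopologicalSpace Q] [ChartedSpace H Q] [IsManifold I ∞ Q] [T2Space Q]
  {X : Type*} [NormedAddCommGroup X] [NormedSpace ℝ X] [FiniteDimensional ℝ X]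
  (A : CircleFlow I Q)

theorem CircleFlow.act_eq_of_gen_eq_zero {q : Q} (hq : A.gen q = 0) (z : Circle) :
    A.act z q = q := by
  obtain ⟨t, rfl⟩ := Circle.exp_surjective z
  have := eq_of_mfderiv_eq_zero (I := I) (γ := fun t : ℝ => A.act (Circle.exp t) q) (fun t => by
    refine (A.hasMFDerivAt_orbit q t).congr_mfderiv ?_
    rw [hq]
    refine ContinuousLinearMap.ext_ring ?_
    exact (congrArg (mfderiv I I (A.act (Circle.exp t)) q) (smul_zero (1 : ℝ))).trans
      (map_zero _)) t
  simpa [A.one_act] using this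

theorem CircleFlow.gen_ne_zero {q : Q} (hfree : ∀ z, A.act z q = q → z = 1) : A.gen q ≠ 0 := by
  intro hq
  have h := hfree _ (A.act_eq_of_gen_eq_zero hq (Circle.exp Real.pi))
  have h2 := congrArg (fun z : Circle => (z : ℂ)) h
  simp only [Circle.coe_exp, Complex.exp_pi_mul_I, Circle.coe_one] at h2
  norm_num at h2

theorem CircleFlow.contMDiffOn_exp_act {W : Type*} [NormedAddCommGroup W] [NormedSpace ℝ W]
    {τ : W → ℝ} {σ : W → Q} {U : Set W} (hτ : ContMDiffOn 𝓘(ℝ, W) 𝓘(ℝ, ℝ) ∞ τ U)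
    (hσ : ContMDiffOn 𝓘(ℝ, W) I ∞ σ U) :
    ContMDiffOn 𝓘(ℝ, W) I ∞ (fun p => A.act (Circle.exp (τ p)) (σ p)) U := by
  have h1 : ContMDiffOn 𝓘(ℝ, W) (𝓡 1) ∞ (fun p => Circle.exp (τ p)) U :=
    ContMDiff.comp_contMDiffOn (g := Circle.exp) contMDiff_circleExp hτ
  exact ContMDiff.comp_contMDiffOn (g := fun z : Circle × Q => A.act z.1 z.2) A.contMDiff_act
    (h1.prodMk hσ)

/-- A local slice for a free circle action through `q₀`. -/
theorem CircleFlow.exists_slice (hfree : ∀ z q, A.act z q = q → z = 1)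
    (hX : Module.finrank ℝ X + 1 = Module.finrank ℝ V) (q₀ : Q) :
    ∃ (σ : X → Q) (B : Set X) (f : Q → X) (O : Set Q), IsOpen B ∧ (0 : X) ∈ B ∧ σ 0 = q₀ ∧
      IsOpen O ∧ ContMDiffOn 𝓘(ℝ, X) I ∞ σ B ∧ ContMDiffOn I 𝓘(ℝ, X) ∞ f O ∧
      (∀ x ∈ B, σ x ∈ O ∧ f (σ x) = x) ∧
      (∀ q ∈ O, f q ∈ B ∧ ∃ z, A.act z (σ (f q)) = q) ∧
      ∀ x ∈ B, ∀ x' ∈ B, ∀ z, A.act z (σ x) = σ x' → x = x' := by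
  obtain ⟨Λ, hΛ⟩ := exists_prod_equiv (X := X) hX (A.gen_ne_zero (fun z => hfree z q₀))
  let R : X →L[ℝ] V := (Λ : ℝ × X →L[ℝ] V).comp (ContinuousLinearMap.inr ℝ ℝ X)
  obtain ⟨σ, U, hU, h0, hσ0, hσ, hdσ⟩ := exists_affine_plot (I := I) q₀ R
  let Θ : ℝ × X → Q := fun p => A.act (Circle.exp p.1) (σ p.2)
  let U' : Set (ℝ × X) := Prod.snd ⁻¹' U
  have hU' : IsOpen U' := hU.preimage continuous_snd
  have hΘ : ContMDiffOn 𝓘(ℝ, ℝ × X) I ∞ Θ U' := by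
    have h1 : ContMDiff 𝓘(ℝ, ℝ × X) 𝓘(ℝ, ℝ) ∞ (Prod.fst : ℝ × X → ℝ) := contDiff_fst.contMDiff
    have h2 : ContMDiff 𝓘(ℝ, ℝ × X) 𝓘(ℝ, X) ∞ (Prod.snd : ℝ × X → X) := contDiff_snd.contMDiff
    have h3 : ContMDiffOn 𝓘(ℝ, ℝ × X) I ∞ (fun p : ℝ × X => σ p.2) U' :=
      ContMDiffOn.comp (g := σ) hσ h2.contMDiffOn (fun p hp => hp)
    exact A.contMDiffOn_exp_act h1.contMDiffOn h3
  have h00 : ((0 : ℝ), (0 : X)) ∈ U' := h0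
  have hΘ0 : Θ (0, 0) = q₀ := by simp [Θ, hσ0, A.one_act]
  have hdΘ := ((hΘ.contMDiffAt (hU'.mem_nhds h00)).mdifferentiableAt (by simp)).hasMFDerivAt
  have hb : Function.Bijective (mfderiv 𝓘(ℝ, ℝ × X) I Θ (0, 0)) := by
    set D : ℝ × X →L[ℝ] V := mfderiv 𝓘(ℝ, ℝ × X) I Θ (0, 0) with hD
    have e1 : D.comp (ContinuousLinearMap.inl ℝ ℝ X)
        = ContinuousLinearMap.toSpanSingleton ℝ (A.gen q₀ : V) := by
      have h1 : HasMFDerivAt 𝓘(ℝ, ℝ) 𝓘(ℝ, ℝ × X) (fun t : ℝ => (t, (0 : X))) 0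
          (ContinuousLinearMap.inl ℝ ℝ X) :=
        (ContinuousLinearMap.inl ℝ ℝ X).hasFDerivAt.hasMFDerivAt
      have h2 := HasMFDerivAt.comp (0 : ℝ) hdΘ h1
      have h3 := (A.contMDiff_orbit q₀ 0).mdifferentiableAt (by simp) |>.hasMFDerivAt
      have h4 : (Θ ∘ fun t : ℝ => (t, (0 : X))) = fun t : ℝ => A.act (Circle.exp t) q₀ := by
        funext t; simp [Θ, hσ0]
      rw [h4] at h2
      refine (hasMFDerivAt_unique h2 h3).trans ?_
      refine ContinuousLinearMap.ext_ring ?_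
      exact (one_smul ℝ (A.gen q₀)).symm
    have e2 : D.comp (ContinuousLinearMap.inr ℝ ℝ X) = R := by
      have h1 : HasMFDerivAt 𝓘(ℝ, X) 𝓘(ℝ, ℝ × X) (fun x : X => ((0 : ℝ), x)) 0
          (ContinuousLinearMap.inr ℝ ℝ X) :=
        (ContinuousLinearMap.inr ℝ ℝ X).hasFDerivAt.hasMFDerivAt
      have h2 := HasMFDerivAt.comp (0 : X) hdΘ h1
      have h4 : (Θ ∘ fun x : X => ((0 : ℝ), x)) = σ := by
        funext t; simp [Θ, A.one_act]
      rw [h4] at h2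
      exact hasMFDerivAt_unique h2 hdσ
    have e3 : D = Λ := by
      refine ContinuousLinearMap.ext fun p => ?_
      have hp : p = (p.1 • ((1 : ℝ), (0 : X))) + (0, p.2) := by ext <;> simp
      have f1 : D (1, 0) = Λ (1, 0) := by
        rw [hΛ]
        exact (DFunLike.congr_fun e1 (1 : ℝ)).trans (one_smul ℝ (A.gen q₀ : V))
      have f2 : D (0, p.2) = Λ (0, p.2) := DFunLike.congr_fun e2 p.2
      rw [hp, map_add, map_smul, f1, f2]
      exact ((Λ : ℝ × X →L[ℝ] V).map_add _ _ |>.trans (by rw [map_smul]; rfl)).symm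
    rw [e3]
    exact Λ.bijective
  obtain ⟨h, hh0, hhU, hhf, hhs⟩ := exists_openPartialHomeomorph_of_mfderiv hU' hΘ h00 hb
  -- a product neighbourhood in the source
  have hsrc : h.source ∈ 𝓝 ((0 : ℝ), (0 : X)) := h.open_source.mem_nhds hh0
  rw [nhds_prod_eq, Filter.mem_prod_iff] at hsrc
  obtain ⟨T, hT, B₁, hB₁, hTB⟩ := hsrc
  obtain ⟨δ, hδ, hδT⟩ := Metric.mem_nhds_iff.1 hT
  let C : Set ℝ := Icc (-Real.pi) Real.pi \ Metric.ball 0 δ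
  have hC : IsCompact C := isCompact_Icc.diff Metric.isOpen_ball
  have hσc : ContinuousAt σ 0 := (hσ.contMDiffAt (hU.mem_nhds h0)).continuousAt
  have hcomp : ∀ᶠ p : X × X in 𝓝 (0, 0), ∀ t ∈ C, A.act (Circle.exp t) (σ p.1) ≠ σ p.2 := by
    refine hC.eventually_forall_of_forall_eventually fun t ht => ?_
    have hne : A.act (Circle.exp t) (σ 0) ≠ σ 0 := by
      intro h
      have h1 := hfree _ _ h
      obtain ⟨m, hm⟩ := Circle.exp_eq_exp.1 (h1.trans Circle.exp_zero.symm)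
      rw [zero_add] at hm
      have hpi := Real.pi_pos
      have hm0 : m = 0 := by
        have h3 : (m : ℝ) < 1 := by
          by_contra h4
          nlinarith [ht.1.2]
        have h4 : (-1 : ℝ) < m := by
          by_contra h4
          nlinarith [ht.1.1]
        have h3' : m < 1 := by exact_mod_cast h3
        have h4' : -1 < m := by exact_mod_cast h4
        omega
      refine ht.2 ?_
      rw [hm, hm0]
      simpa using hδ
    have hc1 : ContinuousAt (fun p : (X × X) × ℝ => A.act (Circle.exp p.2) (σ p.1.1)) ((0, 0), t) := by
      have e1 : ContinuousAt (fun p : (X × X) × ℝ => (Circle.exp p.2, σ p.1.1)) ((0, 0), t) :=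
        ContinuousAt.prodMk (by fun_prop) (ContinuousAt.comp (g := σ) (f := fun p : (X × X) × ℝ => p.1.1) hσc (by fun_prop))
      exact ContinuousAt.comp (g := fun z : Circle × Q => A.act z.1 z.2) A.continuous_act.continuousAt e1
    have hc2 : ContinuousAt (fun p : (X × X) × ℝ => σ p.1.2) ((0, 0), t) :=
      ContinuousAt.comp (g := σ) (f := fun p : (X × X) × ℝ => p.1.2) hσc (by fun_prop)
    exact (hc1.ne_iff_eventually_ne hc2).1 hne
  rw [nhds_prod_eq] at hcomp
  obtain ⟨B₂, hB₂, hcomp⟩ := (Filter.eventually_prod_self_iff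
    (r := fun x x' => ∀ t ∈ C, A.act (Circle.exp t) (σ x) ≠ σ x')).1 hcomp
  obtain ⟨B, hBsub, hBo, hB0⟩ := mem_nhds_iff.1 (Filter.inter_mem hB₁ hB₂)
  have hsrcB : ∀ t ∈ Metric.ball (0 : ℝ) δ, ∀ x ∈ B, (t, x) ∈ h.source := fun t ht x hx =>
    hTB ⟨hδT ht, (hBsub hx).1⟩
  have hball : (0 : ℝ) ∈ Metric.ball (0 : ℝ) δ := Metric.mem_ball_self hδ
  have hhσ : ∀ x ∈ B, h (0, x) = σ x := fun x hx => by
    rw [hhf (hsrcB 0 hball x hx)]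
    simp [Θ, A.one_act]
  have hO : IsOpen (h.target ∩ h.symm ⁻¹' (Prod.snd ⁻¹' B)) :=
    h.symm.isOpen_inter_preimage (hBo.preimage continuous_snd)
  refine ⟨σ, B, fun q => (h.symm q).2, h.target ∩ h.symm ⁻¹' (Prod.snd ⁻¹' B), hBo, hB0, hσ0, hO,
    hσ.mono fun x hx => hhU (hsrcB 0 hball x hx), ?_, ?_, ?_, ?_⟩
  · exact (contDiff_snd.contMDiff (n := ∞)).comp_contMDiffOn (hhs.mono inter_subset_left)
  · intro x hx
    have h1 := hsrcB 0 hball x hx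
    have h2 : h.symm (σ x) = (0, x) := by rw [← hhσ x hx]; exact h.left_inv h1
    refine ⟨⟨?_, ?_⟩, congrArg Prod.snd h2⟩
    · rw [← hhσ x hx]; exact h.map_source h1
    · change (h.symm (σ x)).2 ∈ B
      rw [h2]; exact hx
  · intro q hq
    refine ⟨hq.2, Circle.exp (h.symm q).1, ?_⟩
    have h1 := hhf (h.map_target hq.1)
    rw [h.right_inv hq.1] at h1
    exact h1.symm
  · intro x hx x' hx' z hz
    have hz' : Circle.exp (Complex.arg z) = z := Circle.exp_arg z
    have hmem : Complex.arg z ∈ Icc (-Real.pi) Real.pi :=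
      ⟨(Complex.neg_pi_lt_arg _).le, Complex.arg_le_pi _⟩
    by_cases ht : Complex.arg z ∈ Metric.ball (0 : ℝ) δ
    · have h1 := hsrcB _ ht x hx
      have h2 := hsrcB 0 hball x' hx'
      have h3 : h (Complex.arg z, x) = h (0, x') := by
        rw [hhf h1, hhσ x' hx', ← hz]
        simp only [Θ, hz']
      exact congrArg Prod.snd (h.injOn h1 h2 h3)
    · have h1 := hcomp x (hBsub hx).2 x' (hBsub hx').2 (Complex.arg z) ⟨hmem, ht⟩
      rw [hz'] at h1
      exact absurd hz h1

end Slices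

section QuotientManifold

variable {V : Type*} [NormedAddCommGroup V] [NormedSpace ℝ V] [FiniteDimensional ℝ V]
  {H : Type*} [TopologicalSpace H] {I : ModelWithCorners ℝ V H} [I.Boundaryless]
  {Q : Type*} [TopologicalSpace Q] [ChartedSpace H Q] [IsManifold I ∞ Q]
  {X : Type*} [NormedAddCommGroup X] [NormedSpace ℝ X] [FiniteDimensional ℝ X]
  (A : CircleFlow I Q) {s : Setoid Q}

theorem CircleFlow.isOpenMap_mk (hs : ∀ q q', Quotient.mk s q = Quotient.mk s q' ↔
    ∃ z, A.act z q = q') : IsOpenMap (Quotient.mk s) := by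
  intro O hO
  rw [← isQuotientMap_quotient_mk'.isOpen_preimage]
  have : Quotient.mk s ⁻¹' (Quotient.mk s '' O) = ⋃ z, A.act z ⁻¹' O := by
    ext q
    simp only [mem_preimage, mem_image, mem_iUnion]
    constructor
    · rintro ⟨q', hq', h⟩
      obtain ⟨z, rfl⟩ := (hs _ _).1 h.symm
      exact ⟨z, hq'⟩
    · rintro ⟨z, hz⟩
      exact ⟨_, hz, ((hs _ _).2 ⟨z, rfl⟩).symm⟩
  change IsOpen (Quotient.mk s ⁻¹' (Quotient.mk s '' O))
  rw [this]
  exact isOpen_iUnion fun z => hO.preimage (A.contMDiff_act_left z).continuous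

theorem CircleFlow.t2Space_quotient [T2Space Q] (hs : ∀ q q', Quotient.mk s q = Quotient.mk s q' ↔
    ∃ z, A.act z q = q') : T2Space (Quotient s) := by
  have h0 : IsOpenQuotientMap (Quotient.mk s) :=
    ⟨Quotient.mk_surjective, continuous_quotient_mk', A.isOpenMap_mk hs⟩
  rw [t2Space_iff_of_isOpenQuotientMap h0]
  have h1 : IsClosed {p : Circle × (Q × Q) | A.act p.1 p.2.1 = p.2.2} :=
    isClosed_eq (A.continuous_act.comp (f := fun p : Circle × (Q × Q) => (p.1, p.2.1))
      (by fun_prop)) (by fun_prop)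
  have h2 := isClosedMap_snd_of_compactSpace (X := Circle) (Y := Q × Q) _ h1
  convert h2 using 1
  ext p
  simp [hs]

variable (X) in
/-- A chart of the quotient by a circle action that comes from a local slice `σ`. -/
structure SliceChart (I : ModelWithCorners ℝ V H) (s : Setoid Q) where
  chart : OpenPartialHomeomorph (Quotient s) X
  σ : X → Q
  contMDiffOn_σ : ContMDiffOn 𝓘(ℝ, X) I ∞ σ chart.target
  symm_eq : ∀ x ∈ chart.target, chart.symm x = Quotient.mk s (σ x)
  contMDiffOn_chart : ContMDiffOn I 𝓘(ℝ, X) ∞ (fun q => chart (Quotient.mk s q))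
    (Quotient.mk s ⁻¹' chart.source)

theorem CircleFlow.exists_sliceChart [T2Space Q] (hs : ∀ q q', Quotient.mk s q = Quotient.mk s q' ↔
    ∃ z, A.act z q = q') (hfree : ∀ z q, A.act z q = q → z = 1)
    (hX : Module.finrank ℝ X + 1 = Module.finrank ℝ V) (n : Quotient s) :
    ∃ c : SliceChart X I s, n ∈ c.chart.source := by
  obtain ⟨q₀, rfl⟩ := Quotient.mk_surjective n
  obtain ⟨σ, B, f, O, hB, hB0, hσ0, hO, hσ, hf, hσf, hfσ, hinj⟩ := A.exists_slice hfree hX q₀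
  have hmk : ∀ q ∈ O, Quotient.mk s (σ (f q)) = Quotient.mk s q := fun q hq =>
    (hs _ _).2 (hfσ q hq).2
  have hinjOn : InjOn (fun x => Quotient.mk s (σ x)) B := by
    intro x hx x' hx' h
    obtain ⟨z, hz⟩ := (hs _ _).1 h
    exact hinj x hx x' hx' z hz
  let e₀ : PartialEquiv X (Quotient s) := hinjOn.toPartialEquiv _ _
  have hopen : IsOpenMap (e₀.source.domRestrict e₀) := by
    intro u hu
    obtain ⟨w, hw, rfl⟩ := isOpen_induced_iff.1 hu
    have : e₀.source.domRestrict e₀ '' (Subtype.val ⁻¹' w) = Quotient.mk s '' (O ∩ f ⁻¹' w) := by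
      ext n
      constructor
      · rintro ⟨⟨x, hx⟩, hxw, rfl⟩
        refine ⟨σ x, ⟨(hσf x hx).1, ?_⟩, rfl⟩
        change f (σ x) ∈ w
        rw [(hσf x hx).2]
        exact hxw
      · rintro ⟨q, ⟨hqO, hqw⟩, rfl⟩
        exact ⟨⟨f q, (hfσ q hqO).1⟩, hqw, hmk q hqO⟩
    rw [this]
    exact A.isOpenMap_mk hs _ (hf.continuousOn.isOpen_inter_preimage hO hw)
  let e := OpenPartialHomeomorph.ofContinuousOpenRestrict e₀
    (continuous_quotient_mk'.comp_continuousOn hσ.continuousOn) hopen hB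
  have hef : ∀ q ∈ O, Quotient.mk s q ∈ e.target ∧ e.symm (Quotient.mk s q) = f q := by
    intro q hq
    have h1 : e (f q) = Quotient.mk s q := hmk q hq
    have h2 : f q ∈ e.source := (hfσ q hq).1
    rw [← h1]
    exact ⟨e.map_source h2, e.left_inv h2⟩
  refine ⟨⟨e.symm, σ, hσ, fun x hx => rfl, ?_⟩, ?_⟩
  · intro q hq
    obtain ⟨x, hx, hxq⟩ : ∃ x ∈ B, Quotient.mk s (σ x) = Quotient.mk s q := hq
    obtain ⟨z, hz⟩ := (hs _ _).1 hxq.symm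
    have hqO : A.act z q ∈ O := by rw [hz]; exact (hσf x hx).1
    have hfz : ContMDiffAt I 𝓘(ℝ, X) ∞ (fun q' => f (A.act z q')) q :=
      ContMDiffAt.comp (g := f) (f := A.act z) q (hf.contMDiffAt (hO.mem_nhds hqO))
        (A.contMDiff_act_left z q)
    refine ContMDiffAt.contMDiffWithinAt (hfz.congr_of_eventuallyEq ?_)
    have hev : ∀ᶠ q' in 𝓝 q, A.act z q' ∈ O :=
      (A.contMDiff_act_left z).continuous.continuousAt.preimage_mem_nhds (hO.mem_nhds hqO)
    filter_upwards [hev] with q' hq'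
    have h1 : Quotient.mk s q' = Quotient.mk s (A.act z q') := (hs _ _).2 ⟨z, rfl⟩
    rw [h1]
    exact (hef _ hq').2
  · have := (hef (σ 0) (hσf 0 hB0).1).1
    rw [hσ0] at this
    exact this

/-- The quotient of a manifold by a free circle action is a manifold. -/
theorem CircleFlow.exists_quotient_manifold [T2Space Q]
    (hs : ∀ q q', Quotient.mk s q = Quotient.mk s q' ↔ ∃ z, A.act z q = q')
    (hfree : ∀ z q, A.act z q = q → z = 1)
    (hX : Module.finrank ℝ X + 1 = Module.finrank ℝ V) :
    ∃ (_ : ChartedSpace X (Quotient s)), IsManifold 𝓘(ℝ, X) ∞ (Quotient s) ∧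
      ContMDiff I 𝓘(ℝ, X) ∞ (Quotient.mk s) ∧
      ∀ q, Function.Surjective (mfderiv I 𝓘(ℝ, X) (Quotient.mk s) q) := by
  choose c hc using A.exists_sliceChart (X := X) hs hfree hX
  let cs : ChartedSpace X (Quotient s) :=
    { atlas := range fun n => (c n).chart
      chartAt := fun n => (c n).chart
      mem_chart_source := hc
      chart_mem_atlas := fun n => mem_range_self n }
  have hman : IsManifold 𝓘(ℝ, X) ∞ (Quotient s) := by
    refine isManifold_of_contDiffOn 𝓘(ℝ, X) ∞ (Quotient s) ?_
    rintro _ _ ⟨n, rfl⟩ ⟨n', rfl⟩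
    simp only [modelWithCornersSelf_coe, modelWithCornersSelf_coe_symm, Function.comp_id,
      Function.id_comp, range_id, inter_univ, preimage_id]
    rw [← contMDiffOn_iff_contDiffOn]
    have h1 : ContMDiffOn 𝓘(ℝ, X) 𝓘(ℝ, X) ∞
        (fun x => (c n').chart (Quotient.mk s ((c n).σ x)))
        ((c n).chart.symm ≫ₕ (c n').chart).source := by
      refine ContMDiffOn.comp (g := fun q => (c n').chart (Quotient.mk s q))
        (c n').contMDiffOn_chart ((c n).contMDiffOn_σ.mono fun x hx => hx.1) ?_
      intro x hx
      have h2 := hx.2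
      change (c n).chart.symm x ∈ (c n').chart.source at h2
      rwa [(c n).symm_eq x hx.1] at h2
    refine h1.congr fun x hx => ?_
    change (c n').chart ((c n).chart.symm x) = _
    rw [(c n).symm_eq x hx.1]
  have hmk : ContMDiff I 𝓘(ℝ, X) ∞ (Quotient.mk s) := by
    intro q
    rw [contMDiffAt_iff_target]
    refine ⟨continuous_quotient_mk'.continuousAt, ?_⟩
    exact (c (Quotient.mk s q)).contMDiffOn_chart.contMDiffAt
      (((c (Quotient.mk s q)).chart.open_source.preimage continuous_quotient_mk').mem_nhds
        (hc (Quotient.mk s q)))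
  refine ⟨cs, hman, hmk, fun q => ?_⟩
  set n := Quotient.mk s q with hn
  let e := (c n).chart
  have hen : e n ∈ e.target := e.map_source (hc n)
  have he : ContMDiffAt 𝓘(ℝ, X) 𝓘(ℝ, X) ∞ e n :=
    contMDiffAt_extChartAt (I := 𝓘(ℝ, X)) (x := n)
  have hmkσ : ∀ n' ∈ e.source, Quotient.mk s ((c n).σ (e n')) = n' := fun n' hn' => by
    rw [← (c n).symm_eq _ (e.map_source hn')]
    exact e.left_inv hn'
  obtain ⟨z, hz⟩ := (hs _ _).1 (hmkσ n (hc n))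
  let sec : Quotient s → Q := fun n' => A.act z ((c n).σ (e n'))
  have hsec : ContMDiffAt 𝓘(ℝ, X) I ∞ sec n := by
    refine ContMDiffAt.comp (g := A.act z) n (A.contMDiff_act_left z _) ?_
    exact ContMDiffAt.comp (g := (c n).σ) n
      ((c n).contMDiffOn_σ.contMDiffAt (e.open_target.mem_nhds hen)) he
  have hsq : sec n = q := hz
  have hev : (fun n' => Quotient.mk s (sec n')) =ᶠ[𝓝 n] id := by
    filter_upwards [e.open_source.mem_nhds (hc n)] with n' hn'
    refine Eq.trans ?_ (hmkσ n' hn')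
    exact ((hs _ _).2 ⟨z, rfl⟩).symm
  have h1 : HasMFDerivAt I 𝓘(ℝ, X) (Quotient.mk s) (sec n)
      (mfderiv I 𝓘(ℝ, X) (Quotient.mk s) q) := by
    rw [hsq]; exact ((hmk q).mdifferentiableAt (by simp)).hasMFDerivAt
  have h2 := HasMFDerivAt.comp n h1 (hsec.mdifferentiableAt (by simp)).hasMFDerivAt
  have h3 := h2.congr_of_eventuallyEq hev.symm
  have h4 := hasMFDerivAt_unique h3 (hasMFDerivAt_id n)
  intro b
  refine ⟨mfderiv 𝓘(ℝ, X) I sec n b, ?_⟩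
  exact DFunLike.congr_fun h4 b

theorem CircleFlow.mfderiv_gen {V' : Type*} [NormedAddCommGroup V'] [NormedSpace ℝ V']
    {H' : Type*} [TopologicalSpace H'] {I' : ModelWithCorners ℝ V' H'}
    {N : Type*} [TopologicalSpace N] [ChartedSpace H' N] {f : Q → N} (q : Q)
    (hf : MDifferentiableAt I I' f q) (hinv : ∀ z, f (A.act z q) = f q) :
    mfderiv I I' f q (A.gen q) = 0 := by
  have h1 : HasMFDerivAt I I' f (A.act (Circle.exp 0) q) (mfderiv I I' f q) := by
    rw [Circle.exp_zero, A.one_act]; exact hf.hasMFDerivAt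
  have h2 := HasMFDerivAt.comp (0 : ℝ) h1
    ((A.contMDiff_orbit q 0).mdifferentiableAt (by simp)).hasMFDerivAt
  have h3 : (f ∘ fun t : ℝ => A.act (Circle.exp t) q) = fun _ => f q := by
    funext t; exact hinv _
  rw [h3] at h2
  exact DFunLike.congr_fun (hasMFDerivAt_unique h2 (hasMFDerivAt_const (f q) (0 : ℝ))) (1 : ℝ)

/-- The kernel of the differential of a submersion whose fibres are circle orbits is spanned by
the generator of the action. -/
theorem CircleFlow.exists_smul_gen [T2Space Q] (hfree : ∀ z q, A.act z q = q → z = 1)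
    {V' : Type*} [NormedAddCommGroup V'] [NormedSpace ℝ V'] [FiniteDimensional ℝ V']
    {N : Type*} [TopologicalSpace N] [ChartedSpace V' N] [IsManifold 𝓘(ℝ, V') ∞ N] {f : Q → N}
    (hf : ContMDiff I 𝓘(ℝ, V') ∞ f) (hfib : ∀ q q', f q = f q' → ∃ z, A.act z q = q') (q : Q)
    (hsurj : Function.Surjective (mfderiv I 𝓘(ℝ, V') f q))
    (a : TangentSpace I q) (ha : mfderiv I 𝓘(ℝ, V') f q a = 0) : ∃ r : ℝ, a = r • A.gen q := by
  let s : Setoid Q :=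
    { r := fun q q' => ∃ z, A.act z q = q'
      iseqv := ⟨fun q => ⟨1, A.one_act q⟩, fun ⟨z, hz⟩ => ⟨z⁻¹, by rw [← hz, A.inv_act]⟩,
        fun ⟨z, hz⟩ ⟨z', hz'⟩ => ⟨z' * z, by rw [A.mul_act, hz, hz']⟩⟩ }
  have hs : ∀ q q', Quotient.mk s q = Quotient.mk s q' ↔ ∃ z, A.act z q = q' :=
    fun q q' => Quotient.eq
  have hg : A.gen q ≠ 0 := A.gen_ne_zero fun z => hfree z q
  have hpos : 0 < Module.finrank ℝ V := by
    have : Nontrivial V := ⟨(A.gen q : V), 0, hg⟩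
    exact Module.finrank_pos
  let X := EuclideanSpace ℝ (Fin (Module.finrank ℝ V - 1))
  have hX : Module.finrank ℝ X + 1 = Module.finrank ℝ V := by
    rw [finrank_euclideanSpace_fin]; omega
  obtain ⟨cs, hman, hmk, hsub⟩ := A.exists_quotient_manifold (X := X) hs hfree hX
  obtain ⟨sec, O, hO, hqO, hsq, hsecO, hev⟩ := exists_local_section hf q hsurj
  have hsec := hsecO.contMDiffAt (hO.mem_nhds hqO)
  let D : V →ₗ[ℝ] X := (mfderiv I 𝓘(ℝ, X) (Quotient.mk s) q : V →L[ℝ] X).toLinearMap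
  have hDa : D a = 0 := by
    have h0 := ((hf q).mdifferentiableAt (by simp)).hasMFDerivAt
    have h1 := HasMFDerivAt.comp q (hsec.mdifferentiableAt (by simp)).hasMFDerivAt h0
    have h2 : HasMFDerivAt I 𝓘(ℝ, X) (Quotient.mk s) ((sec ∘ f) q)
        (mfderiv I 𝓘(ℝ, X) (Quotient.mk s) ((sec ∘ f) q)) :=
      ((hmk _).mdifferentiableAt (by simp)).hasMFDerivAt
    have h3 := HasMFDerivAt.comp q h2 h1
    have h4 : (Quotient.mk s ∘ sec ∘ f) =ᶠ[𝓝 q] Quotient.mk s := by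
      filter_upwards [hf.continuous.continuousAt.eventually (hO.mem_nhds hqO)] with q' hq'
      exact (hs _ _).2 (hfib _ _ (hev _ hq'))
    have h5 := hasMFDerivAt_unique (h3.congr_of_eventuallyEq h4.symm)
      ((hmk q).mdifferentiableAt (by simp)).hasMFDerivAt
    refine (DFunLike.congr_fun h5 a).symm.trans ?_
    have h6 : (mfderiv 𝓘(ℝ, V') I sec (f q)) (mfderiv I 𝓘(ℝ, V') f q a) = 0 := by
      rw [ha]; exact map_zero _
    exact (congrArg (mfderiv I 𝓘(ℝ, X) (Quotient.mk s) ((sec ∘ f) q)) h6).trans (map_zero _)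
  have hDg : D (A.gen q) = 0 := A.mfderiv_gen q ((hmk q).mdifferentiableAt (by simp))
    fun z => ((hs _ _).2 ⟨z, rfl⟩).symm
  have hker : Module.finrank ℝ (LinearMap.ker D) = 1 := by
    have h1 := D.finrank_range_add_finrank_ker
    have h2 : LinearMap.range D = ⊤ := LinearMap.range_eq_top.2 (hsub q)
    rw [h2, finrank_top] at h1
    omega
  have hspan := (finrank_eq_one_iff_of_nonzero' (⟨A.gen q, hDg⟩ : LinearMap.ker D)
    (fun h => hg (congrArg Subtype.val h))).1 hker ⟨a, hDa⟩
  obtain ⟨r, hr⟩ := hspan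
  exact ⟨r, (congrArg Subtype.val hr).symm⟩

end QuotientManifold

section LevelSet

theorem exists_equiv_prod_of_surjective {E W X : Type*} [NormedAddCommGroup E] [NormedSpace ℝ E]
    [FiniteDimensional ℝ E] [NormedAddCommGroup W] [NormedSpace ℝ W] [FiniteDimensional ℝ W]
    [NormedAddCommGroup X] [NormedSpace ℝ X] [FiniteDimensional ℝ X]
    (hX : Module.finrank ℝ X + Module.finrank ℝ W = Module.finrank ℝ E) (D : E →L[ℝ] W)
    (hD : Function.Surjective D) : ∃ Λ : E ≃L[ℝ] W × X, ∀ u, (Λ u).1 = D u := by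
  obtain ⟨C, hC⟩ := Submodule.exists_isCompl (LinearMap.ker (D : E →ₗ[ℝ] W))
  have hr : LinearMap.range (D : E →ₗ[ℝ] W) = ⊤ := LinearMap.range_eq_top.2 hD
  have hd : Module.finrank ℝ (LinearMap.ker (D : E →ₗ[ℝ] W)) = Module.finrank ℝ X := by
    have h1 := (D : E →ₗ[ℝ] W).finrank_range_add_finrank_ker
    rw [hr, finrank_top] at h1
    omega
  let e2 := LinearEquiv.ofFinrankEq (LinearMap.ker (D : E →ₗ[ℝ] W)) X hd
  let e1 := LinearMap.equivProdOfSurjectiveOfIsCompl (D : E →ₗ[ℝ] W)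
    (Submodule.projectionOnto _ C hC) hr (Submodule.range_projectionOnto hC)
    (by rw [Submodule.ker_projectionOnto]; exact hC)
  let e := e1.trans ((LinearEquiv.refl ℝ W).prodCongr e2)
  exact ⟨e.toContinuousLinearEquiv, fun u => rfl⟩

variable {E : Type*} [NormedAddCommGroup E] [NormedSpace ℝ E] [FiniteDimensional ℝ E]
  {M : Type*} [TopologicalSpace M] [ChartedSpace E M] [IsManifold 𝓘(ℝ, E) ∞ M]
  {W : Type*} [NormedAddCommGroup W] [NormedSpace ℝ W] [FiniteDimensional ℝ W]
  {X : Type*} [NormedAddCommGroup X] [NormedSpace ℝ X] [FiniteDimensional ℝ X]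
  {f : M → W} {c : W} {p : M → Prop}

theorem hasMFDerivAt_clm_extChartAt (m : M) (R : E →L[ℝ] X) :
    HasMFDerivAt 𝓘(ℝ, E) 𝓘(ℝ, X) (fun m' => R (extChartAt 𝓘(ℝ, E) m m')) m R := by
  have : IsManifold 𝓘(ℝ, E) 1 M := IsManifold.of_le (n := ∞) (by simp)
  have h2 : HasMFDerivAt 𝓘(ℝ, E) 𝓘(ℝ, E) (extChartAt 𝓘(ℝ, E) m) m
      (ContinuousLinearMap.id ℝ E) := by
    have := (mdifferentiableAt_extChartAt (I := 𝓘(ℝ, E)) (mem_chart_source E m)).hasMFDerivAt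
    rw [mfderiv_extChartAt_self] at this
    exact this
  exact HasMFDerivAt.comp m (R.hasFDerivAt.hasMFDerivAt) h2

variable (X p) in
/-- A chart of a level set `{m // p m}` in `M`, with a smooth extension `ext` and a smooth
inverse `par` as a map to `M`. -/
structure LevelChart (E : Type*) [NormedAddCommGroup E] [NormedSpace ℝ E] [ChartedSpace E M] where
  chart : OpenPartialHomeomorph {m // p m} X
  ext : M → X
  par : X → M
  dom : Set M
  isOpen_dom : IsOpen dom
  source_eq : chart.source = Subtype.val ⁻¹' dom
  contMDiffOn_ext : ContMDiffOn 𝓘(ℝ, E) 𝓘(ℝ, X) ∞ ext dom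
  contMDiffOn_par : ContMDiffOn 𝓘(ℝ, X) 𝓘(ℝ, E) ∞ par chart.target
  chart_eq : ∀ m ∈ chart.source, chart m = ext m
  par_eq : ∀ x ∈ chart.target, (chart.symm x : M) = par x

theorem exists_levelChart (hf : ContMDiff 𝓘(ℝ, E) 𝓘(ℝ, W) ∞ f) (hp : ∀ m, p m ↔ f m = c)
    (hX : Module.finrank ℝ X + Module.finrank ℝ W = Module.finrank ℝ E) (m₀ : {m // p m})
    (hsurj : Function.Surjective (mfderiv 𝓘(ℝ, E) 𝓘(ℝ, W) f m₀)) :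
    ∃ e : LevelChart (M := M) X p E, m₀ ∈ e.chart.source := by
  have : IsManifold 𝓘(ℝ, E) 1 M := IsManifold.of_le (n := ∞) (by simp)
  obtain ⟨Λ, hΛ⟩ := exists_equiv_prod_of_surjective (X := X) hX
    (mfderiv 𝓘(ℝ, E) 𝓘(ℝ, W) f m₀ : E →L[ℝ] W) hsurj
  let R : E →L[ℝ] X := (ContinuousLinearMap.snd ℝ W X).comp (Λ : E →L[ℝ] W × X)
  let Φ : M → W × X := fun m => (f m, R (extChartAt 𝓘(ℝ, E) (m₀ : M) m))
  let U : Set M := (chartAt E (m₀ : M)).source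
  have hU : IsOpen U := (chartAt E (m₀ : M)).open_source
  have h0 : (m₀ : M) ∈ U := mem_chart_source E (m₀ : M)
  have hΦ : ContMDiffOn 𝓘(ℝ, E) 𝓘(ℝ, W × X) ∞ Φ U :=
    hf.contMDiffOn.prodMk_space (R.contDiff.contMDiff.comp_contMDiffOn
      (contMDiffOn_extChartAt (x := (m₀ : M))))
  have hb : Function.Bijective (mfderiv 𝓘(ℝ, E) 𝓘(ℝ, W × X) Φ m₀) := by
    have h1 : HasMFDerivAt 𝓘(ℝ, E) 𝓘(ℝ, W) f m₀ (mfderiv 𝓘(ℝ, E) 𝓘(ℝ, W) f m₀) :=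
      ((hf m₀).mdifferentiableAt (by simp)).hasMFDerivAt
    have h3 := hasMFDerivAt_clm_extChartAt (m₀ : M) R
    have h4 := ((hΦ.contMDiffAt (hU.mem_nhds h0)).mdifferentiableAt (by simp)).hasMFDerivAt
    have h5 : HasMFDerivAt 𝓘(ℝ, W × X) 𝓘(ℝ, W) Prod.fst (Φ m₀) (ContinuousLinearMap.fst ℝ W X) :=
      hasFDerivAt_fst.hasMFDerivAt
    have h6 : HasMFDerivAt 𝓘(ℝ, W × X) 𝓘(ℝ, X) Prod.snd (Φ m₀) (ContinuousLinearMap.snd ℝ W X) :=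
      hasFDerivAt_snd.hasMFDerivAt
    have h7 := hasMFDerivAt_unique (HasMFDerivAt.comp (m₀ : M) h5 h4) h1
    have h8 := hasMFDerivAt_unique (HasMFDerivAt.comp (m₀ : M) h6 h4) h3
    let D : E →L[ℝ] W × X := mfderiv 𝓘(ℝ, E) 𝓘(ℝ, W × X) Φ m₀
    have h9 : D = (Λ : E →L[ℝ] W × X) := by
      refine ContinuousLinearMap.ext fun u => Prod.ext ?_ ?_
      · exact (DFunLike.congr_fun h7 u).trans (hΛ u).symm
      · exact DFunLike.congr_fun h8 u
    exact (congrArg (fun L : E →L[ℝ] W × X => Function.Bijective L) h9).mpr Λ.bijective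
  obtain ⟨h, hh0, hhU, hhf, hhs⟩ := exists_openPartialHomeomorph_of_mfderiv hU hΦ h0 hb
  have hcx : Continuous fun x : X => (c, x) := by fun_prop
  have hfst : ∀ m ∈ h.source, (h m).1 = f m := fun m hm => by rw [hhf hm]
  have hpt : ∀ x : X, (c, x) ∈ h.target → p (h.symm (c, x)) := fun x hx => by
    rw [hp, ← hfst _ (h.map_target hx), h.right_inv hx]
  have hval : ∀ m ∈ h.source, p m → h m = (c, (h m).2) := fun m hm hpm =>
    Prod.ext ((hfst m hm).trans ((hp m).1 hpm)) rfl
  classical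
  let inv : X → {m // p m} := fun x => if hx : p (h.symm (c, x)) then ⟨_, hx⟩ else m₀
  have hinv : ∀ x : X, (c, x) ∈ h.target → (inv x : M) = h.symm (c, x) := fun x hx => by
    simp only [inv, dif_pos (hpt x hx)]
  let e : OpenPartialHomeomorph {m // p m} X :=
    { toFun := fun m => (h m).2
      invFun := inv
      source := Subtype.val ⁻¹' h.source
      target := (fun x : X => (c, x)) ⁻¹' h.target
      map_source' := fun m hm => by
        change (c, (h m).2) ∈ h.target
        rw [← hval m hm m.2]; exact h.map_source hm
      map_target' := fun x hx => by
        change (inv x : M) ∈ h.source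
        rw [hinv x hx]; exact h.map_target hx
      left_inv' := fun m hm => by
        have h1 : (c, (h m).2) ∈ h.target := by rw [← hval m hm m.2]; exact h.map_source hm
        refine Subtype.ext ?_
        rw [hinv _ h1, ← hval m hm m.2, h.left_inv hm]
      right_inv' := fun x hx => by
        rw [hinv x hx, h.right_inv hx]
      open_source := h.open_source.preimage continuous_subtype_val
      open_target := h.open_target.preimage hcx
      continuousOn_toFun := continuous_snd.comp_continuousOn
        (h.continuousOn.comp continuous_subtype_val.continuousOn fun m hm => hm)
      continuousOn_invFun := by
        refine (Topology.IsInducing.subtypeVal (t := {m | p m})).continuousOn_iff.2 ?_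
        refine ContinuousOn.congr (f := fun x => h.symm (c, x)) ?_ fun x hx => hinv x hx
        exact h.continuousOn_symm.comp hcx.continuousOn fun x hx => hx }
  refine ⟨⟨e, fun m => (h m).2, fun x => h.symm (c, x), h.source, h.open_source, rfl, ?_, ?_,
    fun m hm => rfl, fun x hx => hinv x hx⟩, hh0⟩
  · have h1 : ContMDiff 𝓘(ℝ, W × X) 𝓘(ℝ, X) ∞ (Prod.snd : W × X → X) := contDiff_snd.contMDiff
    exact h1.comp_contMDiffOn ((hΦ.mono hhU).congr hhf)
  · have h1 : ContMDiff 𝓘(ℝ, X) 𝓘(ℝ, W × X) ∞ (fun x : X => (c, x)) :=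
      (contDiff_const.prodMk contDiff_id).contMDiff
    exact hhs.comp h1.contMDiffOn fun x hx => hx

/-- A regular level set is a submanifold, with local smooth retractions. -/
theorem exists_level_manifold (hf : ContMDiff 𝓘(ℝ, E) 𝓘(ℝ, W) ∞ f) (hp : ∀ m, p m ↔ f m = c)
    (hX : (∃ m, p m) → Module.finrank ℝ X + Module.finrank ℝ W = Module.finrank ℝ E)
    (hsurj : ∀ m, p m → Function.Surjective (mfderiv 𝓘(ℝ, E) 𝓘(ℝ, W) f m)) :
    ∃ (_ : ChartedSpace X {m // p m}), IsManifold 𝓘(ℝ, X) ∞ {m // p m} ∧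
      ContMDiff 𝓘(ℝ, X) 𝓘(ℝ, E) ∞ (Subtype.val : {m // p m} → M) ∧
      (∀ m : {m // p m}, ∃ r : M → {m // p m}, ContMDiffAt 𝓘(ℝ, E) 𝓘(ℝ, X) ∞ r m ∧
        ∀ᶠ m' : {m // p m} in 𝓝 m, r (m' : M) = m') ∧
      ∀ m : {m // p m}, Function.Injective
        (mfderiv 𝓘(ℝ, X) 𝓘(ℝ, E) (Subtype.val : {m // p m} → M) m) ∧
        ∀ u : TangentSpace 𝓘(ℝ, E) (m : M), mfderiv 𝓘(ℝ, E) 𝓘(ℝ, W) f m u = 0 →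
          ∃ a, mfderiv 𝓘(ℝ, X) 𝓘(ℝ, E) (Subtype.val : {m // p m} → M) m a = u := by
  choose e he using fun m : {m // p m} =>
    exists_levelChart (X := X) hf hp (hX ⟨m, m.2⟩) m (hsurj m m.2)
  let cs : ChartedSpace X {m // p m} :=
    { atlas := range fun n => (e n).chart
      chartAt := fun n => (e n).chart
      mem_chart_source := he
      chart_mem_atlas := fun n => mem_range_self n }
  have hdom : ∀ n m, m ∈ (e n).chart.source ↔ (m : M) ∈ (e n).dom := fun n m => by
    rw [(e n).source_eq]; rfl
  have hman : IsManifold 𝓘(ℝ, X) ∞ {m // p m} := by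
    refine isManifold_of_contDiffOn 𝓘(ℝ, X) ∞ {m // p m} ?_
    rintro _ _ ⟨n, rfl⟩ ⟨n', rfl⟩
    simp only [modelWithCornersSelf_coe, modelWithCornersSelf_coe_symm, Function.comp_id,
      Function.id_comp, range_id, inter_univ, preimage_id]
    rw [← contMDiffOn_iff_contDiffOn]
    have hmem : ∀ x ∈ ((e n).chart.symm ≫ₕ (e n').chart).source,
        (e n).par x ∈ (e n').dom := by
      intro x hx
      rw [← (e n).par_eq x hx.1, ← hdom]
      exact hx.2
    have h1 : ContMDiffOn 𝓘(ℝ, X) 𝓘(ℝ, X) ∞ (fun x => (e n').ext ((e n).par x))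
        ((e n).chart.symm ≫ₕ (e n').chart).source :=
      ContMDiffOn.comp (g := (e n').ext) (e n').contMDiffOn_ext
        ((e n).contMDiffOn_par.mono fun x hx => hx.1) hmem
    refine h1.congr fun x hx => ?_
    refine ((e n').chart_eq _ hx.2).trans ?_
    exact congrArg (e n').ext ((e n).par_eq x hx.1)
  have hchart : ∀ m : {m // p m}, ContMDiffAt 𝓘(ℝ, X) 𝓘(ℝ, X) ∞ (e m).chart m := fun m =>
    contMDiffAt_extChartAt (I := 𝓘(ℝ, X)) (x := m)
  have htgt : ∀ m : {m // p m}, (e m).chart m ∈ (e m).chart.target := fun m =>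
    (e m).chart.map_source (he m)
  have hvale : ∀ m : {m // p m}, ∀ m' ∈ (e m).chart.source, (m' : M) = (e m).par ((e m).chart m') :=
    fun m m' hm' => by
      rw [← (e m).par_eq _ ((e m).chart.map_source hm'), (e m).chart.left_inv hm']
  have hval : ContMDiff 𝓘(ℝ, X) 𝓘(ℝ, E) ∞ (Subtype.val : {m // p m} → M) := by
    intro m
    have h1 : ContMDiffAt 𝓘(ℝ, X) 𝓘(ℝ, E) ∞ (fun m' => (e m).par ((e m).chart m')) m :=
      ContMDiffAt.comp (g := (e m).par) m
        ((e m).contMDiffOn_par.contMDiffAt ((e m).chart.open_target.mem_nhds (htgt m))) (hchart m)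
    refine h1.congr_of_eventuallyEq ?_
    filter_upwards [(e m).chart.open_source.mem_nhds (he m)] with m' hm'
    exact hvale m m' hm'
  have hretr : ∀ m : {m // p m}, ∃ r : M → {m // p m}, ContMDiffAt 𝓘(ℝ, E) 𝓘(ℝ, X) ∞ r m ∧
        ∀ᶠ m' : {m // p m} in 𝓝 m, r (m' : M) = m' := by
    intro m
    have h1 : (e m).ext (m : M) = (e m).chart m := ((e m).chart_eq m (he m)).symm
    have h2 : ContMDiffAt 𝓘(ℝ, X) 𝓘(ℝ, X) ∞ (e m).chart.symm ((e m).chart m) :=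
      contMDiffAt_extChartAt_symm' (I := 𝓘(ℝ, X)) (q := m) (mem_extChartAt_target m)
    refine ⟨fun m' => (e m).chart.symm ((e m).ext m'), ?_, ?_⟩
    · refine ContMDiffAt.comp (g := (e m).chart.symm) (m : M) ?_
        ((e m).contMDiffOn_ext.contMDiffAt ((e m).isOpen_dom.mem_nhds ((hdom m m).1 (he m))))
      rw [h1]; exact h2
    · filter_upwards [(e m).chart.open_source.mem_nhds (he m)] with m' hm'
      rw [← (e m).chart_eq m' hm', (e m).chart.left_inv hm']
  refine ⟨cs, hman, hval, hretr, fun m => ?_⟩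
  have hdv : HasMFDerivAt 𝓘(ℝ, X) 𝓘(ℝ, E) (Subtype.val : {m // p m} → M) m
      (mfderiv 𝓘(ℝ, X) 𝓘(ℝ, E) Subtype.val m) := ((hval m).mdifferentiableAt (by simp)).hasMFDerivAt
  have hinj : Function.Injective
      (mfderiv 𝓘(ℝ, X) 𝓘(ℝ, E) (Subtype.val : {m // p m} → M) m) := by
    obtain ⟨r, hr, hev⟩ := hretr m
    have h1 := HasMFDerivAt.comp m (hr.mdifferentiableAt (by simp)).hasMFDerivAt hdv
    have h2 := hasMFDerivAt_unique (h1.congr_of_eventuallyEq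
      (show id =ᶠ[𝓝 m] r ∘ Subtype.val from hev.mono fun m' h => h.symm)) (hasMFDerivAt_id m)
    intro a b hab
    have ha := DFunLike.congr_fun h2 a
    have hb := DFunLike.congr_fun h2 b
    exact ha.symm.trans ((congrArg (mfderiv 𝓘(ℝ, E) 𝓘(ℝ, X) r (m : M)) hab).trans hb)
  refine ⟨hinj, fun u hu => ?_⟩
  let D : E →ₗ[ℝ] W := (mfderiv 𝓘(ℝ, E) 𝓘(ℝ, W) f m : E →L[ℝ] W).toLinearMap
  let J : X →ₗ[ℝ] E := (mfderiv 𝓘(ℝ, X) 𝓘(ℝ, E) (Subtype.val : {m // p m} → M) m : X →L[ℝ] E).toLinearMap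
  have hDJ : LinearMap.range J ≤ LinearMap.ker D := by
    rintro _ ⟨a, rfl⟩
    have h1 := HasMFDerivAt.comp m ((hf m).mdifferentiableAt (by simp)).hasMFDerivAt hdv
    have h2 : (f ∘ (Subtype.val : {m // p m} → M)) = fun _ => c := by
      funext m'; exact (hp m').1 m'.2
    rw [h2] at h1
    exact DFunLike.congr_fun (hasMFDerivAt_unique h1 (hasMFDerivAt_const c m)) a
  have hdim : Module.finrank ℝ (LinearMap.range J) = Module.finrank ℝ (LinearMap.ker D) := by
    have h1 := D.finrank_range_add_finrank_ker
    have h2 : LinearMap.range D = ⊤ := LinearMap.range_eq_top.2 (hsurj m m.2)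
    rw [h2, finrank_top] at h1
    have h3 := LinearMap.finrank_range_of_inj (f := J) hinj
    have h4 := hX ⟨m, m.2⟩
    omega
  have heq := Submodule.eq_of_le_of_finrank_eq hDJ hdim
  have hmem : u ∈ LinearMap.ker D := hu
  rw [← heq] at hmem
  exact hmem

/-- A map to a level set with local smooth retractions is smooth if it is smooth as a map to the
ambient manifold. -/
theorem contMDiff_of_val {V : Type*} [NormedAddCommGroup V] [NormedSpace ℝ V]
    {H : Type*} [TopologicalSpace H] {I : ModelWithCorners ℝ V H}
    {Q : Type*} [TopologicalSpace Q] [ChartedSpace H Q] [ChartedSpace X {m // p m}]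
    (hretr : ∀ m : {m // p m}, ∃ r : M → {m // p m}, ContMDiffAt 𝓘(ℝ, E) 𝓘(ℝ, X) ∞ r m ∧
        ∀ᶠ m' : {m // p m} in 𝓝 m, r (m' : M) = m') {φ : Q → {m // p m}}
    (hφ : ContMDiff I 𝓘(ℝ, E) ∞ fun q => (φ q : M)) : ContMDiff I 𝓘(ℝ, X) ∞ φ := by
  intro q
  obtain ⟨r, hr, hev⟩ := hretr (φ q)
  have hc : Continuous φ := Topology.IsInducing.subtypeVal.continuous_iff.2 hφ.continuous
  refine (ContMDiffAt.comp (g := r) q hr (hφ q)).congr_of_eventuallyEq ?_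
  filter_upwards [hc.continuousAt.eventually hev] with q' hq'
  exact hq'.symm

end LevelSet

section Descent

variable {V : Type*} [NormedAddCommGroup V] [NormedSpace ℝ V] [FiniteDimensional ℝ V]
  {H : Type*} [TopologicalSpace H] {I : ModelWithCorners ℝ V H} [I.Boundaryless]
  {Q : Type*} [TopologicalSpace Q] [ChartedSpace H Q] [IsManifold I ∞ Q]
  {E' : Type*} [NormedAddCommGroup E'] [NormedSpace ℝ E'] [FiniteDimensional ℝ E']
  {N : Type*} [TopologicalSpace N] [ChartedSpace E' N] [IsManifold 𝓘(ℝ, E') ∞ N] {q : Q → N}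
  {V' : Type*} [NormedAddCommGroup V'] [NormedSpace ℝ V']

/-- A smooth plot of the base of a submersion lifts locally. -/
theorem exists_lift_plot (hq : ContMDiff I 𝓘(ℝ, E') ∞ q) (z : Q)
    (hsub : Function.Surjective (mfderiv I 𝓘(ℝ, E') q z)) {φ : V' → N} {u : V'} (hu : q z = φ u)
    (hφ : ∀ᶠ y in 𝓝 u, ContMDiffAt 𝓘(ℝ, V') 𝓘(ℝ, E') ∞ φ y) :
    ∃ Z : V' → Q, Z u = z ∧ ∀ᶠ y in 𝓝 u, ContMDiffAt 𝓘(ℝ, V') I ∞ Z y ∧ q (Z y) = φ y ∧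
      ∀ a, ((mfderiv I 𝓘(ℝ, E') q (Z y) : V →L[ℝ] E') ((mfderiv 𝓘(ℝ, V') I Z y : V' →L[ℝ] V) a))
        = (mfderiv 𝓘(ℝ, V') 𝓘(ℝ, E') φ y : V' →L[ℝ] E') a := by
  obtain ⟨s, O, hO, hzO, hsz, hs, hqs⟩ := exists_local_section hq z hsub
  have hev : ∀ᶠ y in 𝓝 u, φ y ∈ O := by
    rw [hu] at hzO
    exact hφ.self_of_nhds.continuousAt.preimage_mem_nhds (hO.mem_nhds hzO)
  refine ⟨fun y => s (φ y), by simp only [← hu, hsz], ?_⟩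
  filter_upwards [hev, hφ, hev.eventually_nhds] with y hy hφy hy'
  have hZ : ContMDiffAt 𝓘(ℝ, V') I ∞ (fun y => s (φ y)) y :=
    ContMDiffAt.comp (g := s) y (hs.contMDiffAt (hO.mem_nhds hy)) hφy
  refine ⟨hZ, hqs _ hy, fun a => ?_⟩
  have h1 := HasMFDerivAt.comp y ((hq (s (φ y))).mdifferentiableAt (by simp)).hasMFDerivAt
    (hZ.mdifferentiableAt (by simp)).hasMFDerivAt
  have h2 := h1.congr_of_eventuallyEq
    (show φ =ᶠ[𝓝 y] q ∘ fun y => s (φ y) from hy'.mono fun y' h => (hqs _ h).symm)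
  exact (DFunLike.congr_fun (hasMFDerivAt_unique h2
    (hφy.mdifferentiableAt (by simp)).hasMFDerivAt) a)

theorem eventually_contMDiffAt_extChartAt_symm (n : N) :
    ∀ᶠ y in 𝓝 (extChartAt 𝓘(ℝ, E') n n),
      ContMDiffAt 𝓘(ℝ, E') 𝓘(ℝ, E') ∞ (extChartAt 𝓘(ℝ, E') n).symm y := by
  filter_upwards [(isOpen_extChartAt_target (I := 𝓘(ℝ, E')) n).mem_nhds (mem_extChartAt_target n)]
    with y hy
  exact contMDiffAt_extChartAt_symm' hy

/-- A bilinear form on a finite-dimensional space as a continuous bilinear form. -/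
def toCLMTwo {W : Type*} [NormedAddCommGroup W] [NormedSpace ℝ W] [FiniteDimensional ℝ W]
    (B : W →ₗ[ℝ] W →ₗ[ℝ] ℝ) : W →L[ℝ] W →L[ℝ] ℝ :=
  LinearMap.toContinuousLinearMap
    ((LinearMap.toContinuousLinearMap : (W →ₗ[ℝ] ℝ) ≃ₗ[ℝ] W →L[ℝ] ℝ).toLinearMap ∘ₗ B)

/-- A hyperKähler structure on the base of a surjective submersion `q` is constructed from
quaternionic data on the total space that are basic modulo the kernel of `dq`. -/
theorem exists_hyperkahler_of_submersion (hq : ContMDiff I 𝓘(ℝ, E') ∞ q)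
    (hsurj : Function.Surjective q)
    (hsub : ∀ z, Function.Surjective (mfderiv I 𝓘(ℝ, E') q z))
    (G : Q → V →ₗ[ℝ] V →ₗ[ℝ] ℝ) (J : Fin 3 → Q → V →ₗ[ℝ] V)
    (hsymm : ∀ z a b, G z a b = G z b a)
    (hpos : ∀ z a, (mfderiv I 𝓘(ℝ, E') q z : V →L[ℝ] E') a ≠ 0 → 0 < G z a a)
    (hinv : ∀ z z' a b a' b', q z = q z' →
      (mfderiv I 𝓘(ℝ, E') q z : V →L[ℝ] E') a = (mfderiv I 𝓘(ℝ, E') q z' : V →L[ℝ] E') a' →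
      (mfderiv I 𝓘(ℝ, E') q z : V →L[ℝ] E') b = (mfderiv I 𝓘(ℝ, E') q z' : V →L[ℝ] E') b' →
      G z a b = G z' a' b' ∧ ∀ r, G z a (J r z b) = G z' a' (J r z' b'))
    (J_sq : ∀ r z a b, G z a (J r z (J r z b)) = - G z a b)
    (J_mul : ∀ z a b, G z a (J 0 z (J 1 z b)) = G z a (J 2 z b))
    (J_mul_swap : ∀ z a b, G z a (J 1 z (J 0 z b)) = - G z a (J 2 z b))
    (metric_J : ∀ r z a b, G z (J r z a) (J r z b) = G z a b)
    (hG : ∀ (Z : E' → Q) y, (∀ᶠ y' in 𝓝 y, ContMDiffAt 𝓘(ℝ, E') I ∞ Z y') → ∀ a b, ContDiffAt ℝ ∞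
      (fun y => G (Z y) ((mfderiv 𝓘(ℝ, E') I Z y : E' →L[ℝ] V) a)
        ((mfderiv 𝓘(ℝ, E') I Z y : E' →L[ℝ] V) b)) y)
    (hJ : ∀ r (Z : E' → Q) y, (∀ᶠ y' in 𝓝 y, ContMDiffAt 𝓘(ℝ, E') I ∞ Z y') → ∀ a b, ContDiffAt ℝ ∞
      (fun y => G (Z y) ((mfderiv 𝓘(ℝ, E') I Z y : E' →L[ℝ] V) a)
        (J r (Z y) ((mfderiv 𝓘(ℝ, E') I Z y : E' →L[ℝ] V) b))) y)
    (hd : ∀ r (Z : E' → Q) y, (∀ᶠ y' in 𝓝 y, ContMDiffAt 𝓘(ℝ, E') I ∞ Z y') → ∀ a b c,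
      dTwo (fun y a b => G (Z y) ((mfderiv 𝓘(ℝ, E') I Z y : E' →L[ℝ] V) a)
        (J r (Z y) ((mfderiv 𝓘(ℝ, E') I Z y : E' →L[ℝ] V) b))) y a b c = 0) :
    ∃ S : HyperkahlerStructure E' N, ∀ (z : Q) (a b : V),
      S.metric.inner (q z) ((mfderiv I 𝓘(ℝ, E') q z : V →L[ℝ] E') a)
        ((mfderiv I 𝓘(ℝ, E') q z : V →L[ℝ] E') b) = G z a b ∧
      ∀ r, S.omega r (q z) ((mfderiv I 𝓘(ℝ, E') q z : V →L[ℝ] E') a)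
        ((mfderiv I 𝓘(ℝ, E') q z : V →L[ℝ] E') b) = G z a (J r z b) := by
  let dq : Q → V →L[ℝ] E' := fun z => mfderiv I 𝓘(ℝ, E') q z
  choose zz hzz using hsurj
  have hR : ∀ z, ∃ R : E' →ₗ[ℝ] V, ∀ u, dq z (R u) = u := fun z => by
    obtain ⟨R, hR⟩ := (dq z).toLinearMap.exists_rightInverse_of_surjective
      (LinearMap.range_eq_top.2 (hsub z))
    exact ⟨R, fun u => LinearMap.congr_fun hR u⟩
  choose R hR using hR
  let g : N → E' →L[ℝ] E' →L[ℝ] ℝ := fun n =>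
    toCLMTwo ((G (zz n)).compl₁₂ (R (zz n)) (R (zz n)))
  let K : Fin 3 → N → E' →L[ℝ] E' := fun r n =>
    LinearMap.toContinuousLinearMap ((dq (zz n)).toLinearMap ∘ₗ J r (zz n) ∘ₗ R (zz n))
  have hgap : ∀ n u v, g n u v = G (zz n) (R (zz n) u) (R (zz n) v) := fun n u v => rfl
  have hKap : ∀ r n u, K r n u = dq (zz n) (J r (zz n) (R (zz n) u)) := fun r n u => rfl
  have hg : ∀ n z a b u v, q z = n → dq z a = u → dq z b = v → g n u v = G z a b := by
    intro n z a b u v hz ha hb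
    rw [hgap]
    refine (hinv (zz n) z _ _ a b ((hzz n).trans hz.symm) ?_ ?_).1
    · exact (hR (zz n) u).trans ha.symm
    · exact (hR (zz n) v).trans hb.symm
  have hgK : ∀ r n z a b u v, q z = n → dq z a = u → dq z b = v →
      g n u (K r n v) = G z a (J r z b) := by
    intro r n z a b u v hz ha hb
    rw [hg n (zz n) (R (zz n) u) (J r (zz n) (R (zz n) v)) u (K r n v) (hzz n) (hR _ _) rfl]
    refine (hinv (zz n) z _ _ a b ((hzz n).trans hz.symm) ?_ ?_).2 r
    · exact (hR (zz n) u).trans ha.symm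
    · exact (hR (zz n) v).trans hb.symm
  have hgsymm : ∀ n u v, g n u v = g n v u := fun n u v => hsymm _ _ _
  have hgpos : ∀ n v, v ≠ 0 → 0 < g n v v := by
    intro n v hv
    refine hpos _ _ ?_
    have := hR (zz n) v
    exact fun h => hv (this.symm.trans h)
  have hext : ∀ n u v, (∀ w, g n w u = g n w v) → u = v := by
    intro n u v h
    by_contra hne
    have h1 := hgpos n (u - v) (sub_ne_zero.2 hne)
    rw [map_sub, h, sub_self] at h1
    exact lt_irrefl _ h1
  have hlift : ∀ n : N, ∃ Z : E' → Q, ∀ᶠ y in 𝓝 (extChartAt 𝓘(ℝ, E') n n),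
      ContMDiffAt 𝓘(ℝ, E') I ∞ Z y ∧ q (Z y) = (extChartAt 𝓘(ℝ, E') n).symm y ∧
      ∀ a, dq (Z y) ((mfderiv 𝓘(ℝ, E') I Z y : E' →L[ℝ] V) a)
        = (mfderiv 𝓘(ℝ, E') 𝓘(ℝ, E') (extChartAt 𝓘(ℝ, E') n).symm y : E' →L[ℝ] E') a := by
    intro n
    obtain ⟨Z, -, hZ⟩ := exists_lift_plot hq (zz n) (hsub _) (φ := (extChartAt 𝓘(ℝ, E') n).symm)
      (u := extChartAt 𝓘(ℝ, E') n n) ((hzz n).trans (extChartAt_to_inv n).symm)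
      (eventually_contMDiffAt_extChartAt_symm n)
    exact ⟨Z, hZ⟩
  have hsmooth : SmoothTwo (E := E') (M := N) g := by
    intro n a b
    obtain ⟨Z, hZ⟩ := hlift n
    refine (hG Z _ (hZ.mono fun _ h => h.1) a b).congr_of_eventuallyEq ?_
    filter_upwards [hZ] with y hy
    exact hg _ (Z y) _ _ _ _ hy.2.1 (hy.2.2 a) (hy.2.2 b)
  have hsmoothK : ∀ r, SmoothTwo (formOf (E := E') (M := N) g (K r)) := by
    intro r n a b
    obtain ⟨Z, hZ⟩ := hlift n
    refine (hJ r Z _ (hZ.mono fun _ h => h.1) a b).congr_of_eventuallyEq ?_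
    filter_upwards [hZ] with y hy
    exact hgK r _ (Z y) _ _ _ _ hy.2.1 (hy.2.2 a) (hy.2.2 b)
  have hclosed : ∀ r (n : N) (u v w : E'),
      extDerivTwo (formOf (E := E') (M := N) g (K r)) n u v w = 0 := by
    intro r n u v w
    obtain ⟨Z, hZ⟩ := hlift n
    refine Eq.trans (dTwo_congr ?_ _ _ _) (hd r Z _ (hZ.mono fun y h => h.1) _ _ _)
    filter_upwards [hZ] with y hy a b
    exact hgK r _ (Z y) _ _ _ _ hy.2.1 (hy.2.2 a) (hy.2.2 b)
  have hKK : ∀ r r' n w u, g n w (K r n (K r' n u))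
      = G (zz n) (R (zz n) w) (J r (zz n) (J r' (zz n) (R (zz n) u))) := fun r r' n w u =>
    hgK r n (zz n) _ _ w (K r' n u) (hzz n) (hR _ _) rfl
  have hK1 : ∀ r n w u, g n w (K r n u)
      = G (zz n) (R (zz n) w) (J r (zz n) (R (zz n) u)) := fun r n w u =>
    hgK r n (zz n) _ _ w u (hzz n) (hR _ _) (hR _ _)
  refine ⟨HyperkahlerStructure.ofForms (E := E') (M := N) g K hgsymm hgpos hsmooth hsmoothK
    ?_ ?_ ?_ ?_ hclosed, fun z a b => ⟨?_, fun r => ?_⟩⟩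
  · intro r n u
    refine hext n _ _ fun w => ?_
    refine (hKK r r n w u).trans ((J_sq _ _ _ _).trans ?_)
    exact ((g n w).map_neg u).symm
  · intro n u
    refine hext n _ _ fun w => ?_
    exact (hKK 0 1 n w u).trans ((J_mul _ _ _).trans (hK1 2 n w u).symm)
  · intro n u
    refine hext n _ _ fun w => ?_
    refine (hKK 1 0 n w u).trans ((J_mul_swap _ _ _).trans ?_)
    rw [← hK1 2 n w u]
    exact ((g n w).map_neg _).symm
  · intro r n u v
    refine (hg n (zz n) (J r (zz n) (R (zz n) u)) (J r (zz n) (R (zz n) v)) _ _ (hzz n) rfl rfl).trans ?_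
    exact metric_J _ _ _ _
  · exact hg (q z) z a b _ _ rfl rfl rfl
  · exact hgK r (q z) z a b _ _ rfl rfl rfl

end Descent

section Flows

variable {V : Type*} [NormedAddCommGroup V] [NormedSpace ℝ V]

/-- The exterior derivative squares to zero. -/
theorem dTwo_dOne {B : V → V → ℝ} {u : V} (hB : ∀ a, ContDiffAt ℝ ∞ (fun y => B y a) u)
    (a b c : V) : dTwo (dOne B) u a b c = 0 := by
  have hd : ∀ a b, DifferentiableAt ℝ (fun y => fderiv ℝ (fun y => B y b) y a) u := fun a b =>
    (((hB b).fderiv_right (m := 1) (by exact two_le_infty)).differentiableAt (by simp)).clm_apply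
      (differentiableAt_const a)
  have hs : ∀ a b c, fderiv ℝ (fun y => fderiv ℝ (fun y => B y b) y a) u c
      = fderiv ℝ (fderiv ℝ (fun y => B y b)) u c a := fun a b c => by
    have h1 : DifferentiableAt ℝ (fderiv ℝ (fun y => B y b)) u :=
      ((hB b).fderiv_right (m := 1) (by exact two_le_infty)).differentiableAt (by simp)
    rw [fderiv_clm_apply h1 (differentiableAt_const a)]
    simp
  have hsym : ∀ a b c, fderiv ℝ (fderiv ℝ (fun y => B y b)) u c a
      = fderiv ℝ (fderiv ℝ (fun y => B y b)) u a c := fun a b c =>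
    ((hB b).isSymmSndFDerivAt (by simpa using two_le_infty)).eq c a
  have hsub : ∀ a b c, fderiv ℝ (fun y => dOne B y a b) u c
      = fderiv ℝ (fderiv ℝ (fun y => B y b)) u c a
        - fderiv ℝ (fderiv ℝ (fun y => B y a)) u c b := fun a b c => by
    simp only [dOne]
    rw [fderiv_fun_sub (hd a b) (hd b a), sub_apply, hs, hs]
  simp only [dTwo, hsub]
  rw [hsym a b c, hsym b c a, hsym c a b]
  ring

theorem fderiv_prod_left {F : ℝ × V → ℝ} {t : ℝ} {u : V} (hF : DifferentiableAt ℝ F (t, u)) :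
    fderiv ℝ F (t, u) (1, 0) = deriv (fun s => F (s, u)) t := by
  have h1 : HasFDerivAt (fun s : ℝ => (s, u)) (ContinuousLinearMap.inl ℝ ℝ V) t :=
    hasFDerivAt_prodMk_left t u
  have h2 := (HasFDerivAt.comp t hF.hasFDerivAt h1).hasDerivAt.deriv
  exact h2.symm

theorem fderiv_prod_right {F : ℝ × V → ℝ} {t : ℝ} {u : V} (hF : DifferentiableAt ℝ F (t, u))
    (a : V) : fderiv ℝ F (t, u) (0, a) = fderiv ℝ (fun y => F (t, y)) u a := by
  have h1 : HasFDerivAt (fun y : V => (t, y)) (ContinuousLinearMap.inr ℝ ℝ V) u :=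
    hasFDerivAt_prodMk_right t u
  have h2 := (HasFDerivAt.comp u hF.hasFDerivAt h1).fderiv
  exact (DFunLike.congr_fun h2 a).symm

/-- A smooth one-parameter family of maps that starts at the identity. -/
structure SmoothFlow (E : Type*) [NormedAddCommGroup E] [NormedSpace ℝ E]
    (M : Type*) [TopologicalSpace M] [ChartedSpace E M] where
  act : ℝ → M → M
  zero_act : ∀ m, act 0 m = m
  contMDiff_act : ContMDiff (𝓘(ℝ, ℝ).prod 𝓘(ℝ, E)) 𝓘(ℝ, E) ∞ (fun z : ℝ × M => act z.1 z.2)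

namespace SmoothFlow

variable {E : Type*} [NormedAddCommGroup E] [NormedSpace ℝ E]
  {M : Type*} [TopologicalSpace M] [ChartedSpace E M] (Φ : SmoothFlow E M)

/-- The initial velocity of a flow. -/
def field (m : M) : TangentSpace 𝓘(ℝ, E) m :=
  mfderiv 𝓘(ℝ, ℝ) 𝓘(ℝ, E) (fun t : ℝ => Φ.act t m) 0 (1 : ℝ)

/-- The differential of the maps of the flow. -/
def push (t : ℝ) (m : M) : TangentSpace 𝓘(ℝ, E) m →L[ℝ] TangentSpace 𝓘(ℝ, E) (Φ.act t m) :=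
  mfderiv 𝓘(ℝ, E) 𝓘(ℝ, E) (Φ.act t) m

theorem contMDiff_act_left (t : ℝ) : ContMDiff 𝓘(ℝ, E) 𝓘(ℝ, E) ∞ (Φ.act t) :=
  Φ.contMDiff_act.comp (contMDiff_const.prodMk contMDiff_id)

/-- The plot `(t, y) ↦ Φ_t (φ y)`. -/
def plot (φ : V → M) (p : ℝ × V) : M := Φ.act p.1 (φ p.2)

variable {Φ}

theorem contMDiffAt_plot {φ : V → M} {u : V} (hφ : ContMDiffAt 𝓘(ℝ, V) 𝓘(ℝ, E) ∞ φ u) (t : ℝ) :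
    ContMDiffAt 𝓘(ℝ, ℝ × V) 𝓘(ℝ, E) ∞ (Φ.plot φ) (t, u) := by
  have h1 : ContMDiff 𝓘(ℝ, ℝ × V) 𝓘(ℝ, ℝ) ∞ (Prod.fst : ℝ × V → ℝ) := contDiff_fst.contMDiff
  have h2 : ContMDiff 𝓘(ℝ, ℝ × V) 𝓘(ℝ, V) ∞ (Prod.snd : ℝ × V → V) := contDiff_snd.contMDiff
  have h3 : ContMDiffAt 𝓘(ℝ, ℝ × V) 𝓘(ℝ, E) ∞ (fun p : ℝ × V => φ p.2) (t, u) :=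
    ContMDiffAt.comp (g := φ) (f := Prod.snd) (t, u) hφ (h2 (t, u))
  exact ContMDiffAt.comp (g := fun z : ℝ × M => Φ.act z.1 z.2)
    (f := fun p : ℝ × V => (p.1, φ p.2)) (t, u) (Φ.contMDiff_act _) ((h1 (t, u)).prodMk h3)

theorem plotD_plot_time {φ : V → M} {u : V} (hφ : ContMDiffAt 𝓘(ℝ, V) 𝓘(ℝ, E) ∞ φ u) :
    ((plotD (E := E) (Φ.plot φ) (0, u) (1, 0) : E)) = Φ.field (φ u) := by
  have h1 : HasMFDerivAt 𝓘(ℝ, ℝ) 𝓘(ℝ, ℝ × V) (fun t : ℝ => (t, u)) 0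
      (ContinuousLinearMap.inl ℝ ℝ V) := (hasFDerivAt_prodMk_left (0 : ℝ) u).hasMFDerivAt
  have h2 := HasMFDerivAt.comp (0 : ℝ)
    ((contMDiffAt_plot (Φ := Φ) hφ 0).mdifferentiableAt (by simp)).hasMFDerivAt h1
  exact (DFunLike.congr_fun h2.mfderiv (1 : ℝ)).symm

theorem plotD_plot_space {φ : V → M} {u : V} (hφ : ContMDiffAt 𝓘(ℝ, V) 𝓘(ℝ, E) ∞ φ u) (t : ℝ)
    (a : V) : plotD (E := E) (Φ.plot φ) (t, u) (0, a) = Φ.push t (φ u) (plotD (E := E) φ u a) := by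
  have h1 : HasMFDerivAt 𝓘(ℝ, V) 𝓘(ℝ, ℝ × V) (fun y : V => (t, y)) u
      (ContinuousLinearMap.inr ℝ ℝ V) := (hasFDerivAt_prodMk_right t u).hasMFDerivAt
  have h2 := HasMFDerivAt.comp u
    ((contMDiffAt_plot (Φ := Φ) hφ t).mdifferentiableAt (by simp)).hasMFDerivAt h1
  have h3 := HasMFDerivAt.comp u
    ((Φ.contMDiff_act_left t (φ u)).mdifferentiableAt (by simp)).hasMFDerivAt
    (hφ.mdifferentiableAt (by simp)).hasMFDerivAt
  exact DFunLike.congr_fun (hasMFDerivAt_unique h2 h3) a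

theorem push_zero (m : M) (a : TangentSpace 𝓘(ℝ, E) m) : (Φ.push 0 m a : E) = a := by
  have h : Φ.act 0 = id := funext Φ.zero_act
  have h1 : HasMFDerivAt 𝓘(ℝ, E) 𝓘(ℝ, E) (Φ.act 0) m (ContinuousLinearMap.id ℝ E) := by
    rw [h]; exact hasMFDerivAt_id m
  exact DFunLike.congr_fun h1.mfderiv a

theorem push_congr {t : ℝ} {m m' : M} (h : m = m') {u : TangentSpace 𝓘(ℝ, E) m}
    {u' : TangentSpace 𝓘(ℝ, E) m'} (hu : (u : E) = u') : (Φ.push t m u : E) = Φ.push t m' u' := by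
  subst h
  cases hu
  rfl

theorem plotD_plot_zero {φ : V → M} {u : V} (hφ : ContMDiffAt 𝓘(ℝ, V) 𝓘(ℝ, E) ∞ φ u)
    (a : V) : (plotD (E := E) (Φ.plot φ) (0, u) (0, a) : E) = plotD (E := E) φ u a :=
  (plotD_plot_space hφ 0 a).trans (push_zero _ _)

end SmoothFlow

theorem two_tensor_congr {E : Type*} [NormedAddCommGroup E] [NormedSpace ℝ E]
    {M : Type*} [TopologicalSpace M] [ChartedSpace E M]
    (β : (m : M) → TangentSpace 𝓘(ℝ, E) m →L[ℝ] TangentSpace 𝓘(ℝ, E) m →L[ℝ] ℝ) {m m' : M}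
    (h : m = m') {u v : TangentSpace 𝓘(ℝ, E) m} {u' v' : TangentSpace 𝓘(ℝ, E) m'}
    (hu : (u : E) = u') (hv : (v : E) = v') : β m u v = β m' u' v' := by
  subst h
  cases hu
  cases hv
  rfl

theorem one_form_congr {E : Type*} [NormedAddCommGroup E] [NormedSpace ℝ E]
    {M : Type*} [TopologicalSpace M] [ChartedSpace E M]
    (α : (m : M) → TangentSpace 𝓘(ℝ, E) m →L[ℝ] ℝ) {m m' : M}
    (h : m = m') {u : TangentSpace 𝓘(ℝ, E) m} {u' : TangentSpace 𝓘(ℝ, E) m'}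
    (hu : (u : E) = u') : α m u = α m' u' := by
  subst h
  cases hu
  rfl

theorem extDerivOne_congr {E : Type*} [NormedAddCommGroup E] [NormedSpace ℝ E]
    {M : Type*} [TopologicalSpace M] [ChartedSpace E M]
    (α : (m : M) → TangentSpace 𝓘(ℝ, E) m →L[ℝ] ℝ) {m m' : M}
    (h : m = m') {u v : TangentSpace 𝓘(ℝ, E) m} {u' v' : TangentSpace 𝓘(ℝ, E) m'}
    (hu : (u : E) = u') (hv : (v : E) = v') : extDerivOne α m u v = extDerivOne α m' u' v' := by
  subst h
  cases hu
  cases hv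
  rfl

theorem mvfderiv_congr {E G : Type*} [NormedAddCommGroup E] [NormedSpace ℝ E]
    [NormedAddCommGroup G] [NormedSpace ℝ G] {M : Type*} [TopologicalSpace M] [ChartedSpace E M]
    (f : M → G) {m m' : M} (h : m = m') {u : TangentSpace 𝓘(ℝ, E) m}
    {u' : TangentSpace 𝓘(ℝ, E) m'} (hu : (u : E) = u') :
    mvfderiv 𝓘(ℝ, E) f m u = mvfderiv 𝓘(ℝ, E) f m' u' := by
  subst h
  cases hu
  rfl

theorem fderiv_comp_plot {E G : Type*} [NormedAddCommGroup E] [NormedSpace ℝ E]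
    [NormedAddCommGroup G] [NormedSpace ℝ G] {M : Type*} [TopologicalSpace M] [ChartedSpace E M]
    {f : M → G} {φ : V → M} {u : V}
    (hf : MDifferentiableAt 𝓘(ℝ, E) 𝓘(ℝ, G) f (φ u)) (hφ : MDifferentiableAt 𝓘(ℝ, V) 𝓘(ℝ, E) φ u)
    (a : V) : fderiv ℝ (fun y => f (φ y)) u a = mvfderiv 𝓘(ℝ, E) f (φ u) (plotD (E := E) φ u a) := by
  have h := HasMFDerivAt.comp u hf.hasMFDerivAt hφ.hasMFDerivAt
  let Df : E →L[ℝ] G := mfderiv 𝓘(ℝ, E) 𝓘(ℝ, G) f (φ u)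
  let Dφ : V →L[ℝ] E := mfderiv 𝓘(ℝ, V) 𝓘(ℝ, E) φ u
  have h' : HasFDerivAt (fun y => f (φ y)) (Df.comp Dφ) u := hasMFDerivAt_iff_hasFDerivAt.1 h
  rw [h'.fderiv]
  rfl

namespace SmoothFlow

variable {E : Type*} [NormedAddCommGroup E] [NormedSpace ℝ E] [FiniteDimensional ℝ E]
  {M : Type*} [TopologicalSpace M] [ChartedSpace E M] [IsManifold 𝓘(ℝ, E) ∞ M]
  {Φ : SmoothFlow E M}
  {β : (m : M) → TangentSpace 𝓘(ℝ, E) m →L[ℝ] TangentSpace 𝓘(ℝ, E) m →L[ℝ] ℝ}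
  {α : (m : M) → TangentSpace 𝓘(ℝ, E) m →L[ℝ] ℝ} [FiniteDimensional ℝ V]

theorem pullTwo_plot_field {φ : V → M} {u : V} (hφ : ContMDiffAt 𝓘(ℝ, V) 𝓘(ℝ, E) ∞ φ u)
    (a : V) : pullTwo β (Φ.plot φ) (0, u) (1, 0) (0, a)
      = pullOne (fun m => β m (Φ.field m)) φ u a :=
  two_tensor_congr β (Φ.zero_act (φ u)) (plotD_plot_time hφ) (plotD_plot_zero hφ a)

theorem pullTwo_plot_field_field {φ : V → M} {u : V}
    (hφ : ContMDiffAt 𝓘(ℝ, V) 𝓘(ℝ, E) ∞ φ u) :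
    pullTwo β (Φ.plot φ) (0, u) (1, 0) (1, 0) = β (φ u) (Φ.field (φ u)) (Φ.field (φ u)) :=
  two_tensor_congr β (Φ.zero_act (φ u)) (plotD_plot_time hφ) (plotD_plot_time hφ)

theorem pullOne_plot_field {φ : V → M} {u : V} (hφ : ContMDiffAt 𝓘(ℝ, V) 𝓘(ℝ, E) ∞ φ u) :
    pullOne α (Φ.plot φ) (0, u) (1, 0) = α (φ u) (Φ.field (φ u)) :=
  one_form_congr α (Φ.zero_act (φ u)) (plotD_plot_time hφ)

theorem contDiffAt_zero_prod {F : ℝ × V → ℝ} {u : V} (hF : ContDiffAt ℝ ∞ F (0, u)) :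
    ContDiffAt ℝ ∞ (fun y => F (0, y)) u :=
  ContDiffAt.comp (g := F) (f := fun y : V => ((0 : ℝ), y)) u hF
    (contDiffAt_const.prodMk contDiffAt_id)

theorem smoothOne_field (hβ : SmoothTwo β) : SmoothOne (fun m => β m (Φ.field m)) := by
  intro m a
  refine (contDiffAt_zero_prod (contDiffAt_pullTwo hβ
    (contMDiffAt_plot (Φ := Φ) (contMDiffAt_extChartAt_symm m) 0) (1, 0) (0, a))).congr_of_eventuallyEq ?_
  filter_upwards [eventually_contMDiffAt_extChartAt_symm m] with y hy
  exact (pullTwo_plot_field hy a).symm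

theorem contMDiff_field_field (hβ : SmoothTwo β) :
    ContMDiff 𝓘(ℝ, E) 𝓘(ℝ, ℝ) ∞ (fun m => β m (Φ.field m) (Φ.field m)) := by
  intro m
  rw [contMDiffAt_iff_chart]
  refine (contDiffAt_zero_prod (contDiffAt_pullTwo hβ
    (contMDiffAt_plot (Φ := Φ) (contMDiffAt_extChartAt_symm m) 0) (1, 0) (1, 0))).congr_of_eventuallyEq ?_
  filter_upwards [eventually_contMDiffAt_extChartAt_symm m] with y hy
  exact (pullTwo_plot_field_field hy).symm

theorem contMDiff_field (hα : SmoothOne α) :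
    ContMDiff 𝓘(ℝ, E) 𝓘(ℝ, ℝ) ∞ (fun m => α m (Φ.field m)) := by
  intro m
  rw [contMDiffAt_iff_chart]
  refine (contDiffAt_zero_prod ((contDiffAt_pullOne hα
    (contMDiffAt_plot (Φ := Φ) (contMDiffAt_extChartAt_symm m) 0)).clm_apply
      (contDiffAt_const (c := ((1 : ℝ), (0 : E)))))).congr_of_eventuallyEq ?_
  filter_upwards [eventually_contMDiffAt_extChartAt_symm m] with y hy
  exact (pullOne_plot_field hy).symm

/-- Cartan's formula for a closed 2-form: `d (ι_Y β) = L_Y β`. -/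
theorem extDerivOne_field (hβ : SmoothTwo β) (hskew : ∀ m u v, β m u v = - β m v u)
    (hd : ∀ m u v w, extDerivTwo β m u v w = 0) (m : M) (u v : TangentSpace 𝓘(ℝ, E) m) :
    extDerivOne (fun m => β m (Φ.field m)) m u v
      = deriv (fun t => β (Φ.act t m) (Φ.push t m u) (Φ.push t m v)) 0 := by
  let φ := (extChartAt 𝓘(ℝ, E) m).symm
  let y₀ : E := extChartAt 𝓘(ℝ, E) m m
  have hφ : ContMDiffAt 𝓘(ℝ, E) 𝓘(ℝ, E) ∞ φ y₀ := contMDiffAt_extChartAt_symm m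
  have hφm : φ y₀ = m := extChartAt_to_inv m
  have hpl := contMDiffAt_plot (Φ := Φ) hφ 0
  have hF : ∀ a b, DifferentiableAt ℝ (fun p => pullTwo β (Φ.plot φ) p a b) (0, y₀) := fun a b =>
    (contDiffAt_pullTwo hβ hpl a b).differentiableAt (by simp)
  have key := dTwo_pullTwo hβ hskew hpl (1, 0) (0, dChart m m u) (0, dChart m m v)
  rw [hd] at key
  simp only [dTwo] at key
  rw [fderiv_prod_left (hF _ _), fderiv_prod_right (hF _ _), fderiv_prod_right (hF _ _)] at key
  have hι : ∀ a b : E, fderiv ℝ (fun y => pullTwo β (Φ.plot φ) (0, y) (1, 0) (0, a)) y₀ b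
      = fderiv ℝ (fun y => pullOne (fun m => β m (Φ.field m)) φ y a) y₀ b := by
    intro a b
    have : (fun y => pullTwo β (Φ.plot φ) (0, y) (1, 0) (0, a))
        =ᶠ[𝓝 y₀] fun y => pullOne (fun m => β m (Φ.field m)) φ y a := by
      filter_upwards [eventually_contMDiffAt_extChartAt_symm m] with y hy
      exact pullTwo_plot_field hy a
    rw [this.fderiv_eq]
  have hι' : ∀ a b : E, fderiv ℝ (fun y => pullTwo β (Φ.plot φ) (0, y) (0, a) (1, 0)) y₀ b
      = - fderiv ℝ (fun y => pullOne (fun m => β m (Φ.field m)) φ y a) y₀ b := by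
    intro a b
    rw [← hι]
    have : (fun y => pullTwo β (Φ.plot φ) (0, y) (0, a) (1, 0))
        = fun y => - pullTwo β (Φ.plot φ) (0, y) (1, 0) (0, a) := by
      funext y; exact hskew _ _ _
    rw [this, fderiv_fun_neg, neg_apply]
  rw [hι, hι'] at key
  have hder : (fun t => pullTwo β (Φ.plot φ) (t, y₀) (0, dChart m m u) (0, dChart m m v))
      = fun t => β (Φ.act t m) (Φ.push t m u) (Φ.push t m v) := by
    funext t
    have e1 : ∀ w : TangentSpace 𝓘(ℝ, E) m,
        (plotD (E := E) (Φ.plot φ) (t, y₀) (0, dChart m m w) : E) = Φ.push t m w := by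
      intro w
      refine (plotD_plot_space hφ t (dChart m m w)).trans ?_
      have h1 : (plotD (E := E) φ y₀ (dChart m m w) : E) = w := by
        have h2 := (hasMFDerivAt_extChartAt_symm_self (I := 𝓘(ℝ, E)) m).mfderiv
        have h3 := DFunLike.congr_fun h2 (dChart m m w)
        refine h3.trans ?_
        exact dChart_self m w
      exact push_congr hφm h1
    exact two_tensor_congr β (by simp only [plot, hφm]) (e1 u) (e1 v)
  rw [hder] at key
  have hfin : extDerivOne (fun m => β m (Φ.field m)) m u v
      = dOne (fun y a => pullOne (fun m => β m (Φ.field m)) φ y a) y₀ (dChart m m u)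
        (dChart m m v) := by
    have hs := ((smoothOne_field (Φ := Φ) hβ).contDiffAt_chart m).differentiableAt (by simp)
    rw [dOne_clm hs]
    rfl
  rw [hfin, dOne]
  linarith

theorem plotD_extChartAt_symm (m : M) (w : TangentSpace 𝓘(ℝ, E) m) :
    (plotD (E := E) (extChartAt 𝓘(ℝ, E) m).symm (extChartAt 𝓘(ℝ, E) m m) w : E) = w :=
  DFunLike.congr_fun (hasMFDerivAt_extChartAt_symm_self (I := 𝓘(ℝ, E)) m).mfderiv w

/-- Cartan's formula for a 1-form. -/
theorem deriv_flow_oneForm (hα : SmoothOne α) (m : M) (u : TangentSpace 𝓘(ℝ, E) m) :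
    deriv (fun t => α (Φ.act t m) (Φ.push t m u)) 0
      = extDerivOne α m (Φ.field m) u + mvfderiv 𝓘(ℝ, E) (fun m => α m (Φ.field m)) m u := by
  let φ := (extChartAt 𝓘(ℝ, E) m).symm
  let y₀ : E := extChartAt 𝓘(ℝ, E) m m
  obtain ⟨e, he⟩ : ∃ e : E, e = u := ⟨u, rfl⟩
  have hpe : (plotD (E := E) φ y₀ e : E) = u := by
    rw [he]; exact plotD_extChartAt_symm m u
  have hφ : ContMDiffAt 𝓘(ℝ, E) 𝓘(ℝ, E) ∞ φ y₀ := contMDiffAt_extChartAt_symm m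
  have hφm : φ y₀ = m := extChartAt_to_inv m
  have hpl := contMDiffAt_plot (Φ := Φ) hφ 0
  have hF : ∀ a, DifferentiableAt ℝ (fun p => pullOne α (Φ.plot φ) p a) (0, y₀) := fun a =>
    ((contDiffAt_pullOne hα hpl).differentiableAt (by simp)).clm_apply (differentiableAt_const a)
  have key := dOne_pullOne hα hpl (1, 0) (0, e)
  simp only [dOne] at key
  rw [fderiv_prod_left (hF _), fderiv_prod_right (hF _)] at key
  have h1 : fderiv ℝ (fun y => pullOne α (Φ.plot φ) (0, y) (1, 0)) y₀ e
      = mvfderiv 𝓘(ℝ, E) (fun m => α m (Φ.field m)) m u := by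
    have : (fun y => pullOne α (Φ.plot φ) (0, y) (1, 0))
        =ᶠ[𝓝 y₀] fun y => α (φ y) (Φ.field (φ y)) := by
      filter_upwards [eventually_contMDiffAt_extChartAt_symm m] with y hy
      exact pullOne_plot_field hy
    rw [this.fderiv_eq, fderiv_comp_plot (f := fun m => α m (Φ.field m)) (φ := φ)
      ((contMDiff_field hα (φ y₀)).mdifferentiableAt (by simp)) (hφ.mdifferentiableAt (by simp))]
    exact mvfderiv_congr _ hφm hpe
  have h2 : (fun t => pullOne α (Φ.plot φ) (t, y₀) (0, e))
      = fun t => α (Φ.act t m) (Φ.push t m u) := by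
    funext t
    refine one_form_congr α (by simp only [plot, hφm]) ?_
    exact (plotD_plot_space hφ t e).trans (push_congr hφm hpe)
  have h3 : extDerivOne α (Φ.plot φ (0, y₀)) (plotD (Φ.plot φ) (0, y₀) (1, 0))
      (plotD (Φ.plot φ) (0, y₀) (0, e)) = extDerivOne α m (Φ.field m) u := by
    have e0 : Φ.plot φ (0, y₀) = m := (Φ.zero_act _).trans hφm
    refine extDerivOne_congr α e0 ?_ ?_
    · refine (plotD_plot_time hφ).trans ?_
      rw [hφm]
    · exact (plotD_plot_zero hφ e).trans hpe
  rw [h1, h2, h3] at key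
  linarith

end SmoothFlow

end Flows

section QuaternionForms

/-- The real part of a quaternion, as a continuous linear map. -/
def reC : ℍ[ℝ] →L[ℝ] ℝ := LinearMap.toContinuousLinearMap
  { toFun := fun q => q.re
    map_add' := fun _ _ => rfl
    map_smul' := fun _ _ => rfl }

/-- The components of the imaginary part of a quaternion. -/
def imFn (r : Fin 3) (q : ℍ[ℝ]) : ℝ := ![q.imI, q.imJ, q.imK] r

/-- The components of the imaginary part of a quaternion, as continuous linear maps. -/
def imC (r : Fin 3) : ℍ[ℝ] →L[ℝ] ℝ := LinearMap.toContinuousLinearMap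
  { toFun := imFn r
    map_add' := fun a b => by fin_cases r <;> rfl
    map_smul' := fun a b => by fin_cases r <;> rfl }

theorem reC_apply (q : ℍ[ℝ]) : reC q = q.re := rfl
theorem imC_apply (r : Fin 3) (q : ℍ[ℝ]) : imC r q = imFn r q := rfl

instance : StarModule ℝ ℍ[ℝ] := ⟨fun r q => by ext <;> simp⟩

/-- The tensor `metricHP` in terms of its ingredients. -/
def metricF (t v : ℝ) (x c c' : ℍ[ℝ]) (ξ ξ' : ℝ) (η η' : ℍ[ℝ]) (g : ℝ) : ℝ :=
  t * (c * star c').re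
    - (star x * c * qi * ((2 * ξ' : ℝ) + η') + star x * c' * qi * ((2 * ξ : ℝ) + η)).re
    + ‖x‖ ^ 2 * (g + v⁻¹ * (ξ * ξ'))

/-- The form `omegaHP` in terms of its ingredients. -/
def omegaF (t : ℝ) (x c c' : ℍ[ℝ]) (ξ ξ' : ℝ) (η η' om : ℍ[ℝ]) : ℍ[ℝ] :=
  (t / 2) • (c * star c' - c' * star c) + x * om * star x
    - (2 : ℝ) • (ξ' • (c * qi * star x).im - ξ • (c' * qi * star x).im)
    - (c * qi * η' * star x - c' * qi * η * star x).im

/-- The contraction of `omegaHP` with the radial vector field. -/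
def betaF (t : ℝ) (x c : ℍ[ℝ]) (ξ : ℝ) (η : ℍ[ℝ]) : ℍ[ℝ] :=
  omegaF t x x c 0 ξ 0 η 0

theorem betaF_eq (t : ℝ) (x c : ℍ[ℝ]) (ξ : ℝ) (η : ℍ[ℝ]) :
    betaF t x c ξ η = (t / 2) • (x * star c - c * star x) - ξ • (x * qi * star x - star (x * qi * star x))
      - (1 / 2 : ℝ) • (x * qi * η * star x - star (x * qi * η * star x)) := by
  ext <;> simp [betaF, omegaF] <;> ring

/-- The derivative of `betaF` along curves. -/
def betaD (t t' : ℝ) (x x' c c' : ℍ[ℝ]) (ξ ξ' : ℝ) (η η' : ℍ[ℝ]) : ℍ[ℝ] :=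
  (t' / 2) • (x * star c - c * star x)
    + (t / 2) • (x' * star c + x * star c' - (c' * star x + c * star x'))
    - (ξ' • (x * qi * star x - star (x * qi * star x))
      + ξ • (x' * qi * star x + x * qi * star x' - star (x' * qi * star x + x * qi * star x')))
    - (1 / 2 : ℝ) • ((x' * qi * η + x * qi * η') * star x + x * qi * η * star x'
      - star ((x' * qi * η + x * qi * η') * star x + x * qi * η * star x'))

theorem hasDerivAt_betaF {t ξ : ℝ → ℝ} {x c η : ℝ → ℍ[ℝ]} {t' ξ' : ℝ} {x' c' η' : ℍ[ℝ]} {s : ℝ}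
    (ht : HasDerivAt t t' s) (hx : HasDerivAt x x' s) (hc : HasDerivAt c c' s)
    (hξ : HasDerivAt ξ ξ' s) (hη : HasDerivAt η η' s) :
    HasDerivAt (fun s => betaF (t s) (x s) (c s) (ξ s) (η s))
      (betaD (t s) t' (x s) x' (c s) c' (ξ s) ξ' (η s) η') s := by
  simp only [betaF_eq]
  have h1 := (ht.div_const 2).fun_smul ((hx.fun_mul hc.star).fun_sub (hc.fun_mul hx.star))
  have h2 := (hx.mul_const qi).fun_mul hx.star
  have h3 := ((hx.mul_const qi).fun_mul hη).fun_mul hx.star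
  have h := (h1.fun_sub (hξ.fun_smul (h2.fun_sub h2.star))).fun_sub
    ((h3.fun_sub h3.star).fun_const_smul (1 / 2 : ℝ))
  refine h.congr_deriv ?_
  simp only [betaD]
  abel

@[simp] theorem qi_re : qi.re = 0 := rfl
@[simp] theorem qi_imI : qi.imI = 1 := rfl
@[simp] theorem qi_imJ : qi.imJ = 0 := rfl
@[simp] theorem qi_imK : qi.imK = 0 := rfl

theorem betaD_sub (t : ℝ) (x xa xb xab : ℍ[ℝ]) (ξa ξb ξ₁ ξ₂ : ℝ) (ηa ηb η₁ η₂ om : ℍ[ℝ])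
    (hom : om.re = 0) (hξ : ξ₁ - ξ₂ + 1 / 2 * (η₁.re - η₂.re) + om.imI = 0)
    (h1 : η₁.imI - η₂.imI = 0)
    (h2 : η₁.imJ - η₂.imJ = -2 * om.imK) (h3 : η₁.imK - η₂.imK = 2 * om.imJ) :
    betaD t (2 * ηa.imI) x xa xb xab ξb ξ₁ ηb η₁ - betaD t (2 * ηb.imI) x xb xa xab ξa ξ₂ ηa η₂
      = (2 : ℝ) • omegaF t x xa xb ξa ξb ηa ηb om := by
  have e0 : ξ₁ = ξ₂ - 1 / 2 * (η₁.re - η₂.re) - om.imI := by linarith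
  have e1 : η₁.imI = η₂.imI := by linarith
  have e2 : η₁.imJ = η₂.imJ - 2 * om.imK := by linarith
  have e3 : η₁.imK = η₂.imK + 2 * om.imJ := by linarith
  ext
  all_goals
    simp only [betaD, omegaF, Quaternion.re_mul, Quaternion.imI_mul,
      Quaternion.imJ_mul, Quaternion.imK_mul, Quaternion.re_sub, Quaternion.imI_sub,
      Quaternion.imJ_sub, Quaternion.imK_sub, Quaternion.re_add, Quaternion.imI_add,
      Quaternion.imJ_add, Quaternion.imK_add, Quaternion.re_star, Quaternion.imI_star,
      Quaternion.imJ_star, Quaternion.imK_star, Quaternion.re_smul, Quaternion.imI_smul,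
      Quaternion.imJ_smul, Quaternion.imK_smul, Quaternion.re_im, Quaternion.imI_im,
      Quaternion.imJ_im, Quaternion.imK_im, smul_eq_mul, qi_re, qi_imI, qi_imJ, qi_imK, hom,
      e0, e1, e2, e3]
    ring

end QuaternionForms

section BetaDerivative

variable {V : Type*} [NormedAddCommGroup V] [NormedSpace ℝ V]

theorem hasDerivAt_line {G : Type*} [NormedAddCommGroup G] [NormedSpace ℝ G] {f : V → G} {u : V}
    (hf : DifferentiableAt ℝ f u) (a : V) :
    HasDerivAt (fun s : ℝ => f (u + s • a)) (fderiv ℝ f u a) 0 := by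
  have h1 : HasDerivAt (fun s : ℝ => u + s • a) a 0 := by
    simpa using ((hasDerivAt_id (0 : ℝ)).smul_const a).const_add u
  have h2 : HasFDerivAt f (fderiv ℝ f u) (u + (0 : ℝ) • a) := by simpa using hf.hasFDerivAt
  exact h2.comp_hasDerivAt (0 : ℝ) h1

theorem ContDiffAt.qstar {X : V → ℍ[ℝ]} {u : V} (hX : ContDiffAt ℝ ∞ X u) :
    ContDiffAt ℝ ∞ (fun y => star (X y)) u :=
  ((starL' ℝ : ℍ[ℝ] ≃L[ℝ] ℍ[ℝ]) : ℍ[ℝ] →L[ℝ] ℍ[ℝ]).contDiff.contDiffAt.comp u hX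

theorem contDiffAt_betaF {T : V → ℝ} {X c : V → ℍ[ℝ]} {ξ : V → ℝ} {η : V → ℍ[ℝ]} {u : V}
    (hT : ContDiffAt ℝ ∞ T u) (hX : ContDiffAt ℝ ∞ X u) (hc : ContDiffAt ℝ ∞ c u)
    (hξ : ContDiffAt ℝ ∞ ξ u) (hη : ContDiffAt ℝ ∞ η u) :
    ContDiffAt ℝ ∞ (fun y => betaF (T y) (X y) (c y) (ξ y) (η y)) u := by
  simp only [betaF_eq]
  have hXs := ContDiffAt.qstar hX
  have hcs := ContDiffAt.qstar hc
  have h2 := (hX.mul (contDiffAt_const (c := qi))).mul hXs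
  have h3 := ((hX.mul (contDiffAt_const (c := qi))).mul hη).mul hXs
  exact (((hT.div_const 2).smul ((hX.mul hcs).sub (hc.mul hXs))).sub
    (hξ.smul (h2.sub (ContDiffAt.qstar h2)))).sub ((h3.sub (ContDiffAt.qstar h3)).const_smul _)

theorem contDiffAt_fderiv_apply {G : Type*} [NormedAddCommGroup G] [NormedSpace ℝ G] {X : V → G}
    {u : V} (hX : ContDiffAt ℝ ∞ X u) (a : V) : ContDiffAt ℝ ∞ (fun y => fderiv ℝ X y a) u :=
  (hX.fderiv_right (m := ∞) (by simp)).clm_apply contDiffAt_const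

/-- The exterior derivative of `betaF`. -/
theorem dOne_betaF {X : V → ℍ[ℝ]} {T : V → ℝ} {ξ : V → V → ℝ} {η : V → V → ℍ[ℝ]} {om : ℍ[ℝ]}
    {u : V} (hX : ContDiffAt ℝ ∞ X u) (hT : ContDiffAt ℝ ∞ T u)
    (hξ : ∀ a, ContDiffAt ℝ ∞ (fun y => ξ y a) u) (hη : ∀ a, ContDiffAt ℝ ∞ (fun y => η y a) u)
    (a b : V) (hTd : ∀ a, fderiv ℝ T u a = 2 * (η u a).imI) (hom : om.re = 0)
    (h0 : dOne ξ u a b + 1 / 2 * dOne (fun y a => (η y a).re) u a b + om.imI = 0)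
    (h1 : dOne (fun y a => imFn 0 (η y a)) u a b = 0)
    (h2 : dOne (fun y a => imFn 1 (η y a)) u a b = -2 * om.imK)
    (h3 : dOne (fun y a => imFn 2 (η y a)) u a b = 2 * om.imJ) (r : Fin 3) :
    dOne (fun y a => imFn r (betaF (T y) (X y) (fderiv ℝ X y a) (ξ y a) (η y a))) u a b
      = 2 * imFn r (omegaF (T u) (X u) (fderiv ℝ X u a) (fderiv ℝ X u b) (ξ u a) (ξ u b) (η u a)
        (η u b) om) := by
  have hdX : ∀ a, ContDiffAt ℝ ∞ (fun y => fderiv ℝ X y a) u := contDiffAt_fderiv_apply hX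
  let F : V → V → ℍ[ℝ] := fun a y => betaF (T y) (X y) (fderiv ℝ X y a) (ξ y a) (η y a)
  have hF : ∀ a, DifferentiableAt ℝ (F a) u := fun a =>
    (contDiffAt_betaF hT hX (hdX a) (hξ a) (hη a)).differentiableAt (by simp)
  have hFd : ∀ a b, fderiv ℝ (F b) u a = betaD (T u) (2 * (η u a).imI) (X u) (fderiv ℝ X u a)
      (fderiv ℝ X u b) (fderiv ℝ (fun y => fderiv ℝ X y b) u a) (ξ u b)
      (fderiv ℝ (fun y => ξ y b) u a) (η u b) (fderiv ℝ (fun y => η y b) u a) := by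
    intro a b
    have e := hasDerivAt_betaF (hasDerivAt_line (hT.differentiableAt (by simp)) a)
      (hasDerivAt_line (hX.differentiableAt (by simp)) a)
      (hasDerivAt_line ((hdX b).differentiableAt (by simp)) a)
      (hasDerivAt_line ((hξ b).differentiableAt (by simp)) a)
      (hasDerivAt_line ((hη b).differentiableAt (by simp)) a)
    have e' := (hasDerivAt_line (hF b) a).unique e
    simpa [hTd] using e'
  have hcomp : ∀ (L : ℍ[ℝ] →L[ℝ] ℝ) {f : V → ℍ[ℝ]} (_ : DifferentiableAt ℝ f u) (a : V),
      fderiv ℝ (fun y => L (f y)) u a = L (fderiv ℝ f u a) := fun L f hf a => by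
    have := (L.hasFDerivAt.comp u hf.hasFDerivAt).fderiv
    exact DFunLike.congr_fun this a
  have hηd : ∀ a, DifferentiableAt ℝ (fun y => η y a) u := fun a =>
    (hη a).differentiableAt (by simp)
  have hsym : fderiv ℝ (fun y => fderiv ℝ X y b) u a = fderiv ℝ (fun y => fderiv ℝ X y a) u b := by
    have hd : DifferentiableAt ℝ (fderiv ℝ X) u :=
      (hX.fderiv_right (m := 1) (by exact two_le_infty)).differentiableAt (by simp)
    rw [fderiv_clm_apply hd (differentiableAt_const b), fderiv_clm_apply hd (differentiableAt_const a)]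
    simpa using (hX.isSymmSndFDerivAt (by simpa using two_le_infty)).eq a b
  have key := betaD_sub (T u) (X u) (fderiv ℝ X u a) (fderiv ℝ X u b)
    (fderiv ℝ (fun y => fderiv ℝ X y b) u a) (ξ u a) (ξ u b) (fderiv ℝ (fun y => ξ y b) u a)
    (fderiv ℝ (fun y => ξ y a) u b) (η u a) (η u b) (fderiv ℝ (fun y => η y b) u a)
    (fderiv ℝ (fun y => η y a) u b) om hom
    (by
      have e1 := hcomp reC (hηd b) a
      have e2 := hcomp reC (hηd a) b
      simp only [dOne] at h0
      simp only [reC_apply] at e1 e2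
      rw [e1, e2] at h0
      exact h0)
    (by
      have e1 := hcomp (imC 0) (hηd b) a
      have e2 := hcomp (imC 0) (hηd a) b
      simp only [dOne] at h1
      simp only [imC_apply] at e1 e2
      rw [e1, e2] at h1
      exact h1)
    (by
      have e1 := hcomp (imC 1) (hηd b) a
      have e2 := hcomp (imC 1) (hηd a) b
      simp only [dOne] at h2
      simp only [imC_apply] at e1 e2
      rw [e1, e2] at h2
      exact h2)
    (by
      have e1 := hcomp (imC 2) (hηd b) a
      have e2 := hcomp (imC 2) (hηd a) b
      simp only [dOne] at h3
      simp only [imC_apply] at e1 e2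
      rw [e1, e2] at h3
      exact h3)
  have e1 := hcomp (imC r) (hF b) a
  have e2 := hcomp (imC r) (hF a) b
  rw [hFd] at e1 e2
  rw [← hsym] at e2
  have e3 := congrArg (imC r) key
  rw [map_sub, map_smul, ← e1, ← e2] at e3
  exact e3

end BetaDerivative

section Units

theorem hasMFDerivAt_units_val (x : (ℍ[ℝ])ˣ) :
    HasMFDerivAt 𝓘(ℝ, ℍ[ℝ]) 𝓘(ℝ, ℍ[ℝ]) (Units.val : (ℍ[ℝ])ˣ → ℍ[ℝ]) x
      (ContinuousLinearMap.id ℝ ℍ[ℝ]) := by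
  have h0 : extChartAt 𝓘(ℝ, ℍ[ℝ]) x = (Units.val : (ℍ[ℝ])ˣ → ℍ[ℝ]) := by
    funext y; simp [extChartAt]
  have h : HasMFDerivAt 𝓘(ℝ, ℍ[ℝ]) 𝓘(ℝ, ℍ[ℝ]) (extChartAt 𝓘(ℝ, ℍ[ℝ]) x) x (dChart x x) :=
    ((contMDiffAt_extChartAt (I := 𝓘(ℝ, ℍ[ℝ])) (n := ∞) (x := x)).mdifferentiableAt
      (by simp)).hasMFDerivAt
  rw [h0] at h
  exact h.congr_mfderiv (ContinuousLinearMap.ext fun w => dChart_self x w)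

/-- A map into the units is smooth if its composition with the inclusion is. -/
theorem contMDiff_units {V H N : Type*} [NormedAddCommGroup V] [NormedSpace ℝ V]
    [TopologicalSpace H] {I : ModelWithCorners ℝ V H} [TopologicalSpace N] [ChartedSpace H N]
    {f : N → (ℍ[ℝ])ˣ} (hf : ContMDiff I 𝓘(ℝ, ℍ[ℝ]) ∞ (fun n => (f n : ℍ[ℝ]))) :
    ContMDiff I 𝓘(ℝ, ℍ[ℝ]) ∞ f :=
  ContMDiff.of_comp_isOpenEmbedding Units.isOpenEmbedding_val hf

@[simp] theorem circleToQuat_re (z : Circle) : (circleToQuat z : ℍ[ℝ]).re = (z : ℂ).re := rfl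
@[simp] theorem circleToQuat_imI (z : Circle) : (circleToQuat z : ℍ[ℝ]).imI = (z : ℂ).im := rfl
@[simp] theorem circleToQuat_imJ (z : Circle) : (circleToQuat z : ℍ[ℝ]).imJ = 0 := rfl
@[simp] theorem circleToQuat_imK (z : Circle) : (circleToQuat z : ℍ[ℝ]).imK = 0 := rfl

theorem contMDiff_circleToQuat : ContMDiff (𝓡 1) 𝓘(ℝ, ℍ[ℝ]) ∞ circleToQuat := by
  refine contMDiff_units ?_
  have : Fact (Module.finrank ℝ ℂ = 1 + 1) := ⟨Complex.finrank_real_complex⟩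
  have h1 : ContMDiff (𝓡 1) 𝓘(ℝ, ℂ) ∞ (fun z : Circle => (z : ℂ)) := contMDiff_coe_sphere
  let L : ℂ →L[ℝ] ℍ[ℝ] := LinearMap.toContinuousLinearMap (Quaternion.ofComplex).toLinearMap
  exact L.contDiff.contMDiff.comp h1

theorem coe_circleToQuat_exp (t : ℝ) :
    (circleToQuat (Circle.exp t) : ℍ[ℝ]) = Real.cos t • 1 + Real.sin t • qi := by
  ext <;> simp [Circle.coe_exp, Complex.exp_ofReal_mul_I_re, Complex.exp_ofReal_mul_I_im]

theorem hasDerivAt_circleToQuat :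
    HasDerivAt (fun t : ℝ => (circleToQuat (Circle.exp t) : ℍ[ℝ])) qi 0 := by
  simp only [coe_circleToQuat_exp]
  have h := ((Real.hasDerivAt_cos 0).smul_const (1 : ℍ[ℝ])).add
    ((Real.hasDerivAt_sin 0).smul_const qi)
  exact h.congr_deriv (by simp)

theorem coe_circleToQuat_inv (z : Circle) :
    (circleToQuat z⁻¹ : ℍ[ℝ]) = star (circleToQuat z : ℍ[ℝ]) := by
  ext <;> simp [-map_inv]

theorem circleToQuat_mul_star (z : Circle) :
    (circleToQuat z : ℍ[ℝ]) * star (circleToQuat z : ℍ[ℝ]) = 1 := by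
  rw [← coe_circleToQuat_inv, ← Units.val_mul, ← map_mul, mul_inv_cancel, map_one, Units.val_one]

theorem circleToQuat_mul_qi (z : Circle) :
    (circleToQuat z : ℍ[ℝ]) * qi = qi * circleToQuat z := by
  ext <;> simp

theorem circleToQuat_injective : Function.Injective circleToQuat := by
  intro z z' h
  have h1 : (circleToQuat z : ℍ[ℝ]) = circleToQuat z' := by rw [h]
  exact Circle.ext (Complex.ext (congrArg QuaternionAlgebra.re h1)
    (congrArg QuaternionAlgebra.imI h1))

end Units

section CircleActions

variable {E : Type*} [NormedAddCommGroup E] [NormedSpace ℝ E]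
  {M : Type*} [TopologicalSpace M] [ChartedSpace E M]

/-- The flow of a circle action. -/
def SmoothAction.toSmoothFlow (A : CircleAction E M) : SmoothFlow E M where
  act t m := A.act (Circle.exp t) m
  zero_act m := by rw [Circle.exp_zero, A.one_act]
  contMDiff_act := A.contMDiff_act.comp ((contMDiff_circleExp.comp contMDiff_fst).prodMk contMDiff_snd)

/-- A circle action as a flow. -/
def SmoothAction.toCircleFlow (A : CircleAction E M) : CircleFlow 𝓘(ℝ, E) M where
  act := A.act
  one_act := A.one_act
  mul_act := A.mul_act
  contMDiff_act := A.contMDiff_act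

theorem SmoothAction.contMDiff_act_left {EG : Type*} [NormedAddCommGroup EG] [NormedSpace ℝ EG]
    {HG : Type*} [TopologicalSpace HG] {IG : ModelWithCorners ℝ EG HG}
    {G : Type*} [Group G] [TopologicalSpace G] [ChartedSpace HG G]
    (A : SmoothAction IG G E M) (g : G) : ContMDiff 𝓘(ℝ, E) 𝓘(ℝ, E) ∞ (A.act g) :=
  A.contMDiff_act.comp (contMDiff_const.prodMk contMDiff_id)

theorem SmoothAction.hasMFDerivAt_act {EG : Type*} [NormedAddCommGroup EG] [NormedSpace ℝ EG]
    {HG : Type*} [TopologicalSpace HG] {IG : ModelWithCorners ℝ EG HG}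
    {G : Type*} [Group G] [TopologicalSpace G] [ChartedSpace HG G]
    (A : SmoothAction IG G E M) (g : G) (m : M) :
    HasMFDerivAt 𝓘(ℝ, E) 𝓘(ℝ, E) (A.act g) m (A.push g m) :=
  ((A.contMDiff_act_left g m).mdifferentiableAt (by simp)).hasMFDerivAt

theorem SmoothAction.hasMFDerivAt_circleOrbit (A : CircleAction E M) (m : M) :
    HasMFDerivAt 𝓘(ℝ, ℝ) 𝓘(ℝ, E) (fun t : ℝ => A.act (Circle.exp t) m) 0
      (ContinuousLinearMap.toSpanSingleton ℝ (A.circleField m)) := by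
  refine ((A.toCircleFlow.contMDiff_orbit m 0).mdifferentiableAt (by simp)).hasMFDerivAt.congr_mfderiv
    (ContinuousLinearMap.ext_ring ?_)
  exact (one_smul ℝ (A.circleField m)).symm

/-- A map that intertwines two circle actions intertwines their vector fields. -/
theorem SmoothAction.mfderiv_circleField {F : Type*} [NormedAddCommGroup F] [NormedSpace ℝ F]
    {P : Type*} [TopologicalSpace P] [ChartedSpace F P] (A : CircleAction E M)
    (B : CircleAction F P) {f : M → P} (m : M) (hf : MDifferentiableAt 𝓘(ℝ, E) 𝓘(ℝ, F) f m)
    (h : ∀ z, f (A.act z m) = B.act z (f m)) :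
    (mfderiv 𝓘(ℝ, E) 𝓘(ℝ, F) f m : E →L[ℝ] F) (A.circleField m) = B.circleField (f m) := by
  have h0 : HasMFDerivAt 𝓘(ℝ, E) 𝓘(ℝ, F) f (A.act (Circle.exp 0) m)
      (mfderiv 𝓘(ℝ, E) 𝓘(ℝ, F) f m) := by
    rw [Circle.exp_zero, A.one_act]; exact hf.hasMFDerivAt
  have h1 := HasMFDerivAt.comp (0 : ℝ) h0 (A.hasMFDerivAt_circleOrbit m)
  have h2 : (f ∘ fun t : ℝ => A.act (Circle.exp t) m) = fun t => B.act (Circle.exp t) (f m) :=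
    funext fun t => h _
  rw [h2] at h1
  have h3 := DFunLike.congr_fun (hasMFDerivAt_unique h1 (B.hasMFDerivAt_circleOrbit (f m))) (1 : ℝ)
  have h4 : (mfderiv 𝓘(ℝ, E) 𝓘(ℝ, F) f m : E →L[ℝ] F) ((1 : ℝ) • (A.circleField m : E))
      = (1 : ℝ) • (B.circleField (f m) : F) := h3
  rwa [one_smul, one_smul] at h4

theorem SmoothAction.push_circleField (A B : CircleAction E M)
    (h : ∀ z z' m, A.act z (B.act z' m) = B.act z' (A.act z m)) (z : Circle) (m : M) :
    A.push z m (B.circleField m) = B.circleField (A.act z m) :=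
  B.mfderiv_circleField B m ((A.contMDiff_act_left z m).mdifferentiableAt (by simp))
    fun z' => h z z' m

theorem SmoothAction.push_circleField_self (A : CircleAction E M) (z : Circle) (m : M) :
    A.push z m (A.circleField m) = A.circleField (A.act z m) :=
  A.push_circleField A (fun z z' m => by rw [← A.mul_act, ← A.mul_act, mul_comm]) z m

end CircleActions

section Contractions

variable {E : Type*} [NormedAddCommGroup E] [NormedSpace ℝ E] [FiniteDimensional ℝ E]
  {M : Type*} [TopologicalSpace M] [ChartedSpace E M] [IsManifold 𝓘(ℝ, E) ∞ M]
  (S : HyperkahlerStructure E M)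

theorem imFn_omegaQ (r : Fin 3) (m : M) (u v : TangentSpace 𝓘(ℝ, E) m) :
    imFn r (S.omegaQ m u v) = S.omega r m u v := by
  fin_cases r <;> rfl

theorem hasDerivAt_conj {γ : ℝ → ℍ[ℝ]} {θ : ℍ[ℝ]} (hγ : HasDerivAt γ θ 0) (h0 : γ 0 = 1)
    (q : ℍ[ℝ]) : HasDerivAt (fun t => γ t * q * star (γ t)) (θ * q + q * star θ) 0 := by
  have h := (hγ.mul_const q).fun_mul hγ.star
  rw [h0] at h
  simpa using h

/-- The exterior derivative of the contraction of `ω` with the field of a flow that acts on `ω` by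
conjugation. -/
theorem HyperkahlerStructure.extDerivOne_contract (Φ : SmoothFlow E M) {γ : ℝ → ℍ[ℝ]} {θ : ℍ[ℝ]}
    (hγ : HasDerivAt γ θ 0) (h0 : γ 0 = 1)
    (hΦ : ∀ t m u v, S.omegaQ (Φ.act t m) (Φ.push t m u) (Φ.push t m v)
      = γ t * S.omegaQ m u v * star (γ t)) (r : Fin 3) (m : M) (u v : TangentSpace 𝓘(ℝ, E) m) :
    extDerivOne (fun m => S.omegaL r m (Φ.field m)) m u v
      = imFn r (θ * S.omegaQ m u v + S.omegaQ m u v * star θ) := by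
  rw [SmoothFlow.extDerivOne_field (S.smoothTwo_omegaL r) (S.omega_skew r)
    (S.extDerivTwo_omegaL r)]
  have h1 : (fun t => S.omegaL r (Φ.act t m) (Φ.push t m u) (Φ.push t m v))
      = fun t => imC r (γ t * S.omegaQ m u v * star (γ t)) := by
    funext t
    rw [imC_apply, ← hΦ, imFn_omegaQ]
    rfl
  rw [h1, ← imC_apply]
  exact ((imC r).hasFDerivAt.comp_hasDerivAt _ (hasDerivAt_conj hγ h0 _)).deriv

end Contractions

@[simp] theorem qj_re : qj.re = 0 := rfl
@[simp] theorem qj_imI : qj.imI = 0 := rfl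
@[simp] theorem qj_imJ : qj.imJ = 1 := rfl
@[simp] theorem qj_imK : qj.imK = 0 := rfl
@[simp] theorem qk_re : qk.re = 0 := rfl
@[simp] theorem qk_imI : qk.imI = 0 := rfl
@[simp] theorem qk_imJ : qk.imJ = 0 := rfl
@[simp] theorem qk_imK : qk.imK = 1 := rfl

section

variable {E : Type*} [NormedAddCommGroup E] [NormedSpace ℝ E]
  {M : Type*} [TopologicalSpace M] [ChartedSpace E M] [IsManifold 𝓘(ℝ, E) ∞ M]
  (S : HyperkahlerStructure E M) (m : M) (u v : TangentSpace 𝓘(ℝ, E) m)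

@[simp] theorem omegaQ_re : (S.omegaQ m u v).re = 0 := rfl
@[simp] theorem omegaQ_imI : (S.omegaQ m u v).imI = S.omega 0 m u v := rfl
@[simp] theorem omegaQ_imJ : (S.omegaQ m u v).imJ = S.omega 1 m u v := rfl
@[simp] theorem omegaQ_imK : (S.omegaQ m u v).imK = S.omega 2 m u v := rfl

end

theorem contDiffAt_quaternion {V : Type*} [NormedAddCommGroup V] [NormedSpace ℝ V] {f : V → ℍ[ℝ]}
    {u : V} (h0 : ContDiffAt ℝ ∞ (fun y => (f y).re) u)
    (h : ∀ r, ContDiffAt ℝ ∞ (fun y => imFn r (f y)) u) : ContDiffAt ℝ ∞ f u := by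
  have e : f = fun y => (f y).re • (1 : ℍ[ℝ]) + imFn 0 (f y) • qi + imFn 1 (f y) • qj
      + imFn 2 (f y) • qk := by
    funext y
    ext <;> simp [imFn]
  rw [e]
  exact (((h0.smul contDiffAt_const).add ((h 0).smul contDiffAt_const)).add
    ((h 1).smul contDiffAt_const)).add ((h 2).smul contDiffAt_const)

namespace InductionData

variable {E : Type*} [NormedAddCommGroup E] [NormedSpace ℝ E] [FiniteDimensional ℝ E]
  {M : Type*} [TopologicalSpace M] [ChartedSpace E M] [IsManifold 𝓘(ℝ, E) ∞ M]
  {F : Type*} [NormedAddCommGroup F] [NormedSpace ℝ F] [FiniteDimensional ℝ F]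
  {P : Type*} [TopologicalSpace P] [ChartedSpace F P] [IsManifold 𝓘(ℝ, F) ∞ P]
  (D : InductionData E M F P)
  {V : Type*} [NormedAddCommGroup V] [NormedSpace ℝ V] [FiniteDimensional ℝ V]

section Base

theorem four_v_add_w (m : M) : 4 * D.v m + D.w m = -2 * D.rho m := by
  rw [v]; ring

/-- The real part of `η`. -/
def etaRe (m : M) : TangentSpace 𝓘(ℝ, E) m →L[ℝ] ℝ := D.hk.metric.inner m (D.Kr m)

/-- The imaginary components of `η`. -/
def etaIm (r : Fin 3) (m : M) : TangentSpace 𝓘(ℝ, E) m →L[ℝ] ℝ := D.hk.omegaL r m (D.Kr m)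

theorem eta_re (m : M) (u : TangentSpace 𝓘(ℝ, E) m) : (D.eta m u).re = D.etaRe m u := by
  simp [eta, etaRe]

theorem eta_imFn (r : Fin 3) (m : M) (u : TangentSpace 𝓘(ℝ, E) m) :
    imFn r (D.eta m u) = D.etaIm r m u := by
  fin_cases r <;> simp [eta, etaIm, imFn,
    HyperkahlerStructure.omegaL_apply]

theorem smoothOne_etaRe : SmoothOne D.etaRe :=
  SmoothFlow.smoothOne_field (Φ := D.rot.toSmoothFlow) D.hk.smoothTwo_metric

theorem smoothOne_etaIm (r : Fin 3) : SmoothOne (D.etaIm r) :=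
  SmoothFlow.smoothOne_field (Φ := D.rot.toSmoothFlow) (D.hk.smoothTwo_omegaL r)

theorem smoothOne_xi : SmoothOne D.xi := contMDiff_iff_smoothOne.1 D.isConnection.contMDiff

theorem contMDiff_w : ContMDiff 𝓘(ℝ, E) 𝓘(ℝ, ℝ) ∞ D.w :=
  SmoothFlow.contMDiff_field_field (Φ := D.rot.toSmoothFlow) D.hk.smoothTwo_metric

theorem contMDiff_v : ContMDiff 𝓘(ℝ, E) 𝓘(ℝ, ℝ) ∞ D.v := by
  have h : D.v = (fun p : ℝ × ℝ => -(p.1 + 2 * p.2) / 4) ∘ fun m => (D.w m, D.rho m) := rfl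
  have h1 : ContDiff ℝ ∞ (fun p : ℝ × ℝ => -(p.1 + 2 * p.2) / 4) := by fun_prop
  rw [h]
  exact h1.contMDiff.comp (D.contMDiff_w.prodMk_space D.isMomentumMap.contMDiff)

theorem extDerivOne_etaIm (r : Fin 3) (m : M) (u u' : TangentSpace 𝓘(ℝ, E) m) :
    extDerivOne (D.etaIm r) m u u'
      = imFn r (qi * D.hk.omegaQ m u u' + D.hk.omegaQ m u u' * star qi) :=
  D.hk.extDerivOne_contract D.rot.toSmoothFlow hasDerivAt_circleToQuat (by simp)
    (fun t m u u' => D.isRotating.omega_push (Circle.exp t) m u u') r m u u'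

theorem extDerivOne_etaIm_zero (m : M) (u u' : TangentSpace 𝓘(ℝ, E) m) :
    extDerivOne (D.etaIm 0) m u u' = 0 := by
  rw [extDerivOne_etaIm]
  simp [imFn]

theorem extDerivOne_etaIm_one (m : M) (u u' : TangentSpace 𝓘(ℝ, E) m) :
    extDerivOne (D.etaIm 1) m u u' = -2 * D.hk.omega 2 m u u' := by
  rw [extDerivOne_etaIm]
  simp [imFn]
  ring

theorem extDerivOne_etaIm_two (m : M) (u u' : TangentSpace 𝓘(ℝ, E) m) :
    extDerivOne (D.etaIm 2) m u u' = 2 * D.hk.omega 1 m u u' := by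
  rw [extDerivOne_etaIm]
  simp [imFn]
  ring

theorem iddbar_rho (m : M) (u u' : TangentSpace 𝓘(ℝ, E) m) :
    D.hk.iddbar 0 D.rho m u u' = -(1 / 2) * extDerivOne D.etaRe m u u' := by
  have h : (fun m => (mvfderiv 𝓘(ℝ, E) D.rho m).comp (D.hk.J 0 m)) = D.etaRe := by
    funext m
    ext u
    rw [ContinuousLinearMap.comp_apply, D.isMomentumMap.deriv_eq, HyperkahlerStructure.omega,
      D.hk.J_sq, map_neg, neg_neg]
    rfl
  rw [HyperkahlerStructure.iddbar, h]

theorem curvatureEquation_iff : D.CurvatureEquation ↔ ∀ (p : P) (u u' : TangentSpace 𝓘(ℝ, F) p),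
    extDerivOne D.xi p u u' + 1 / 2 * extDerivOne D.etaRe (D.proj p)
        (mfderiv 𝓘(ℝ, F) 𝓘(ℝ, E) D.proj p u) (mfderiv 𝓘(ℝ, F) 𝓘(ℝ, E) D.proj p u')
      + D.hk.omega 0 (D.proj p) (mfderiv 𝓘(ℝ, F) 𝓘(ℝ, E) D.proj p u)
        (mfderiv 𝓘(ℝ, F) 𝓘(ℝ, E) D.proj p u') = 0 := by
  refine forall_congr' fun p => forall_congr' fun u => forall_congr' fun u' => ?_
  beta_reduce
  rw [iddbar_rho]
  constructor <;> intro h <;> linarith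

end Base

section Plots

theorem dx_apply (z : (ℍ[ℝ])ˣ × P) (a : ℍ[ℝ] × F) : dx (F := F) z a = a.1 := by
  have h := HasMFDerivAt.comp z (hasMFDerivAt_units_val z.1)
    (hasMFDerivAt_fst (I := 𝓘(ℝ, ℍ[ℝ])) (I' := 𝓘(ℝ, F)) (x := z))
  exact DFunLike.congr_fun h.mfderiv a

theorem toTP_apply (z : (ℍ[ℝ])ˣ × P) (a : ℍ[ℝ] × F) : (toTP (F := F) z a : F) = a.2 :=
  DFunLike.congr_fun (hasMFDerivAt_snd (I := 𝓘(ℝ, ℍ[ℝ])) (I' := 𝓘(ℝ, F)) (x := z)).mfderiv a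

variable {Z : V → (ℍ[ℝ])ˣ × P} {y : V}

theorem contDiffAt_fst_plot (hZ : ContMDiffAt 𝓘(ℝ, V) (𝓘(ℝ, ℍ[ℝ]).prod 𝓘(ℝ, F)) ∞ Z y) :
    ContDiffAt ℝ ∞ (fun y => ((Z y).1 : ℍ[ℝ])) y := by
  have h1 : ContMDiffAt 𝓘(ℝ, V) 𝓘(ℝ, ℍ[ℝ]) ∞ (fun y => (Z y).1) y := hZ.fst
  exact (ContMDiffAt.comp (g := (Units.val : (ℍ[ℝ])ˣ → ℍ[ℝ])) y
    (Units.contMDiff_val _) h1).contDiffAt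

theorem contMDiffAt_snd_plot (hZ : ContMDiffAt 𝓘(ℝ, V) (𝓘(ℝ, ℍ[ℝ]).prod 𝓘(ℝ, F)) ∞ Z y) :
    ContMDiffAt 𝓘(ℝ, V) 𝓘(ℝ, F) ∞ (fun y => (Z y).2) y := hZ.snd

theorem contMDiffAt_proj_plot (hZ : ContMDiffAt 𝓘(ℝ, V) (𝓘(ℝ, ℍ[ℝ]).prod 𝓘(ℝ, F)) ∞ Z y) :
    ContMDiffAt 𝓘(ℝ, V) 𝓘(ℝ, E) ∞ (fun y => D.proj (Z y).2) y :=
  ContMDiffAt.comp (g := D.proj) y (D.isPrincipal.contMDiff _) (contMDiffAt_snd_plot hZ)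

theorem dx_plot (hZ : ContMDiffAt 𝓘(ℝ, V) (𝓘(ℝ, ℍ[ℝ]).prod 𝓘(ℝ, F)) ∞ Z y) (a : V) :
    dx (F := F) (Z y) (mfderiv 𝓘(ℝ, V) (𝓘(ℝ, ℍ[ℝ]).prod 𝓘(ℝ, F)) Z y a)
      = fderiv ℝ (fun y => ((Z y).1 : ℍ[ℝ])) y a := by
  have h1 : HasMFDerivAt (𝓘(ℝ, ℍ[ℝ]).prod 𝓘(ℝ, F)) 𝓘(ℝ, ℍ[ℝ])
      (fun z : (ℍ[ℝ])ˣ × P => (z.1 : ℍ[ℝ])) (Z y) (ContinuousLinearMap.fst ℝ ℍ[ℝ] F) :=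
    HasMFDerivAt.comp (Z y) (hasMFDerivAt_units_val (Z y).1) (hasMFDerivAt_fst (x := Z y))
  have h2 := HasMFDerivAt.comp y h1 (hZ.mdifferentiableAt (by simp)).hasMFDerivAt
  let DZ : V →L[ℝ] ℍ[ℝ] × F := mfderiv 𝓘(ℝ, V) (𝓘(ℝ, ℍ[ℝ]).prod 𝓘(ℝ, F)) Z y
  have h3 : HasFDerivAt (fun y => ((Z y).1 : ℍ[ℝ])) ((ContinuousLinearMap.fst ℝ ℍ[ℝ] F).comp DZ) y :=
    hasMFDerivAt_iff_hasFDerivAt.1 h2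
  refine (dx_apply (Z y) _).trans ?_
  rw [h3.fderiv]
  rfl

theorem toTP_plot (hZ : ContMDiffAt 𝓘(ℝ, V) (𝓘(ℝ, ℍ[ℝ]).prod 𝓘(ℝ, F)) ∞ Z y) (a : V) :
    toTP (F := F) (Z y) (mfderiv 𝓘(ℝ, V) (𝓘(ℝ, ℍ[ℝ]).prod 𝓘(ℝ, F)) Z y a)
      = plotD (E := F) (fun y => (Z y).2) y a := by
  have h2 := HasMFDerivAt.comp y (hasMFDerivAt_snd (I := 𝓘(ℝ, ℍ[ℝ])) (I' := 𝓘(ℝ, F)) (x := Z y))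
    (hZ.mdifferentiableAt (by simp)).hasMFDerivAt
  refine (toTP_apply (Z y) _).trans ?_
  exact (DFunLike.congr_fun h2.mfderiv a).symm

theorem toTM_plot (hZ : ContMDiffAt 𝓘(ℝ, V) (𝓘(ℝ, ℍ[ℝ]).prod 𝓘(ℝ, F)) ∞ Z y) (a : V) :
    D.toTM (Z y) (mfderiv 𝓘(ℝ, V) (𝓘(ℝ, ℍ[ℝ]).prod 𝓘(ℝ, F)) Z y a)
      = plotD (E := E) (fun y => D.proj (Z y).2) y a := by
  rw [toTM, toTP_plot hZ]
  have h2 := HasMFDerivAt.comp y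
    ((D.isPrincipal.contMDiff (Z y).2).mdifferentiableAt (by simp)).hasMFDerivAt
    ((contMDiffAt_snd_plot hZ).mdifferentiableAt (by simp)).hasMFDerivAt
  exact (DFunLike.congr_fun h2.mfderiv a).symm

theorem metricHP_eq (z : (ℍ[ℝ])ˣ × P) (a b : TangentHP (F := F) z) :
    D.metricHP z a b = metricF (-2 * D.rho (D.proj z.2)) (D.v (D.proj z.2)) z.1 (dx z a) (dx z b)
      (D.xiHP z a) (D.xiHP z b) (D.etaHP z a) (D.etaHP z b)
      (D.hk.metric.inner (D.proj z.2) (D.toTM z a) (D.toTM z b)) := by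
  rw [← four_v_add_w]
  rfl

theorem omegaHP_eq (z : (ℍ[ℝ])ˣ × P) (a b : TangentHP (F := F) z) :
    D.omegaHP z a b = omegaF (-2 * D.rho (D.proj z.2)) z.1 (dx z a) (dx z b)
      (D.xiHP z a) (D.xiHP z b) (D.etaHP z a) (D.etaHP z b)
      (D.hk.omegaQ (D.proj z.2) (D.toTM z a) (D.toTM z b)) := by
  rw [← four_v_add_w]
  rfl

end Plots

end InductionData

namespace InductionData

variable {E : Type*} [NormedAddCommGroup E] [NormedSpace ℝ E] [FiniteDimensional ℝ E]
  {M : Type*} [TopologicalSpace M] [ChartedSpace E M] [IsManifold 𝓘(ℝ, E) ∞ M]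
  {F : Type*} [NormedAddCommGroup F] [NormedSpace ℝ F] [FiniteDimensional ℝ F]
  {P : Type*} [TopologicalSpace P] [ChartedSpace F P] [IsManifold 𝓘(ℝ, F) ∞ P]
  (D : InductionData E M F P)
  {V : Type*} [NormedAddCommGroup V] [NormedSpace ℝ V] [FiniteDimensional ℝ V]

section Closedness

theorem contDiffAt_eta {φ : V → M} {y : V} (hφ : ContMDiffAt 𝓘(ℝ, V) 𝓘(ℝ, E) ∞ φ y) (a : V) :
    ContDiffAt ℝ ∞ (fun y => D.eta (φ y) (plotD φ y a)) y := by
  refine contDiffAt_quaternion ?_ fun r => ?_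
  · simp only [eta_re]
    exact (contDiffAt_pullOne D.smoothOne_etaRe hφ).clm_apply (contDiffAt_const (c := a))
  · simp only [eta_imFn]
    exact (contDiffAt_pullOne (D.smoothOne_etaIm r) hφ).clm_apply (contDiffAt_const (c := a))

theorem contDiffAt_omegaQ (S : HyperkahlerStructure E M) {φ : V → M} {y : V}
    (hφ : ContMDiffAt 𝓘(ℝ, V) 𝓘(ℝ, E) ∞ φ y) (a b : V) :
    ContDiffAt ℝ ∞ (fun y => S.omegaQ (φ y) (plotD φ y a) (plotD φ y b)) y := by
  refine contDiffAt_quaternion ?_ fun r => ?_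
  · simp only [omegaQ_re]
    exact contDiffAt_const
  · simp only [imFn_omegaQ]
    exact contDiffAt_pullTwo (S.smoothTwo_omegaL r) hφ a b

variable {Z : V → (ℍ[ℝ])ˣ × P} {y : V}

/-- The pull-back by a plot of the contraction of `omegaHP` with the radial vector field. -/
def betaPlot (Z : V → (ℍ[ℝ])ˣ × P) (y a : V) : ℍ[ℝ] :=
  betaF (-2 * D.rho (D.proj (Z y).2)) (Z y).1 (fderiv ℝ (fun y => ((Z y).1 : ℍ[ℝ])) y a)
    (D.xi (Z y).2 (plotD (fun y => (Z y).2) y a))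
    (D.eta (D.proj (Z y).2) (plotD (fun y => D.proj (Z y).2) y a))

theorem omegaHP_plot (hZ : ContMDiffAt 𝓘(ℝ, V) (𝓘(ℝ, ℍ[ℝ]).prod 𝓘(ℝ, F)) ∞ Z y) (a b : V) :
    D.omegaHP (Z y) (mfderiv 𝓘(ℝ, V) (𝓘(ℝ, ℍ[ℝ]).prod 𝓘(ℝ, F)) Z y a)
        (mfderiv 𝓘(ℝ, V) (𝓘(ℝ, ℍ[ℝ]).prod 𝓘(ℝ, F)) Z y b)
      = omegaF (-2 * D.rho (D.proj (Z y).2)) (Z y).1 (fderiv ℝ (fun y => ((Z y).1 : ℍ[ℝ])) y a)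
        (fderiv ℝ (fun y => ((Z y).1 : ℍ[ℝ])) y b)
        (D.xi (Z y).2 (plotD (fun y => (Z y).2) y a)) (D.xi (Z y).2 (plotD (fun y => (Z y).2) y b))
        (D.eta (D.proj (Z y).2) (plotD (fun y => D.proj (Z y).2) y a))
        (D.eta (D.proj (Z y).2) (plotD (fun y => D.proj (Z y).2) y b))
        (D.hk.omegaQ (D.proj (Z y).2) (plotD (fun y => D.proj (Z y).2) y a)
          (plotD (fun y => D.proj (Z y).2) y b)) := by
  rw [omegaHP_eq, xiHP, xiHP, etaHP, etaHP, dx_plot hZ, dx_plot hZ, D.toTM_plot hZ, D.toTM_plot hZ,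
    toTP_plot hZ, toTP_plot hZ]

theorem metricHP_plot (hZ : ContMDiffAt 𝓘(ℝ, V) (𝓘(ℝ, ℍ[ℝ]).prod 𝓘(ℝ, F)) ∞ Z y) (a b : V) :
    D.metricHP (Z y) (mfderiv 𝓘(ℝ, V) (𝓘(ℝ, ℍ[ℝ]).prod 𝓘(ℝ, F)) Z y a)
        (mfderiv 𝓘(ℝ, V) (𝓘(ℝ, ℍ[ℝ]).prod 𝓘(ℝ, F)) Z y b)
      = metricF (-2 * D.rho (D.proj (Z y).2)) (D.v (D.proj (Z y).2)) (Z y).1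
        (fderiv ℝ (fun y => ((Z y).1 : ℍ[ℝ])) y a) (fderiv ℝ (fun y => ((Z y).1 : ℍ[ℝ])) y b)
        (D.xi (Z y).2 (plotD (fun y => (Z y).2) y a)) (D.xi (Z y).2 (plotD (fun y => (Z y).2) y b))
        (D.eta (D.proj (Z y).2) (plotD (fun y => D.proj (Z y).2) y a))
        (D.eta (D.proj (Z y).2) (plotD (fun y => D.proj (Z y).2) y b))
        (D.hk.metric.inner (D.proj (Z y).2) (plotD (fun y => D.proj (Z y).2) y a)
          (plotD (fun y => D.proj (Z y).2) y b)) := by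
  rw [metricHP_eq, xiHP, xiHP, etaHP, etaHP, dx_plot hZ, dx_plot hZ, D.toTM_plot hZ, D.toTM_plot hZ,
    toTP_plot hZ, toTP_plot hZ]

theorem contDiffAt_comp_plot {f : M → ℝ} (hf : ContMDiff 𝓘(ℝ, E) 𝓘(ℝ, ℝ) ∞ f) {φ : V → M} {y : V}
    (hφ : ContMDiffAt 𝓘(ℝ, V) 𝓘(ℝ, E) ∞ φ y) : ContDiffAt ℝ ∞ (fun y => f (φ y)) y :=
  (ContMDiffAt.comp (g := f) y (hf _) hφ).contDiffAt

theorem contDiffAt_betaPlot (hZ : ContMDiffAt 𝓘(ℝ, V) (𝓘(ℝ, ℍ[ℝ]).prod 𝓘(ℝ, F)) ∞ Z y) (a : V) :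
    ContDiffAt ℝ ∞ (fun y => D.betaPlot Z y a) y :=
  contDiffAt_betaF ((contDiffAt_const (c := (-2 : ℝ))).mul
      (contDiffAt_comp_plot D.isMomentumMap.contMDiff (D.contMDiffAt_proj_plot hZ)))
    (contDiffAt_fst_plot hZ) (contDiffAt_fderiv_apply (contDiffAt_fst_plot hZ) a)
    ((contDiffAt_pullOne D.smoothOne_xi (contMDiffAt_snd_plot hZ)).clm_apply
      (contDiffAt_const (c := a)))
    (D.contDiffAt_eta (D.contMDiffAt_proj_plot hZ) a)

theorem contDiffAt_omegaHP (hZ : ∀ᶠ y' in 𝓝 y, ContMDiffAt 𝓘(ℝ, V) (𝓘(ℝ, ℍ[ℝ]).prod 𝓘(ℝ, F)) ∞ Z y')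
    (a b : V) : ContDiffAt ℝ ∞ (fun y =>
      D.omegaHP (Z y) (mfderiv 𝓘(ℝ, V) (𝓘(ℝ, ℍ[ℝ]).prod 𝓘(ℝ, F)) Z y a)
        (mfderiv 𝓘(ℝ, V) (𝓘(ℝ, ℍ[ℝ]).prod 𝓘(ℝ, F)) Z y b)) y := by
  have hZ0 := hZ.self_of_nhds
  refine ContDiffAt.congr_of_eventuallyEq ?_ (hZ.mono fun y' h => D.omegaHP_plot h a b)
  have hT := (contDiffAt_const (c := (-2 : ℝ))).mul
      (contDiffAt_comp_plot D.isMomentumMap.contMDiff (D.contMDiffAt_proj_plot hZ0))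
  have hX := contDiffAt_fst_plot hZ0
  have hc := fun a => contDiffAt_fderiv_apply hX a
  have hξ : ∀ a, ContDiffAt ℝ ∞ (fun y => D.xi (Z y).2 (plotD (fun y => (Z y).2) y a)) y := fun a =>
    (contDiffAt_pullOne D.smoothOne_xi (contMDiffAt_snd_plot hZ0)).clm_apply
      (contDiffAt_const (c := a))
  have hη := fun a => D.contDiffAt_eta (D.contMDiffAt_proj_plot hZ0) a
  have hom := contDiffAt_omegaQ D.hk (D.contMDiffAt_proj_plot hZ0) a b
  have hXs := ContDiffAt.qstar hX
  have him : ∀ {f : V → ℍ[ℝ]}, ContDiffAt ℝ ∞ f y → ContDiffAt ℝ ∞ (fun y => (f y).im) y := by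
    intro f hf
    refine contDiffAt_quaternion (by simpa using contDiffAt_const) fun r => ?_
    have : (fun y => imFn r (f y).im) = fun y => imC r (f y) := by
      funext y; fin_cases r <;> simp [imC_apply, imFn]
    rw [this]
    exact (imC r).contDiff.contDiffAt.comp y hf
  have hqi : ∀ a, ContDiffAt ℝ ∞ (fun y => fderiv ℝ (fun y => ((Z y).1 : ℍ[ℝ])) y a * qi) y :=
    fun a => (hc a).mul contDiffAt_const
  exact ((((hT.div_const 2).smul (((hc a).mul (ContDiffAt.qstar (hc b))).sub
    ((hc b).mul (ContDiffAt.qstar (hc a))))).add ((hX.mul hom).mul hXs)).sub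
    ((((hξ b).smul (him ((hqi a).mul hXs))).sub
      ((hξ a).smul (him ((hqi b).mul hXs)))).const_smul _)).sub
    (him ((((hqi a).mul (hη b)).mul hXs).sub (((hqi b).mul (hη a)).mul hXs)))

theorem contDiffAt_metricHP (hv : ∀ m, D.v m ≠ 0)
    (hZ : ∀ᶠ y' in 𝓝 y, ContMDiffAt 𝓘(ℝ, V) (𝓘(ℝ, ℍ[ℝ]).prod 𝓘(ℝ, F)) ∞ Z y')
    (a b : V) : ContDiffAt ℝ ∞ (fun y =>
      D.metricHP (Z y) (mfderiv 𝓘(ℝ, V) (𝓘(ℝ, ℍ[ℝ]).prod 𝓘(ℝ, F)) Z y a)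
        (mfderiv 𝓘(ℝ, V) (𝓘(ℝ, ℍ[ℝ]).prod 𝓘(ℝ, F)) Z y b)) y := by
  have hZ0 := hZ.self_of_nhds
  refine ContDiffAt.congr_of_eventuallyEq ?_ (hZ.mono fun y' h => D.metricHP_plot h a b)
  have hT := (contDiffAt_const (c := (-2 : ℝ))).mul
      (contDiffAt_comp_plot D.isMomentumMap.contMDiff (D.contMDiffAt_proj_plot hZ0))
  have hvv := (contDiffAt_comp_plot D.contMDiff_v (D.contMDiffAt_proj_plot hZ0)).inv (hv _)
  have hX := contDiffAt_fst_plot hZ0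
  have hc := fun a => contDiffAt_fderiv_apply hX a
  have hξ : ∀ a, ContDiffAt ℝ ∞ (fun y => D.xi (Z y).2 (plotD (fun y => (Z y).2) y a)) y := fun a =>
    (contDiffAt_pullOne D.smoothOne_xi (contMDiffAt_snd_plot hZ0)).clm_apply
      (contDiffAt_const (c := a))
  have hη := fun a => D.contDiffAt_eta (D.contMDiffAt_proj_plot hZ0) a
  have hg : ContDiffAt ℝ ∞ _ y :=
    contDiffAt_pullTwo D.hk.smoothTwo_metric (D.contMDiffAt_proj_plot hZ0) a b
  have hXs := ContDiffAt.qstar hX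
  have hre : ∀ {f : V → ℍ[ℝ]}, ContDiffAt ℝ ∞ f y → ContDiffAt ℝ ∞ (fun y => (f y).re) y :=
    fun hf => reC.contDiff.contDiffAt.comp y hf
  have hco : ∀ a, ContDiffAt ℝ ∞ (fun y =>
      ((2 * D.xi (Z y).2 (plotD (fun y => (Z y).2) y a) : ℝ) : ℍ[ℝ])
        + D.eta (D.proj (Z y).2) (plotD (fun y => D.proj (Z y).2) y a)) y := fun a => by
    refine ContDiffAt.add ?_ (hη a)
    refine contDiffAt_quaternion (by simpa using contDiffAt_const.mul (hξ a)) fun r => ?_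
    fin_cases r <;> simpa [imFn] using contDiffAt_const
  exact ((hT.mul (hre ((hc a).mul (ContDiffAt.qstar (hc b))))).sub
    (hre ((((hXs.mul (hc a)).mul contDiffAt_const).mul (hco b)).add
      (((hXs.mul (hc b)).mul contDiffAt_const).mul (hco a))))).add
    ((hX.norm_sq ℝ).mul (hg.add (hvv.mul ((hξ a).mul (hξ b)))))

theorem dOne_betaPlot (hcurv : D.CurvatureEquation)
    (hZ : ContMDiffAt 𝓘(ℝ, V) (𝓘(ℝ, ℍ[ℝ]).prod 𝓘(ℝ, F)) ∞ Z y) (r : Fin 3) (a b : V) :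
    dOne (fun y a => imFn r (D.betaPlot Z y a)) y a b = 2 * imFn r (D.omegaHP (Z y)
      (mfderiv 𝓘(ℝ, V) (𝓘(ℝ, ℍ[ℝ]).prod 𝓘(ℝ, F)) Z y a)
      (mfderiv 𝓘(ℝ, V) (𝓘(ℝ, ℍ[ℝ]).prod 𝓘(ℝ, F)) Z y b)) := by
  have hφ := D.contMDiffAt_proj_plot hZ
  have hcurv := D.curvatureEquation_iff.1 hcurv (Z y).2
  have hd : ∀ r, dOne (fun y a => imFn r (D.eta (D.proj (Z y).2)
      (plotD (fun y => D.proj (Z y).2) y a))) y a b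
      = extDerivOne (D.etaIm r) (D.proj (Z y).2) (plotD (fun y => D.proj (Z y).2) y a)
        (plotD (fun y => D.proj (Z y).2) y b) := fun r => by
    simp only [eta_imFn]
    exact dOne_pullOne (D.smoothOne_etaIm r) hφ a b
  have hD : ∀ a, mfderiv 𝓘(ℝ, F) 𝓘(ℝ, E) D.proj (Z y).2 (plotD (fun y => (Z y).2) y a)
      = plotD (E := E) (fun y => D.proj (Z y).2) y a := fun a => by
    rw [← D.toTM_plot hZ, toTM, toTP_plot hZ]
  rw [D.omegaHP_plot hZ]
  refine dOne_betaF (contDiffAt_fst_plot hZ) ((contDiffAt_const (c := (-2 : ℝ))).mul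
      (contDiffAt_comp_plot D.isMomentumMap.contMDiff hφ))
    (fun a => (contDiffAt_pullOne D.smoothOne_xi (contMDiffAt_snd_plot hZ)).clm_apply
      (contDiffAt_const (c := a))) (D.contDiffAt_eta hφ) a b (fun a => ?_) (omegaQ_re _ _ _ _) ?_ ?_
      ?_ ?_ r
  · rw [fderiv_const_mul (contDiffAt_comp_plot D.isMomentumMap.contMDiff hφ |>.differentiableAt
      (by simp)), smul_apply, fderiv_comp_plot (f := D.rho) (φ := fun y => D.proj (Z y).2)
      ((D.isMomentumMap.contMDiff _).mdifferentiableAt (by simp)) (hφ.mdifferentiableAt (by simp)),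
      D.isMomentumMap.deriv_eq]
    have := D.eta_imFn 0 (D.proj (Z y).2) (plotD (fun y => D.proj (Z y).2) y a)
    simp only [imFn, Matrix.cons_val_zero] at this
    rw [this, smul_eq_mul, etaIm, HyperkahlerStructure.omegaL_apply, Kr]
    ring
  · have e1 : dOne (fun y a => pullOne D.xi (fun y => (Z y).2) y a) y a b
        = extDerivOne D.xi (Z y).2 (plotD (fun y => (Z y).2) y a) (plotD (fun y => (Z y).2) y b) :=
      dOne_pullOne D.smoothOne_xi (contMDiffAt_snd_plot hZ) a b
    have e2 : dOne (fun y a => (D.eta (D.proj (Z y).2) (plotD (fun y => D.proj (Z y).2) y a)).re) y a b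
        = extDerivOne D.etaRe (D.proj (Z y).2) (plotD (fun y => D.proj (Z y).2) y a)
          (plotD (fun y => D.proj (Z y).2) y b) := by
      simp only [eta_re]
      exact dOne_pullOne D.smoothOne_etaRe hφ a b
    rw [e1, e2, omegaQ_imI, ← hD, ← hD]
    exact hcurv _ _
  · rw [hd, extDerivOne_etaIm_zero]
  · rw [hd, extDerivOne_etaIm_one, omegaQ_imK]
  · rw [hd, extDerivOne_etaIm_two, omegaQ_imJ]

/-- The form `omegaHP` is closed. -/
theorem dTwo_omegaHP (hcurv : D.CurvatureEquation)
    (hZ : ∀ᶠ y' in 𝓝 y, ContMDiffAt 𝓘(ℝ, V) (𝓘(ℝ, ℍ[ℝ]).prod 𝓘(ℝ, F)) ∞ Z y') (r : Fin 3)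
    (a b c : V) :
    dTwo (fun y a b => imFn r (D.omegaHP (Z y)
      (mfderiv 𝓘(ℝ, V) (𝓘(ℝ, ℍ[ℝ]).prod 𝓘(ℝ, F)) Z y a)
      (mfderiv 𝓘(ℝ, V) (𝓘(ℝ, ℍ[ℝ]).prod 𝓘(ℝ, F)) Z y b))) y a b c = 0 := by
  have hB : ∀ {y}, ContMDiffAt 𝓘(ℝ, V) (𝓘(ℝ, ℍ[ℝ]).prod 𝓘(ℝ, F)) ∞ Z y → ∀ a,
      ContDiffAt ℝ ∞ (fun y => imFn r (D.betaPlot Z y a)) y := fun h a =>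
    (imC r).contDiff.contDiffAt.comp _ (D.contDiffAt_betaPlot h a)
  rw [dTwo_congr (B' := dOne (fun y a => 1 / 2 * imFn r (D.betaPlot Z y a)))
    (hZ.mono fun y h a b => ?_)]
  · exact dTwo_dOne (fun a => contDiffAt_const.mul (hB hZ.self_of_nhds a)) a b c
  · have h1 := D.dOne_betaPlot hcurv h r a b
    simp only [dOne] at h1 ⊢
    rw [fderiv_const_mul ((hB h b).differentiableAt (by simp)),
      fderiv_const_mul ((hB h a).differentiableAt (by simp)), smul_apply, smul_apply, smul_eq_mul,
      smul_eq_mul]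
    linarith

end Closedness

end InductionData

section Hermitian

/-- The quaternions `i`, `j`, `k`. -/
def unitQ (r : Fin 3) : ℍ[ℝ] := ![qi, qj, qk] r

theorem re_mul_star_unitQ (r : Fin 3) (q : ℍ[ℝ]) : (q * star (unitQ r)).re = imFn r q := by
  fin_cases r <;> simp [unitQ, imFn]

theorem mul_star_unitQ_sq (r : Fin 3) (q : ℍ[ℝ]) : q * star (unitQ r) * star (unitQ r) = -q := by
  fin_cases r <;> ext <;> simp [unitQ]

theorem re_unitQ_conj (r : Fin 3) (q : ℍ[ℝ]) : (unitQ r * q * star (unitQ r)).re = q.re := by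
  fin_cases r <;> simp [unitQ]

theorem star_qj_mul_star_qi : star qj * star qi = star qk := by ext <;> simp

theorem star_qi_mul_star_qj : star qi * star qj = -star qk := by ext <;> simp

variable {V : Type*} [NormedAddCommGroup V] [NormedSpace ℝ V] [FiniteDimensional ℝ V]
  {H : Type*} [TopologicalSpace H] {I : ModelWithCorners ℝ V H} [I.Boundaryless]
  {Q : Type*} [TopologicalSpace Q] [ChartedSpace H Q] [IsManifold I ∞ Q]
  {E' : Type*} [NormedAddCommGroup E'] [NormedSpace ℝ E'] [FiniteDimensional ℝ E']
  {N : Type*} [TopologicalSpace N] [ChartedSpace E' N] [IsManifold 𝓘(ℝ, E') ∞ N] {q : Q → N}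

/-- A hyperKähler structure on the base of a submersion from a basic quaternionic-hermitian form
with closed imaginary part. -/
theorem exists_hyperkahler_of_hermitian (hq : ContMDiff I 𝓘(ℝ, E') ∞ q)
    (hsurj : Function.Surjective q)
    (hsub : ∀ z, Function.Surjective (mfderiv I 𝓘(ℝ, E') q z))
    (h : Q → V →ₗ[ℝ] V →ₗ[ℝ] ℍ[ℝ]) (hstar : ∀ z a b, h z b a = star (h z a b))
    (hJ : ∀ r z b, ∃ c, ∀ a, h z a c = h z a b * star (unitQ r))
    (hpos : ∀ z (a : V), (mfderiv I 𝓘(ℝ, E') q z : V →L[ℝ] E') a ≠ 0 → 0 < (h z a a).re)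
    (hinv : ∀ z z' (a b a' b' : V), q z = q z' →
      (mfderiv I 𝓘(ℝ, E') q z : V →L[ℝ] E') a = (mfderiv I 𝓘(ℝ, E') q z' : V →L[ℝ] E') a' →
      (mfderiv I 𝓘(ℝ, E') q z : V →L[ℝ] E') b = (mfderiv I 𝓘(ℝ, E') q z' : V →L[ℝ] E') b' →
      h z a b = h z' a' b')
    (hsm : ∀ (Z : E' → Q) y, (∀ᶠ y' in 𝓝 y, ContMDiffAt 𝓘(ℝ, E') I ∞ Z y') → ∀ a b,
      ContDiffAt ℝ ∞ (fun y => h (Z y) ((mfderiv 𝓘(ℝ, E') I Z y : E' →L[ℝ] V) a)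
        ((mfderiv 𝓘(ℝ, E') I Z y : E' →L[ℝ] V) b)) y)
    (hd : ∀ r (Z : E' → Q) y, (∀ᶠ y' in 𝓝 y, ContMDiffAt 𝓘(ℝ, E') I ∞ Z y') → ∀ a b c,
      dTwo (fun y a b => imFn r (h (Z y) ((mfderiv 𝓘(ℝ, E') I Z y : E' →L[ℝ] V) a)
        ((mfderiv 𝓘(ℝ, E') I Z y : E' →L[ℝ] V) b))) y a b c = 0) :
    ∃ S : HyperkahlerStructure E' N, ∀ (z : Q) (a b : V),
      S.metric.inner (q z) ((mfderiv I 𝓘(ℝ, E') q z : V →L[ℝ] E') a)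
        ((mfderiv I 𝓘(ℝ, E') q z : V →L[ℝ] E') b) = (h z a b).re ∧
      ∀ r, S.omega r (q z) ((mfderiv I 𝓘(ℝ, E') q z : V →L[ℝ] E') a)
        ((mfderiv I 𝓘(ℝ, E') q z : V →L[ℝ] E') b) = imFn r (h z a b) := by
  choose j hj using hJ
  let bs := Module.finBasis ℝ V
  let J : Fin 3 → Q → V →ₗ[ℝ] V := fun r z => bs.constr ℝ fun i => j r z (bs i)
  have hJ : ∀ r z a b, h z a (J r z b) = h z a b * star (unitQ r) := by
    intro r z a b
    have : (h z a) ∘ₗ J r z = (LinearMap.mulRight ℝ (star (unitQ r))) ∘ₗ h z a := by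
      refine bs.ext fun i => ?_
      simp [J, hj]
    exact LinearMap.congr_fun this b
  have hJ' : ∀ r z a b, h z (J r z a) b = unitQ r * h z a b := by
    intro r z a b
    rw [hstar, hJ, star_mul, star_star, ← hstar]
  let G : Q → V →ₗ[ℝ] V →ₗ[ℝ] ℝ := fun z => (h z).compr₂ reC.toLinearMap
  have hG : ∀ z a b, G z a b = (h z a b).re := fun z a b => rfl
  have hGJ : ∀ r z a b, G z a (J r z b) = imFn r (h z a b) := fun r z a b => by
    rw [hG, hJ, re_mul_star_unitQ]
  obtain ⟨S, hS⟩ := exists_hyperkahler_of_submersion hq hsurj hsub G J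
    (fun z a b => by rw [hG, hG, hstar]; simp)
    (fun z a ha => hpos z a ha)
    (fun z z' a b a' b' h1 h2 h3 => by
      have := hinv z z' a b a' b' h1 h2 h3
      exact ⟨congrArg reC this,
        fun r => (hGJ r z a b).trans ((congrArg (imFn r) this).trans (hGJ r z' a' b').symm)⟩)
    (fun r z a b => by rw [hG, hJ, hJ, mul_star_unitQ_sq, hG]; rfl)
    (fun z a b => by
      rw [hG, hJ, hJ, hG, hJ, mul_assoc]
      congr 2
      exact star_qj_mul_star_qi)
    (fun z a b => by
      rw [hG, hJ, hJ, hG, hJ, mul_assoc]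
      have : star (unitQ 0) * star (unitQ 1) = - star (unitQ 2) := star_qi_mul_star_qj
      rw [this, mul_neg]
      rfl)
    (fun r z a b => by rw [hG, hG, hJ, hJ', re_unitQ_conj])
    (fun Z y hZ a b => reC.contDiff.contDiffAt.comp y (hsm Z y hZ a b))
    (fun r Z y hZ a b => ((imC r).contDiff.contDiffAt.comp y (hsm Z y hZ a b)).congr_of_eventuallyEq
      (Eventually.of_forall fun y => hGJ r (Z y) _ _))
    (fun r Z y hZ a b c => (dTwo_congr (Eventually.of_forall fun y a b => hGJ r (Z y) _ _) a b
      c).trans (hd r Z y hZ a b c))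
  exact ⟨S, fun z a b => ⟨(hS z a b).1, fun r => ((hS z a b).2 r).trans (hGJ r z a b)⟩⟩

end Hermitian

namespace HyperkahlerStructure

variable {E : Type*} [NormedAddCommGroup E] [NormedSpace ℝ E] [FiniteDimensional ℝ E]
  {M : Type*} [TopologicalSpace M] [ChartedSpace E M] [IsManifold 𝓘(ℝ, E) ∞ M]
  (S : HyperkahlerStructure E M)

/-- The quaternionic-hermitian form `g + ω`. -/
def herm (m : M) (u v : TangentSpace 𝓘(ℝ, E) m) : ℍ[ℝ] :=
  (S.metric.inner m u v : ℍ[ℝ]) + S.omegaQ m u v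

/-- Multiplication of tangent vectors by quaternions. -/
def qsmul (m : M) (c : ℍ[ℝ]) (u : TangentSpace 𝓘(ℝ, E) m) : TangentSpace 𝓘(ℝ, E) m :=
  c.re • u + c.imI • S.J 0 m u + c.imJ • S.J 1 m u + c.imK • S.J 2 m u

variable (m : M) (u v w : TangentSpace 𝓘(ℝ, E) m)

@[simp] theorem herm_re : (S.herm m u v).re = S.metric.inner m u v := by simp [herm]
@[simp] theorem herm_imI : (S.herm m u v).imI = S.metric.inner m u (S.J 0 m v) := by
  simp [herm, omega]
@[simp] theorem herm_imJ : (S.herm m u v).imJ = S.metric.inner m u (S.J 1 m v) := by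
  simp [herm, omega]
@[simp] theorem herm_imK : (S.herm m u v).imK = S.metric.inner m u (S.J 2 m v) := by
  simp [herm, omega]

theorem imFn_herm (r : Fin 3) : imFn r (S.herm m u v) = S.omega r m u v := by
  fin_cases r <;> simp [imFn, omega]

theorem herm_im : (S.herm m u v).im = S.omegaQ m u v := by
  simp [herm, Quaternion.im_add]
  ext <;> simp

theorem J_mul_J (m : M) (u : TangentSpace 𝓘(ℝ, E) m) :
    S.J 1 m (S.J 2 m u) = S.J 0 m u ∧ S.J 2 m (S.J 1 m u) = - S.J 0 m u ∧
    S.J 2 m (S.J 0 m u) = S.J 1 m u ∧ S.J 0 m (S.J 2 m u) = - S.J 1 m u := by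
  refine ⟨?_, ?_, ?_, ?_⟩
  · have h := S.J_mul_swap m (S.J 1 m u)
    rw [S.J_mul] at h
    rw [h, ← S.J_mul, S.J_sq, map_neg, neg_neg]
  · rw [← S.J_mul, S.J_sq, map_neg]
  · have h := S.J_mul_swap m (S.J 0 m u)
    rw [S.J_sq, map_neg] at h
    exact (neg_injective h).symm
  · rw [← S.J_mul, S.J_sq]

theorem star_herm : star (S.herm m u v) = S.herm m v u := by
  ext
  · simpa using S.metric.symm m u v
  all_goals
    simp only [Quaternion.imI_star, Quaternion.imJ_star, Quaternion.imK_star, herm_imI, herm_imJ,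
      herm_imK]
    exact (S.omega_skew _ m v u).symm

theorem herm_J (r : Fin 3) : S.herm m u (S.J r m v) = S.herm m u v * star (unitQ r) := by
  obtain ⟨h1, h2, h3, h4⟩ := S.J_mul_J m v
  fin_cases r <;> ext <;>
    simp [unitQ, S.J_sq, S.J_mul, S.J_mul_swap, h1, h2, h3, h4]

theorem herm_add_right : S.herm m u (v + w) = S.herm m u v + S.herm m u w := by
  ext <;> simp [map_add]

theorem herm_smul_right (c : ℝ) : S.herm m u (c • v) = c • S.herm m u v := by
  ext <;> simp [map_smul]

theorem herm_add_left : S.herm m (u + v) w = S.herm m u w + S.herm m v w := by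
  rw [← star_herm, herm_add_right, star_add, star_herm, star_herm]

theorem herm_smul_left (c : ℝ) : S.herm m (c • u) v = c • S.herm m u v := by
  rw [← star_herm, herm_smul_right, star_smul, star_herm]
  rfl

theorem herm_qsmul_right (c : ℍ[ℝ]) : S.herm m u (S.qsmul m c v) = S.herm m u v * star c := by
  have hc : star c = c.re • (1 : ℍ[ℝ]) + c.imI • star (unitQ 0) + c.imJ • star (unitQ 1)
      + c.imK • star (unitQ 2) := by
    ext <;> simp [unitQ]
  rw [qsmul, herm_add_right, herm_add_right, herm_add_right, herm_smul_right, herm_smul_right,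
    herm_smul_right, herm_smul_right, herm_J, herm_J, herm_J, hc]
  simp only [mul_add, mul_smul_comm, mul_one]

theorem herm_qsmul_left (c : ℍ[ℝ]) : S.herm m (S.qsmul m c u) v = c * S.herm m u v := by
  rw [← star_herm, herm_qsmul_right, star_mul, star_star, star_herm]

theorem qsmul_add_left (c d : ℍ[ℝ]) : S.qsmul m (c + d) u = S.qsmul m c u + S.qsmul m d u := by
  simp only [qsmul, Quaternion.re_add, Quaternion.imI_add, Quaternion.imJ_add, Quaternion.imK_add,
    add_smul]
  abel

theorem qsmul_smul_left (a : ℝ) (c : ℍ[ℝ]) : S.qsmul m (a • c) u = a • S.qsmul m c u := by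
  simp only [qsmul, Quaternion.re_smul, Quaternion.imI_smul, Quaternion.imJ_smul,
    Quaternion.imK_smul, smul_eq_mul, mul_smul, smul_add]

theorem qsmul_one : S.qsmul m 1 u = u := by
  simp [qsmul]

theorem herm_self : S.herm m u u = (S.metric.inner m u u : ℍ[ℝ]) := by
  have h : ∀ r, S.metric.inner m u (S.J r m u) = 0 := fun r => by
    have := S.omega_skew r m u u
    rw [omega] at this
    linarith
  ext <;> simp [h]

end HyperkahlerStructure

section Invariance

namespace SmoothFlow

variable {E : Type*} [NormedAddCommGroup E] [NormedSpace ℝ E] [FiniteDimensional ℝ E]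
  {M : Type*} [TopologicalSpace M] [ChartedSpace E M] [IsManifold 𝓘(ℝ, E) ∞ M]
  {Φ : SmoothFlow E M} {α : (m : M) → TangentSpace 𝓘(ℝ, E) m →L[ℝ] ℝ}

theorem differentiable_flow_oneForm (hα : SmoothOne α) (m : M) (u : TangentSpace 𝓘(ℝ, E) m) :
    Differentiable ℝ (fun t => α (Φ.act t m) (Φ.push t m u)) := by
  intro t
  let φ := (extChartAt 𝓘(ℝ, E) m).symm
  let y₀ : E := extChartAt 𝓘(ℝ, E) m m
  obtain ⟨e, he⟩ : ∃ e : E, e = u := ⟨u, rfl⟩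
  have hpe : (plotD (E := E) φ y₀ e : E) = u := by
    rw [he]; exact plotD_extChartAt_symm m u
  have hφ : ContMDiffAt 𝓘(ℝ, E) 𝓘(ℝ, E) ∞ φ y₀ := contMDiffAt_extChartAt_symm m
  have hφm : φ y₀ = m := extChartAt_to_inv m
  have h1 : DifferentiableAt ℝ (fun p => pullOne α (Φ.plot φ) p (0, e)) (t, y₀) :=
    ((contDiffAt_pullOne hα (contMDiffAt_plot (Φ := Φ) hφ t)).differentiableAt (by simp)).clm_apply
      (differentiableAt_const _)
  have h2 : (fun t => α (Φ.act t m) (Φ.push t m u))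
      = fun t => pullOne α (Φ.plot φ) (t, y₀) (0, e) := by
    funext t
    refine (one_form_congr α (by simp only [plot, hφm]) ?_).symm
    exact (plotD_plot_space hφ t e).trans (push_congr hφm hpe)
  rw [h2]
  exact DifferentiableAt.comp (g := fun p => pullOne α (Φ.plot φ) p (0, e))
    (f := fun t : ℝ => (t, y₀)) t h1 (by fun_prop)

end SmoothFlow

namespace SmoothAction

variable {E : Type*} [NormedAddCommGroup E] [NormedSpace ℝ E]
  {M : Type*} [TopologicalSpace M] [ChartedSpace E M] (A : CircleAction E M)

theorem push_mul {EG : Type*} [NormedAddCommGroup EG] [NormedSpace ℝ EG]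
    {HG : Type*} [TopologicalSpace HG] {IG : ModelWithCorners ℝ EG HG}
    {G : Type*} [Group G] [TopologicalSpace G] [ChartedSpace HG G]
    (A : SmoothAction IG G E M) (g h : G) (m : M) (u : TangentSpace 𝓘(ℝ, E) m) :
    (A.push (g * h) m u : E) = A.push g (A.act h m) (A.push h m u) := by
  have h1 := HasMFDerivAt.comp m (A.hasMFDerivAt_act g (A.act h m)) (A.hasMFDerivAt_act h m)
  have h2 : A.act g ∘ A.act h = A.act (g * h) := funext fun m => (A.mul_act g h m).symm
  rw [h2] at h1
  exact DFunLike.congr_fun h1.mfderiv u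

theorem push_one {EG : Type*} [NormedAddCommGroup EG] [NormedSpace ℝ EG]
    {HG : Type*} [TopologicalSpace HG] {IG : ModelWithCorners ℝ EG HG}
    {G : Type*} [Group G] [TopologicalSpace G] [ChartedSpace HG G]
    (A : SmoothAction IG G E M) (m : M) (u : TangentSpace 𝓘(ℝ, E) m) :
    (A.push 1 m u : E) = u := by
  have h2 : A.act 1 = id := funext A.one_act
  have h1 : HasMFDerivAt 𝓘(ℝ, E) 𝓘(ℝ, E) (A.act 1) m (ContinuousLinearMap.id ℝ E) := by
    rw [h2]; exact hasMFDerivAt_id m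
  exact DFunLike.congr_fun h1.mfderiv u

/-- A function whose differential vanishes on the field of a circle action is invariant. -/
theorem invariant_of_deriv {f : M → ℝ} (hf : MDifferentiable 𝓘(ℝ, E) 𝓘(ℝ, ℝ) f)
    (h : ∀ m, mvfderiv 𝓘(ℝ, E) f m (A.circleField m) = 0) (z : Circle) (m : M) :
    f (A.act z m) = f m := by
  have hd : ∀ t, HasDerivAt (fun t : ℝ => f (A.act (Circle.exp t) m)) 0 t := by
    intro t
    have h1 := HasMFDerivAt.comp t (hf (A.act (Circle.exp t) m)).hasMFDerivAt
      (A.toCircleFlow.hasMFDerivAt_orbit m t)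
    let Df : E →L[ℝ] ℝ := mfderiv 𝓘(ℝ, E) 𝓘(ℝ, ℝ) f (A.act (Circle.exp t) m)
    let DA : E →L[ℝ] E := mfderiv 𝓘(ℝ, E) 𝓘(ℝ, E) (A.act (Circle.exp t)) m
    have h2 : HasFDerivAt (fun t : ℝ => f (A.act (Circle.exp t) m)) (Df.comp (DA.comp
        (ContinuousLinearMap.toSpanSingleton ℝ (A.circleField m : E)))) t :=
      hasMFDerivAt_iff_hasFDerivAt.1 h1
    refine h2.hasDerivAt.congr_deriv ?_
    have h3 := h (A.act (Circle.exp t) m)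
    rw [← A.push_circleField_self] at h3
    have h4 : (mfderiv 𝓘(ℝ, E) 𝓘(ℝ, ℝ) f (A.act (Circle.exp t) m) : E →L[ℝ] ℝ)
      ((mfderiv 𝓘(ℝ, E) 𝓘(ℝ, E) (A.act (Circle.exp t)) m : E →L[ℝ] E)
        ((1 : ℝ) • A.circleField m : E)) = 0 := by
      rw [one_smul]; exact h3
    exact h4
  have hc := is_const_of_deriv_eq_zero (fun t => (hd t).differentiableAt) (fun t => (hd t).deriv)
  obtain ⟨t, rfl⟩ : ∃ t, Circle.exp t = z := ⟨_, Circle.exp_arg z⟩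
  have := hc t 0
  simpa [A.one_act] using this

/-- A 1-form whose Lie derivative along the field of a circle action vanishes is invariant. -/
theorem invariant_oneForm [FiniteDimensional ℝ E] [IsManifold 𝓘(ℝ, E) ∞ M]
    {α : (m : M) → TangentSpace 𝓘(ℝ, E) m →L[ℝ] ℝ}
    (hα : SmoothOne α) (h : ∀ m u, extDerivOne α m (A.circleField m) u
      + mvfderiv 𝓘(ℝ, E) (fun m => α m (A.circleField m)) m u = 0) (z : Circle) (m : M)
    (u : TangentSpace 𝓘(ℝ, E) m) : α (A.act z m) (A.push z m u) = α m u := by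
  let f : ℝ → ℝ := fun t => α (A.act (Circle.exp t) m) (A.push (Circle.exp t) m u)
  have hdiff : Differentiable ℝ f :=
    SmoothFlow.differentiable_flow_oneForm (Φ := A.toSmoothFlow) hα m u
  have hadd : ∀ s t, f (s + t) = α (A.act (Circle.exp s) (A.act (Circle.exp t) m))
      (A.push (Circle.exp s) (A.act (Circle.exp t) m) (A.push (Circle.exp t) m u)) := fun s t => by
    refine one_form_congr α (by rw [Circle.exp_add, A.mul_act]) ?_
    rw [Circle.exp_add]
    exact A.push_mul _ _ m u
  have hd : ∀ t, deriv f t = 0 := by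
    intro t
    have h1 := SmoothFlow.deriv_flow_oneForm (Φ := A.toSmoothFlow) hα (A.act (Circle.exp t) m)
      (A.push (Circle.exp t) m u)
    have h2 : deriv (fun s => f (s + t)) 0 = 0 := by
      simp only [hadd]
      exact h1.trans (h _ _)
    rwa [deriv_comp_add_const, zero_add] at h2
  have hc := is_const_of_deriv_eq_zero hdiff hd
  obtain ⟨t, rfl⟩ : ∃ t, Circle.exp t = z := ⟨_, Circle.exp_arg z⟩
  refine (hc t 0).trans (one_form_congr α (by rw [Circle.exp_zero, A.one_act]) ?_)
  rw [Circle.exp_zero]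
  exact A.push_one m u

end SmoothAction

namespace InductionData

variable {E : Type*} [NormedAddCommGroup E] [NormedSpace ℝ E] [FiniteDimensional ℝ E]
  {M : Type*} [TopologicalSpace M] [ChartedSpace E M] [IsManifold 𝓘(ℝ, E) ∞ M]
  {F : Type*} [NormedAddCommGroup F] [NormedSpace ℝ F] [FiniteDimensional ℝ F]
  {P : Type*} [TopologicalSpace P] [ChartedSpace F P] [IsManifold 𝓘(ℝ, F) ∞ P]
  (D : InductionData E M F P)

theorem push_Kr (z : Circle) (m : M) : D.rot.push z m (D.Kr m) = D.Kr (D.rot.act z m) :=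
  D.rot.push_circleField_self z m

theorem w_act (z : Circle) (m : M) : D.w (D.rot.act z m) = D.w m := by
  rw [w, ← push_Kr, D.isRotating.metric_push]
  rfl

theorem rho_act (z : Circle) (m : M) : D.rho (D.rot.act z m) = D.rho m := by
  refine D.rot.invariant_of_deriv (D.isMomentumMap.contMDiff.mdifferentiable (by simp)) (fun m => ?_)
    z m
  have := D.hk.omega_skew 0 m (D.rot.circleField m) (D.rot.circleField m)
  rw [D.isMomentumMap.deriv_eq]
  linarith

theorem v_act (z : Circle) (m : M) : D.v (D.rot.act z m) = D.v m := by
  rw [v, w_act, rho_act]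
  rfl

theorem extDerivOne_etaRe_Kr (m : M) (u : TangentSpace 𝓘(ℝ, E) m) :
    extDerivOne D.etaRe m (D.Kr m) u = - mvfderiv 𝓘(ℝ, E) D.w m u := by
  have h := SmoothFlow.deriv_flow_oneForm (Φ := D.rot.toSmoothFlow) D.smoothOne_etaRe m u
  have h1 : (fun t => D.etaRe (D.rot.act (Circle.exp t) m) (D.rot.push (Circle.exp t) m u))
      = fun _ => D.etaRe m u := by
    funext t
    rw [etaRe, ← push_Kr, D.isRotating.metric_push]
    rfl
  have h2 : deriv (fun t => D.etaRe (D.rot.toSmoothFlow.act t m) (D.rot.toSmoothFlow.push t m u)) 0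
      = 0 := by
    refine (congrArg (fun f => deriv f 0) h1).trans ?_
    simp
  rw [h2] at h
  exact eq_neg_of_add_eq_zero_left h.symm

/-- The differential of `proj` on the field of the lifted action. -/
theorem dproj_lift_field (p : P) :
    (mfderiv 𝓘(ℝ, F) 𝓘(ℝ, E) D.proj p : F →L[ℝ] E) (D.lift.circleField p) = D.Kr (D.proj p) :=
  D.lift.mfderiv_circleField D.rot p ((D.isPrincipal.contMDiff p).mdifferentiableAt (by simp))
    fun z => D.proj_lift z p

/-- The curvature equation makes the connection invariant under the lifted action. -/
theorem xi_lift (hnorm : D.IsNormalized) (hcurv : D.CurvatureEquation) (z : Circle) (p : P)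
    (u : TangentSpace 𝓘(ℝ, F) p) : D.xi (D.lift.act z p) (D.lift.push z p u) = D.xi p u := by
  refine D.lift.invariant_oneForm D.smoothOne_xi (fun p u => ?_) z p u
  have h0 : (fun p => D.xi p (D.lift.circleField p)) = fun p => 2 * D.v (D.proj p) :=
    funext hnorm
  have hc := D.curvatureEquation_iff.1 hcurv p (D.lift.circleField p) u
  have hK := D.dproj_lift_field p
  let du : TangentSpace 𝓘(ℝ, E) (D.proj p) := mfderiv 𝓘(ℝ, F) 𝓘(ℝ, E) D.proj p u
  have hc' : extDerivOne D.xi p (D.lift.circleField p) u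
      + 1 / 2 * extDerivOne D.etaRe (D.proj p) (D.Kr (D.proj p)) du
      + D.hk.omega 0 (D.proj p) (D.Kr (D.proj p)) du = 0 := by
    rw [← hK]; exact hc
  rw [extDerivOne_etaRe_Kr] at hc'
  have hw : HasMFDerivAt 𝓘(ℝ, E) 𝓘(ℝ, ℝ) D.w (D.proj p) (mvfderiv 𝓘(ℝ, E) D.w (D.proj p)) :=
    ((D.contMDiff_w _).mdifferentiableAt (by simp)).hasMFDerivAt
  have hr : HasMFDerivAt 𝓘(ℝ, E) 𝓘(ℝ, ℝ) D.rho (D.proj p) (mvfderiv 𝓘(ℝ, E) D.rho (D.proj p)) :=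
    ((D.isMomentumMap.contMDiff _).mdifferentiableAt (by simp)).hasMFDerivAt
  have hp : HasMFDerivAt 𝓘(ℝ, F) 𝓘(ℝ, E) D.proj p (mfderiv 𝓘(ℝ, F) 𝓘(ℝ, E) D.proj p) :=
    ((D.isPrincipal.contMDiff p).mdifferentiableAt (by simp)).hasMFDerivAt
  have h1 := ((HasMFDerivAt.comp p hw hp).add
    ((HasMFDerivAt.comp p hr hp).const_smul (2 : ℝ))).const_smul (-(1 / 2) : ℝ)
  have h2 : (fun p => 2 * D.v (D.proj p))
      = (-(1 / 2) : ℝ) • (D.w ∘ D.proj + (2 : ℝ) • (D.rho ∘ D.proj)) := by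
    funext p
    simp [v]
    ring
  have h3 : mvfderiv 𝓘(ℝ, F) (fun p => 2 * D.v (D.proj p)) p u
      = -(1 / 2) * (mvfderiv 𝓘(ℝ, E) D.w (D.proj p) du
        + 2 * mvfderiv 𝓘(ℝ, E) D.rho (D.proj p) du) := by
    rw [← h2] at h1
    exact DFunLike.congr_fun h1.mfderiv u
  have h4 := D.isMomentumMap.deriv_eq (D.proj p) du
  have h5 : D.rot.circleField (D.proj p) = D.Kr (D.proj p) := rfl
  rw [h0, h3, h4, h5]
  linarith

end InductionData

end Invariance

section UnitMaps

/-- The differential of a map into the units is that of its composition with the inclusion. -/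
theorem hasMFDerivAt_units {V H N : Type*} [NormedAddCommGroup V] [NormedSpace ℝ V]
    [TopologicalSpace H] {I : ModelWithCorners ℝ V H} [TopologicalSpace N] [ChartedSpace H N]
    {f : N → (ℍ[ℝ])ˣ} {n : N} (hf : MDifferentiableAt I 𝓘(ℝ, ℍ[ℝ]) f n) {f' : V →L[ℝ] ℍ[ℝ]}
    (h : HasMFDerivAt I 𝓘(ℝ, ℍ[ℝ]) (fun n => (f n : ℍ[ℝ])) n f') :
    HasMFDerivAt I 𝓘(ℝ, ℍ[ℝ]) f n f' := by
  have h1 := HasMFDerivAt.comp n (hasMFDerivAt_units_val (f n)) hf.hasMFDerivAt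
  have h2 := hasMFDerivAt_unique h1 h
  exact hf.hasMFDerivAt.congr_mfderiv h2

theorem hasMFDerivAt_mul_right (g x : (ℍ[ℝ])ˣ) :
    HasMFDerivAt 𝓘(ℝ, ℍ[ℝ]) 𝓘(ℝ, ℍ[ℝ]) (fun x : (ℍ[ℝ])ˣ => x * g) x
      ((ContinuousLinearMap.mul ℝ ℍ[ℝ]).flip (g : ℍ[ℝ])) := by
  refine hasMFDerivAt_units ((contMDiff_mul_right (I := 𝓘(ℝ, ℍ[ℝ])) (n := ∞)
    (a := g) x).mdifferentiableAt (by simp)) ?_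
  have h1 : HasMFDerivAt 𝓘(ℝ, ℍ[ℝ]) 𝓘(ℝ, ℍ[ℝ]) (fun y : ℍ[ℝ] => y * g) (x : ℍ[ℝ])
      ((ContinuousLinearMap.mul ℝ ℍ[ℝ]).flip (g : ℍ[ℝ])) :=
    (((ContinuousLinearMap.mul ℝ ℍ[ℝ]).flip (g : ℍ[ℝ])).hasFDerivAt (x := (x : ℍ[ℝ]))).hasMFDerivAt
  exact HasMFDerivAt.comp x h1 (hasMFDerivAt_units_val x)

theorem hasMFDerivAt_mul_left (g x : (ℍ[ℝ])ˣ) :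
    HasMFDerivAt 𝓘(ℝ, ℍ[ℝ]) 𝓘(ℝ, ℍ[ℝ]) (fun x : (ℍ[ℝ])ˣ => g * x) x
      (ContinuousLinearMap.mul ℝ ℍ[ℝ] (g : ℍ[ℝ])) := by
  refine hasMFDerivAt_units ((contMDiff_mul_left (I := 𝓘(ℝ, ℍ[ℝ])) (n := ∞)
    (a := g) x).mdifferentiableAt (by simp)) ?_
  have h1 : HasMFDerivAt 𝓘(ℝ, ℍ[ℝ]) 𝓘(ℝ, ℍ[ℝ]) (fun y : ℍ[ℝ] => (g : ℍ[ℝ]) * y) (x : ℍ[ℝ])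
      (ContinuousLinearMap.mul ℝ ℍ[ℝ] (g : ℍ[ℝ])) :=
    ((ContinuousLinearMap.mul ℝ ℍ[ℝ] (g : ℍ[ℝ])).hasFDerivAt (x := (x : ℍ[ℝ]))).hasMFDerivAt
  exact HasMFDerivAt.comp x h1 (hasMFDerivAt_units_val x)

theorem hasMFDerivAt_circleToQuat (x : (ℍ[ℝ])ˣ) :
    HasMFDerivAt 𝓘(ℝ, ℝ) 𝓘(ℝ, ℍ[ℝ]) (fun t : ℝ => x * circleToQuat (Circle.exp t)) 0
      (ContinuousLinearMap.toSpanSingleton ℝ ((x : ℍ[ℝ]) * qi)) := by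
  have h0 : ContMDiff 𝓘(ℝ, ℝ) 𝓘(ℝ, ℍ[ℝ]) ∞ (fun t : ℝ => x * circleToQuat (Circle.exp t)) :=
    contMDiff_const.mul (contMDiff_circleToQuat.comp contMDiff_circleExp)
  refine hasMFDerivAt_units ((h0 0).mdifferentiableAt (by simp)) ?_
  have h1 := (hasDerivAt_circleToQuat.const_mul (x : ℍ[ℝ])).hasFDerivAt
  exact h1.hasMFDerivAt

instance : SecondCountableTopology (ℍ[ℝ])ˣ :=
  (Units.isOpenEmbedding_val (R := ℍ[ℝ])).toIsEmbedding.secondCountableTopology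

end UnitMaps

namespace InductionData

variable {E : Type*} [NormedAddCommGroup E] [NormedSpace ℝ E] [FiniteDimensional ℝ E]
  {M : Type*} [TopologicalSpace M] [ChartedSpace E M] [IsManifold 𝓘(ℝ, E) ∞ M]
  {F : Type*} [NormedAddCommGroup F] [NormedSpace ℝ F] [FiniteDimensional ℝ F]
  {P : Type*} [TopologicalSpace P] [ChartedSpace F P] [IsManifold 𝓘(ℝ, F) ∞ P]
  (D : InductionData E M F P)

/-- The circle action on `ℍ* × P`. -/
def flowHP : CircleFlow (𝓘(ℝ, ℍ[ℝ]).prod 𝓘(ℝ, F)) ((ℍ[ℝ])ˣ × P) where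
  act z a := (a.1 * circleToQuat z, D.lift.act z⁻¹ a.2)
  one_act a := by simp [D.lift.one_act]
  mul_act z z' a := by
    simp only [map_mul, mul_inv_rev, Prod.mk.injEq]
    refine ⟨?_, ?_⟩
    · rw [mul_assoc, ← map_mul, ← map_mul, mul_comm z]
    · rw [← D.lift.mul_act, mul_comm]
  contMDiff_act := by
    have h1 : ContMDiff ((𝓡 1).prod (𝓘(ℝ, ℍ[ℝ]).prod 𝓘(ℝ, F))) 𝓘(ℝ, ℍ[ℝ]) ∞
        (fun z : Circle × ((ℍ[ℝ])ˣ × P) => z.2.1 * circleToQuat z.1) :=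
      (contMDiff_fst.comp contMDiff_snd).mul (contMDiff_circleToQuat.comp contMDiff_fst)
    have h2 : ContMDiff ((𝓡 1).prod (𝓘(ℝ, ℍ[ℝ]).prod 𝓘(ℝ, F))) 𝓘(ℝ, F) ∞
        (fun z : Circle × ((ℍ[ℝ])ˣ × P) => D.lift.act z.1⁻¹ z.2.2) :=
      D.lift.contMDiff_act.comp (((contMDiff_inv (𝓡 1) ∞).comp contMDiff_fst).prodMk
        (contMDiff_snd.comp contMDiff_snd))
    exact h1.prodMk h2

theorem flowHP_free (z : Circle) (a : (ℍ[ℝ])ˣ × P) (h : D.flowHP.act z a = a) : z = 1 := by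
  have h1 : a.1 * circleToQuat z = a.1 := congrArg Prod.fst h
  rw [mul_eq_left] at h1
  exact circleToQuat_injective (h1.trans (map_one _).symm)

theorem sameOrbit_iff (a b : (ℍ[ℝ])ˣ × P) : D.SameOrbit a b ↔ ∃ z, D.flowHP.act z a = b :=
  exists_congr fun _ => eq_comm

/-- The orbit space is a manifold. -/
theorem exists_orbitSpace_manifold [T2Space P] [SecondCountableTopology P] :
    ∃ (n : ℕ) (_ : ChartedSpace (EuclideanSpace ℝ (Fin n)) D.OrbitSpace),
        IsManifold (𝓡 n) ∞ D.OrbitSpace ∧ T2Space D.OrbitSpace ∧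
        SecondCountableTopology D.OrbitSpace ∧
        D.IsQuotientMap (E' := EuclideanSpace ℝ (Fin n))
          (Quotient.mk D.orbitSetoid : (ℍ[ℝ])ˣ × P → D.OrbitSpace) := by
  have hs : ∀ a b, Quotient.mk D.orbitSetoid a = Quotient.mk D.orbitSetoid b
      ↔ ∃ z, D.flowHP.act z a = b := fun a b => by
    rw [← sameOrbit_iff]
    exact Quotient.eq
  have hdim : Module.finrank ℝ (EuclideanSpace ℝ (Fin (3 + Module.finrank ℝ F))) + 1
      = Module.finrank ℝ (ℍ[ℝ] × F) := by
    rw [finrank_euclideanSpace_fin, Module.finrank_prod, Quaternion.finrank_eq_four]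
    ring
  obtain ⟨cs, h1, h2, h3⟩ := D.flowHP.exists_quotient_manifold
    (X := EuclideanSpace ℝ (Fin (3 + Module.finrank ℝ F))) hs D.flowHP_free hdim
  exact ⟨_, cs, h1, D.flowHP.t2Space_quotient hs,
    TopologicalSpace.Quotient.secondCountableTopology (D.flowHP.isOpenMap_mk hs),
    h2, h3, fun a b => (hs a b).trans (D.sameOrbit_iff a b).symm⟩

/-- The vector field of the circle action on `ℍ* × P`. -/
theorem gen_flowHP (a : (ℍ[ℝ])ˣ × P) :
    (D.flowHP.gen a : ℍ[ℝ] × F) = ((a.1 : ℍ[ℝ]) * qi, -D.lift.circleField a.2) := by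
  have h0 : HasMFDerivAt 𝓘(ℝ, ℝ) 𝓘(ℝ, F) (fun t : ℝ => D.lift.act (Circle.exp t) a.2) (-(0 : ℝ))
      (ContinuousLinearMap.toSpanSingleton ℝ (D.lift.circleField a.2)) := by
    rw [neg_zero]; exact D.lift.hasMFDerivAt_circleOrbit a.2
  have hn : HasMFDerivAt 𝓘(ℝ, ℝ) 𝓘(ℝ, ℝ) (fun t : ℝ => -t) 0 (-ContinuousLinearMap.id ℝ ℝ) :=
    (hasFDerivAt_id (0 : ℝ)).neg.hasMFDerivAt
  have h1 := HasMFDerivAt.comp (f := fun t : ℝ => -t) (0 : ℝ) h0 hn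
  have h2 := (hasMFDerivAt_circleToQuat a.1).prodMk h1
  have h3 : (fun t : ℝ => D.flowHP.act (Circle.exp t) a) = fun t : ℝ =>
      (a.1 * circleToQuat (Circle.exp t),
        ((fun t : ℝ => D.lift.act (Circle.exp t) a.2) ∘ fun t : ℝ => -t) t) := by
    funext t
    simp only [flowHP, Function.comp_apply, Circle.exp_neg]
  have h4 := h2.mfderiv
  rw [← h3] at h4
  have h5 := DFunLike.congr_fun h4 (1 : ℝ)
  refine h5.trans ?_
  refine Prod.ext (one_smul ℝ ((a.1 : ℍ[ℝ]) * qi)) ?_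
  have h6 : (-(1 : ℝ)) • (D.lift.circleField a.2 : F) = -D.lift.circleField a.2 := by
    rw [neg_smul, one_smul]
  exact h6

theorem mfderiv_flowHP (z : Circle) (a : (ℍ[ℝ])ˣ × P) (c : ℍ[ℝ] × F) :
    (mfderiv (𝓘(ℝ, ℍ[ℝ]).prod 𝓘(ℝ, F)) (𝓘(ℝ, ℍ[ℝ]).prod 𝓘(ℝ, F)) (D.flowHP.act z) a
        : ℍ[ℝ] × F →L[ℝ] ℍ[ℝ] × F) c
      = (c.1 * circleToQuat z, (D.lift.push z⁻¹ a.2 : F →L[ℝ] F) c.2) := by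
  have h := (hasMFDerivAt_mul_right (circleToQuat z) a.1).prodMap (p := a)
    (D.lift.hasMFDerivAt_act z⁻¹ a.2)
  refine (DFunLike.congr_fun h.mfderiv c).trans (Prod.ext ?_ rfl)
  exact DFunLike.congr_fun (hasMFDerivAt_mul_right (circleToQuat z) a.1).mfderiv c.1

end InductionData

section HermitianAlgebra

/-- The sum of `metricF` and `omegaF`. -/
def hermF (t v : ℝ) (x e e' : ℍ[ℝ]) (ξ ξ' : ℝ) (η η' h : ℍ[ℝ]) : ℍ[ℝ] :=
  t • (e * star e') - e * ((2 * ξ' : ℝ) + η') * star x - star (e' * ((2 * ξ : ℝ) + η) * star x)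
    + x * ((v⁻¹ * (ξ * ξ') : ℝ) + h) * star x

theorem metricF_add_omegaF (t v : ℝ) (x c c' : ℍ[ℝ]) (ξ ξ' : ℝ) (η η' : ℍ[ℝ]) (g : ℝ) (om : ℍ[ℝ])
    (hom : om.re = 0) :
    (metricF t v x c c' ξ ξ' η η' g : ℍ[ℝ]) + omegaF t x c c' ξ ξ' η η' om
      = hermF t v x (c * qi) (c' * qi) ξ ξ' η η' (g + om) := by
  have hn : ‖x‖ ^ 2 = x.re ^ 2 + x.imI ^ 2 + x.imJ ^ 2 + x.imK ^ 2 := by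
    rw [← Quaternion.normSq_def', Quaternion.normSq_eq_norm_mul_self]; ring
  ext
  all_goals
    simp only [metricF, omegaF, hermF, hn, Quaternion.re_mul, Quaternion.imI_mul,
      Quaternion.imJ_mul, Quaternion.imK_mul, Quaternion.re_sub, Quaternion.imI_sub,
      Quaternion.imJ_sub, Quaternion.imK_sub, Quaternion.re_add, Quaternion.imI_add,
      Quaternion.imJ_add, Quaternion.imK_add, Quaternion.re_star, Quaternion.imI_star,
      Quaternion.imJ_star, Quaternion.imK_star, Quaternion.re_smul, Quaternion.imI_smul,
      Quaternion.imJ_smul, Quaternion.imK_smul, Quaternion.re_im, Quaternion.imI_im,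
      Quaternion.imJ_im, Quaternion.imK_im, smul_eq_mul, qi_re, qi_imI, qi_imJ, qi_imK, hom,
      Quaternion.re_coe, Quaternion.imI_coe, Quaternion.imJ_coe, Quaternion.imK_coe]
    ring

theorem hermF_eq {v w : ℝ} (hv : v ≠ 0) (x y y' : ℍ[ℝ]) (ξ ξ' : ℝ) (η η' h : ℍ[ℝ]) :
    hermF (4 * v + w) v x (x * y) (x * y') ξ ξ' η η' h
      = x * (v⁻¹ • (((ξ : ℍ[ℝ]) - (2 * v) • y) * star ((ξ' : ℍ[ℝ]) - (2 * v) • y'))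
        + (h - y * η' - star (y' * η) + w • (y * star y'))) * star x := by
  have h1 : hermF (4 * v + w) v x (x * y) (x * y') ξ ξ' η η' h
      = x * ((4 * v + w) • (y * star y') - y * ((2 * ξ' : ℝ) + η') - star (y' * ((2 * ξ : ℝ) + η))
        + ((v⁻¹ * (ξ * ξ') : ℝ) + h)) * star x := by
    simp only [hermF, mul_add, mul_sub, add_mul, sub_mul, star_mul, star_add, mul_assoc,
      mul_smul_comm, smul_mul_assoc, star_star]
  rw [h1]
  congr 2
  simp only [star_sub, star_mul, star_add, star_smul, Quaternion.star_coe, star_trivial]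
  simp only [mul_sub, sub_mul, mul_add, add_mul, smul_sub, smul_mul_assoc, mul_smul_comm, smul_smul]
  have e1 : v⁻¹ * (2 * v) = 2 := by field_simp
  have e2 : v⁻¹ * (2 * v * (2 * v)) = 4 * v := by field_simp; norm_num
  generalize v⁻¹ = k at e1 e2 ⊢
  simp only [e1, e2, add_smul]
  ext <;> simp <;> ring

theorem hermF_circle (t v : ℝ) (x e e' : ℍ[ℝ]) (ξ ξ' : ℝ) (η η' h : ℍ[ℝ]) {s : ℍ[ℝ]}
    (hs : s * star s = 1) :
    hermF t v (x * s) (e * s) (e' * s) ξ ξ' (star s * η * s) (star s * η' * s) (star s * h * s)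
      = hermF t v x e e' ξ ξ' η η' h := by
  have hs' : ∀ q : ℍ[ℝ], s * (star s * q) = q := fun q => by rw [← mul_assoc, hs, one_mul]
  have hc : ∀ (r : ℝ) (q : ℍ[ℝ]), (r : ℍ[ℝ]) * q = r • q := fun r q => by
    rw [Quaternion.coe_mul_eq_smul]
  simp only [hermF, mul_add, add_mul, star_mul, star_add, mul_assoc, hs', hc, mul_smul_comm,
    star_smul, star_star]

end HermitianAlgebra

namespace InductionData

variable {E : Type*} [NormedAddCommGroup E] [NormedSpace ℝ E] [FiniteDimensional ℝ E]
  {M : Type*} [TopologicalSpace M] [ChartedSpace E M] [IsManifold 𝓘(ℝ, E) ∞ M]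
  {F : Type*} [NormedAddCommGroup F] [NormedSpace ℝ F] [FiniteDimensional ℝ F]
  {P : Type*} [TopologicalSpace P] [ChartedSpace F P] [IsManifold 𝓘(ℝ, F) ∞ P]
  (D : InductionData E M F P)

/-- The quaternion-valued form `metricHP + omegaHP`. -/
def hermHP (z : (ℍ[ℝ])ˣ × P) (a b : ℍ[ℝ] × F) : ℍ[ℝ] :=
  (D.metricHP z a b : ℍ[ℝ]) + D.omegaHP z a b

/-- The differential of the bundle projection. -/
def dproj (p : P) : F →L[ℝ] TangentSpace 𝓘(ℝ, E) (D.proj p) := mfderiv 𝓘(ℝ, F) 𝓘(ℝ, E) D.proj p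

/-- The connection form as a functional on the model space. -/
def xiF (p : P) : F →L[ℝ] ℝ := D.xi p

/-- The coefficient `x⁻¹ dx i`. -/
def yHP (z : (ℍ[ℝ])ˣ × P) (a : ℍ[ℝ] × F) : ℍ[ℝ] := ((z.1⁻¹ : (ℍ[ℝ])ˣ) : ℍ[ℝ]) * a.1 * qi

/-- The vertical part of a tangent vector of `ℍ* × P`. -/
def sigmaHP (z : (ℍ[ℝ])ˣ × P) (a : ℍ[ℝ] × F) : ℍ[ℝ] :=
  (D.xiF z.2 a.2 : ℍ[ℝ]) - (2 * D.v (D.proj z.2)) • yHP z a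

/-- The horizontal part of a tangent vector of `ℍ* × P`. -/
def tauHP (z : (ℍ[ℝ])ˣ × P) (a : ℍ[ℝ] × F) : TangentSpace 𝓘(ℝ, E) (D.proj z.2) :=
  D.dproj z.2 a.2 - D.hk.qsmul (D.proj z.2) (yHP z a) (D.Kr (D.proj z.2))

theorem toTM_apply (z : (ℍ[ℝ])ˣ × P) (a : ℍ[ℝ] × F) : D.toTM z a = D.dproj z.2 a.2 :=
  congrArg (D.dproj z.2) (toTP_apply z a)

theorem xiHP_apply (z : (ℍ[ℝ])ˣ × P) (a : ℍ[ℝ] × F) :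
    D.xiHP z a = D.xiF z.2 a.2 :=
  congrArg (D.xiF z.2) (toTP_apply z a)

theorem hermHP_eq_hermF (z : (ℍ[ℝ])ˣ × P) (a b : ℍ[ℝ] × F) :
    D.hermHP z a b = hermF (-2 * D.rho (D.proj z.2)) (D.v (D.proj z.2)) z.1 (a.1 * qi) (b.1 * qi)
      (D.xiF z.2 a.2) (D.xiF z.2 b.2)
      (D.hk.herm (D.proj z.2) (D.Kr (D.proj z.2)) (D.dproj z.2 a.2))
      (D.hk.herm (D.proj z.2) (D.Kr (D.proj z.2)) (D.dproj z.2 b.2))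
      (D.hk.herm (D.proj z.2) (D.dproj z.2 a.2) (D.dproj z.2 b.2)) := by
  have key : ∀ a b : TangentHP (F := F) z, (D.metricHP z a b : ℍ[ℝ]) + D.omegaHP z a b
      = hermF (-2 * D.rho (D.proj z.2)) (D.v (D.proj z.2)) z.1 (dx z a * qi) (dx z b * qi)
        (D.xiHP z a) (D.xiHP z b) (D.hk.herm (D.proj z.2) (D.Kr (D.proj z.2)) (D.toTM z a))
        (D.hk.herm (D.proj z.2) (D.Kr (D.proj z.2)) (D.toTM z b))
        (D.hk.herm (D.proj z.2) (D.toTM z a) (D.toTM z b)) := fun a b => by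
    rw [metricHP_eq, omegaHP_eq, metricF_add_omegaF _ _ _ _ _ _ _ _ _ _ _ (omegaQ_re _ _ _ _)]
    rfl
  refine (key a b).trans ?_
  rw [dx_apply, dx_apply, xiHP_apply, xiHP_apply, toTM_apply, toTM_apply]

theorem mul_yHP (z : (ℍ[ℝ])ˣ × P) (a : ℍ[ℝ] × F) : (z.1 : ℍ[ℝ]) * yHP z a = a.1 * qi := by
  rw [yHP, mul_assoc, ← mul_assoc (z.1 : ℍ[ℝ]), Units.mul_inv, one_mul]

theorem herm_sub_qsmul (S : HyperkahlerStructure E M) (m : M) (K u u' : TangentSpace 𝓘(ℝ, E) m)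
    (y y' : ℍ[ℝ]) : S.herm m (u - S.qsmul m y K) (u' - S.qsmul m y' K)
      = S.herm m u u' - y * S.herm m K u' - star (y' * S.herm m K u)
        + S.metric.inner m K K • (y * star y') := by
  have hl : ∀ a b c, S.herm m (a - b) c = S.herm m a c - S.herm m b c := fun a b c => by
    have := S.herm_add_left m (a - b) b c
    rw [sub_add_cancel] at this
    rw [this, add_sub_cancel_right]
  have hr : ∀ a b c, S.herm m c (a - b) = S.herm m c a - S.herm m c b := fun a b c => by
    rw [← S.star_herm, hl, star_sub, S.star_herm, S.star_herm]
  rw [hl, hr, hr, S.herm_qsmul_right, S.herm_qsmul_left, S.herm_qsmul_right, S.herm_qsmul_left,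
    S.herm_self, star_mul, S.star_herm]
  rw [Quaternion.mul_coe_eq_smul, smul_mul_assoc]
  abel

theorem hermHP_eq {z : (ℍ[ℝ])ˣ × P} (hv : D.v (D.proj z.2) ≠ 0) (a b : ℍ[ℝ] × F) :
    D.hermHP z a b = z.1 * ((D.v (D.proj z.2))⁻¹ • (D.sigmaHP z a * star (D.sigmaHP z b))
      + D.hk.herm (D.proj z.2) (D.tauHP z a) (D.tauHP z b)) * star (z.1 : ℍ[ℝ]) := by
  rw [hermHP_eq_hermF, ← mul_yHP z, ← mul_yHP z, ← four_v_add_w, hermF_eq hv, tauHP, tauHP,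
    herm_sub_qsmul]
  rfl

theorem sigmaHP_add (z : (ℍ[ℝ])ˣ × P) (a b : ℍ[ℝ] × F) :
    D.sigmaHP z (a + b) = D.sigmaHP z a + D.sigmaHP z b := by
  simp only [sigmaHP, yHP, Prod.fst_add, Prod.snd_add, map_add, Quaternion.coe_add, mul_add, add_mul,
    smul_add]
  abel

theorem sigmaHP_smul (z : (ℍ[ℝ])ˣ × P) (c : ℝ) (a : ℍ[ℝ] × F) :
    D.sigmaHP z (c • a) = c • D.sigmaHP z a := by
  simp only [sigmaHP, yHP, Prod.smul_fst, Prod.smul_snd, map_smul, Quaternion.coe_smul,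
    mul_smul_comm, smul_mul_assoc, smul_sub, smul_comm c]

theorem tauHP_add (z : (ℍ[ℝ])ˣ × P) (a b : ℍ[ℝ] × F) :
    D.tauHP z (a + b) = D.tauHP z a + D.tauHP z b := by
  have h1 : yHP z (a + b) = yHP z a + yHP z b := by
    simp only [yHP, Prod.fst_add, mul_add, add_mul]
  rw [tauHP, tauHP, tauHP, h1, D.hk.qsmul_add_left, Prod.snd_add, map_add]
  abel

theorem tauHP_smul (z : (ℍ[ℝ])ˣ × P) (c : ℝ) (a : ℍ[ℝ] × F) :
    D.tauHP z (c • a) = c • D.tauHP z a := by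
  have h1 : yHP z (c • a) = c • yHP z a := by
    simp only [yHP, Prod.smul_fst, mul_smul_comm, smul_mul_assoc]
  rw [tauHP, tauHP, h1, D.hk.qsmul_smul_left, Prod.smul_snd, map_smul]
  rw [smul_sub]

/-- The form `hermHP` as a bilinear map. -/
def hermL (hv : ∀ m, D.v m ≠ 0) (z : (ℍ[ℝ])ˣ × P) : (ℍ[ℝ] × F) →ₗ[ℝ] (ℍ[ℝ] × F) →ₗ[ℝ] ℍ[ℝ] :=
  LinearMap.mk₂ ℝ (D.hermHP z)
    (fun a b c => by
      simp only [D.hermHP_eq (hv _), sigmaHP_add, tauHP_add, D.hk.herm_add_left, add_mul, mul_add,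
        smul_add]
      abel)
    (fun r a b => by
      simp only [D.hermHP_eq (hv _), sigmaHP_smul, tauHP_smul, D.hk.herm_smul_left, smul_mul_assoc,
        mul_smul_comm, smul_comm _ r, ← smul_add])
    (fun a b c => by
      simp only [D.hermHP_eq (hv _), sigmaHP_add, tauHP_add, D.hk.herm_add_right, add_mul, mul_add,
        smul_add, star_add]
      abel)
    (fun r a b => by
      simp only [D.hermHP_eq (hv _), sigmaHP_smul, tauHP_smul, D.hk.herm_smul_right, star_smul,
        star_trivial, mul_smul_comm, smul_mul_assoc, smul_comm _ r, ← smul_add])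

theorem star_hermHP (hv : ∀ m, D.v m ≠ 0) (z : (ℍ[ℝ])ˣ × P) (a b : ℍ[ℝ] × F) :
    D.hermHP z b a = star (D.hermHP z a b) := by
  rw [D.hermHP_eq (hv _), D.hermHP_eq (hv _)]
  simp only [star_mul, star_add, star_smul, star_star, D.hk.star_herm, star_trivial, mul_assoc]

/-- The vertical and horizontal parts of a tangent vector can be prescribed. -/
theorem exists_sigmaHP_tauHP {z : (ℍ[ℝ])ˣ × P} (hv : D.v (D.proj z.2) ≠ 0) (s : ℍ[ℝ])
    (t : TangentSpace 𝓘(ℝ, E) (D.proj z.2)) : ∃ a, D.sigmaHP z a = s ∧ D.tauHP z a = t := by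
  let y : ℍ[ℝ] := -(2 * D.v (D.proj z.2))⁻¹ • s.im
  obtain ⟨u₀, hu₀⟩ : ∃ u₀ : F, D.dproj z.2 u₀ = t + D.hk.qsmul (D.proj z.2) y (D.Kr (D.proj z.2)) :=
    D.isPrincipal.submersion z.2 _
  have hK0 : D.dproj z.2 (D.princ.circleField z.2) = 0 :=
    D.princ.toCircleFlow.mfderiv_gen z.2 ((D.isPrincipal.contMDiff z.2).mdifferentiableAt (by simp))
      fun ζ => ((D.isPrincipal.fibre _ _).2 ⟨ζ, rfl⟩).symm
  let X : F →L[ℝ] ℝ := D.xiF z.2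
  let k : F := D.princ.circleField z.2
  have hXk : X k = 1 := D.isConnection.field z.2
  let u : F := u₀ + (s.re - X u₀) • k
  have hXu : X u = s.re := by
    simp only [u, map_add, map_smul, hXk]
    simp
  have hdu : D.dproj z.2 u = t + D.hk.qsmul (D.proj z.2) y (D.Kr (D.proj z.2)) := by
    simp only [u, map_add, map_smul]
    have hK0' : D.dproj z.2 k = 0 := hK0
    rw [hK0', smul_zero, add_zero, hu₀]
  have hy : yHP (F := F) z (-((z.1 : ℍ[ℝ]) * y * qi), u) = y := by
    rw [yHP]
    simp only [mul_neg, neg_mul]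
    rw [← mul_assoc, ← mul_assoc, Units.inv_mul, one_mul, mul_assoc]
    have : qi * qi = -1 := by ext <;> simp
    rw [this]; simp
  refine ⟨(-((z.1 : ℍ[ℝ]) * y * qi), u), ?_, ?_⟩
  · rw [sigmaHP, hy]
    have h1 : (2 * D.v (D.proj z.2)) • y = -s.im := by
      simp only [y, neg_smul, smul_neg, smul_smul]
      rw [mul_inv_cancel₀ (by simpa using hv), one_smul]
    rw [h1, sub_neg_eq_add]
    have h2 : D.xiF z.2 u = s.re := hXu
    simp only [h2]
    exact Quaternion.re_add_im s
  · rw [tauHP, hy]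
    simp only [hdu, add_sub_cancel_right]

theorem exists_hermHP_J (hv : ∀ m, D.v m ≠ 0) (r : Fin 3) (z : (ℍ[ℝ])ˣ × P) (b : ℍ[ℝ] × F) :
    ∃ c, ∀ a, D.hermHP z a c = D.hermHP z a b * star (unitQ r) := by
  let θ : ℍ[ℝ] := ((z.1⁻¹ : (ℍ[ℝ])ˣ) : ℍ[ℝ]) * unitQ r * z.1
  have hθ : (z.1 : ℍ[ℝ]) * θ = unitQ r * z.1 := by
    simp only [θ]
    rw [← mul_assoc, ← mul_assoc, Units.mul_inv, one_mul]
  obtain ⟨c, hc1, hc2⟩ := D.exists_sigmaHP_tauHP (hv (D.proj z.2)) (θ * D.sigmaHP z b)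
    (D.hk.qsmul (D.proj z.2) θ (D.tauHP z b))
  refine ⟨c, fun a => ?_⟩
  have h2 : star θ * star (z.1 : ℍ[ℝ]) = star (z.1 : ℍ[ℝ]) * star (unitQ r) := by
    rw [← star_mul, hθ, star_mul]
  rw [D.hermHP_eq (hv _), D.hermHP_eq (hv _), hc1, hc2, D.hk.herm_qsmul_right, star_mul,
    ← mul_assoc, ← smul_mul_assoc, ← add_mul, ← mul_assoc, mul_assoc _ (star θ), h2, ← mul_assoc]

end InductionData

namespace HyperkahlerStructure

variable {E : Type*} [NormedAddCommGroup E] [NormedSpace ℝ E] [FiniteDimensional ℝ E]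
  {M : Type*} [TopologicalSpace M] [ChartedSpace E M] [IsManifold 𝓘(ℝ, E) ∞ M]
  (S : HyperkahlerStructure E M)

theorem metric_self_nonneg (m : M) (u : TangentSpace 𝓘(ℝ, E) m) : 0 ≤ S.metric.inner m u u := by
  by_cases h : u = 0
  · simp [h]
  · exact (S.metric.pos m u h).le

theorem eq_zero_of_metric_self {m : M} {u : TangentSpace 𝓘(ℝ, E) m}
    (h : S.metric.inner m u u = 0) : u = 0 := by
  by_contra hne
  exact (S.metric.pos m u hne).ne' h

end HyperkahlerStructure

theorem mul_coe_mul_star (x : ℍ[ℝ]) (r : ℝ) : x * (r : ℍ[ℝ]) * star x = ((r * ‖x‖ ^ 2 : ℝ) : ℍ[ℝ]) := by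
  rw [Quaternion.mul_coe_eq_smul, smul_mul_assoc, Quaternion.self_mul_star,
    Quaternion.normSq_eq_norm_mul_self, ← Quaternion.coe_smul, smul_eq_mul, sq]

namespace InductionData

variable {E : Type*} [NormedAddCommGroup E] [NormedSpace ℝ E] [FiniteDimensional ℝ E]
  {M : Type*} [TopologicalSpace M] [ChartedSpace E M] [IsManifold 𝓘(ℝ, E) ∞ M]
  {F : Type*} [NormedAddCommGroup F] [NormedSpace ℝ F] [FiniteDimensional ℝ F]
  {P : Type*} [TopologicalSpace P] [ChartedSpace F P] [IsManifold 𝓘(ℝ, F) ∞ P]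
  (D : InductionData E M F P)

theorem hermHP_self (hv : ∀ m, 0 < D.v m) (z : (ℍ[ℝ])ˣ × P) (a : ℍ[ℝ] × F) :
    (D.hermHP z a a).re = ((D.v (D.proj z.2))⁻¹ * ‖D.sigmaHP z a‖ ^ 2
      + D.hk.metric.inner (D.proj z.2) (D.tauHP z a) (D.tauHP z a)) * ‖(z.1 : ℍ[ℝ])‖ ^ 2 := by
  rw [D.hermHP_eq (hv _).ne', D.hk.herm_self, Quaternion.self_mul_star,
    Quaternion.normSq_eq_norm_mul_self, ← Quaternion.coe_smul, ← Quaternion.coe_add,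
    mul_coe_mul_star, Quaternion.re_coe, smul_eq_mul, sq ‖D.sigmaHP z a‖]

theorem yHP_gen (z : (ℍ[ℝ])ˣ × P) : yHP z (D.flowHP.gen z) = -1 := by
  have h1 : (D.flowHP.gen z : ℍ[ℝ] × F).1 = (z.1 : ℍ[ℝ]) * qi := congrArg Prod.fst (D.gen_flowHP z)
  have h2 : yHP z (D.flowHP.gen z)
      = ((z.1⁻¹ : (ℍ[ℝ])ˣ) : ℍ[ℝ]) * ((z.1 : ℍ[ℝ]) * qi) * qi := by rw [← h1]; rfl
  rw [h2, ← mul_assoc, Units.inv_mul, one_mul]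
  ext <;> simp

theorem sigmaHP_gen (hnorm : D.IsNormalized) (z : (ℍ[ℝ])ˣ × P) :
    D.sigmaHP z (D.flowHP.gen z) = 0 := by
  have h1 : (D.flowHP.gen z : ℍ[ℝ] × F).2 = -D.lift.circleField z.2 :=
    congrArg Prod.snd (D.gen_flowHP z)
  have h2 : D.xiF z.2 (D.flowHP.gen z : ℍ[ℝ] × F).2 = -(2 * D.v (D.proj z.2)) := by
    rw [h1]
    refine ((D.xiF z.2).map_neg _).trans ?_
    exact congrArg Neg.neg (hnorm z.2)
  have h3 : D.sigmaHP z (D.flowHP.gen z) = ((-(2 * D.v (D.proj z.2)) : ℝ) : ℍ[ℝ])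
      - (2 * D.v (D.proj z.2)) • (-1 : ℍ[ℝ]) := by
    rw [← h2, ← D.yHP_gen z]; rfl
  rw [h3]
  ext <;> simp

theorem dproj_lift (p : P) : D.dproj p (D.lift.circleField p) = D.Kr (D.proj p) :=
  D.dproj_lift_field p

theorem tauHP_gen (z : (ℍ[ℝ])ˣ × P) : D.tauHP z (D.flowHP.gen z) = 0 := by
  have h1 : (D.flowHP.gen z : ℍ[ℝ] × F).2 = -D.lift.circleField z.2 :=
    congrArg Prod.snd (D.gen_flowHP z)
  have h2 : D.dproj z.2 (D.flowHP.gen z : ℍ[ℝ] × F).2 = -D.Kr (D.proj z.2) := by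
    rw [h1]
    refine ((D.dproj z.2).map_neg _).trans ?_
    exact congrArg Neg.neg (D.dproj_lift z.2)
  have h3 : D.tauHP z (D.flowHP.gen z) = -D.Kr (D.proj z.2)
      - D.hk.qsmul (D.proj z.2) (-1) (D.Kr (D.proj z.2)) := by
    rw [← h2, ← D.yHP_gen z]; rfl
  rw [h3, show (-1 : ℍ[ℝ]) = (-1 : ℝ) • (1 : ℍ[ℝ]) by simp, D.hk.qsmul_smul_left, D.hk.qsmul_one]
  simp

/-- The common kernel of `sigmaHP` and `tauHP` is spanned by the circle action. -/
theorem exists_smul_gen_of_sigmaHP [T2Space P] (hnorm : D.IsNormalized)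
    {z : (ℍ[ℝ])ˣ × P} (hv : D.v (D.proj z.2) ≠ 0) {a : ℍ[ℝ] × F}
    (hσ : D.sigmaHP z a = 0) (hτ : D.tauHP z a = 0) :
    ∃ r : ℝ, a = r • (D.flowHP.gen z : ℍ[ℝ] × F) := by
  have hy : yHP z a = ((yHP z a).re : ℍ[ℝ]) := by
    have h : ∀ r, imFn r (D.sigmaHP z a) = 0 := fun r => by rw [hσ]; fin_cases r <;> rfl
    have hr : ∀ r, imFn r (yHP z a) = 0 := fun r => by
      have := h r
      fin_cases r <;> simpa [sigmaHP, imFn, hv] using this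
    ext
    · simp
    · simpa [imFn] using hr 0
    · simpa [imFn] using hr 1
    · simpa [imFn] using hr 2
  set y := (yHP z a).re with hyd
  have hξ : D.xiF z.2 a.2 = 2 * D.v (D.proj z.2) * y := by
    have h := congrArg QuaternionAlgebra.re hσ
    simp [sigmaHP] at h
    linarith
  have hd : D.dproj z.2 a.2 = y • D.Kr (D.proj z.2) := by
    rw [tauHP, hy, show ((y : ℝ) : ℍ[ℝ]) = y • (1 : ℍ[ℝ]) by ext <;> simp, D.hk.qsmul_smul_left,
      D.hk.qsmul_one] at hτ
    exact sub_eq_zero.1 hτ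
  let Y : F := D.lift.circleField z.2
  let k : F := D.princ.circleField z.2
  have hY : D.dproj z.2 Y = D.Kr (D.proj z.2) := D.dproj_lift z.2
  have hker : D.dproj z.2 (a.2 - y • Y) = 0 := by
    rw [map_sub, map_smul, hY, hd, sub_self]
  obtain ⟨r, hr⟩ := D.princ.toCircleFlow.exists_smul_gen (fun ζ p h => D.isPrincipal.free ζ p h)
    D.isPrincipal.contMDiff (fun p p' h => (D.isPrincipal.fibre p p').1 h) z.2
    (D.isPrincipal.submersion z.2) (a.2 - y • Y) hker
  have hr' : a.2 - y • Y = r • k := hr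
  have hk : D.xiF z.2 k = 1 := D.isConnection.field z.2
  have hYx : D.xiF z.2 Y = 2 * D.v (D.proj z.2) := hnorm z.2
  have hr0 : r = 0 := by
    have h := congrArg (D.xiF z.2) hr'
    rw [map_sub, map_smul, map_smul, hk, hYx, hξ, smul_eq_mul, smul_eq_mul] at h
    linarith
  rw [hr0, zero_smul, sub_eq_zero] at hr'
  refine ⟨-y, ?_⟩
  have hg := D.gen_flowHP z
  rw [hg]
  refine Prod.ext ?_ ?_
  · have h1 := mul_yHP z a
    rw [hy, Quaternion.mul_coe_eq_smul] at h1
    have h2 : a.1 * qi * qi = -a.1 := by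
      rw [mul_assoc]
      have : qi * qi = -1 := by ext <;> simp
      rw [this]; simp
    rw [← h1] at h2
    rw [← neg_eq_iff_eq_neg] at h2
    have h3 : -(y • (z.1 : ℍ[ℝ]) * qi) = -y • ((z.1 : ℍ[ℝ]) * qi) := by
      rw [smul_mul_assoc, neg_smul]
    exact h2.symm.trans h3
  · refine hr'.trans ?_
    have : -y • (-Y) = y • Y := by simp
    exact this.symm

theorem herm_push_rot (z : Circle) (m : M) (u u' : TangentSpace 𝓘(ℝ, E) m) :
    D.hk.herm (D.rot.act z m) (D.rot.push z m u) (D.rot.push z m u')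
      = (circleToQuat z : ℍ[ℝ]) * D.hk.herm m u u' * star (circleToQuat z : ℍ[ℝ]) := by
  rw [HyperkahlerStructure.herm, HyperkahlerStructure.herm, D.isRotating.metric_push,
    D.isRotating.omega_push, mul_add, add_mul]
  congr 1
  rw [Quaternion.mul_coe_eq_smul, smul_mul_assoc, circleToQuat_mul_star]
  ext <;> simp

theorem herm_congr (S : HyperkahlerStructure E M) {m m' : M} (h : m = m')
    {u v : TangentSpace 𝓘(ℝ, E) m} {u' v' : TangentSpace 𝓘(ℝ, E) m'}
    (hu : (u : E) = u') (hv : (v : E) = v') : S.herm m u v = S.herm m' u' v' := by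
  subst h
  cases hu
  cases hv
  rfl

theorem dproj_push_lift (z : Circle) (p : P) (u : F) :
    (D.dproj (D.lift.act z p) ((D.lift.push z p : F →L[ℝ] F) u) : E)
      = D.rot.push z (D.proj p) (D.dproj p u) := by
  have h1 := HasMFDerivAt.comp p
    ((D.isPrincipal.contMDiff (D.lift.act z p)).mdifferentiableAt (by simp)).hasMFDerivAt
    (D.lift.hasMFDerivAt_act z p)
  have h2 := HasMFDerivAt.comp p (D.rot.hasMFDerivAt_act z (D.proj p))
    ((D.isPrincipal.contMDiff p).mdifferentiableAt (by simp)).hasMFDerivAt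
  have h3 : D.proj ∘ D.lift.act z = D.rot.act z ∘ D.proj := funext fun p => D.proj_lift z p
  rw [h3] at h1
  exact DFunLike.congr_fun (hasMFDerivAt_unique h1 h2) u

/-- The form `hermHP` is invariant under the circle action. -/
theorem hermHP_flowHP (hnorm : D.IsNormalized) (hcurv : D.CurvatureEquation) (ζ : Circle)
    (z : (ℍ[ℝ])ˣ × P) (a b : ℍ[ℝ] × F) :
    D.hermHP (D.flowHP.act ζ z) (a.1 * circleToQuat ζ, (D.lift.push ζ⁻¹ z.2 : F →L[ℝ] F) a.2)
      (b.1 * circleToQuat ζ, (D.lift.push ζ⁻¹ z.2 : F →L[ℝ] F) b.2) = D.hermHP z a b := by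
  rw [hermHP_eq_hermF, hermHP_eq_hermF]
  have hp : D.proj (D.flowHP.act ζ z).2 = D.rot.act ζ⁻¹ (D.proj z.2) := D.proj_lift ζ⁻¹ z.2
  have hK : (D.Kr (D.proj (D.flowHP.act ζ z).2) : E) = D.rot.push ζ⁻¹ (D.proj z.2) (D.Kr (D.proj z.2)) := by
    rw [push_Kr, hp]
  have hd : ∀ u : F, (D.dproj (D.flowHP.act ζ z).2 ((D.lift.push ζ⁻¹ z.2 : F →L[ℝ] F) u) : E)
      = D.rot.push ζ⁻¹ (D.proj z.2) (D.dproj z.2 u) := D.dproj_push_lift ζ⁻¹ z.2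
  have hξ : ∀ u : F, D.xiF (D.flowHP.act ζ z).2 ((D.lift.push ζ⁻¹ z.2 : F →L[ℝ] F) u) = D.xiF z.2 u :=
    D.xi_lift hnorm hcurv ζ⁻¹ z.2
  have hstar : (circleToQuat ζ⁻¹ : ℍ[ℝ]) = star (circleToQuat ζ : ℍ[ℝ]) := coe_circleToQuat_inv ζ
  have hη : ∀ u : F, D.hk.herm (D.proj (D.flowHP.act ζ z).2) (D.Kr (D.proj (D.flowHP.act ζ z).2))
      (D.dproj (D.flowHP.act ζ z).2 ((D.lift.push ζ⁻¹ z.2 : F →L[ℝ] F) u))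
      = star (circleToQuat ζ : ℍ[ℝ]) * D.hk.herm (D.proj z.2) (D.Kr (D.proj z.2)) (D.dproj z.2 u)
        * (circleToQuat ζ : ℍ[ℝ]) := fun u => by
    rw [herm_congr D.hk hp hK (hd u), herm_push_rot, hstar, star_star]
  have hh : D.hk.herm (D.proj (D.flowHP.act ζ z).2)
      (D.dproj (D.flowHP.act ζ z).2 ((D.lift.push ζ⁻¹ z.2 : F →L[ℝ] F) a.2))
      (D.dproj (D.flowHP.act ζ z).2 ((D.lift.push ζ⁻¹ z.2 : F →L[ℝ] F) b.2))
      = star (circleToQuat ζ : ℍ[ℝ]) * D.hk.herm (D.proj z.2) (D.dproj z.2 a.2) (D.dproj z.2 b.2)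
        * (circleToQuat ζ : ℍ[ℝ]) := by
    rw [herm_congr D.hk hp (hd a.2) (hd b.2), herm_push_rot, hstar, star_star]
  rw [hη, hη, hh, hξ, hξ, hp, rho_act, v_act]
  have hx : ((D.flowHP.act ζ z).1 : ℍ[ℝ]) = (z.1 : ℍ[ℝ]) * circleToQuat ζ := rfl
  have hc : ∀ c : ℍ[ℝ], c * (circleToQuat ζ : ℍ[ℝ]) * qi = c * qi * circleToQuat ζ := fun c => by
    rw [mul_assoc, circleToQuat_mul_qi, ← mul_assoc]
  rw [hx, hc, hc]
  exact hermF_circle _ _ _ _ _ _ _ _ _ _ (circleToQuat_mul_star ζ)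

end InductionData

theorem imFn_coe_add (r : Fin 3) (c : ℝ) (q : ℍ[ℝ]) : imFn r ((c : ℍ[ℝ]) + q) = imFn r q := by
  fin_cases r <;> simp [imFn]

namespace InductionData

variable {E : Type*} [NormedAddCommGroup E] [NormedSpace ℝ E] [FiniteDimensional ℝ E]
  {M : Type*} [TopologicalSpace M] [ChartedSpace E M] [IsManifold 𝓘(ℝ, E) ∞ M]
  {F : Type*} [NormedAddCommGroup F] [NormedSpace ℝ F] [FiniteDimensional ℝ F]
  {P : Type*} [TopologicalSpace P] [ChartedSpace F P] [IsManifold 𝓘(ℝ, F) ∞ P]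
  (D : InductionData E M F P)
  {E' : Type*} [NormedAddCommGroup E'] [NormedSpace ℝ E'] [FiniteDimensional ℝ E']
  {N : Type*} [TopologicalSpace N] [ChartedSpace E' N] [IsManifold 𝓘(ℝ, E') ∞ N]
  {q : (ℍ[ℝ])ˣ × P → N}

theorem mfderiv_gen_eq_zero (hq : D.IsQuotientMap (E' := E') q) (z : (ℍ[ℝ])ˣ × P) :
    mfderiv (𝓘(ℝ, ℍ[ℝ]).prod 𝓘(ℝ, F)) 𝓘(ℝ, E') q z (D.flowHP.gen z) = 0 :=
  D.flowHP.mfderiv_gen z ((hq.contMDiff z).mdifferentiableAt (by simp)) fun ζ =>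
    ((hq.fibre _ _).2 ((D.sameOrbit_iff _ _).2 ⟨ζ, rfl⟩)).symm

theorem mfderiv_push_flowHP (hq : D.IsQuotientMap (E' := E') q) (ζ : Circle) (z : (ℍ[ℝ])ˣ × P)
    (a : ℍ[ℝ] × F) :
    (mfderiv (𝓘(ℝ, ℍ[ℝ]).prod 𝓘(ℝ, F)) 𝓘(ℝ, E') q (D.flowHP.act ζ z) : ℍ[ℝ] × F →L[ℝ] E')
      (a.1 * circleToQuat ζ, (D.lift.push ζ⁻¹ z.2 : F →L[ℝ] F) a.2)
    = (mfderiv (𝓘(ℝ, ℍ[ℝ]).prod 𝓘(ℝ, F)) 𝓘(ℝ, E') q z : ℍ[ℝ] × F →L[ℝ] E') a := by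
  have h1 := HasMFDerivAt.comp z
    ((hq.contMDiff (D.flowHP.act ζ z)).mdifferentiableAt (by simp)).hasMFDerivAt
    ((D.flowHP.contMDiff_act_left ζ z).mdifferentiableAt (by simp)).hasMFDerivAt
  have h2 : q ∘ D.flowHP.act ζ = q := funext fun z =>
    ((hq.fibre _ _).2 ((D.sameOrbit_iff _ _).2 ⟨ζ, rfl⟩)).symm
  rw [h2] at h1
  let dq : ℍ[ℝ] × F →L[ℝ] E' :=
    mfderiv (𝓘(ℝ, ℍ[ℝ]).prod 𝓘(ℝ, F)) 𝓘(ℝ, E') q (D.flowHP.act ζ z)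
  refine (congrArg dq (D.mfderiv_flowHP ζ z a)).symm.trans ?_
  exact (DFunLike.congr_fun h1.mfderiv a).symm

theorem hermHP_congr (hv : ∀ m, D.v m ≠ 0) {z : (ℍ[ℝ])ˣ × P} {a b a' b' : ℍ[ℝ] × F}
    (h1 : D.sigmaHP z a = D.sigmaHP z a') (h2 : D.tauHP z a = D.tauHP z a')
    (h3 : D.sigmaHP z b = D.sigmaHP z b') (h4 : D.tauHP z b = D.tauHP z b') :
    D.hermHP z a b = D.hermHP z a' b' := by
  rw [D.hermHP_eq (hv _), D.hermHP_eq (hv _), h1, h2, h3, h4]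

/-- The induced hyperKähler structure exists if the curvature equation holds. -/
theorem exists_isInduced [T2Space P] (hv : ∀ m, 0 < D.v m) (hnorm : D.IsNormalized)
    (hcurv : D.CurvatureEquation) (hq : D.IsQuotientMap (E' := E') q)
    (hsurj : Function.Surjective q) : ∃ S : HyperkahlerStructure E' N, D.IsInduced q S := by
  have hv' : ∀ m, D.v m ≠ 0 := fun m => (hv m).ne'
  have hker : ∀ (z : (ℍ[ℝ])ˣ × P) (a a' : ℍ[ℝ] × F),
      (mfderiv (𝓘(ℝ, ℍ[ℝ]).prod 𝓘(ℝ, F)) 𝓘(ℝ, E') q z : ℍ[ℝ] × F →L[ℝ] E') a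
        = (mfderiv (𝓘(ℝ, ℍ[ℝ]).prod 𝓘(ℝ, F)) 𝓘(ℝ, E') q z : ℍ[ℝ] × F →L[ℝ] E') a' →
      D.sigmaHP z a = D.sigmaHP z a' ∧ D.tauHP z a = D.tauHP z a' := by
    intro z a a' h
    let dq : ℍ[ℝ] × F →L[ℝ] E' := mfderiv (𝓘(ℝ, ℍ[ℝ]).prod 𝓘(ℝ, F)) 𝓘(ℝ, E') q z
    have h0 : dq (a - a') = 0 := by rw [map_sub]; exact sub_eq_zero.2 h
    obtain ⟨r, hr⟩ := D.flowHP.exists_smul_gen D.flowHP_free hq.contMDiff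
      (fun z z' h => (D.sameOrbit_iff _ _).1 ((hq.fibre z z').1 h)) z (hq.submersion z) (a - a') h0
    let k : ℍ[ℝ] × F := D.flowHP.gen z
    have h1 : a = a' + r • k := by
      rw [← sub_eq_iff_eq_add']; exact hr
    have h2 : D.sigmaHP z k = 0 := D.sigmaHP_gen hnorm z
    have h3 : D.tauHP z k = 0 := D.tauHP_gen z
    rw [h1, sigmaHP_add, sigmaHP_smul, tauHP_add, tauHP_smul, h2, h3]
    simp
  obtain ⟨S, hS⟩ := exists_hyperkahler_of_hermitian hq.contMDiff hsurj hq.submersion (D.hermL hv')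
    (D.star_hermHP hv') (fun r z b => D.exists_hermHP_J hv' r z b)
    (fun z a ha => by
      have h := D.hermHP_self hv z a
      have h1 : 0 ≤ (D.v (D.proj z.2))⁻¹ * ‖D.sigmaHP z a‖ ^ 2 :=
        mul_nonneg (inv_nonneg.2 (hv _).le) (sq_nonneg _)
      have h2 := D.hk.metric_self_nonneg _ (D.tauHP z a)
      have hx : 0 < ‖(z.1 : ℍ[ℝ])‖ ^ 2 := by
        have := norm_pos_iff.2 z.1.ne_zero
        positivity
      by_contra hcon
      have h0 : (D.v (D.proj z.2))⁻¹ * ‖D.sigmaHP z a‖ ^ 2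
          + D.hk.metric.inner (D.proj z.2) (D.tauHP z a) (D.tauHP z a) ≤ 0 := by
        by_contra hc
        exact hcon (lt_of_lt_of_eq (mul_pos (not_le.1 hc) hx) h.symm)
      have hσ : D.sigmaHP z a = 0 := by
        have h3 : (D.v (D.proj z.2))⁻¹ * ‖D.sigmaHP z a‖ ^ 2 = 0 := by linarith
        rcases mul_eq_zero.1 h3 with h4 | h4
        · exact absurd h4 (inv_ne_zero (hv' _))
        · exact norm_eq_zero.1 (by simpa using h4)
      have hτ : D.tauHP z a = 0 := D.hk.eq_zero_of_metric_self (by linarith)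
      obtain ⟨r, hr⟩ := D.exists_smul_gen_of_sigmaHP hnorm (hv' _) hσ hτ
      let dq : ℍ[ℝ] × F →L[ℝ] E' := mfderiv (𝓘(ℝ, ℍ[ℝ]).prod 𝓘(ℝ, F)) 𝓘(ℝ, E') q z
      have hg : dq (D.flowHP.gen z) = 0 := D.mfderiv_gen_eq_zero hq z
      have : dq a = 0 := by
        rw [hr]
        exact (dq.map_smul r _).trans (by rw [hg, smul_zero])
      exact ha this)
    (fun z z' a b a' b' h ha hb => by
      obtain ⟨ζ, rfl⟩ := (D.sameOrbit_iff _ _).1 ((hq.fibre z z').1 h)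
      have e1 := hker (D.flowHP.act ζ z) _ a' ((D.mfderiv_push_flowHP hq ζ z a).trans ha)
      have e2 := hker (D.flowHP.act ζ z) _ b' ((D.mfderiv_push_flowHP hq ζ z b).trans hb)
      refine (D.hermHP_flowHP hnorm hcurv ζ z a b).symm.trans ?_
      exact D.hermHP_congr hv' e1.1 e1.2 e2.1 e2.2)
    (fun Z y hZ a b => by
      refine ContDiffAt.add ?_ (D.contDiffAt_omegaHP hZ a b)
      have h1 := D.contDiffAt_metricHP hv' hZ a b
      refine contDiffAt_quaternion (by simpa using h1) fun r => ?_
      fin_cases r <;> simpa [imFn] using contDiffAt_const)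
    (fun r Z y hZ a b c => by
      refine (dTwo_congr (Eventually.of_forall fun y a b => ?_) a b c).trans
        (D.dTwo_omegaHP hcurv hZ r a b c)
      exact imFn_coe_add r _ _)
  refine ⟨S, fun z a b => ?_⟩
  obtain ⟨h1, h2⟩ := hS z a b
  have hom : ∀ r, imFn r (D.hermHP z a b) = imFn r (D.omegaHP z a b) := fun r =>
    imFn_coe_add r _ _
  have hre : (D.omegaHP z a b).re = 0 := by
    simp [omegaHP]
    ring
  refine ⟨h1.trans ?_, ?_⟩
  · change ((D.metricHP z a b : ℍ[ℝ]) + D.omegaHP z a b).re = _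
    rw [Quaternion.re_add, hre, Quaternion.re_coe, add_zero]
  · ext
    · rw [hre]; rfl
    · exact (h2 0).trans (hom 0)
    · exact (h2 1).trans (hom 1)
    · exact (h2 2).trans (hom 2)

end InductionData

/-- The unit `e ^ t` of the quaternions. -/
def expUnit (t : ℝ) : (ℍ[ℝ])ˣ where
  val := Real.exp t • 1
  inv := Real.exp (-t) • 1
  val_inv := by rw [smul_mul_smul_comm, ← Real.exp_add]; simp
  inv_val := by rw [smul_mul_smul_comm, ← Real.exp_add]; simp

theorem coe_expUnit (t : ℝ) : (expUnit t : ℍ[ℝ]) = Real.exp t • 1 := rfl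

theorem contMDiff_expUnit : ContMDiff 𝓘(ℝ, ℝ) 𝓘(ℝ, ℍ[ℝ]) ∞ expUnit := by
  refine contMDiff_units ?_
  have : ContDiff ℝ ∞ (fun t : ℝ => Real.exp t • (1 : ℍ[ℝ])) := Real.contDiff_exp.smul contDiff_const
  exact this.contMDiff

theorem hasDerivAt_expUnit (t : ℝ) :
    HasDerivAt (fun t : ℝ => (expUnit t : ℍ[ℝ])) (Real.exp t • 1) t :=
  (Real.hasDerivAt_exp t).smul_const (1 : ℍ[ℝ])

theorem expUnit_zero : expUnit 0 = 1 := by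
  ext1
  simp [coe_expUnit]

theorem plotD_comp_snd {E V : Type*} [NormedAddCommGroup E] [NormedSpace ℝ E]
    [NormedAddCommGroup V] [NormedSpace ℝ V] {M : Type*} [TopologicalSpace M] [ChartedSpace E M]
    {φ : V → M} {p : ℝ × V} (hφ : MDifferentiableAt 𝓘(ℝ, V) 𝓘(ℝ, E) φ p.2) (a : ℝ × V) :
    plotD (E := E) (fun p : ℝ × V => φ p.2) p a = plotD (E := E) φ p.2 a.2 := by
  have h := plotD_comp (f := (Prod.snd : ℝ × V → V)) (y := p) hφ differentiableAt_snd a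
  rw [fderiv_snd] at h
  exact h

theorem imFn_omegaF_radial (t : ℝ) (ξ : ℝ) (η : ℍ[ℝ]) :
    imFn 0 (omegaF t 1 1 0 0 ξ 0 η 0) = -(2 * ξ + η.re) ∧
    imFn 0 (omegaF t 1 0 1 ξ 0 η 0 0) = 2 * ξ + η.re := by
  constructor
  · simp [imFn, omegaF]
    ring
  · simp [imFn, omegaF]

theorem imFn_omegaF_real (t s : ℝ) (ξ ξ' : ℝ) (η η' om : ℍ[ℝ]) :
    imFn 0 (omegaF t (s • 1) 0 0 ξ ξ' η η' om) = s ^ 2 * om.imI := by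
  simp [imFn, omegaF]
  ring

namespace InductionData

variable {E : Type*} [NormedAddCommGroup E] [NormedSpace ℝ E] [FiniteDimensional ℝ E]
  {M : Type*} [TopologicalSpace M] [ChartedSpace E M] [IsManifold 𝓘(ℝ, E) ∞ M]
  {F : Type*} [NormedAddCommGroup F] [NormedSpace ℝ F] [FiniteDimensional ℝ F]
  {P : Type*} [TopologicalSpace P] [ChartedSpace F P] [IsManifold 𝓘(ℝ, F) ∞ P]
  (D : InductionData E M F P)
  {E' : Type*} [NormedAddCommGroup E'] [NormedSpace ℝ E'] [FiniteDimensional ℝ E']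
  {N : Type*} [TopologicalSpace N] [ChartedSpace E' N] [IsManifold 𝓘(ℝ, E') ∞ N]
  {q : (ℍ[ℝ])ˣ × P → N} {V : Type*} [NormedAddCommGroup V] [NormedSpace ℝ V] [FiniteDimensional ℝ V]

theorem omegaHP_expUnit {σ : V → P} {t : ℝ} {y : V} (hσ : ContMDiffAt 𝓘(ℝ, V) 𝓘(ℝ, F) ∞ σ y)
    {Z : ℝ × V → (ℍ[ℝ])ˣ × P} (hZdef : Z = fun p => (expUnit p.1, σ p.2))
    (hZ : ContMDiffAt 𝓘(ℝ, ℝ × V) (𝓘(ℝ, ℍ[ℝ]).prod 𝓘(ℝ, F)) ∞ Z (t, y)) (a b : ℝ × V) :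
    D.omegaHP (Z (t, y)) (mfderiv 𝓘(ℝ, ℝ × V) (𝓘(ℝ, ℍ[ℝ]).prod 𝓘(ℝ, F)) Z (t, y) a)
        (mfderiv 𝓘(ℝ, ℝ × V) (𝓘(ℝ, ℍ[ℝ]).prod 𝓘(ℝ, F)) Z (t, y) b)
      = omegaF (-2 * D.rho (D.proj (σ y))) (Real.exp t • 1) (a.1 • Real.exp t • 1)
        (b.1 • Real.exp t • 1) (D.xi (σ y) (plotD σ y a.2)) (D.xi (σ y) (plotD σ y b.2))
        (D.eta (D.proj (σ y)) (plotD (fun y => D.proj (σ y)) y a.2))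
        (D.eta (D.proj (σ y)) (plotD (fun y => D.proj (σ y)) y b.2))
        (D.hk.omegaQ (D.proj (σ y)) (plotD (fun y => D.proj (σ y)) y a.2)
          (plotD (fun y => D.proj (σ y)) y b.2)) := by
  rw [D.omegaHP_plot hZ]
  subst hZdef
  have hπ : ContMDiffAt 𝓘(ℝ, V) 𝓘(ℝ, E) ∞ (fun y => D.proj (σ y)) y :=
    ContMDiffAt.comp (g := D.proj) y (D.isPrincipal.contMDiff _) hσ
  have hX : ∀ a : ℝ × V, fderiv ℝ (fun p : ℝ × V => (expUnit p.1 : ℍ[ℝ])) (t, y) a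
      = a.1 • Real.exp t • 1 := fun a => by
    have h := HasFDerivAt.comp (t, y) (g := fun t : ℝ => (expUnit t : ℍ[ℝ]))
      (f := (Prod.fst : ℝ × V → ℝ)) (hasDerivAt_expUnit t).hasFDerivAt hasFDerivAt_fst
    exact DFunLike.congr_fun h.fderiv a
  have e1 : ∀ a : ℝ × V, plotD (E := F) (fun p : ℝ × V => σ p.2) (t, y) a = plotD (E := F) σ y a.2 :=
    fun a => plotD_comp_snd (p := (t, y)) (hσ.mdifferentiableAt (by simp)) a
  have e2 : ∀ a : ℝ × V, plotD (E := E) (fun p : ℝ × V => D.proj (σ p.2)) (t, y) a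
      = plotD (E := E) (fun y => D.proj (σ y)) y a.2 :=
    fun a => plotD_comp_snd (φ := fun y => D.proj (σ y)) (p := (t, y))
      (hπ.mdifferentiableAt (by simp)) a
  simp only [hX, e1, e2]
  rfl

theorem curvature_plot (hq : ContMDiff (𝓘(ℝ, ℍ[ℝ]).prod 𝓘(ℝ, F)) 𝓘(ℝ, E') ∞ q)
    (S : HyperkahlerStructure E' N) (hS : D.IsInduced q S) {σ : V → P} {y₀ : V}
    (hσ : ∀ᶠ y in 𝓝 y₀, ContMDiffAt 𝓘(ℝ, V) 𝓘(ℝ, F) ∞ σ y) (b c : V) :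
    extDerivOne D.xi (σ y₀) (plotD σ y₀ b) (plotD σ y₀ c) + 1 / 2 * extDerivOne D.etaRe (D.proj (σ y₀))
        (plotD (fun y => D.proj (σ y)) y₀ b) (plotD (fun y => D.proj (σ y)) y₀ c)
      + D.hk.omega 0 (D.proj (σ y₀)) (plotD (fun y => D.proj (σ y)) y₀ b)
        (plotD (fun y => D.proj (σ y)) y₀ c) = 0 := by
  have hσ0 := hσ.self_of_nhds
  have hπ0 : ContMDiffAt 𝓘(ℝ, V) 𝓘(ℝ, E) ∞ (fun y => D.proj (σ y)) y₀ :=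
    ContMDiffAt.comp (g := D.proj) y₀ (D.isPrincipal.contMDiff _) hσ0
  obtain ⟨Z, hZdef⟩ : ∃ Z : ℝ × V → (ℍ[ℝ])ˣ × P, Z = fun p => (expUnit p.1, σ p.2) := ⟨_, rfl⟩
  have hZ : ∀ t y, ContMDiffAt 𝓘(ℝ, V) 𝓘(ℝ, F) ∞ σ y →
      ContMDiffAt 𝓘(ℝ, ℝ × V) (𝓘(ℝ, ℍ[ℝ]).prod 𝓘(ℝ, F)) ∞ Z (t, y) := fun t y h => by
    have h1 : ContMDiff 𝓘(ℝ, ℝ × V) 𝓘(ℝ, ℝ) ∞ (Prod.fst : ℝ × V → ℝ) := contDiff_fst.contMDiff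
    have h2 : ContMDiff 𝓘(ℝ, ℝ × V) 𝓘(ℝ, V) ∞ (Prod.snd : ℝ × V → V) := contDiff_snd.contMDiff
    rw [hZdef]
    exact (ContMDiffAt.comp (g := expUnit) (t, y) (contMDiff_expUnit _) (h1 _)).prodMk
      (ContMDiffAt.comp (g := σ) (f := Prod.snd) (t, y) h (h2 _))
  let φ : ℝ × V → N := fun p => q (Z p)
  have hφ : ∀ t y, ContMDiffAt 𝓘(ℝ, V) 𝓘(ℝ, F) ∞ σ y →
      ContMDiffAt 𝓘(ℝ, ℝ × V) 𝓘(ℝ, E') ∞ φ (t, y) := fun t y h =>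
    ContMDiffAt.comp (g := q) (t, y) (hq _) (hZ t y h)
  have hpull : ∀ t y, ContMDiffAt 𝓘(ℝ, V) 𝓘(ℝ, F) ∞ σ y → ∀ a b : ℝ × V,
      pullTwo (S.omegaL 0) φ (t, y) a b = imFn 0 (omegaF (-2 * D.rho (D.proj (σ y)))
        (Real.exp t • 1) (a.1 • Real.exp t • 1)
        (b.1 • Real.exp t • 1) (D.xi (σ y) (plotD σ y a.2)) (D.xi (σ y) (plotD σ y b.2))
        (D.eta (D.proj (σ y)) (plotD (fun y => D.proj (σ y)) y a.2))
        (D.eta (D.proj (σ y)) (plotD (fun y => D.proj (σ y)) y b.2))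
        (D.hk.omegaQ (D.proj (σ y)) (plotD (fun y => D.proj (σ y)) y a.2)
          (plotD (fun y => D.proj (σ y)) y b.2))) := by
    intro t y h a b
    rw [← D.omegaHP_expUnit h hZdef (hZ t y h), ← (hS (Z (t, y)) _ _).2, imFn_omegaQ]
    have h1 := HasMFDerivAt.comp (t, y) ((hq (Z (t, y))).mdifferentiableAt (by simp)).hasMFDerivAt
      ((hZ t y h).mdifferentiableAt (by simp)).hasMFDerivAt
    have h2 : ∀ a, plotD (E := E') φ (t, y) a
        = mfderiv (𝓘(ℝ, ℍ[ℝ]).prod 𝓘(ℝ, F)) 𝓘(ℝ, E') q (Z (t, y))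
          (mfderiv 𝓘(ℝ, ℝ × V) (𝓘(ℝ, ℍ[ℝ]).prod 𝓘(ℝ, F)) Z (t, y) a) := fun a =>
      DFunLike.congr_fun h1.mfderiv a
    rw [← h2, ← h2]
    rfl
  have hdiff : ∀ a b, DifferentiableAt ℝ (fun p => pullTwo (S.omegaL 0) φ p a b) (0, y₀) :=
    fun a b => (contDiffAt_pullTwo (S.smoothTwo_omegaL 0) (hφ 0 y₀ hσ0) a b).differentiableAt
      (by simp)
  have key := dTwo_pullTwo (S.smoothTwo_omegaL 0) (S.omega_skew 0) (hφ 0 y₀ hσ0) (1, 0) (0, b) (0, c)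
  rw [S.extDerivTwo_omegaL 0] at key
  simp only [dTwo] at key
  rw [fderiv_prod_left (hdiff _ _), fderiv_prod_right (hdiff _ _), fderiv_prod_right (hdiff _ _)]
    at key
  have hom0 : ∀ (m : M) (u : TangentSpace 𝓘(ℝ, E) m), D.hk.omegaQ m u 0 = 0 ∧ D.hk.omegaQ m 0 u = 0 :=
    fun m u => by
      constructor <;> ext <;> simp [HyperkahlerStructure.omega]
  have heta0 : ∀ m : M, D.eta m 0 = 0 := fun m => by
    rw [eta, (hom0 m _).1]
    simp
  have f1 : deriv (fun t => pullTwo (S.omegaL 0) φ (t, y₀) (0, b) (0, c)) 0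
      = 2 * D.hk.omega 0 (D.proj (σ y₀)) (plotD (fun y => D.proj (σ y)) y₀ b)
        (plotD (fun y => D.proj (σ y)) y₀ c) := by
    simp only [hpull _ y₀ hσ0, zero_smul, imFn_omegaF_real, omegaQ_imI]
    have h := ((Real.hasDerivAt_exp 0).pow 2).mul_const (D.hk.omega 0 (D.proj (σ y₀))
      (plotD (fun y => D.proj (σ y)) y₀ b) (plotD (fun y => D.proj (σ y)) y₀ c))
    refine h.deriv.trans ?_
    simp
  have f2 : (fun y => pullTwo (S.omegaL 0) φ (0, y) (0, c) (1, 0)) =ᶠ[𝓝 y₀] fun y =>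
      2 * pullOne D.xi σ y c + pullOne D.etaRe (fun y => D.proj (σ y)) y c := by
    filter_upwards [hσ] with y hy
    rw [hpull 0 y hy]
    simp only [map_zero, zero_smul, Real.exp_zero, one_smul, heta0, (hom0 _ _).1,
      (imFn_omegaF_radial _ _ _).2, eta_re]
    rfl
  have f3 : (fun y => pullTwo (S.omegaL 0) φ (0, y) (1, 0) (0, b)) =ᶠ[𝓝 y₀] fun y =>
      -(2 * pullOne D.xi σ y b + pullOne D.etaRe (fun y => D.proj (σ y)) y b) := by
    filter_upwards [hσ] with y hy
    rw [hpull 0 y hy]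
    simp only [map_zero, zero_smul, Real.exp_zero, one_smul, heta0, (hom0 _ _).2,
      (imFn_omegaF_radial _ _ _).1, eta_re]
    rfl
  have g1 : ∀ a, DifferentiableAt ℝ (fun y => pullOne D.xi σ y a) y₀ := fun a =>
    ((contDiffAt_pullOne D.smoothOne_xi hσ0).differentiableAt (by simp)).clm_apply
      (differentiableAt_const a)
  have g2 : ∀ a, DifferentiableAt ℝ (fun y => pullOne D.etaRe (fun y => D.proj (σ y)) y a) y₀ :=
    fun a => ((contDiffAt_pullOne D.smoothOne_etaRe hπ0).differentiableAt (by simp)).clm_apply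
      (differentiableAt_const a)
  rw [f1, f2.fderiv_eq, f3.fderiv_eq, fderiv_fun_neg, fderiv_fun_add ((g1 c).const_mul 2) (g2 c),
    fderiv_fun_add ((g1 b).const_mul 2) (g2 b), fderiv_const_mul (g1 c), fderiv_const_mul (g1 b)] at key
  simp only [add_apply, neg_apply, smul_apply, smul_eq_mul] at key
  have d1 := dOne_pullOne D.smoothOne_xi hσ0 b c
  have d2 := dOne_pullOne D.smoothOne_etaRe hπ0 b c
  simp only [dOne] at d1 d2
  rw [← d1, ← d2]
  linarith

/-- The curvature equation is necessary for the induced hyperKähler structure. -/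
theorem curvatureEquation_of_isInduced (hq : ContMDiff (𝓘(ℝ, ℍ[ℝ]).prod 𝓘(ℝ, F)) 𝓘(ℝ, E') ∞ q)
    (S : HyperkahlerStructure E' N) (hS : D.IsInduced q S) : D.CurvatureEquation := by
  rw [curvatureEquation_iff]
  let C : (p : P) → F → F → Prop := fun p u u' => extDerivOne D.xi p u u'
    + 1 / 2 * extDerivOne D.etaRe (D.proj p) (mfderiv 𝓘(ℝ, F) 𝓘(ℝ, E) D.proj p u)
      (mfderiv 𝓘(ℝ, F) 𝓘(ℝ, E) D.proj p u')
    + D.hk.omega 0 (D.proj p) (mfderiv 𝓘(ℝ, F) 𝓘(ℝ, E) D.proj p u)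
      (mfderiv 𝓘(ℝ, F) 𝓘(ℝ, E) D.proj p u') = 0
  have hC : ∀ {p p' : P} {u u' v v' : F}, p = p' → u = u' → v = v' → C p u v → C p' u' v' := by
    rintro p p' u u' v v' rfl rfl rfl h
    exact h
  intro p u u'
  obtain ⟨e, he⟩ : ∃ e : F, e = u := ⟨u, rfl⟩
  obtain ⟨e', he'⟩ : ∃ e : F, e = u' := ⟨u', rfl⟩
  have h := D.curvature_plot hq S hS (σ := (extChartAt 𝓘(ℝ, F) p).symm) (y₀ := extChartAt 𝓘(ℝ, F) p p)
    (eventually_contMDiffAt_extChartAt_symm p) e e'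
  refine hC (extChartAt_to_inv (I := 𝓘(ℝ, F)) p) ((SmoothFlow.plotD_extChartAt_symm p e).trans he)
    ((SmoothFlow.plotD_extChartAt_symm p e').trans he') ?_
  have h1 := HasMFDerivAt.comp (extChartAt 𝓘(ℝ, F) p p)
    ((D.isPrincipal.contMDiff ((extChartAt 𝓘(ℝ, F) p).symm (extChartAt 𝓘(ℝ, F) p p))).mdifferentiableAt
      (by simp)).hasMFDerivAt
    ((contMDiffAt_extChartAt_symm p).mdifferentiableAt (by simp)).hasMFDerivAt
  have h2 : ∀ a, plotD (E := E) (fun y => D.proj ((extChartAt 𝓘(ℝ, F) p).symm y))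
      (extChartAt 𝓘(ℝ, F) p p) a = mfderiv 𝓘(ℝ, F) 𝓘(ℝ, E) D.proj
        ((extChartAt 𝓘(ℝ, F) p).symm (extChartAt 𝓘(ℝ, F) p p))
        (plotD (E := F) (extChartAt 𝓘(ℝ, F) p).symm (extChartAt 𝓘(ℝ, F) p p) a) := fun a =>
    DFunLike.congr_fun h1.mfderiv a
  rw [h2, h2] at h
  exact h

end InductionData

section Permuting

variable {E : Type*} [NormedAddCommGroup E] [NormedSpace ℝ E] [FiniteDimensional ℝ E]
  {M : Type*} [TopologicalSpace M] [ChartedSpace E M] [IsManifold 𝓘(ℝ, E) ∞ M]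
  {S : HyperkahlerStructure E M} {B : QuatAction E M}

/-- The flow of an action of `ℍ*` along a curve in `ℍ*`. -/
def SmoothAction.curveFlow (B : QuatAction E M) (γ : ℝ → (ℍ[ℝ])ˣ) (h0 : γ 0 = 1)
    (hγ : ContMDiff 𝓘(ℝ, ℝ) 𝓘(ℝ, ℍ[ℝ]) ∞ γ) : SmoothFlow E M where
  act t m := B.act (γ t) m
  zero_act m := by rw [h0, B.one_act]
  contMDiff_act := B.contMDiff_act.comp ((hγ.comp contMDiff_fst).prodMk contMDiff_snd)

theorem SmoothAction.hasMFDerivAt_quatOrbit (B : QuatAction E M) (m : M) :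
    HasMFDerivAt 𝓘(ℝ, ℍ[ℝ]) 𝓘(ℝ, E) (fun x : (ℍ[ℝ])ˣ => B.act x m) 1
      (mfderiv 𝓘(ℝ, ℍ[ℝ]) 𝓘(ℝ, E) (fun x : (ℍ[ℝ])ˣ => B.act x m) 1) := by
  have h : ContMDiff 𝓘(ℝ, ℍ[ℝ]) 𝓘(ℝ, E) ∞ (fun x : (ℍ[ℝ])ˣ => B.act x m) :=
    B.contMDiff_act.comp (contMDiff_id.prodMk contMDiff_const)
  exact ((h 1).mdifferentiableAt (by simp)).hasMFDerivAt

theorem SmoothAction.field_curveFlow (B : QuatAction E M) {γ : ℝ → (ℍ[ℝ])ˣ} (h0 : γ 0 = 1)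
    (hγ : ContMDiff 𝓘(ℝ, ℝ) 𝓘(ℝ, ℍ[ℝ]) ∞ γ) {θ : ℍ[ℝ]}
    (hθ : HasDerivAt (fun t => (γ t : ℍ[ℝ])) θ 0) (m : M) :
    (B.curveFlow γ h0 hγ).field m = B.quatField θ m := by
  have h1 : HasMFDerivAt 𝓘(ℝ, ℝ) 𝓘(ℝ, ℍ[ℝ]) γ 0 (ContinuousLinearMap.toSpanSingleton ℝ θ) :=
    hasMFDerivAt_units ((hγ 0).mdifferentiableAt (by simp)) hθ.hasFDerivAt.hasMFDerivAt
  have h2 := B.hasMFDerivAt_quatOrbit m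
  rw [← h0] at h2
  have h3 := HasMFDerivAt.comp (0 : ℝ) h2 h1
  have h4 := DFunLike.congr_fun h3.mfderiv (1 : ℝ)
  refine h4.trans ?_
  have h5 : (mfderiv 𝓘(ℝ, ℍ[ℝ]) 𝓘(ℝ, E) (fun x : (ℍ[ℝ])ˣ => B.act x m) (γ 0) : ℍ[ℝ] →L[ℝ] E)
      ((1 : ℝ) • θ) = B.quatField θ m := by
    rw [one_smul, h0]
    rfl
  exact h5

theorem IsPermuting.herm_push (h : IsPermuting S B) (x : (ℍ[ℝ])ˣ) (m : M)
    (u v : TangentSpace 𝓘(ℝ, E) m) : S.herm (B.act x m) (B.push x m u) (B.push x m v)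
      = (x : ℍ[ℝ]) * S.herm m u v * star (x : ℍ[ℝ]) := by
  rw [HyperkahlerStructure.herm, HyperkahlerStructure.herm, h.metric_push, h.omega_push, mul_add,
    add_mul, mul_coe_mul_star, mul_comm]

theorem HyperkahlerStructure.eq_of_herm {m : M} {u v : TangentSpace 𝓘(ℝ, E) m}
    (h : ∀ w, S.herm m w u = S.herm m w v) : u = v := by
  rw [← sub_eq_zero]
  refine S.eq_zero_of_metric_self ?_
  have h1 := congrArg QuaternionAlgebra.re (h (u - v))
  simp only [S.herm_re] at h1
  rw [map_sub, h1, sub_self]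

theorem SmoothAction.push_surjective {EG : Type*} [NormedAddCommGroup EG] [NormedSpace ℝ EG]
    {HG : Type*} [TopologicalSpace HG] {IG : ModelWithCorners ℝ EG HG}
    {G : Type*} [Group G] [TopologicalSpace G] [ChartedSpace HG G]
    (A : SmoothAction IG G E M) (g : G) (m : M) : Function.Surjective (A.push g m) := by
  intro w
  have h1 := A.push_mul g g⁻¹ (A.act g m)
  have h2 : A.act g⁻¹ (A.act g m) = m := by rw [← A.mul_act, inv_mul_cancel, A.one_act]
  have h3 : ∀ (m' : M), m' = m → ∀ u : E, ∃ u' : E,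
      (A.push g m : E →L[ℝ] E) u' = (A.push g m' : E →L[ℝ] E) u := by
    rintro m' rfl u
    exact ⟨u, rfl⟩
  obtain ⟨u', hu'⟩ := h3 _ h2 (A.push g⁻¹ (A.act g m) w)
  refine ⟨u', hu'.trans ((h1 w).symm.trans ?_)⟩
  rw [mul_inv_cancel]
  exact A.push_one _ w

/-- The imaginary quaternion with given coordinates. -/
def quatOf (a : EuclideanSpace ℝ (Fin 3)) : ℍ[ℝ] := ⟨0, a 0, a 1, a 2⟩

@[simp] theorem quatOf_re (a : EuclideanSpace ℝ (Fin 3)) : (quatOf a).re = 0 := rfl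
@[simp] theorem quatOf_imI (a : EuclideanSpace ℝ (Fin 3)) : (quatOf a).imI = a 0 := rfl
@[simp] theorem quatOf_imJ (a : EuclideanSpace ℝ (Fin 3)) : (quatOf a).imJ = a 1 := rfl
@[simp] theorem quatOf_imK (a : EuclideanSpace ℝ (Fin 3)) : (quatOf a).imK = a 2 := rfl

theorem norm_quatOf (a : EuclideanSpace ℝ (Fin 3)) : ‖quatOf a‖ = ‖a‖ := by
  have h1 : ‖quatOf a‖ ^ 2 = ‖a‖ ^ 2 := by
    rw [sq, ← Quaternion.normSq_eq_norm_mul_self, Quaternion.normSq_def', EuclideanSpace.norm_sq_eq]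
    simp [Fin.sum_univ_three]
  exact (sq_eq_sq₀ (norm_nonneg _) (norm_nonneg _)).1 h1

theorem quatOf_sq {a : EuclideanSpace ℝ (Fin 3)} (ha : ‖a‖ = 1) : quatOf a * quatOf a = -1 := by
  have h : star (quatOf a) = -quatOf a := by ext <;> simp
  have h1 := Quaternion.self_mul_star (a := quatOf a)
  rw [Quaternion.normSq_eq_norm_mul_self, norm_quatOf, ha, h, mul_neg] at h1
  rw [← neg_eq_iff_eq_neg, h1]
  simp

theorem sphereJ_eq_qsmul (a : EuclideanSpace ℝ (Fin 3)) (m : M) (u : TangentSpace 𝓘(ℝ, E) m) :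
    S.sphereJ a m u = S.qsmul m (quatOf a) u := by
  simp [HyperkahlerStructure.sphereJ, HyperkahlerStructure.qsmul]

theorem IsPermuting.mapsComplexStructure (h : IsPermuting S B) {x : (ℍ[ℝ])ˣ}
    {a b : EuclideanSpace ℝ (Fin 3)} (hx : (x : ℍ[ℝ]) * quatOf a = quatOf b * x) :
    MapsComplexStructure S B x a b := by
  intro m u
  refine HyperkahlerStructure.eq_of_herm (S := S) fun w => ?_
  obtain ⟨w, rfl⟩ := B.push_surjective x m w
  rw [sphereJ_eq_qsmul, sphereJ_eq_qsmul, h.herm_push, S.herm_qsmul_right, S.herm_qsmul_right,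
    h.herm_push, mul_assoc, mul_assoc, mul_assoc, ← star_mul, hx, star_mul]
  simp only [mul_assoc]

/-- Any two imaginary unit quaternions are conjugate. -/
theorem exists_mul_quatOf {a b : EuclideanSpace ℝ (Fin 3)} (ha : ‖a‖ = 1) (hb : ‖b‖ = 1) :
    ∃ x : ℍ[ℝ], x ≠ 0 ∧ x * quatOf a = quatOf b * x := by
  have ha2 := quatOf_sq ha
  have hb2 := quatOf_sq hb
  by_cases hab : quatOf b = -quatOf a
  · have hk : ∀ c : ℍ[ℝ], (c * quatOf a - quatOf a * c) * quatOf a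
        = quatOf b * (c * quatOf a - quatOf a * c) := fun c => by
      rw [hab, sub_mul, mul_assoc, ha2, neg_mul, mul_sub, ← mul_assoc (quatOf a) (quatOf a), ha2,
        ← mul_assoc]
      noncomm_ring
    by_cases hi : qi * quatOf a - quatOf a * qi = 0
    · by_cases hj : qj * quatOf a - quatOf a * qj = 0
      · exfalso
        have h1 := congrArg QuaternionAlgebra.imJ hi
        have h2 := congrArg QuaternionAlgebra.imK hi
        have h3 := congrArg QuaternionAlgebra.imK hj
        simp at h1 h2 h3
        have e0 : a 0 = 0 := by linarith
        have e1 : a 1 = 0 := by linarith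
        have e2 : a 2 = 0 := by linarith
        have : ‖a‖ = 0 := by
          rw [← norm_quatOf, norm_eq_zero]
          ext <;> simp [e0, e1, e2]
        rw [ha] at this
        exact one_ne_zero this
      · exact ⟨_, hj, hk qj⟩
    · exact ⟨_, hi, hk qi⟩
  · refine ⟨1 - quatOf b * quatOf a, fun h0 => hab ?_, ?_⟩
    · have h1 : quatOf b * quatOf a = 1 := (sub_eq_zero.1 h0).symm
      have h2 : quatOf b * quatOf a * quatOf a = quatOf a := by rw [h1, one_mul]
      rw [mul_assoc, ha2] at h2
      rw [← h2]; simp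
    · rw [sub_mul, mul_sub, mul_assoc, ha2, ← mul_assoc, hb2]
      simp [add_comm]

/-- A permuting action acts transitively on the sphere of complex structures. -/
theorem IsPermuting.isTransitiveOnComplexStructures (h : IsPermuting S B) :
    IsTransitiveOnComplexStructures S B := by
  refine ⟨fun x a ha => ?_, fun a b ha hb => ?_⟩
  · let c : ℍ[ℝ] := (x : ℍ[ℝ]) * quatOf a * ((x⁻¹ : (ℍ[ℝ])ˣ) : ℍ[ℝ])
    have hcre : c.re = 0 := by
      have h1 : ((x⁻¹ : (ℍ[ℝ])ˣ) : ℍ[ℝ]) = (Quaternion.normSq (x : ℍ[ℝ]))⁻¹ • star (x : ℍ[ℝ]) := by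
        rw [Units.val_inv_eq_inv_val, Quaternion.inv_def]
      simp only [c, h1, mul_smul_comm, Quaternion.re_smul]
      simp
      ring
    have hcn : ‖c‖ = 1 := by
      simp only [c, norm_mul, norm_quatOf, ha, mul_one]
      rw [← norm_mul, Units.mul_inv, norm_one]
    let b : EuclideanSpace ℝ (Fin 3) := !₂[c.imI, c.imJ, c.imK]
    have hb : quatOf b = c := by
      ext <;> simp [b, hcre]
    refine ⟨b, by rw [← norm_quatOf, hb, hcn], h.mapsComplexStructure ?_⟩
    rw [hb]
    simp only [c]
    rw [mul_assoc _ _ (x : ℍ[ℝ]), Units.inv_mul, mul_one]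
  · obtain ⟨x, hx0, hx⟩ := exists_mul_quatOf ha hb
    exact ⟨Units.mk0 x hx0, h.mapsComplexStructure hx⟩

end Permuting

theorem extDerivOne_neg {E : Type*} [NormedAddCommGroup E] [NormedSpace ℝ E]
    {M : Type*} [TopologicalSpace M] [ChartedSpace E M]
    (α : (m : M) → TangentSpace 𝓘(ℝ, E) m →L[ℝ] ℝ) (m : M) (u v : TangentSpace 𝓘(ℝ, E) m) :
    extDerivOne (fun m => -α m) m u v = -extDerivOne α m u v := by
  have h : oneFormCoord (fun m => -α m) m = fun y => -oneFormCoord α m y := by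
    funext y
    ext a
    rfl
  rw [extDerivOne, extDerivOne, h, fderiv_fun_neg]
  simp only [neg_apply]
  ring

section Permuting

variable {E : Type*} [NormedAddCommGroup E] [NormedSpace ℝ E] [FiniteDimensional ℝ E]
  {M : Type*} [TopologicalSpace M] [ChartedSpace E M] [IsManifold 𝓘(ℝ, E) ∞ M]
  {S : HyperkahlerStructure E M} {B : QuatAction E M}

namespace SmoothAction

theorem quatField_add (B : QuatAction E M) (a b : ℍ[ℝ]) (m : M) :
    B.quatField (a + b) m = B.quatField a m + B.quatField b m :=
  map_add (mfderiv 𝓘(ℝ, ℍ[ℝ]) 𝓘(ℝ, E) (fun x : (ℍ[ℝ])ˣ => B.act x m) 1 : ℍ[ℝ] →L[ℝ] E) a b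

theorem quatField_smul (B : QuatAction E M) (c : ℝ) (a : ℍ[ℝ]) (m : M) :
    B.quatField (c • a) m = c • B.quatField a m :=
  map_smul (mfderiv 𝓘(ℝ, ℍ[ℝ]) 𝓘(ℝ, E) (fun x : (ℍ[ℝ])ˣ => B.act x m) 1 : ℍ[ℝ] →L[ℝ] E) c a

/-- The flow of the radial action. -/
def radialFlow (B : QuatAction E M) : SmoothFlow E M :=
  B.curveFlow expUnit expUnit_zero contMDiff_expUnit

theorem field_radialFlow (B : QuatAction E M) (m : M) : B.radialFlow.field m = B.quatField 1 m :=
  B.field_curveFlow expUnit_zero contMDiff_expUnit (by simpa using hasDerivAt_expUnit 0) m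

theorem contMDiff_circleExpUnit :
    ContMDiff 𝓘(ℝ, ℝ) 𝓘(ℝ, ℍ[ℝ]) ∞ (fun t : ℝ => circleToQuat (Circle.exp t)) :=
  contMDiff_circleToQuat.comp contMDiff_circleExp

/-- The flow of the action of the unit complex numbers. -/
def phaseFlow (B : QuatAction E M) : SmoothFlow E M :=
  B.curveFlow (fun t => circleToQuat (Circle.exp t)) (by simp) contMDiff_circleExpUnit

theorem field_phaseFlow (B : QuatAction E M) (m : M) : B.phaseFlow.field m = B.quatField qi m :=
  B.field_curveFlow (by simp) contMDiff_circleExpUnit hasDerivAt_circleToQuat m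

/-- The action of `ℍ*` maps the generated vector fields to each other. -/
theorem push_quatField (B : QuatAction E M) (x : (ℍ[ℝ])ˣ) (m : M) (a : ℍ[ℝ]) :
    B.push x m (B.quatField a m)
      = B.quatField ((x : ℍ[ℝ]) * a * ((x⁻¹ : (ℍ[ℝ])ˣ) : ℍ[ℝ])) (B.act x m) := by
  have h0 : HasMFDerivAt 𝓘(ℝ, E) 𝓘(ℝ, E) (B.act x) (B.act 1 m)
      (mfderiv 𝓘(ℝ, E) 𝓘(ℝ, E) (B.act x) (B.act 1 m)) := B.hasMFDerivAt_act x _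
  have h1 := HasMFDerivAt.comp (1 : (ℍ[ℝ])ˣ) h0 (B.hasMFDerivAt_quatOrbit m)
  have hc : x * 1 * x⁻¹ = 1 := by simp
  have h2 := B.hasMFDerivAt_quatOrbit (B.act x m)
  rw [← hc] at h2
  have h3 := HasMFDerivAt.comp (1 : (ℍ[ℝ])ˣ) h2
    (HasMFDerivAt.comp (1 : (ℍ[ℝ])ˣ) (hasMFDerivAt_mul_right x⁻¹ (x * 1)) (hasMFDerivAt_mul_left x 1))
  have h4 : (B.act x ∘ fun y : (ℍ[ℝ])ˣ => B.act y m)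
      = (fun y => B.act y (B.act x m)) ∘ ((fun y => y * x⁻¹) ∘ fun y => x * y) := by
    funext y
    simp only [Function.comp_apply, ← B.mul_act]
    congr 1
    group
  rw [h4] at h1
  have h5 := DFunLike.congr_fun (hasMFDerivAt_unique h1 h3) a
  have h6 : (mfderiv 𝓘(ℝ, ℍ[ℝ]) 𝓘(ℝ, E) (fun y : (ℍ[ℝ])ˣ => B.act y (B.act x m)) (x * 1 * x⁻¹)
      : ℍ[ℝ] →L[ℝ] E) ((x : ℍ[ℝ]) * a * ((x⁻¹ : (ℍ[ℝ])ˣ) : ℍ[ℝ]))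
      = B.quatField ((x : ℍ[ℝ]) * a * ((x⁻¹ : (ℍ[ℝ])ˣ) : ℍ[ℝ])) (B.act x m) := by
    rw [hc]
    rfl
  have h7 : (mfderiv 𝓘(ℝ, E) 𝓘(ℝ, E) (B.act x) (B.act 1 m) : E →L[ℝ] E) (B.quatField a m)
      = B.push x m (B.quatField a m) := by
    rw [B.one_act]
    rfl
  exact h7.symm.trans (h5.trans h6)

theorem push_quatField_one (B : QuatAction E M) (x : (ℍ[ℝ])ˣ) (m : M) :
    B.push x m (B.quatField 1 m) = B.quatField 1 (B.act x m) := by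
  rw [push_quatField, mul_one, Units.mul_inv]

end SmoothAction

namespace IsPermuting

theorem quatField_eq (h : IsPermuting S B) (a : ℍ[ℝ]) (m : M) :
    B.quatField a m = S.qsmul m a (B.quatField 1 m) := by
  have hJ : ∀ (r : Fin 3) (e : ℍ[ℝ]), S.J r m (B.quatField e m) = -B.quatField 1 m →
      B.quatField e m = S.J r m (B.quatField 1 m) := fun r e he => by
    rw [← neg_neg (B.quatField 1 m), ← he, map_neg, S.J_sq, neg_neg]
  have ha : a = a.re • 1 + a.imI • qi + a.imJ • qj + a.imK • qk := by
    ext <;> simp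
  conv_lhs => rw [ha]
  simp only [B.quatField_add, B.quatField_smul]
  rw [hJ 0 _ (h.field_i m), hJ 1 _ (h.field_j m), hJ 2 _ (h.field_k m)]
  rfl

theorem herm_quatField_right (h : IsPermuting S B) (m : M) (u : TangentSpace 𝓘(ℝ, E) m) (a : ℍ[ℝ]) :
    S.herm m u (B.quatField a m) = S.herm m u (B.quatField 1 m) * star a := by
  rw [h.quatField_eq, S.herm_qsmul_right]

theorem extDerivOne_radial (h : IsPermuting S B) (r : Fin 3) (m : M) (u v : TangentSpace 𝓘(ℝ, E) m) :
    extDerivOne (fun m => S.omegaL r m (B.quatField 1 m)) m u v = 2 * S.omega r m u v := by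
  have h1 := S.extDerivOne_contract B.radialFlow (γ := fun t => (expUnit t : ℍ[ℝ])) (θ := 1)
    (by simpa using hasDerivAt_expUnit 0) (by simp [expUnit_zero])
    (fun t m u v => h.omega_push (expUnit t) m u v) r m u v
  simp only [B.field_radialFlow] at h1
  rw [h1, ← imFn_omegaQ]
  fin_cases r <;> simp [imFn] <;> ring

theorem extDerivOne_metric_radial (h : IsPermuting S B) (m : M) (u v : TangentSpace 𝓘(ℝ, E) m) :
    extDerivOne (fun m => S.metric.inner m (B.quatField 1 m)) m u v = 0 := by
  have h1 := S.extDerivOne_contract B.phaseFlow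
    (γ := fun t => (circleToQuat (Circle.exp t) : ℍ[ℝ])) (θ := qi)
    hasDerivAt_circleToQuat (by simp)
    (fun t m u v => h.omega_push (circleToQuat (Circle.exp t)) m u v) 0 m u v
  simp only [B.field_phaseFlow] at h1
  have h2 : (fun m => S.omegaL 0 m (B.quatField qi m))
      = fun m => S.metric.inner m (B.quatField 1 m) := by
    funext m
    ext v
    have h3 := S.omega_skew 0 m (B.quatField qi m) v
    change S.omegaL 0 m (B.quatField qi m) v = _
    rw [S.omegaL_apply, h3, HyperkahlerStructure.omega, h.field_i, map_neg, neg_neg]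
    exact S.metric.symm m _ _
  rw [h2] at h1
  rw [h1]
  simp [imFn]

theorem mvfderiv_radial_sq (h : IsPermuting S B) (m : M) (u : TangentSpace 𝓘(ℝ, E) m) :
    mvfderiv 𝓘(ℝ, E) (fun m => S.metric.inner m (B.quatField 1 m) (B.quatField 1 m)) m u
      = 2 * S.metric.inner m (B.quatField 1 m) u := by
  have hα : SmoothOne (fun m => S.metric.inner m (B.quatField 1 m)) := by
    have := SmoothFlow.smoothOne_field (Φ := B.radialFlow) S.smoothTwo_metric
    simpa only [B.field_radialFlow] using this
  have h1 := SmoothFlow.deriv_flow_oneForm (Φ := B.radialFlow) hα m u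
  simp only [B.field_radialFlow] at h1
  rw [h.extDerivOne_metric_radial, zero_add] at h1
  rw [← h1]
  have h2 : (fun t => S.metric.inner (B.radialFlow.act t m) (B.quatField 1 (B.radialFlow.act t m))
      (B.radialFlow.push t m u)) = fun t => Real.exp t ^ 2 * S.metric.inner m (B.quatField 1 m) u := by
    funext t
    have h3 := h.metric_push (expUnit t) m (B.quatField 1 m) u
    rw [B.push_quatField_one, coe_expUnit, norm_smul, norm_one, mul_one, Real.norm_eq_abs, sq_abs] at h3
    exact h3
  rw [h2]
  refine (((Real.hasDerivAt_exp 0).fun_pow 2).mul_const _).deriv.trans ?_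
  simp

theorem contMDiff_radial_sq (S : HyperkahlerStructure E M) (B : QuatAction E M) :
    ContMDiff 𝓘(ℝ, E) 𝓘(ℝ, ℝ) ∞
      (fun m => S.metric.inner m (B.quatField 1 m) (B.quatField 1 m)) := by
  have := SmoothFlow.contMDiff_field_field (Φ := B.radialFlow) S.smoothTwo_metric
  simpa only [B.field_radialFlow] using this

theorem mvfderiv_potential (h : IsPermuting S B) (m : M) (u : TangentSpace 𝓘(ℝ, E) m) :
    mvfderiv 𝓘(ℝ, E) (fun m => -(1 / 2) * S.metric.inner m (B.quatField 1 m) (B.quatField 1 m)) m u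
      = -S.metric.inner m (B.quatField 1 m) u := by
  have h3 : HasMFDerivAt 𝓘(ℝ, E) 𝓘(ℝ, ℝ) _ m _ :=
    (((contMDiff_radial_sq S B m).mdifferentiableAt (by simp)).hasMFDerivAt).const_smul (-(1 / 2) : ℝ)
  refine (DFunLike.congr_fun h3.mfderiv u).trans ?_
  refine (congrArg (fun c : ℝ => -(1 / 2) * c) (h.mvfderiv_radial_sq m u)).trans ?_
  ring

/-- A permuting action has the hyperKähler potential `- |Y₀|² / 2`. -/
theorem isHyperkahlerPotential (h : IsPermuting S B) : S.IsHyperkahlerPotential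
    (fun m => -(1 / 2) * S.metric.inner m (B.quatField 1 m) (B.quatField 1 m)) := by
  have hs := contMDiff_radial_sq S B
  have hs' : ContMDiff 𝓘(ℝ, E) 𝓘(ℝ, ℝ) ∞
      (fun m => -(1 / 2) * S.metric.inner m (B.quatField 1 m) (B.quatField 1 m)) :=
    contMDiff_const.mul hs
  refine ⟨hs', fun r m u v => ?_⟩
  have h1 : (fun m => (mvfderiv 𝓘(ℝ, E) (fun m => -(1 / 2) * S.metric.inner m (B.quatField 1 m)
      (B.quatField 1 m)) m).comp (S.J r m)) = fun m => -S.omegaL r m (B.quatField 1 m) := by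
    funext m
    ext v
    exact h.mvfderiv_potential m _
  rw [HyperkahlerStructure.iddbar, h1, extDerivOne_neg, h.extDerivOne_radial]
  ring

end IsPermuting

end Permuting

theorem hermF_mul_left (y : ℍ[ℝ]) (t v : ℝ) (x e e' : ℍ[ℝ]) (ξ ξ' : ℝ) (η η' h : ℍ[ℝ]) :
    hermF t v (y * x) (y * e) (y * e') ξ ξ' η η' h = y * hermF t v x e e' ξ ξ' η η' h * star y := by
  simp only [hermF, mul_add, mul_sub, add_mul, sub_mul, star_mul, star_add, star_star, mul_assoc,
    mul_smul_comm, smul_mul_assoc]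

theorem hermF_radial (t v : ℝ) (x e a : ℍ[ℝ]) (ξ : ℝ) (η : ℍ[ℝ]) :
    hermF t v x e (a * x * qi) ξ 0 η 0 0 = hermF t v x e (x * qi) ξ 0 η 0 0 * star a := by
  simp [hermF, sub_mul, star_mul, mul_assoc]

theorem HyperkahlerStructure.herm_zero_right {E : Type*} [NormedAddCommGroup E] [NormedSpace ℝ E]
    [FiniteDimensional ℝ E]
    {M : Type*} [TopologicalSpace M] [ChartedSpace E M] [IsManifold 𝓘(ℝ, E) ∞ M]
    (S : HyperkahlerStructure E M) (m : M) (u : TangentSpace 𝓘(ℝ, E) m) : S.herm m u 0 = 0 := by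
  have h := S.herm_smul_right m u 0 0
  rwa [smul_zero, zero_smul] at h

theorem HyperkahlerStructure.herm_neg_right {E : Type*} [NormedAddCommGroup E] [NormedSpace ℝ E]
    [FiniteDimensional ℝ E]
    {M : Type*} [TopologicalSpace M] [ChartedSpace E M] [IsManifold 𝓘(ℝ, E) ∞ M]
    (S : HyperkahlerStructure E M) (m : M) (u v : TangentSpace 𝓘(ℝ, E) m) :
    S.herm m u (-v) = -S.herm m u v := by
  have h := S.herm_smul_right m u v (-1)
  rwa [neg_one_smul, neg_one_smul] at h

theorem HyperkahlerStructure.metric_omegaQ_of_herm {E E' M M' : Type*} [NormedAddCommGroup E]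
    [NormedSpace ℝ E] [FiniteDimensional ℝ E] [TopologicalSpace M] [ChartedSpace E M]
    [IsManifold 𝓘(ℝ, E) ∞ M] [NormedAddCommGroup E'] [NormedSpace ℝ E'] [FiniteDimensional ℝ E']
    [TopologicalSpace M'] [ChartedSpace E' M'] [IsManifold 𝓘(ℝ, E') ∞ M']
    {S : HyperkahlerStructure E M} {S' : HyperkahlerStructure E' M'} {m : M} {m' : M'}
    {u v : TangentSpace 𝓘(ℝ, E) m} {u' v' : TangentSpace 𝓘(ℝ, E') m'} {y : ℍ[ℝ]}
    (h : S'.herm m' u' v' = y * S.herm m u v * star y) :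
    S'.metric.inner m' u' v' = ‖y‖ ^ 2 * S.metric.inner m u v ∧
      S'.omegaQ m' u' v' = y * S.omegaQ m u v * star y := by
  rw [HyperkahlerStructure.herm, HyperkahlerStructure.herm, mul_add, add_mul, mul_coe_mul_star] at h
  have h0 : (y * S.omegaQ m u v * star y).re = 0 := by
    simp
    ring
  have h1 : S'.metric.inner m' u' v' = ‖y‖ ^ 2 * S.metric.inner m u v := by
    have h2 := congrArg QuaternionAlgebra.re h
    rw [Quaternion.re_add, Quaternion.re_add, h0, Quaternion.re_coe, Quaternion.re_coe,
      omegaQ_re, add_zero, add_zero, mul_comm] at h2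
    exact h2
  refine ⟨h1, ?_⟩
  rw [h1, mul_comm] at h
  exact add_left_cancel h

theorem unitQ_mul_self (r : Fin 3) : unitQ r * unitQ r = -1 := by
  fin_cases r <;> ext <;> simp [unitQ]

namespace InductionData

variable {E : Type*} [NormedAddCommGroup E] [NormedSpace ℝ E] [FiniteDimensional ℝ E]
  {M : Type*} [TopologicalSpace M] [ChartedSpace E M] [IsManifold 𝓘(ℝ, E) ∞ M]
  {F : Type*} [NormedAddCommGroup F] [NormedSpace ℝ F] [FiniteDimensional ℝ F]
  {P : Type*} [TopologicalSpace P] [ChartedSpace F P] [IsManifold 𝓘(ℝ, F) ∞ P]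
  {D : InductionData E M F P}
  {E' : Type*} [NormedAddCommGroup E'] [NormedSpace ℝ E'] [FiniteDimensional ℝ E']
  {N : Type*} [TopologicalSpace N] [ChartedSpace E' N] [IsManifold 𝓘(ℝ, E') ∞ N]
  {q : (ℍ[ℝ])ˣ × P → N} {S : HyperkahlerStructure E' N} {A : QuatAction E' N}

theorem hermHP_mul_left (y : (ℍ[ℝ])ˣ) (z : (ℍ[ℝ])ˣ × P) (a b : ℍ[ℝ] × F) :
    D.hermHP (y * z.1, z.2) ((y : ℍ[ℝ]) * a.1, a.2) ((y : ℍ[ℝ]) * b.1, b.2)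
      = (y : ℍ[ℝ]) * D.hermHP z a b * star (y : ℍ[ℝ]) := by
  rw [hermHP_eq_hermF, hermHP_eq_hermF, ← hermF_mul_left]
  simp only [Units.val_mul, mul_assoc]

theorem hermHP_radial (z : (ℍ[ℝ])ˣ × P) (a : ℍ[ℝ] × F) (e : ℍ[ℝ]) :
    D.hermHP z a (e * z.1, 0) = D.hermHP z a ((z.1 : ℍ[ℝ]), 0) * star e := by
  rw [hermHP_eq_hermF, hermHP_eq_hermF]
  simp only [map_zero, D.hk.herm_zero_right]
  exact hermF_radial _ _ _ _ _ _ _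

/-- The differential of the quotient map, on `ℍ × F`. -/
def dq (F : Type*) [NormedAddCommGroup F] [NormedSpace ℝ F] {P : Type*} [TopologicalSpace P]
    [ChartedSpace F P] {E' : Type*} [NormedAddCommGroup E'] [NormedSpace ℝ E']
    {N : Type*} [TopologicalSpace N] [ChartedSpace E' N]
    (q : (ℍ[ℝ])ˣ × P → N) (z : (ℍ[ℝ])ˣ × P) : ℍ[ℝ] × F →L[ℝ] TangentSpace 𝓘(ℝ, E') (q z) :=
  mfderiv (𝓘(ℝ, ℍ[ℝ]).prod 𝓘(ℝ, F)) 𝓘(ℝ, E') q z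

theorem IsInduced.herm_eq (hS : D.IsInduced q S) (z : (ℍ[ℝ])ˣ × P) (a b : ℍ[ℝ] × F) :
    S.herm (q z) (dq F q z a) (dq F q z b) = D.hermHP z a b := by
  have h1 : S.metric.inner (q z) (dq F q z a) (dq F q z b) = D.metricHP z a b := (hS z a b).1
  have h2 : S.omegaQ (q z) (dq F q z a) (dq F q z b) = D.omegaHP z a b := (hS z a b).2
  rw [HyperkahlerStructure.herm, h1, h2]
  rfl

/-- Left multiplication on `ℍ*` induces an action on the quotient. -/
theorem IsQuotientMap.exists_quatAction (hq : D.IsQuotientMap (E' := E') q)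
    (hsurj : Function.Surjective q) :
    ∃ A : QuatAction E' N, ∀ y x p, A.act y (q (x, p)) = q (y * x, p) := by
  choose s hs using hsurj
  have key : ∀ (y : (ℍ[ℝ])ˣ) (z z' : (ℍ[ℝ])ˣ × P), q z = q z' → q (y * z.1, z.2) = q (y * z'.1, z'.2) := by
    intro y z z' h
    obtain ⟨ζ, rfl⟩ := (hq.fibre _ _).1 h
    exact (hq.fibre _ _).2 ⟨ζ, by rw [← mul_assoc]⟩
  refine ⟨⟨fun y n => q (y * (s n).1, (s n).2), fun n => by simp [hs], fun g h n => ?_, ?_⟩,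
    fun y x p => key y _ _ (hs _)⟩
  · rw [key g _ _ (hs _), mul_assoc]
  · rintro ⟨y, n⟩
    obtain ⟨σ, O, hO, hn, -, hσ, hqσ⟩ := exists_local_section hq.contMDiff (s n) (hq.submersion _)
    rw [hs] at hn
    have h1 : ContMDiffAt (𝓘(ℝ, ℍ[ℝ]).prod 𝓘(ℝ, E')) (𝓘(ℝ, ℍ[ℝ]).prod 𝓘(ℝ, F)) ∞
        (fun w : (ℍ[ℝ])ˣ × N => σ w.2) (y, n) :=
      ContMDiffAt.comp (g := σ) (f := Prod.snd) (y, n) (hσ.contMDiffAt (hO.mem_nhds hn))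
        contMDiffAt_snd
    have h2 : ContMDiffAt (𝓘(ℝ, ℍ[ℝ]).prod 𝓘(ℝ, E')) (𝓘(ℝ, ℍ[ℝ]).prod 𝓘(ℝ, F)) ∞
        (fun w : (ℍ[ℝ])ˣ × N => (w.1 * (σ w.2).1, (σ w.2).2)) (y, n) :=
      (contMDiffAt_fst.mul h1.fst).prodMk h1.snd
    have h3 := ContMDiffAt.comp (g := q) (y, n) (hq.contMDiff _) h2
    refine h3.congr_of_eventuallyEq ?_
    filter_upwards [continuousAt_snd.preimage_mem_nhds (hO.mem_nhds hn)] with w hw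
    exact key w.1 _ _ ((hs _).trans (hqσ _ hw).symm)

theorem IsQuotientMap.push_dq (hq : D.IsQuotientMap (E' := E') q)
    (hA : ∀ y x p, A.act y (q (x, p)) = q (y * x, p)) (y : (ℍ[ℝ])ˣ) (z : (ℍ[ℝ])ˣ × P) (a : ℍ[ℝ] × F) :
    (A.push y (q z) (dq F q z a) : E') = dq F q (y * z.1, z.2) ((y : ℍ[ℝ]) * a.1, a.2) := by
  have h0 : HasMFDerivAt 𝓘(ℝ, E') 𝓘(ℝ, E') (A.act y) (q z)
      (mfderiv 𝓘(ℝ, E') 𝓘(ℝ, E') (A.act y) (q z)) := A.hasMFDerivAt_act y _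
  have h1 := HasMFDerivAt.comp z h0 ((hq.contMDiff z).mdifferentiableAt (by simp)).hasMFDerivAt
  have h2 := HasMFDerivAt.comp z
    ((hq.contMDiff (y * z.1, z.2)).mdifferentiableAt (by simp)).hasMFDerivAt
    ((HasMFDerivAt.comp (I := 𝓘(ℝ, ℍ[ℝ]).prod 𝓘(ℝ, F)) z (hasMFDerivAt_mul_left y z.1)
      (hasMFDerivAt_fst (I := 𝓘(ℝ, ℍ[ℝ])) (I' := 𝓘(ℝ, F)) z)).prodMk (hasMFDerivAt_snd z))
  have h3 : A.act y ∘ q = q ∘ fun z : (ℍ[ℝ])ˣ × P => (y * z.1, z.2) := funext fun z => hA y z.1 z.2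
  rw [h3] at h1
  exact DFunLike.congr_fun (hasMFDerivAt_unique h1 h2) a

theorem IsQuotientMap.quatField_eq (hq : D.IsQuotientMap (E' := E') q)
    (hA : ∀ y x p, A.act y (q (x, p)) = q (y * x, p)) (e : ℍ[ℝ]) (z : (ℍ[ℝ])ˣ × P) :
    A.quatField e (q z) = dq F q z (e * z.1, 0) := by
  have h1 := HasMFDerivAt.comp (1 : (ℍ[ℝ])ˣ)
    ((hq.contMDiff (1 * z.1, z.2)).mdifferentiableAt (by simp)).hasMFDerivAt
    ((hasMFDerivAt_mul_right z.1 1).prodMk (hasMFDerivAt_const z.2 (1 : (ℍ[ℝ])ˣ)))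
  have h2 : (fun x : (ℍ[ℝ])ˣ => A.act x (q z)) = q ∘ fun y => (y * z.1, z.2) :=
    funext fun y => hA y z.1 z.2
  rw [← h2] at h1
  refine (DFunLike.congr_fun h1.mfderiv e).trans ?_
  have h4 : (mfderiv (𝓘(ℝ, ℍ[ℝ]).prod 𝓘(ℝ, F)) 𝓘(ℝ, E') q (1 * z.1, z.2) : ℍ[ℝ] × F →L[ℝ] E')
      (e * z.1, 0) = dq F q z (e * z.1, 0) := by
    rw [one_mul]
    rfl
  exact h4

/-- The induced action of `ℍ*` is permuting. -/
theorem IsInduced.isPermuting (hq : D.IsQuotientMap (E' := E') q) (hsurj : Function.Surjective q)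
    (hS : D.IsInduced q S) (hA : ∀ y x p, A.act y (q (x, p)) = q (y * x, p)) : IsPermuting S A := by
  have hdq : ∀ z (u : TangentSpace 𝓘(ℝ, E') (q z)), ∃ a, dq F q z a = u := fun z u => hq.submersion z u
  have hpush : ∀ y m u v, S.herm (A.act y m) (A.push y m u) (A.push y m v)
      = (y : ℍ[ℝ]) * S.herm m u v * star (y : ℍ[ℝ]) := by
    intro y m u v
    obtain ⟨z, rfl⟩ := hsurj m
    obtain ⟨a, rfl⟩ := hdq z u
    obtain ⟨b, rfl⟩ := hdq z v
    rw [hS.herm_eq, ← hermHP_mul_left, ← hS.herm_eq]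
    exact herm_congr S (hA y z.1 z.2) (hq.push_dq hA y z a) (hq.push_dq hA y z b)
  have hJ : ∀ (r : Fin 3) (m : N), S.J r m (A.quatField (unitQ r) m) = -A.quatField 1 m := by
    intro r m
    refine HyperkahlerStructure.eq_of_herm (S := S) fun w => ?_
    obtain ⟨z, rfl⟩ := hsurj m
    obtain ⟨a, rfl⟩ := hdq z w
    rw [S.herm_J, hq.quatField_eq hA, hq.quatField_eq hA, hS.herm_eq, hermHP_radial, mul_assoc,
      ← star_mul, unitQ_mul_self, S.herm_neg_right, hS.herm_eq, hermHP_radial]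
    simp
  exact ⟨fun y m u v => (HyperkahlerStructure.metric_omegaQ_of_herm (hpush y m u v)).1,
    fun y m u v => (HyperkahlerStructure.metric_omegaQ_of_herm (hpush y m u v)).2,
    fun m => hJ 0 m, fun m => hJ 1 m, fun m => hJ 2 m⟩

theorem IsInduced.radial_sq (hq : D.IsQuotientMap (E' := E') q) (hS : D.IsInduced q S)
    (hA : ∀ y x p, A.act y (q (x, p)) = q (y * x, p)) (x : (ℍ[ℝ])ˣ) (p : P) :
    -(1 / 2) * S.metric.inner (q (x, p)) (A.quatField 1 (q (x, p))) (A.quatField 1 (q (x, p)))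
      = -((4 * D.v (D.proj p) + D.w (D.proj p)) / 2) * ‖(x : ℍ[ℝ])‖ ^ 2 := by
  rw [← S.herm_re, hq.quatField_eq hA, hS.herm_eq, hermHP_eq_hermF, ← four_v_add_w]
  simp only [map_zero, D.hk.herm_zero_right, hermF]
  have h : ‖(x : ℍ[ℝ])‖ ^ 2 = (x : ℍ[ℝ]).re ^ 2 + (x : ℍ[ℝ]).imI ^ 2 + (x : ℍ[ℝ]).imJ ^ 2
      + (x : ℍ[ℝ]).imK ^ 2 := by
    rw [← Quaternion.normSq_def', Quaternion.normSq_eq_norm_mul_self]; ring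
  rw [h]
  simp
  ring

end InductionData

theorem hasMFDerivAt_clm_comp {E G G' : Type*} [NormedAddCommGroup E] [NormedSpace ℝ E]
    [NormedAddCommGroup G] [NormedSpace ℝ G] [NormedAddCommGroup G'] [NormedSpace ℝ G']
    {M : Type*} [TopologicalSpace M] [ChartedSpace E M] (L : G →L[ℝ] G') {f : M → G} {m : M}
    (hf : MDifferentiableAt 𝓘(ℝ, E) 𝓘(ℝ, G) f m) :
    HasMFDerivAt 𝓘(ℝ, E) 𝓘(ℝ, G') (fun m => L (f m)) m
      (L.comp (mfderiv 𝓘(ℝ, E) 𝓘(ℝ, G) f m : E →L[ℝ] G)) :=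
  HasMFDerivAt.comp (g := L) m (L.hasFDerivAt (x := f m)).hasMFDerivAt hf.hasMFDerivAt

/-- The imaginary part of a quaternion as a vector. -/
def imV : ℍ[ℝ] →L[ℝ] (Fin 3 → ℝ) := ContinuousLinearMap.pi imC

theorem imV_apply (q : ℍ[ℝ]) (r : Fin 3) : imV q r = imFn r q := rfl

theorem eq_of_imFn {a b : ℍ[ℝ]} (h0 : a.re = b.re) (h : ∀ r, imFn r a = imFn r b) : a = b := by
  ext
  · exact h0
  · exact h 0
  · exact h 1
  · exact h 2

theorem exists_hasFDerivAt_conj (c : ℍ[ℝ]) : ∃ L : ℍ[ℝ] →L[ℝ] ℍ[ℝ],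
    (∀ θ, L θ = θ * c + c * star θ) ∧ HasFDerivAt (fun y : ℍ[ℝ] => y * c * star y) L 1 := by
  have e1 : HasFDerivAt (fun y : ℍ[ℝ] => y * c)
      ((ContinuousLinearMap.mul ℝ ℍ[ℝ]).flip c) (1 : ℍ[ℝ]) :=
    ((ContinuousLinearMap.mul ℝ ℍ[ℝ]).flip c).hasFDerivAt
  have e2 : HasFDerivAt (fun y : ℍ[ℝ] => star y)
      ((starL' ℝ : ℍ[ℝ] ≃L[ℝ] ℍ[ℝ]) : ℍ[ℝ] →L[ℝ] ℍ[ℝ]) (1 : ℍ[ℝ]) :=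
    (starL' ℝ : ℍ[ℝ] ≃L[ℝ] ℍ[ℝ]).hasFDerivAt
  refine ⟨_, fun θ => ?_, e1.mul' e2⟩
  simp [add_comm]

section Setting

variable {E : Type*} [NormedAddCommGroup E] [NormedSpace ℝ E] [FiniteDimensional ℝ E]
  {M : Type*} [TopologicalSpace M] [ChartedSpace E M] [IsManifold 𝓘(ℝ, E) ∞ M]

/-- A permuting action of `ℍ*` and a commuting triholomorphic circle action with an equivariant
hyperKähler momentum map. -/
structure IsReductionSetting (S : HyperkahlerStructure E M) (B : QuatAction E M)
    (A : CircleAction E M) (μ : M → ℍ[ℝ]) : Prop where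
  perm : IsPermuting S B
  tri : IsTriholomorphic S A
  mom : IsHyperkahlerMomentumMap S A μ
  comm : ∀ x z m, B.act x (A.act z m) = A.act z (B.act x m)
  equiv : ∀ x m, μ (B.act x m) = (x : ℍ[ℝ]) * μ m * star (x : ℍ[ℝ])

/-- The action of the unit complex numbers. -/
def SmoothAction.phase (B : QuatAction E M) : CircleAction E M where
  act z m := B.act (circleToQuat z) m
  one_act m := by rw [map_one, B.one_act]
  mul_act z z' m := by rw [map_mul, B.mul_act]
  contMDiff_act := B.contMDiff_act.comp
    ((contMDiff_circleToQuat.comp contMDiff_fst).prodMk contMDiff_snd)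

theorem SmoothAction.circleField_phase (B : QuatAction E M) (m : M) :
    B.phase.circleField m = B.quatField qi m := B.field_phaseFlow m

variable {S : HyperkahlerStructure E M} {B : QuatAction E M} {A : CircleAction E M} {μ : M → ℍ[ℝ]}

theorem IsTriholomorphic.herm_push (h : IsTriholomorphic S A) (z : Circle) (m : M)
    (u v : TangentSpace 𝓘(ℝ, E) m) :
    S.herm (A.act z m) (A.push z m u) (A.push z m v) = S.herm m u v := by
  ext
  · simp only [S.herm_re, h.metric_push]
  all_goals
    simp only [S.herm_imI, S.herm_imJ, S.herm_imK, ← h.J_push, h.metric_push]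

namespace IsReductionSetting

theorem mvfderiv_mu (h : IsReductionSetting S B A μ) (m : M) (u : TangentSpace 𝓘(ℝ, E) m) :
    mvfderiv 𝓘(ℝ, E) μ m u = -(S.herm m (A.circleField m) u).im := by
  rw [h.mom.deriv_eq, S.herm_im]

theorem hasMFDerivAt_mu (h : IsReductionSetting S B A μ) (m : M) :
    HasMFDerivAt 𝓘(ℝ, E) 𝓘(ℝ, ℍ[ℝ]) μ m (mfderiv 𝓘(ℝ, E) 𝓘(ℝ, ℍ[ℝ]) μ m) :=
  ((h.mom.contMDiff m).mdifferentiableAt (by simp)).hasMFDerivAt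

theorem mvfderiv_imV_mu (h : IsReductionSetting S B A μ) (m : M) (u : TangentSpace 𝓘(ℝ, E) m) :
    (mfderiv 𝓘(ℝ, E) 𝓘(ℝ, Fin 3 → ℝ) (fun m => imV (μ m)) m : E →L[ℝ] (Fin 3 → ℝ)) u
      = imV (mvfderiv 𝓘(ℝ, E) μ m u) :=
  DFunLike.congr_fun (hasMFDerivAt_clm_comp imV (h.hasMFDerivAt_mu m).mdifferentiableAt).mfderiv u

theorem mu_act (h : IsReductionSetting S B A μ) (z : Circle) (m : M) : μ (A.act z m) = μ m := by
  refine eq_of_imFn (by rw [h.mom.re_eq, h.mom.re_eq]) fun r => ?_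
  have hr : ∀ m, HasMFDerivAt 𝓘(ℝ, E) 𝓘(ℝ, ℝ) (fun m => imC r (μ m)) m
      ((imC r).comp (mfderiv 𝓘(ℝ, E) 𝓘(ℝ, ℍ[ℝ]) μ m : E →L[ℝ] ℍ[ℝ])) := fun m =>
    hasMFDerivAt_clm_comp (imC r) (h.hasMFDerivAt_mu m).mdifferentiableAt
  refine A.invariant_of_deriv (fun m => (hr m).mdifferentiableAt) (fun m => ?_) z m
  refine (DFunLike.congr_fun (hr m).mfderiv (A.circleField m)).trans ?_
  have h1 : imC r (mvfderiv 𝓘(ℝ, E) μ m (A.circleField m)) = 0 := by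
    rw [h.mvfderiv_mu, S.herm_self]
    simp
  exact h1

theorem mvfderiv_mu_quatField (h : IsReductionSetting S B A μ) (m : M) (θ : ℍ[ℝ]) :
    mvfderiv 𝓘(ℝ, E) μ m (B.quatField θ m) = θ * μ m + μ m * star θ := by
  obtain ⟨L, hL, h2⟩ := exists_hasFDerivAt_conj (μ m)
  let Dμ : E →L[ℝ] ℍ[ℝ] := mfderiv 𝓘(ℝ, E) 𝓘(ℝ, ℍ[ℝ]) μ (B.act 1 m)
  let DO : ℍ[ℝ] →L[ℝ] E := mfderiv 𝓘(ℝ, ℍ[ℝ]) 𝓘(ℝ, E) (fun x : (ℍ[ℝ])ˣ => B.act x m) 1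
  have h1 : HasMFDerivAt 𝓘(ℝ, ℍ[ℝ]) 𝓘(ℝ, ℍ[ℝ]) (fun x : (ℍ[ℝ])ˣ => μ (B.act x m)) 1 (Dμ.comp DO) :=
    HasMFDerivAt.comp (1 : (ℍ[ℝ])ˣ) (h.hasMFDerivAt_mu (B.act 1 m)) (B.hasMFDerivAt_quatOrbit m)
  rw [← Units.val_one] at h2
  have h3 : HasMFDerivAt 𝓘(ℝ, ℍ[ℝ]) 𝓘(ℝ, ℍ[ℝ])
      (fun x : (ℍ[ℝ])ˣ => (x : ℍ[ℝ]) * μ m * star (x : ℍ[ℝ])) 1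
      (L.comp (ContinuousLinearMap.id ℝ ℍ[ℝ])) :=
    HasMFDerivAt.comp (1 : (ℍ[ℝ])ˣ) (g := fun y : ℍ[ℝ] => y * μ m * star y)
      (h2.hasMFDerivAt) (hasMFDerivAt_units_val 1)
  have h4 : (fun x : (ℍ[ℝ])ˣ => μ (B.act x m))
      = fun x : (ℍ[ℝ])ˣ => (x : ℍ[ℝ]) * μ m * star (x : ℍ[ℝ]) := funext fun x => h.equiv x m
  rw [h4] at h1
  have h5 : Dμ.comp DO = L.comp (ContinuousLinearMap.id ℝ ℍ[ℝ]) := hasMFDerivAt_unique h1 h3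
  have h6 : Dμ (DO θ) = L θ := DFunLike.congr_fun h5 θ
  rw [← hL, ← h6]
  exact mvfderiv_congr μ (B.one_act m).symm rfl

theorem herm_K_Y (h : IsReductionSetting S B A μ) (m : M) (θ : ℍ[ℝ]) :
    S.herm m (A.circleField m) (B.quatField θ m) = -(2 : ℝ) • (μ m * star θ) := by
  have key : ∀ θ, -(S.herm m (A.circleField m) (B.quatField 1 m) * star θ).im
      = θ * μ m + μ m * star θ := fun θ => by
    rw [← h.perm.herm_quatField_right, ← h.mvfderiv_mu, h.mvfderiv_mu_quatField]
  have h1 := key 1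
  have h2 := congrArg QuaternionAlgebra.imI (key qi)
  have hre := h.mom.re_eq m
  rw [h.perm.herm_quatField_right, ← smul_mul_assoc]
  congr 1
  generalize S.herm m (A.circleField m) (B.quatField 1 m) = Q at *
  have i1 := congrArg QuaternionAlgebra.imI h1
  have i2 := congrArg QuaternionAlgebra.imJ h1
  have i3 := congrArg QuaternionAlgebra.imK h1
  simp at h2 i1 i2 i3
  ext <;> simp <;> linarith

theorem push_K (h : IsReductionSetting S B A μ) (x : (ℍ[ℝ])ˣ) (m : M) :
    B.push x m (A.circleField m) = A.circleField (B.act x m) :=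
  A.mfderiv_circleField A m (B.hasMFDerivAt_act x m).mdifferentiableAt fun z => h.comm x z m

theorem push_Y (h : IsReductionSetting S B A μ) (z : Circle) (m : M) (θ : ℍ[ℝ]) :
    A.push z m (B.quatField θ m) = B.quatField θ (A.act z m) := by
  have h0 : HasMFDerivAt 𝓘(ℝ, E) 𝓘(ℝ, E) (A.act z) (B.act 1 m)
      (mfderiv 𝓘(ℝ, E) 𝓘(ℝ, E) (A.act z) (B.act 1 m)) := A.hasMFDerivAt_act z _
  have h1 := HasMFDerivAt.comp (1 : (ℍ[ℝ])ˣ) h0 (B.hasMFDerivAt_quatOrbit m)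
  have h4 : (A.act z ∘ fun y : (ℍ[ℝ])ˣ => B.act y m) = fun y => B.act y (A.act z m) :=
    funext fun y => (h.comm y z m).symm
  rw [h4] at h1
  refine Eq.trans ?_ (DFunLike.congr_fun h1.mfderiv θ).symm
  have h7 : A.push z m (B.quatField θ m)
      = (mfderiv 𝓘(ℝ, E) 𝓘(ℝ, E) (A.act z) (B.act 1 m) : E →L[ℝ] E) (B.quatField θ m) := by
    rw [B.one_act]
    rfl
  exact h7

theorem surjective_mfderiv_mu (h : IsReductionSetting S B A μ) {m : M} (hK : A.circleField m ≠ 0) :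
    Function.Surjective (mfderiv 𝓘(ℝ, E) 𝓘(ℝ, Fin 3 → ℝ) (fun m => imV (μ m)) m) := by
  intro w
  obtain ⟨b, hb⟩ : ∃ b : Fin 3 → ℝ, b = w := ⟨w, rfl⟩
  have hk : S.metric.inner m (A.circleField m) (A.circleField m) ≠ 0 :=
    fun h0 => hK (S.eq_zero_of_metric_self h0)
  let k := S.metric.inner m (A.circleField m) (A.circleField m)
  let c : ℍ[ℝ] := k⁻¹ • (b 0 • qi + b 1 • qj + b 2 • qk)
  refine ⟨S.qsmul m c (A.circleField m), (h.mvfderiv_imV_mu m _).trans (Eq.trans ?_ hb)⟩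
  rw [h.mvfderiv_mu, S.herm_qsmul_right, S.herm_self]
  have hkk : k * k⁻¹ = 1 := mul_inv_cancel₀ hk
  change imV (-((k : ℍ[ℝ]) * star c).im) = b
  simp only [c]
  generalize k⁻¹ = l at hkk
  funext r
  have e1 : ∀ b : ℝ, k * (l * b) = b := fun b => by rw [← mul_assoc, hkk, one_mul]
  fin_cases r <;> simp [imV_apply, imFn, e1]

end IsReductionSetting

end Setting

section LevelSet

variable {E : Type*} [NormedAddCommGroup E] [NormedSpace ℝ E] [FiniteDimensional ℝ E]
  {M : Type*} [TopologicalSpace M] [ChartedSpace E M] [IsManifold 𝓘(ℝ, E) ∞ M]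

/-- The level set `μ⁻¹(-i)`. -/
abbrev LevelSet (μ : M → ℍ[ℝ]) := {m : M // μ m = -qi}

/-- The manifold structure on the level set makes it a submanifold. -/
structure IsLevelManifold (E : Type*) [NormedAddCommGroup E] [NormedSpace ℝ E] [ChartedSpace E M]
    (X : Type*) [NormedAddCommGroup X] [NormedSpace ℝ X]
    (μ : M → ℍ[ℝ]) [ChartedSpace X (LevelSet μ)] : Prop where
  contMDiff_val : ContMDiff 𝓘(ℝ, X) 𝓘(ℝ, E) ∞ (Subtype.val : LevelSet μ → M)
  retr : ∀ p : LevelSet μ, ∃ r : M → LevelSet μ, ContMDiffAt 𝓘(ℝ, E) 𝓘(ℝ, X) ∞ r p ∧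
    ∀ᶠ p' : LevelSet μ in 𝓝 p, r (p' : M) = p'
  injective : ∀ p : LevelSet μ, Function.Injective
    (mfderiv 𝓘(ℝ, X) 𝓘(ℝ, E) (Subtype.val : LevelSet μ → M) p)
  range : ∀ (p : LevelSet μ) (u : TangentSpace 𝓘(ℝ, E) (p : M)), mvfderiv 𝓘(ℝ, E) μ (p : M) u = 0 →
    ∃ a, mfderiv 𝓘(ℝ, X) 𝓘(ℝ, E) (Subtype.val : LevelSet μ → M) p a = u

variable {S : HyperkahlerStructure E M} {B : QuatAction E M} {A : CircleAction E M} {μ : M → ℍ[ℝ]}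

theorem HyperkahlerStructure.four_le_finrank (S : HyperkahlerStructure E M) {m : M}
    {u : TangentSpace 𝓘(ℝ, E) m} (hu : u ≠ 0) : 4 ≤ Module.finrank ℝ E := by
  let L : ℍ[ℝ] →ₗ[ℝ] TangentSpace 𝓘(ℝ, E) m :=
    { toFun := fun c => S.qsmul m c u
      map_add' := fun c d => S.qsmul_add_left m u c d
      map_smul' := fun a c => S.qsmul_smul_left m u a c }
  have hL : Function.Injective L := by
    rw [injective_iff_map_eq_zero]
    intro c hc
    have h1 : S.herm m u (S.qsmul m c u) = 0 := by
      rw [show S.qsmul m c u = 0 from hc, S.herm_zero_right]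
    rw [S.herm_qsmul_right, S.herm_self, mul_eq_zero] at h1
    rcases h1 with h1 | h1
    · exact absurd (S.eq_zero_of_metric_self (Quaternion.coe_injective (h1.trans Quaternion.coe_zero.symm))) hu
    · exact star_eq_zero.1 h1
  have h4 : Module.finrank ℝ ℍ[ℝ] = 4 := Quaternion.finrank_eq_four
  rw [← h4]
  exact LinearMap.finrank_le_finrank_of_injective (M' := E) (f := L) hL

namespace IsReductionSetting

theorem exists_levelManifold (h : IsReductionSetting S B A μ)
    (hK : ∀ m, μ m = -qi → A.circleField m ≠ 0) :
    ∃ (k : ℕ) (_ : ChartedSpace (EuclideanSpace ℝ (Fin (k + 1))) (LevelSet μ)),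
      IsManifold (𝓡 (k + 1)) ∞ (LevelSet μ) ∧
      IsLevelManifold E (EuclideanSpace ℝ (Fin (k + 1))) μ := by
  obtain ⟨k, hk⟩ : ∃ k : ℕ, (∃ m, μ m = -qi) → k + 1 + 3 = Module.finrank ℝ E := by
    by_cases hne : ∃ m, μ m = -qi
    · obtain ⟨m, hm⟩ := hne
      have := S.four_le_finrank (hK m hm)
      exact ⟨Module.finrank ℝ E - 4, fun _ => by omega⟩
    · exact ⟨0, fun h => absurd h hne⟩
  have hp : ∀ m, μ m = -qi ↔ imV (μ m) = imV (-qi) := fun m =>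
    ⟨fun hm => by rw [hm], fun hm => eq_of_imFn (by rw [h.mom.re_eq]; simp) fun r => congrFun hm r⟩
  have hf : ContMDiff 𝓘(ℝ, E) 𝓘(ℝ, Fin 3 → ℝ) ∞ (fun m => imV (μ m)) :=
    imV.contDiff.contMDiff.comp h.mom.contMDiff
  obtain ⟨cs, hman, hval, hretr, hran⟩ := exists_level_manifold
    (X := EuclideanSpace ℝ (Fin (k + 1))) (p := fun m => μ m = -qi) hf hp (by simpa using hk)
    (fun m hm => h.surjective_mfderiv_mu (hK m hm))
  refine ⟨k, cs, hman, hval, hretr, fun p => (hran p).1, fun p u hu => (hran p).2 u ?_⟩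
  refine (h.mvfderiv_imV_mu (p : M) u).trans ?_
  rw [hu, map_zero]
  rfl

end IsReductionSetting

variable {X : Type*} [NormedAddCommGroup X] [NormedSpace ℝ X] [FiniteDimensional ℝ X]
  [ChartedSpace X (LevelSet μ)] [IsManifold 𝓘(ℝ, X) ∞ (LevelSet μ)]

/-- The restriction to the level set of a circle action. -/
def IsLevelManifold.restrict (hL : IsLevelManifold E X μ) (C : CircleAction E M)
    (hC : ∀ z m, μ m = -qi → μ (C.act z m) = -qi) : CircleAction X (LevelSet μ) where
  act z p := ⟨C.act z p, hC z p p.2⟩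
  one_act p := Subtype.ext (C.one_act p)
  mul_act z z' p := Subtype.ext (C.mul_act z z' p)
  contMDiff_act := contMDiff_of_val hL.retr (C.contMDiff_act.comp
    (contMDiff_fst.prodMk (hL.contMDiff_val.comp contMDiff_snd)))

variable (E X) in
/-- The differential of the inclusion of the level set. -/
def dval (p : LevelSet μ) : X →L[ℝ] TangentSpace 𝓘(ℝ, E) (p : M) :=
  mfderiv 𝓘(ℝ, X) 𝓘(ℝ, E) (Subtype.val : LevelSet μ → M) p

namespace IsLevelManifold

theorem hasMFDerivAt_val (hL : IsLevelManifold E X μ) (p : LevelSet μ) :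
    HasMFDerivAt 𝓘(ℝ, X) 𝓘(ℝ, E) (Subtype.val : LevelSet μ → M) p (dval E X p) :=
  ((hL.contMDiff_val p).mdifferentiableAt (by simp)).hasMFDerivAt

theorem dval_restrict_field (hL : IsLevelManifold E X μ) (C : CircleAction E M)
    (hC : ∀ z m, μ m = -qi → μ (C.act z m) = -qi) (p : LevelSet μ) :
    dval E X p ((hL.restrict C hC).circleField p) = C.circleField (p : M) :=
  SmoothAction.mfderiv_circleField (hL.restrict C hC) C p (hL.hasMFDerivAt_val p).mdifferentiableAt
    fun _ => rfl

theorem dval_push (hL : IsLevelManifold E X μ) (C : CircleAction E M)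
    (hC : ∀ z m, μ m = -qi → μ (C.act z m) = -qi) (z : Circle) (p : LevelSet μ) (a : X) :
    dval E X ((hL.restrict C hC).act z p) ((hL.restrict C hC).push z p a)
      = C.push z (p : M) (dval E X p a) := by
  have h1 := HasMFDerivAt.comp p (hL.hasMFDerivAt_val ((hL.restrict C hC).act z p))
    ((hL.restrict C hC).hasMFDerivAt_act z p)
  have h2 := HasMFDerivAt.comp p (C.hasMFDerivAt_act z (p : M)) (hL.hasMFDerivAt_val p)
  exact DFunLike.congr_fun (hasMFDerivAt_unique h1 h2) a

theorem mvfderiv_dval (hL : IsLevelManifold E X μ) (h : IsReductionSetting S B A μ)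
    (p : LevelSet μ) (a : X) : mvfderiv 𝓘(ℝ, E) μ (p : M) (dval E X p a) = 0 := by
  have h1 := HasMFDerivAt.comp p (h.hasMFDerivAt_mu (p : M)) (hL.hasMFDerivAt_val p)
  have h2 : (μ ∘ (Subtype.val : LevelSet μ → M)) = fun _ => -qi := funext fun p => p.2
  rw [h2] at h1
  exact DFunLike.congr_fun (hasMFDerivAt_unique h1 (hasMFDerivAt_const (-qi) p)) a

end IsLevelManifold

variable (S A) in
/-- `|K₀|²`. -/
def sqK (m : M) : ℝ := S.metric.inner m (A.circleField m) (A.circleField m)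

variable (S A μ X) in
/-- The connection form `g(K₀, ·) / |K₀|²` on the level set. -/
def levelXi (p : LevelSet μ) : X →L[ℝ] ℝ :=
  (sqK S A (p : M))⁻¹ • (S.metric.inner (p : M) (A.circleField (p : M))).comp (dval E X p)

variable (S A) in
/-- The pull-back of the quaternionic hermitian form of the quotient to the level set. -/
def levelHerm (p : LevelSet μ) (a b : X) : ℍ[ℝ] :=
  S.herm (p : M) (dval E X p a) (dval E X p b)
    - ((sqK S A (p : M) * (levelXi S A μ X p a * levelXi S A μ X p b) : ℝ) : ℍ[ℝ])

variable (S A) in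
/-- The horizontal part of a vector tangent to the level set. -/
def levelHor (p : LevelSet μ) (a : X) : TangentSpace 𝓘(ℝ, E) (p : M) :=
  dval E X p a - levelXi S A μ X p a • A.circleField (p : M)

namespace IsLevelManifold

variable (hL : IsLevelManifold E X μ) (h : IsReductionSetting S B A μ)
  (hK : ∀ m, μ m = -qi → A.circleField m ≠ 0)
include hL h hK

theorem sqK_pos (p : LevelSet μ) : 0 < sqK S A (p : M) :=
  lt_of_le_of_ne (S.metric_self_nonneg _ _) fun h0 => hK p p.2 (S.eq_zero_of_metric_self h0.symm)

theorem levelXi_mul (p : LevelSet μ) (a : X) :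
    sqK S A (p : M) * levelXi S A μ X p a
      = S.metric.inner (p : M) (A.circleField (p : M)) (dval E X p a) := by
  have h0 := (hL.sqK_pos h hK p).ne'
  change sqK S A (p : M) * ((sqK S A (p : M))⁻¹ * _) = _
  rw [mul_inv_cancel_left₀ h0]
  rfl

theorem herm_K_dval (p : LevelSet μ) (a : X) :
    S.herm (p : M) (A.circleField (p : M)) (dval E X p a)
      = ((sqK S A (p : M) * levelXi S A μ X p a : ℝ) : ℍ[ℝ]) := by
  have h1 := hL.mvfderiv_dval h p a
  rw [h.mvfderiv_mu, neg_eq_zero] at h1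
  rw [hL.levelXi_mul h hK, ← S.herm_re, ← Quaternion.re_add_im (S.herm _ _ _), h1]
  simp

theorem herm_K_levelHor (p : LevelSet μ) (a : X) :
    S.herm (p : M) (A.circleField (p : M)) (levelHor S A p a) = 0 := by
  rw [levelHor, sub_eq_add_neg, S.herm_add_right, S.herm_neg_right, S.herm_smul_right, S.herm_self,
    hL.herm_K_dval h hK]
  change _ + -(levelXi S A μ X p a • ((sqK S A (p : M) : ℝ) : ℍ[ℝ])) = 0
  rw [mul_comm, Quaternion.coe_mul, Quaternion.coe_mul_eq_smul, add_neg_cancel]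

theorem levelHerm_eq (p : LevelSet μ) (a b : X) :
    levelHerm S A p a b = S.herm (p : M) (levelHor S A p a) (levelHor S A p b) := by
  have h1 : dval E X p b = levelHor S A p b + levelXi S A μ X p b • A.circleField (p : M) :=
    (sub_add_cancel _ _).symm
  have h2 : S.herm (p : M) (levelHor S A p a) (A.circleField (p : M)) = 0 := by
    rw [← S.star_herm, hL.herm_K_levelHor h hK, star_zero]
  have h3 : dval E X p a = levelHor S A p a + levelXi S A μ X p a • A.circleField (p : M) :=
    (sub_add_cancel _ _).symm
  rw [levelHerm, h3, h1, S.herm_add_left, S.herm_add_right, S.herm_add_right, S.herm_smul_right, h2,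
    S.herm_smul_left, S.herm_smul_left, hL.herm_K_levelHor h hK, S.herm_smul_right, S.herm_self]
  change _ + _ + (_ + levelXi S A μ X p a • levelXi S A μ X p b • ((sqK S A (p : M) : ℝ) : ℍ[ℝ])) - _ = _
  rw [smul_zero, smul_zero, add_zero, zero_add, smul_smul, ← Quaternion.coe_mul_eq_smul,
    ← Quaternion.coe_mul, mul_comm, add_sub_cancel_right]

theorem eq_smul_of_levelHor (hA : ∀ z m, μ m = -qi → μ (A.act z m) = -qi) {p : LevelSet μ} {a : X}
    (ha : levelHor S A p a = 0) :
    a = levelXi S A μ X p a • ((hL.restrict A hA).circleField p : X) := by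
  refine hL.injective p ?_
  let k : X := (hL.restrict A hA).circleField p
  have hk : dval E X p k = A.circleField (p : M) := hL.dval_restrict_field A hA p
  have h1 : dval E X p (levelXi S A μ X p a • k) = dval E X p a := by
    rw [map_smul, hk]
    exact (sub_eq_zero.1 ha).symm
  exact h1.symm

theorem exists_levelHor_J (r : Fin 3) (p : LevelSet μ) (b : X) :
    ∃ c : X, levelHor S A p c = S.J r (p : M) (levelHor S A p b) := by
  have h1 : S.herm (p : M) (A.circleField (p : M)) (S.J r (p : M) (levelHor S A p b)) = 0 := by
    rw [S.herm_J, hL.herm_K_levelHor h hK, zero_mul]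
  obtain ⟨c, hc⟩ : ∃ c : X, dval E X p c = S.J r (p : M) (levelHor S A p b) :=
    hL.range p _ (by rw [h.mvfderiv_mu, h1]; simp)
  refine ⟨c, ?_⟩
  have h2 : levelXi S A μ X p c = 0 := by
    have h3 := hL.levelXi_mul h hK p c
    rw [hc, ← S.herm_re, h1] at h3
    exact (mul_eq_zero.1 h3).resolve_left (hL.sqK_pos h hK p).ne'
  rw [levelHor, h2, zero_smul, sub_zero, hc]

end IsLevelManifold

end LevelSet

theorem imFn_sub_coe (r : Fin 3) (q : ℍ[ℝ]) (c : ℝ) : imFn r (q - (c : ℍ[ℝ])) = imFn r q := by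
  fin_cases r <;> simp [imFn]

theorem norm_circleToQuat (z : Circle) : ‖(circleToQuat z : ℍ[ℝ])‖ = 1 := by
  have h := congrArg norm (circleToQuat_mul_star z)
  rw [norm_mul, norm_star, norm_one, ← sq] at h
  exact (pow_eq_one_iff_of_nonneg (norm_nonneg _) two_ne_zero).1 h

section Wrappers

variable {X P : Type*} [NormedAddCommGroup X] [NormedSpace ℝ X] [TopologicalSpace P]
  [ChartedSpace X P]

/-- The differential of the action of a group element, on the model space. -/
def SmoothAction.pushL (C : CircleAction X P) (z : Circle) (p : P) : X →L[ℝ] X := C.push z p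

/-- The vector field of a circle action, in the model space. -/
def SmoothAction.fieldL (C : CircleAction X P) (p : P) : X := C.circleField p

end Wrappers

section LevelSet

variable {E : Type*} [NormedAddCommGroup E] [NormedSpace ℝ E] [FiniteDimensional ℝ E]
  {M : Type*} [TopologicalSpace M] [ChartedSpace E M] [IsManifold 𝓘(ℝ, E) ∞ M]
  {S : HyperkahlerStructure E M} {B : QuatAction E M} {A : CircleAction E M} {μ : M → ℍ[ℝ]}
  {X : Type*} [NormedAddCommGroup X] [NormedSpace ℝ X] [FiniteDimensional ℝ X]
  [ChartedSpace X (LevelSet μ)] [IsManifold 𝓘(ℝ, X) ∞ (LevelSet μ)]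

theorem IsReductionSetting.mu_act_level (h : IsReductionSetting S B A μ) (z : Circle) (m : M)
    (hm : μ m = -qi) : μ (A.act z m) = -qi := (h.mu_act z m).trans hm

theorem IsReductionSetting.mu_phase_level (h : IsReductionSetting S B A μ) (z : Circle) (m : M)
    (hm : μ m = -qi) : μ (B.phase.act z m) = -qi := by
  refine (h.equiv _ m).trans ?_
  rw [hm, mul_neg, neg_mul, circleToQuat_mul_qi, mul_assoc, circleToQuat_mul_star, mul_one]

variable (X) in
/-- The differential of a map to the level set. -/
def levelPlotD {V : Type*} [NormedAddCommGroup V] [NormedSpace ℝ V] (Z : V → LevelSet μ) (y : V) :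
    V →L[ℝ] X := mfderiv 𝓘(ℝ, V) 𝓘(ℝ, X) Z y

theorem plotD_val (hL : IsLevelManifold E X μ) {V : Type*} [NormedAddCommGroup V] [NormedSpace ℝ V]
    {Z : V → LevelSet μ} {y : V} (hZ : ContMDiffAt 𝓘(ℝ, V) 𝓘(ℝ, X) ∞ Z y) (a : V) :
    plotD (E := E) (fun y => (Z y : M)) y a
      = dval E X (Z y) (levelPlotD X Z y a) :=
  DFunLike.congr_fun (HasMFDerivAt.comp y (hL.hasMFDerivAt_val (Z y))
    (hZ.mdifferentiableAt (by simp)).hasMFDerivAt).mfderiv a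

namespace IsLevelManifold

variable (hL : IsLevelManifold E X μ) (h : IsReductionSetting S B A μ)

/-- The principal action on the level set. -/
def princ : CircleAction X (LevelSet μ) := hL.restrict A h.mu_act_level

/-- The action of the unit complex numbers on the level set. -/
def lift : CircleAction X (LevelSet μ) := hL.restrict B.phase h.mu_phase_level

theorem dval_princ_field (p : LevelSet μ) :
    dval E X p ((hL.princ h).fieldL p) = A.circleField (p : M) := hL.dval_restrict_field _ _ p

theorem dval_lift_field (p : LevelSet μ) :
    dval E X p ((hL.lift h).fieldL p) = B.quatField qi (p : M) :=
  (hL.dval_restrict_field _ _ p).trans (B.circleField_phase _)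

theorem dval_princ_push (z : Circle) (p : LevelSet μ) (a : X) :
    dval E X ((hL.princ h).act z p) ((hL.princ h).pushL z p a) = A.push z (p : M) (dval E X p a) :=
  hL.dval_push _ _ z p a

theorem dval_lift_push (z : Circle) (p : LevelSet μ) (a : X) :
    dval E X ((hL.lift h).act z p) ((hL.lift h).pushL z p a)
      = B.push (circleToQuat z) (p : M) (dval E X p a) :=
  hL.dval_push _ _ z p a

theorem sqK_princ (z : Circle) (p : LevelSet μ) :
    sqK S A ((hL.princ h).act z p : M) = sqK S A (p : M) := by
  have h1 := h.tri.metric_push z (p : M) (A.circleField (p : M)) (A.circleField (p : M))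
  rw [A.push_circleField_self] at h1
  exact h1

theorem sqK_lift (z : Circle) (p : LevelSet μ) :
    sqK S A ((hL.lift h).act z p : M) = sqK S A (p : M) := by
  have h1 := h.perm.metric_push (circleToQuat z) (p : M) (A.circleField (p : M)) (A.circleField (p : M))
  rw [h.push_K, norm_circleToQuat, one_pow, one_mul] at h1
  exact h1

theorem levelXi_princ (z : Circle) (p : LevelSet μ) (a : X) :
    levelXi S A μ X ((hL.princ h).act z p) ((hL.princ h).pushL z p a) = levelXi S A μ X p a := by
  have h1 : S.metric.inner ((hL.princ h).act z p : M) (A.circleField ((hL.princ h).act z p : M))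
      (dval E X ((hL.princ h).act z p) ((hL.princ h).pushL z p a))
      = S.metric.inner (p : M) (A.circleField (p : M)) (dval E X p a) := by
    have h2 := h.tri.metric_push z (p : M) (A.circleField (p : M)) (dval E X p a)
    rw [A.push_circleField_self] at h2
    rw [hL.dval_princ_push h]
    exact h2
  have h3 := hL.sqK_princ h z p
  exact congrArg₂ (fun k c : ℝ => k⁻¹ * c) h3 h1

theorem levelXi_lift (z : Circle) (p : LevelSet μ) (a : X) :
    levelXi S A μ X ((hL.lift h).act z p) ((hL.lift h).pushL z p a) = levelXi S A μ X p a := by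
  have h1 : S.metric.inner ((hL.lift h).act z p : M) (A.circleField ((hL.lift h).act z p : M))
      (dval E X ((hL.lift h).act z p) ((hL.lift h).pushL z p a))
      = S.metric.inner (p : M) (A.circleField (p : M)) (dval E X p a) := by
    have h2 := h.perm.metric_push (circleToQuat z) (p : M) (A.circleField (p : M)) (dval E X p a)
    rw [h.push_K, norm_circleToQuat, one_pow, one_mul] at h2
    rw [hL.dval_lift_push h]
    exact h2
  exact congrArg₂ (fun k c : ℝ => k⁻¹ * c) (hL.sqK_lift h z p) h1

theorem levelHerm_princ (z : Circle) (p : LevelSet μ) (a b : X) :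
    levelHerm (X := X) S A ((hL.princ h).act z p) ((hL.princ h).pushL z p a) ((hL.princ h).pushL z p b)
      = levelHerm S A p a b := by
  rw [levelHerm, levelHerm, hL.sqK_princ h, hL.levelXi_princ h, hL.levelXi_princ h,
    hL.dval_princ_push h, hL.dval_princ_push h]
  congr 1
  exact h.tri.herm_push z p _ _

theorem levelHerm_lift (z : Circle) (p : LevelSet μ) (a b : X) :
    levelHerm (X := X) S A ((hL.lift h).act z p) ((hL.lift h).pushL z p a) ((hL.lift h).pushL z p b)
      = (circleToQuat z : ℍ[ℝ]) * levelHerm S A p a b * star (circleToQuat z : ℍ[ℝ]) := by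
  rw [levelHerm, levelHerm, hL.sqK_lift h, hL.levelXi_lift h, hL.levelXi_lift h,
    hL.dval_lift_push h, hL.dval_lift_push h, mul_sub, sub_mul, mul_coe_mul_star, norm_circleToQuat,
    one_pow, mul_one]
  congr 1
  exact h.perm.herm_push _ p _ _

theorem imFn_levelHerm (r : Fin 3) (p : LevelSet μ) (a b : X) :
    imFn r (levelHerm S A p a b) = S.omegaL r (p : M) (dval E X p a) (dval E X p b) := by
  rw [levelHerm, imFn_sub_coe, S.imFn_herm]
  rfl

variable (hK : ∀ m, μ m = -qi → A.circleField m ≠ 0)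
include hL h hK

theorem levelHor_princ_field (p : LevelSet μ) :
    levelXi S A μ X p ((hL.princ h).fieldL p) = 1 ∧
    levelHor (X := X) S A p ((hL.princ h).fieldL p) = 0 := by
  have h1 : levelXi S A μ X p ((hL.princ h).fieldL p) = 1 := by
    have h2 := hL.levelXi_mul h hK p ((hL.princ h).fieldL p)
    rw [hL.dval_princ_field h] at h2
    exact mul_left_cancel₀ (hL.sqK_pos h hK p).ne' (h2.trans (mul_one _).symm)
  refine ⟨h1, ?_⟩
  rw [levelHor, h1, hL.dval_princ_field h, one_smul, sub_self]

/-- `levelHerm` as a bilinear map. -/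
theorem exists_levelHermL : ∃ H : LevelSet μ → X →ₗ[ℝ] X →ₗ[ℝ] ℍ[ℝ],
    ∀ p a b, H p a b = levelHerm S A p a b := by
  have hadd : ∀ (p : LevelSet μ) (a b : X), levelHor S A p (a + b) = levelHor S A p a + levelHor S A p b :=
    fun p a b => by
      simp only [levelHor, map_add, add_smul]
      abel
  have hsmul : ∀ (p : LevelSet μ) (c : ℝ) (a : X), levelHor S A p (c • a) = c • levelHor S A p a :=
    fun p c a => by
      simp only [levelHor, map_smul, smul_sub, smul_assoc]
  refine ⟨fun p => LinearMap.mk₂ ℝ (levelHerm S A p) (fun a b c => ?_) (fun r a b => ?_)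
    (fun a b c => ?_) (fun r a b => ?_), fun p a b => rfl⟩ <;>
  simp only [hL.levelHerm_eq h hK, hadd, hsmul, S.herm_add_left, S.herm_add_right, S.herm_smul_left,
    S.herm_smul_right]

theorem contDiffAt_levelXi {V : Type*} [NormedAddCommGroup V] [NormedSpace ℝ V]
    [FiniteDimensional ℝ V] {Z : V → LevelSet μ} {y : V}
    (hZ : ∀ᶠ y' in 𝓝 y, ContMDiffAt 𝓘(ℝ, V) 𝓘(ℝ, X) ∞ Z y') (a : V) :
    ContDiffAt ℝ ∞ (fun y => levelXi S A μ X (Z y) (levelPlotD X Z y a)) y ∧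
    ContDiffAt ℝ ∞ (fun y => sqK S A (Z y : M)) y := by
  have hφ : ContMDiffAt 𝓘(ℝ, V) 𝓘(ℝ, E) ∞ (fun y => (Z y : M)) y :=
    ContMDiffAt.comp (g := (Subtype.val : LevelSet μ → M)) y (hL.contMDiff_val _) hZ.self_of_nhds
  have hα : SmoothOne (fun m => S.metric.inner m (A.circleField m)) :=
    SmoothFlow.smoothOne_field (Φ := A.toSmoothFlow) S.smoothTwo_metric
  have hk : ContDiffAt ℝ ∞ (fun y => sqK S A (Z y : M)) y := InductionData.contDiffAt_comp_plot
    (SmoothFlow.contMDiff_field_field (Φ := A.toSmoothFlow) S.smoothTwo_metric) hφ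
  refine ⟨?_, hk⟩
  refine ((hk.inv (hL.sqK_pos h hK (Z y)).ne').mul ((contDiffAt_pullOne hα hφ).clm_apply
    (contDiffAt_const (c := a)))).congr_of_eventuallyEq ?_
  filter_upwards [hZ] with y' hy'
  rw [pullOne_apply, plotD_val hL hy']
  rfl

/-- The hyperKähler structure of the quotient of the level set. -/
theorem exists_reduction [T2Space M] {E' : Type*} [NormedAddCommGroup E'] [NormedSpace ℝ E']
    [FiniteDimensional ℝ E'] {N : Type*} [TopologicalSpace N] [ChartedSpace E' N]
    [IsManifold 𝓘(ℝ, E') ∞ N] {pr : LevelSet μ → N}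
    (hpr : IsPrincipalCircleBundle (E := E') (hL.princ h) pr) :
    ∃ S' : HyperkahlerStructure E' N, ∀ (p : LevelSet μ) (a b : X),
      S'.herm (pr p) ((mfderiv 𝓘(ℝ, X) 𝓘(ℝ, E') pr p : X →L[ℝ] E') a)
        ((mfderiv 𝓘(ℝ, X) 𝓘(ℝ, E') pr p : X →L[ℝ] E') b) = levelHerm S A p a b := by
  obtain ⟨H, hH⟩ := hL.exists_levelHermL h hK
  have hgen : ∀ p, (mfderiv 𝓘(ℝ, X) 𝓘(ℝ, E') pr p : X →L[ℝ] E') ((hL.princ h).fieldL p) = 0 :=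
    fun p => (hL.princ h).toCircleFlow.mfderiv_gen p ((hpr.contMDiff p).mdifferentiableAt (by simp))
      fun z => ((hpr.fibre _ _).2 ⟨z, rfl⟩).symm
  have hker : ∀ (p : LevelSet μ) (a a' : X), (mfderiv 𝓘(ℝ, X) 𝓘(ℝ, E') pr p : X →L[ℝ] E') a
      = (mfderiv 𝓘(ℝ, X) 𝓘(ℝ, E') pr p : X →L[ℝ] E') a' → levelHor S A p a = levelHor S A p a' := by
    intro p a a' haa
    let d : X →L[ℝ] E' := mfderiv 𝓘(ℝ, X) 𝓘(ℝ, E') pr p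
    have h0 : d (a - a') = 0 := by rw [map_sub]; exact sub_eq_zero.2 haa
    obtain ⟨r, hr⟩ := (hL.princ h).toCircleFlow.exists_smul_gen hpr.free hpr.contMDiff
      (fun p p' => (hpr.fibre p p').1) p (hpr.submersion p) (a - a') h0
    let k : X := (hL.princ h).fieldL p
    have h1 : a = a' + r • k := by
      rw [← sub_eq_iff_eq_add']; exact hr
    have h2 : levelHor S A p k = 0 := (hL.levelHor_princ_field h hK p).2
    have h3 : levelHor S A p (a' + r • k) = levelHor S A p a' + r • levelHor S A p k := by
      simp only [levelHor, map_add, map_smul, add_smul, smul_sub, smul_assoc]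
      abel
    rw [h1, h3, h2, smul_zero, add_zero]
  obtain ⟨S', hS'⟩ := exists_hyperkahler_of_hermitian hpr.contMDiff hpr.surjective hpr.submersion H
    (fun p a b => by
      rw [hH, hH, hL.levelHerm_eq h hK, hL.levelHerm_eq h hK, S.star_herm])
    (fun r p b => by
      obtain ⟨c, hc⟩ := hL.exists_levelHor_J h hK r p b
      refine ⟨c, fun a => ?_⟩
      rw [hH, hH, hL.levelHerm_eq h hK, hL.levelHerm_eq h hK, hc, S.herm_J])
    (fun p a ha => by
      rw [hH, hL.levelHerm_eq h hK, S.herm_re]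
      refine lt_of_le_of_ne (S.metric_self_nonneg _ _) fun h0 => ha ?_
      have h1 := hL.eq_smul_of_levelHor h hK h.mu_act_level (S.eq_zero_of_metric_self h0.symm)
      rw [h1, map_smul]
      exact (congrArg _ (hgen p)).trans (smul_zero _))
    (fun p p' a b a' b' hp ha hb => by
      obtain ⟨z, rfl⟩ := (hpr.fibre p p').1 hp
      have hpush : ∀ a : X, (mfderiv 𝓘(ℝ, X) 𝓘(ℝ, E') pr ((hL.princ h).act z p) : X →L[ℝ] E')
          ((hL.princ h).pushL z p a) = (mfderiv 𝓘(ℝ, X) 𝓘(ℝ, E') pr p : X →L[ℝ] E') a := fun a => by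
        have h1 := HasMFDerivAt.comp p
          ((hpr.contMDiff ((hL.princ h).act z p)).mdifferentiableAt (by simp)).hasMFDerivAt
          ((hL.princ h).hasMFDerivAt_act z p)
        have h2 : pr ∘ (hL.princ h).act z = pr := funext fun p => ((hpr.fibre _ _).2 ⟨z, rfl⟩).symm
        rw [h2] at h1
        exact (DFunLike.congr_fun h1.mfderiv a).symm
      rw [hH, hH, ← hL.levelHerm_princ h z p a b, hL.levelHerm_eq h hK, hL.levelHerm_eq h hK,
        hker _ _ a' ((hpush a).trans ha), hker _ _ b' ((hpush b).trans hb)])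
    (fun Z y hZ a b => by
      have hφ : ContMDiffAt 𝓘(ℝ, E') 𝓘(ℝ, E) ∞ (fun y => (Z y : M)) y :=
        ContMDiffAt.comp (g := (Subtype.val : LevelSet μ → M)) y (hL.contMDiff_val _) hZ.self_of_nhds
      refine ContDiffAt.congr_of_eventuallyEq (f := fun y => levelHerm S A (Z y) (levelPlotD X Z y a)
        (levelPlotD X Z y b)) ?_ (Eventually.of_forall fun y => hH _ _ _)
      refine contDiffAt_quaternion ?_ fun r => ?_
      · refine ((contDiffAt_pullTwo S.smoothTwo_metric hφ a b).sub
          ((hL.contDiffAt_levelXi h hK hZ a).2.mul ((hL.contDiffAt_levelXi h hK hZ a).1.mul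
            (hL.contDiffAt_levelXi h hK hZ b).1))).congr_of_eventuallyEq ?_
        filter_upwards [hZ] with y' hy'
        rw [levelHerm, Quaternion.re_sub, S.herm_re, Quaternion.re_coe, pullTwo, plotD_val hL hy',
          plotD_val hL hy']
      · refine (contDiffAt_pullTwo (S.smoothTwo_omegaL r) hφ a b).congr_of_eventuallyEq ?_
        filter_upwards [hZ] with y' hy'
        rw [imFn_levelHerm, pullTwo, plotD_val hL hy', plotD_val hL hy'])
    (fun r Z y hZ a b c => by
      have hφ : ContMDiffAt 𝓘(ℝ, E') 𝓘(ℝ, E) ∞ (fun y => (Z y : M)) y :=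
        ContMDiffAt.comp (g := (Subtype.val : LevelSet μ → M)) y (hL.contMDiff_val _) hZ.self_of_nhds
      refine (dTwo_congr (B' := pullTwo (S.omegaL r) fun y => (Z y : M)) ?_ a b c).trans ?_
      · filter_upwards [hZ] with y' hy' a b
        refine (congrArg (imFn r) (hH (Z y') (levelPlotD X Z y' a) (levelPlotD X Z y' b))).trans ?_
        rw [imFn_levelHerm, pullTwo, plotD_val hL hy', plotD_val hL hy']
      · rw [dTwo_pullTwo (S.smoothTwo_omegaL r) (S.omega_skew r) hφ, S.extDerivTwo_omegaL])
  refine ⟨S', fun p a b => eq_of_imFn ?_ fun r => ?_⟩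
  · rw [S'.herm_re, ← hH]
    exact (hS' p a b).1
  · rw [S'.imFn_herm, ← hH]
    exact (hS' p a b).2 r

end IsLevelManifold

end LevelSet

section Descent

variable {X : Type*} [NormedAddCommGroup X] [NormedSpace ℝ X] [FiniteDimensional ℝ X]
  {P : Type*} [TopologicalSpace P] [ChartedSpace X P] [IsManifold 𝓘(ℝ, X) ∞ P]
  {E' : Type*} [NormedAddCommGroup E'] [NormedSpace ℝ E'] [FiniteDimensional ℝ E']
  {N : Type*} [TopologicalSpace N] [ChartedSpace E' N] [IsManifold 𝓘(ℝ, E') ∞ N] {pr : P → N}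

/-- A circle action that preserves the fibres of a submersion descends. -/
theorem SmoothAction.exists_descend (C : CircleAction X P) (hpr : ContMDiff 𝓘(ℝ, X) 𝓘(ℝ, E') ∞ pr)
    (hsurj : Function.Surjective pr) (hsub : ∀ p, Function.Surjective (mfderiv 𝓘(ℝ, X) 𝓘(ℝ, E') pr p))
    (hC : ∀ z p p', pr p = pr p' → pr (C.act z p) = pr (C.act z p')) :
    ∃ C' : CircleAction E' N, ∀ z p, pr (C.act z p) = C'.act z (pr p) := by
  choose s hs using hsurj
  refine ⟨⟨fun z n => pr (C.act z (s n)), fun n => by rw [C.one_act, hs], fun g g' n => ?_, ?_⟩,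
    fun z p => hC z _ _ (hs _).symm⟩
  · rw [C.mul_act]
    exact hC g _ _ (hs _).symm
  · rintro ⟨z, n⟩
    obtain ⟨σ, O, hO, hn, -, hσ, hqσ⟩ := exists_local_section hpr (s n) (hsub _)
    rw [hs] at hn
    have h1 : ContMDiffAt ((𝓡 1).prod 𝓘(ℝ, E')) 𝓘(ℝ, X) ∞ (fun w : Circle × N => σ w.2) (z, n) :=
      ContMDiffAt.comp (g := σ) (f := Prod.snd) (z, n) (hσ.contMDiffAt (hO.mem_nhds hn))
        contMDiffAt_snd
    have h2 : ContMDiffAt ((𝓡 1).prod 𝓘(ℝ, E')) 𝓘(ℝ, X) ∞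
        (fun w : Circle × N => C.act w.1 (σ w.2)) (z, n) :=
      ContMDiffAt.comp (g := fun w : Circle × P => C.act w.1 w.2)
        (f := fun w : Circle × N => (w.1, σ w.2)) (z, n) (C.contMDiff_act _)
        (contMDiffAt_fst.prodMk h1)
    refine (ContMDiffAt.comp (g := pr) (z, n) (hpr _) h2).congr_of_eventuallyEq ?_
    filter_upwards [continuousAt_snd.preimage_mem_nhds (hO.mem_nhds hn)] with w hw
    exact hC w.1 _ _ ((hs _).trans (hqσ _ hw).symm)

/-- A smooth function that is constant on the fibres of a submersion descends. -/
theorem exists_descend_function {f : P → ℝ} (hf : ContMDiff 𝓘(ℝ, X) 𝓘(ℝ, ℝ) ∞ f)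
    (hpr : ContMDiff 𝓘(ℝ, X) 𝓘(ℝ, E') ∞ pr) (hsurj : Function.Surjective pr)
    (hsub : ∀ p, Function.Surjective (mfderiv 𝓘(ℝ, X) 𝓘(ℝ, E') pr p))
    (hfib : ∀ p p', pr p = pr p' → f p = f p') :
    ∃ f' : N → ℝ, ContMDiff 𝓘(ℝ, E') 𝓘(ℝ, ℝ) ∞ f' ∧ ∀ p, f' (pr p) = f p := by
  choose s hs using hsurj
  refine ⟨fun n => f (s n), fun n => ?_, fun p => hfib _ _ (hs _)⟩
  obtain ⟨σ, O, hO, hn, -, hσ, hqσ⟩ := exists_local_section hpr (s n) (hsub _)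
  rw [hs] at hn
  refine (ContMDiffAt.comp (g := f) n (hf _)
    (hσ.contMDiffAt (hO.mem_nhds hn))).congr_of_eventuallyEq ?_
  filter_upwards [hO.mem_nhds hn] with w hw
  exact hfib _ _ ((hs _).trans (hqσ _ hw).symm)

end Descent

section LevelSet

variable {E : Type*} [NormedAddCommGroup E] [NormedSpace ℝ E] [FiniteDimensional ℝ E]
  {M : Type*} [TopologicalSpace M] [ChartedSpace E M] [IsManifold 𝓘(ℝ, E) ∞ M]
  {S : HyperkahlerStructure E M} {B : QuatAction E M} {A : CircleAction E M} {μ : M → ℍ[ℝ]}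
  {X : Type*} [NormedAddCommGroup X] [NormedSpace ℝ X] [FiniteDimensional ℝ X]
  [ChartedSpace X (LevelSet μ)] [IsManifold 𝓘(ℝ, X) ∞ (LevelSet μ)]
  {E' : Type*} [NormedAddCommGroup E'] [NormedSpace ℝ E'] [FiniteDimensional ℝ E']
  {N : Type*} [TopologicalSpace N] [ChartedSpace E' N] [IsManifold 𝓘(ℝ, E') ∞ N]

variable (S B) in
/-- `|Y₀|²`. -/
def sqY (m : M) : ℝ := S.metric.inner m (B.quatField 1 m) (B.quatField 1 m)

variable (S B A) in
/-- The data of the construction on the level set that are obtained by reduction. -/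
structure IsReductionData (D : InductionData E' N X (LevelSet μ)) : Prop where
  princ_act : ∀ z p, (D.princ.act z p : M) = A.act z (p : M)
  lift_act : ∀ z p, (D.lift.act z p : M) = B.act (circleToQuat z) (p : M)
  xi_eq : ∀ p, D.xiF p = levelXi S A μ X p
  herm_eq : ∀ p a b, D.hk.herm (D.proj p) (D.dproj p a) (D.dproj p b) = levelHerm S A p a b
  rho_eq : ∀ p, D.rho (D.proj p) = -(1 / 2) * sqY S B (p : M)

namespace IsLevelManifold

variable (hL : IsLevelManifold E X μ) (h : IsReductionSetting S B A μ)
  (hK : ∀ m, μ m = -qi → A.circleField m ≠ 0)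

include hK in
theorem isConnection_levelXi : IsConnection (hL.princ h) (fun p => levelXi S A μ X p) where
  contMDiff := contMDiff_iff_smoothOne.2 fun p a => (hL.contDiffAt_levelXi h hK
    (eventually_contMDiffAt_extChartAt_symm p) a).1
  invariant z p u := hL.levelXi_princ h z p u
  field p := (hL.levelHor_princ_field h hK p).1

theorem metric_quatField_qi (m : M) (u : TangentSpace 𝓘(ℝ, E) m) (h : IsPermuting S B) :
    S.omega 0 m (B.quatField qi m) u = S.metric.inner m (B.quatField 1 m) u := by
  have h3 := S.omega_skew 0 m (B.quatField qi m) u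
  rw [HyperkahlerStructure.omega, HyperkahlerStructure.omega, h.field_i, map_neg, neg_neg] at h3
  exact h3.trans (S.metric.symm m _ _)

include hK in
/-- The reduction of a permuting action at the level `-i` provides the data of the construction. -/
theorem exists_inductionData [T2Space M] {pr : LevelSet μ → N}
    (hpr : IsPrincipalCircleBundle (E := E') (hL.princ h) pr) :
    ∃ D : InductionData E' N X (LevelSet μ), IsReductionData S B A D := by
  obtain ⟨S', hS'⟩ := hL.exists_reduction h hK hpr
  let dpr : (p : LevelSet μ) → X →L[ℝ] TangentSpace 𝓘(ℝ, E') (pr p) := fun p =>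
    mfderiv 𝓘(ℝ, X) 𝓘(ℝ, E') pr p
  have hdpr : ∀ p (u : TangentSpace 𝓘(ℝ, E') (pr p)), ∃ a, dpr p a = u := fun p u => hpr.submersion p u
  have hpd : ∀ p, HasMFDerivAt 𝓘(ℝ, X) 𝓘(ℝ, E') pr p (dpr p) := fun p =>
    ((hpr.contMDiff p).mdifferentiableAt (by simp)).hasMFDerivAt
  have hcomm : ∀ z z' p, (hL.lift h).act z ((hL.princ h).act z' p)
      = (hL.princ h).act z' ((hL.lift h).act z p) := fun z z' p => Subtype.ext (h.comm _ z' (p : M))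
  obtain ⟨rot, hrot⟩ := (hL.lift h).exists_descend hpr.contMDiff hpr.surjective hpr.submersion
    (fun z p p' hp => by
      obtain ⟨z', rfl⟩ := (hpr.fibre p p').1 hp
      rw [hcomm]
      exact (hpr.fibre _ _).2 ⟨z', rfl⟩)
  have hherm : ∀ z n u v, S'.herm (rot.act z n) (rot.push z n u) (rot.push z n v)
      = (circleToQuat z : ℍ[ℝ]) * S'.herm n u v * star (circleToQuat z : ℍ[ℝ]) := by
    intro z n u v
    obtain ⟨p, rfl⟩ := hpr.surjective n
    obtain ⟨a, rfl⟩ := hdpr p u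
    obtain ⟨b, rfl⟩ := hdpr p v
    have hpush : ∀ a : X, (rot.push z (pr p) (dpr p a) : E')
        = dpr ((hL.lift h).act z p) ((hL.lift h).pushL z p a) := fun a => by
      have h1 := HasMFDerivAt.comp p (rot.hasMFDerivAt_act z (pr p)) (hpd p)
      have h2 := HasMFDerivAt.comp p (hpd ((hL.lift h).act z p)) ((hL.lift h).hasMFDerivAt_act z p)
      have h3 : rot.act z ∘ pr = pr ∘ (hL.lift h).act z := funext fun p => (hrot z p).symm
      rw [h3] at h1
      exact DFunLike.congr_fun (hasMFDerivAt_unique h1 h2) a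
    have e1 : S'.herm (pr p) (dpr p a) (dpr p b) = levelHerm S A p a b := hS' p a b
    rw [e1, ← hL.levelHerm_lift h]
    exact (InductionData.herm_congr S' (hrot z p).symm (hpush a) (hpush b)).trans (hS' _ _ _)
  let f : M → ℝ := fun m => -(1 / 2) * sqY S B m
  have hf : ContMDiff 𝓘(ℝ, E) 𝓘(ℝ, ℝ) ∞ f := h.perm.isHyperkahlerPotential.1
  obtain ⟨ρ, hρ, hρf⟩ := exists_descend_function (f := fun p : LevelSet μ => f (p : M))
    (hf.comp hL.contMDiff_val) hpr.contMDiff hpr.surjective hpr.submersion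
    (fun p p' hp => by
      obtain ⟨z, rfl⟩ := (hpr.fibre p p').1 hp
      have h1 := h.tri.metric_push z (p : M) (B.quatField 1 (p : M)) (B.quatField 1 (p : M))
      rw [h.push_Y] at h1
      exact congrArg (fun c : ℝ => -(1 / 2) * c) h1.symm)
  have hmom : IsMomentumMapOne S' rot ρ := by
    refine ⟨hρ, fun n u => ?_⟩
    obtain ⟨p, rfl⟩ := hpr.surjective n
    obtain ⟨a, rfl⟩ := hdpr p u
    let Dρ : E' →L[ℝ] ℝ := mfderiv 𝓘(ℝ, E') 𝓘(ℝ, ℝ) ρ (pr p)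
    let Df : E →L[ℝ] ℝ := mfderiv 𝓘(ℝ, E) 𝓘(ℝ, ℝ) f (p : M)
    let d1 : X →L[ℝ] E' := dpr p
    let d2 : X →L[ℝ] E := dval E X p
    have h1 : HasMFDerivAt 𝓘(ℝ, X) 𝓘(ℝ, ℝ) (fun p => ρ (pr p)) p (Dρ.comp d1) :=
      HasMFDerivAt.comp p ((hρ (pr p)).mdifferentiableAt (by simp)).hasMFDerivAt (hpd p)
    have h2 : HasMFDerivAt 𝓘(ℝ, X) 𝓘(ℝ, ℝ) (fun p : LevelSet μ => f (p : M)) p (Df.comp d2) :=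
      HasMFDerivAt.comp (g := f) p ((hf (p : M)).mdifferentiableAt (by simp)).hasMFDerivAt (hL.hasMFDerivAt_val p)
    rw [show (fun p => ρ (pr p)) = fun p : LevelSet μ => f (p : M) from funext hρf] at h1
    have h3 : Dρ.comp d1 = Df.comp d2 := hasMFDerivAt_unique h1 h2
    have h4 : Dρ (d1 a) = Df (d2 a) := DFunLike.congr_fun h3 a
    have h5 : Df (d2 a) = -S.metric.inner (p : M) (B.quatField 1 (p : M)) (dval E X p a) :=
      h.perm.mvfderiv_potential (p : M) (dval E X p a)
    refine h4.trans (h5.trans ?_)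
    have h6 : dpr p ((hL.lift h).fieldL p) = rot.circleField (pr p) :=
      (hL.lift h).mfderiv_circleField rot p (hpd p).mdifferentiableAt fun z => hrot z p
    have h7 : S'.herm (pr p) (dpr p ((hL.lift h).fieldL p)) (dpr p a)
        = levelHerm S A p ((hL.lift h).fieldL p) a := hS' p _ a
    rw [← h6, ← S'.imFn_herm _ _ _ 0, h7, imFn_levelHerm, hL.dval_lift_field h, S.omegaL_apply,
      metric_quatField_qi _ _ h.perm]
  refine ⟨{ hk := S', rot := rot, rho := ρ, isMomentumMap := hmom, proj := pr, princ := hL.princ h,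
            isPrincipal := hpr, xi := fun p => levelXi S A μ X p,
            isConnection := hL.isConnection_levelXi h hK, lift := hL.lift h, lift_comm := hcomm,
            proj_lift := hrot, isRotating := ⟨fun z m u v => ?_, fun z m u v =>
              (HyperkahlerStructure.metric_omegaQ_of_herm (hherm z m u v)).2⟩ },
    fun _ _ => rfl, fun _ _ => rfl, fun _ => rfl, hS', hρf⟩
  have h1 := (HyperkahlerStructure.metric_omegaQ_of_herm (hherm z m u v)).1
  rwa [norm_circleToQuat, one_pow, one_mul] at h1

end IsLevelManifold

end LevelSet

theorem qi_mul_qi : qi * qi = -1 := by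
  ext <;> simp

theorem hermF_reduction (t v : ℝ) (x θ θ' : ℍ[ℝ]) (ξ ξ' : ℝ) (k k' h : ℍ[ℝ]) :
    hermF t v x (x * θ * qi) (x * θ' * qi) ξ ξ' (qi * k - ((2 * ξ : ℝ) : ℍ[ℝ]))
        (qi * k' - ((2 * ξ' : ℝ) : ℍ[ℝ])) (h - ((v⁻¹ * (ξ * ξ') : ℝ) : ℍ[ℝ]))
      = x * (t • (θ * star θ') + θ * k' + star (θ' * k) + h) * star x := by
  have h1 : ∀ a b : ℍ[ℝ], a * qi * (qi * b) = -(a * b) := fun a b => by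
    rw [mul_assoc, ← mul_assoc qi qi, qi_mul_qi, neg_one_mul, mul_neg]
  have h2 : x * θ * qi * star (x * θ' * qi) = x * (θ * star θ') * star x := by
    have h3 : star qi = -qi := by ext <;> simp
    rw [star_mul, star_mul, h3, mul_assoc (x * θ), ← mul_assoc qi, mul_neg, qi_mul_qi, neg_neg, one_mul]
    simp only [mul_assoc]
  rw [hermF, add_sub_cancel, add_sub_cancel, add_sub_cancel, h1, h1, h2]
  simp only [mul_add, add_mul, mul_smul_comm, smul_mul_assoc, neg_mul, star_neg, sub_neg_eq_add,
    star_mul, star_star, mul_assoc]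

theorem exists_circleToQuat {z : (ℍ[ℝ])ˣ} (h : (z : ℍ[ℝ]) * -qi * star (z : ℍ[ℝ]) = -qi) :
    ∃ ζ : Circle, z = circleToQuat ζ := by
  have hi : ‖qi‖ = 1 := by
    have : ‖qi‖ * ‖qi‖ = 1 := by
      rw [← norm_mul, qi_mul_qi, norm_neg, norm_one]
    nlinarith [norm_nonneg qi]
  have hn : ‖(z : ℍ[ℝ])‖ * ‖(z : ℍ[ℝ])‖ = 1 := by
    have h1 := congrArg norm h
    rwa [norm_mul, norm_mul, norm_neg, norm_star, hi, mul_one] at h1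
  have hz : star (z : ℍ[ℝ]) * z = 1 := by
    rw [Quaternion.star_mul_self, Quaternion.normSq_eq_norm_mul_self, hn, Quaternion.coe_one]
  have hc : (z : ℍ[ℝ]) * qi = qi * z := by
    have h1 := congrArg (· * (z : ℍ[ℝ])) h
    simp only [mul_assoc, hz, mul_one] at h1
    simpa using h1
  have hJ : (z : ℍ[ℝ]).imJ = 0 := by
    have := congrArg QuaternionAlgebra.imK hc
    simp at this
    linarith
  have hK : (z : ℍ[ℝ]).imK = 0 := by
    have := congrArg QuaternionAlgebra.imJ hc
    simp at this
    linarith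
  have hns : (z : ℍ[ℝ]).re ^ 2 + (z : ℍ[ℝ]).imI ^ 2 = 1 := by
    have h1 := Quaternion.normSq_def' (a := (z : ℍ[ℝ]))
    rw [Quaternion.normSq_eq_norm_mul_self, hn, hJ, hK] at h1
    linarith
  let w : ℂ := ⟨(z : ℍ[ℝ]).re, (z : ℍ[ℝ]).imI⟩
  have hw : ‖w‖ = 1 := by
    have h1 : ‖w‖ ^ 2 = 1 := by
      rw [← Complex.normSq_eq_norm_sq, Complex.normSq_apply]
      simp only [w]
      linarith
    exact (pow_eq_one_iff_of_nonneg (norm_nonneg _) two_ne_zero).1 h1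
  obtain ⟨ζ, hζ⟩ : ∃ ζ : Circle, (ζ : ℂ) = w := ⟨⟨w, mem_sphere_zero_iff_norm.2 hw⟩, rfl⟩
  refine ⟨ζ, ?_⟩
  ext1
  ext <;> simp [hζ, w, hJ, hK]

theorem exists_mul_neg_qi_mul_star {b : ℍ[ℝ]} (hb : b ≠ 0) (hre : b.re = 0) :
    ∃ x : (ℍ[ℝ])ˣ, (x : ℍ[ℝ]) * -qi * star (x : ℍ[ℝ]) = b := by
  have hn : ‖b‖ ≠ 0 := norm_ne_zero_iff.2 hb
  let a₀ : EuclideanSpace ℝ (Fin 3) := !₂[-1, 0, 0]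
  let b₀ : EuclideanSpace ℝ (Fin 3) := !₂[‖b‖⁻¹ * b.imI, ‖b‖⁻¹ * b.imJ, ‖b‖⁻¹ * b.imK]
  have ha : quatOf a₀ = -qi := by ext <;> simp [a₀]
  have hb₀ : quatOf b₀ = ‖b‖⁻¹ • b := by ext <;> simp [b₀, hre]
  have ha1 : ‖a₀‖ = 1 := by
    simp [a₀, EuclideanSpace.norm_eq, Fin.sum_univ_three]
  have hb1 : ‖b₀‖ = 1 := by
    rw [← norm_quatOf, hb₀, norm_smul, norm_inv, norm_norm, inv_mul_cancel₀ hn]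
  obtain ⟨y, hy0, hy⟩ := exists_mul_quatOf ha1 hb1
  rw [ha, hb₀] at hy
  have hy1 : ‖y‖ ≠ 0 := norm_ne_zero_iff.2 hy0
  let s : ℝ := √‖b‖ * ‖y‖⁻¹
  have hs : s ≠ 0 := mul_ne_zero (Real.sqrt_ne_zero'.2 (lt_of_le_of_ne (norm_nonneg _) hn.symm))
    (inv_ne_zero hy1)
  have hs2 : s * s * (‖y‖ * ‖y‖) * ‖b‖⁻¹ = 1 := by
    have h1 : √‖b‖ * √‖b‖ = ‖b‖ := Real.mul_self_sqrt (norm_nonneg _)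
    calc s * s * (‖y‖ * ‖y‖) * ‖b‖⁻¹
        = (√‖b‖ * √‖b‖) * (‖y‖⁻¹ * ‖y‖) * (‖y‖⁻¹ * ‖y‖) * ‖b‖⁻¹ := by simp only [s]; ring
      _ = 1 := by rw [h1, inv_mul_cancel₀ hy1, mul_one, mul_one, mul_inv_cancel₀ hn]
  refine ⟨Units.mk0 (s • y) (smul_ne_zero hs hy0), ?_⟩
  rw [Units.val_mk0, smul_mul_assoc, hy, star_smul, star_trivial, smul_mul_assoc, mul_smul_comm,
    smul_mul_assoc, smul_mul_assoc, mul_assoc, Quaternion.self_mul_star,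
    Quaternion.normSq_eq_norm_mul_self, Quaternion.mul_coe_eq_smul, smul_smul, smul_smul, smul_smul]
  rw [show s * s * ‖b‖⁻¹ * (‖y‖ * ‖y‖) = 1 by rw [← hs2]; ring, one_smul]

section LevelSet

variable {E : Type*} [NormedAddCommGroup E] [NormedSpace ℝ E] [FiniteDimensional ℝ E]
  {M : Type*} [TopologicalSpace M] [ChartedSpace E M] [IsManifold 𝓘(ℝ, E) ∞ M]
  {S : HyperkahlerStructure E M} {B : QuatAction E M} {A : CircleAction E M} {μ : M → ℍ[ℝ]}
  {X : Type*} [NormedAddCommGroup X] [NormedSpace ℝ X] [FiniteDimensional ℝ X]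
  [ChartedSpace X (LevelSet μ)] [IsManifold 𝓘(ℝ, X) ∞ (LevelSet μ)]
  {E' : Type*} [NormedAddCommGroup E'] [NormedSpace ℝ E'] [FiniteDimensional ℝ E']
  {N : Type*} [TopologicalSpace N] [ChartedSpace E' N] [IsManifold 𝓘(ℝ, E') ∞ N]

namespace IsReductionData

variable {D : InductionData E' N X (LevelSet μ)} (hD : IsReductionData S B A D)
  (hL : IsLevelManifold E X μ) (h : IsReductionSetting S B A μ)
  (hK : ∀ m, μ m = -qi → A.circleField m ≠ 0)
include hD hL h hK

theorem dval_lift (p : LevelSet μ) : dval E X p (D.lift.fieldL p) = B.quatField qi (p : M) :=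
  (SmoothAction.mfderiv_circleField D.lift B.phase p (hL.hasMFDerivAt_val p).mdifferentiableAt
    fun z => hD.lift_act z p).trans (B.circleField_phase _)

theorem sqK_mul_xi_lift (p : LevelSet μ) :
    sqK S A (p : M) * levelXi S A μ X p (D.lift.fieldL p) = 2 := by
  rw [hL.levelXi_mul h hK, hD.dval_lift hL h hK, ← S.herm_re, h.herm_K_Y, p.2]
  simp

theorem herm_Kr (p : LevelSet μ) (a : X) :
    D.hk.herm (D.proj p) (D.Kr (D.proj p)) (D.dproj p a)
      = qi * S.herm (p : M) (B.quatField 1 (p : M)) (dval E X p a)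
        - ((2 * levelXi S A μ X p a : ℝ) : ℍ[ℝ]) := by
  have h1 : D.dproj p (D.lift.fieldL p) = D.Kr (D.proj p) := D.dproj_lift p
  rw [← h1, hD.herm_eq, levelHerm, hD.dval_lift hL h hK, h.perm.quatField_eq, S.herm_qsmul_left,
    ← mul_assoc (sqK S A (p : M)), hD.sqK_mul_xi_lift hL h hK]

theorem w_eq (p : LevelSet μ) :
    D.w (D.proj p) = sqY S B (p : M) - 4 * (sqK S A (p : M))⁻¹ := by
  have h1 : D.dproj p (D.lift.fieldL p) = D.Kr (D.proj p) := D.dproj_lift p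
  have h2 := congrArg QuaternionAlgebra.re (hD.herm_eq p (D.lift.fieldL p) (D.lift.fieldL p))
  have h3 := hD.sqK_mul_xi_lift hL h hK p
  have h4 : levelXi S A μ X p (D.lift.fieldL p) = 2 * (sqK S A (p : M))⁻¹ := by
    rw [← h3, mul_comm, ← mul_assoc, inv_mul_cancel₀ (hL.sqK_pos h hK p).ne', one_mul]
  rw [h1, D.hk.herm_re, levelHerm, hD.dval_lift hL h hK, h.perm.quatField_eq, S.herm_qsmul_left,
    S.herm_qsmul_right, S.herm_self, ← mul_assoc, mul_coe_mul_star, ← mul_assoc (sqK S A (p : M)), h3,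
    h4] at h2
  have hi : ‖qi‖ ^ 2 = 1 := by
    rw [sq, ← norm_mul, qi_mul_qi, norm_neg, norm_one]
  rw [hi, mul_one, Quaternion.re_sub, Quaternion.re_coe, Quaternion.re_coe] at h2
  refine h2.trans ?_
  rw [sqY]
  ring

theorem v_eq (p : LevelSet μ) : D.v (D.proj p) = (sqK S A (p : M))⁻¹ := by
  rw [InductionData.v, hD.w_eq hL h hK, hD.rho_eq]
  ring

theorem v_pos (n : N) : 0 < D.v n := by
  obtain ⟨p, rfl⟩ := D.isPrincipal.surjective n
  rw [hD.v_eq hL h hK]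
  exact inv_pos.2 (hL.sqK_pos h hK p)

theorem isNormalized : D.IsNormalized := by
  intro p
  have h1 : D.xi p (D.lift.circleField p) = levelXi S A μ X p (D.lift.fieldL p) :=
    DFunLike.congr_fun (hD.xi_eq p) (D.lift.fieldL p)
  have h3 := hD.sqK_mul_xi_lift hL h hK p
  rw [h1, hD.v_eq hL h hK, ← h3, mul_right_comm, mul_inv_cancel₀ (hL.sqK_pos h hK p).ne', one_mul]

theorem isReduction : IsReduction S A μ (-qi) D.hk D.princ D.proj := by
  have homega : ∀ (p : LevelSet μ) (a b : X), D.hk.omegaQ (D.proj p) (D.dproj p a) (D.dproj p b)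
      = S.omegaQ (p : M) (dval E X p a) (dval E X p b) := fun p a b => by
    have h1 := congrArg Quaternion.im (hD.herm_eq p a b)
    rw [D.hk.herm_im, levelHerm, Quaternion.im_sub, S.herm_im, Quaternion.im_coe, sub_zero] at h1
    exact h1
  have hmet : ∀ (p : LevelSet μ) (a b : X),
      S.metric.inner (p : M) (dval E X p a) (A.circleField (p : M)) = 0 →
      D.hk.metric.inner (D.proj p) (D.dproj p a) (D.dproj p b)
        = S.metric.inner (p : M) (dval E X p a) (dval E X p b) := fun p a b ha => by
    have h1 := congrArg QuaternionAlgebra.re (hD.herm_eq p a b)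
    have h2 : levelXi S A μ X p a = 0 := by
      have h3 := hL.levelXi_mul h hK p a
      rw [S.metric.symm, ha] at h3
      exact (mul_eq_zero.1 h3).resolve_left (hL.sqK_pos h hK p).ne'
    rw [D.hk.herm_re, levelHerm, Quaternion.re_sub, S.herm_re, Quaternion.re_coe, h2, zero_mul, mul_zero,
      sub_zero] at h1
    exact h1
  exact ⟨hL.contMDiff_val, hL.injective, hD.princ_act, D.isPrincipal, homega,
    fun p u v hu _ => hmet p u v hu⟩

end IsReductionData

end LevelSet

section LevelSet

variable {E : Type*} [NormedAddCommGroup E] [NormedSpace ℝ E] [FiniteDimensional ℝ E]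
  {M : Type*} [TopologicalSpace M] [ChartedSpace E M] [IsManifold 𝓘(ℝ, E) ∞ M]
  {S : HyperkahlerStructure E M} {B : QuatAction E M} {A : CircleAction E M} {μ : M → ℍ[ℝ]}
  {X : Type*} [NormedAddCommGroup X] [NormedSpace ℝ X] [FiniteDimensional ℝ X]
  [ChartedSpace X (LevelSet μ)] [IsManifold 𝓘(ℝ, X) ∞ (LevelSet μ)]
  {E' : Type*} [NormedAddCommGroup E'] [NormedSpace ℝ E'] [FiniteDimensional ℝ E']
  {N : Type*} [TopologicalSpace N] [ChartedSpace E' N] [IsManifold 𝓘(ℝ, E') ∞ N]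

variable (μ) in
/-- The map `(x, p) ↦ x p`. -/
def sweep (B : QuatAction E M) (z : (ℍ[ℝ])ˣ × LevelSet μ) : M := B.act z.1 (z.2 : M)

theorem IsLevelManifold.contMDiff_sweep (hL : IsLevelManifold E X μ) :
    ContMDiff (𝓘(ℝ, ℍ[ℝ]).prod 𝓘(ℝ, X)) 𝓘(ℝ, E) ∞ (sweep μ B) :=
  B.contMDiff_act.comp (contMDiff_fst.prodMk (hL.contMDiff_val.comp contMDiff_snd))

theorem IsLevelManifold.dq_sweep (hL : IsLevelManifold E X μ) (z : (ℍ[ℝ])ˣ × LevelSet μ)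
    (a : ℍ[ℝ] × X) : InductionData.dq X (sweep μ B) z a
      = B.push z.1 (z.2 : M) (B.quatField (((z.1⁻¹ : (ℍ[ℝ])ˣ) : ℍ[ℝ]) * a.1) (z.2 : M)
        + dval E X z.2 a.2) := by
  obtain ⟨x, p⟩ := z
  let ψ : (ℍ[ℝ])ˣ × LevelSet μ → M := fun w => B.act (x⁻¹ * w.1) (w.2 : M)
  have hψ : sweep μ B = B.act x ∘ ψ := funext fun w => by
    simp only [sweep, ψ, Function.comp_apply, ← B.mul_act, mul_inv_cancel_left]
  have hψs : ContMDiff (𝓘(ℝ, ℍ[ℝ]).prod 𝓘(ℝ, X)) 𝓘(ℝ, E) ∞ ψ :=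
    B.contMDiff_act.comp ((contMDiff_const.mul contMDiff_fst).prodMk
      (hL.contMDiff_val.comp contMDiff_snd))
  have hψd : HasMFDerivAt (𝓘(ℝ, ℍ[ℝ]).prod 𝓘(ℝ, X)) 𝓘(ℝ, E) ψ (x, p)
      (mfderiv (𝓘(ℝ, ℍ[ℝ]).prod 𝓘(ℝ, X)) 𝓘(ℝ, E) ψ (x, p)) :=
    ((hψs (x, p)).mdifferentiableAt (by simp)).hasMFDerivAt
  let dψ : ℍ[ℝ] × X →L[ℝ] E := mfderiv (𝓘(ℝ, ℍ[ℝ]).prod 𝓘(ℝ, X)) 𝓘(ℝ, E) ψ (x, p)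
  have hx : x⁻¹ * x = 1 := by simp
  have h1 : ∀ c : ℍ[ℝ], dψ (c, 0) = B.quatField (((x⁻¹ : (ℍ[ℝ])ˣ) : ℍ[ℝ]) * c) (p : M) := by
    intro c
    have e1 := HasMFDerivAt.comp x (g := ψ) (f := fun y : (ℍ[ℝ])ˣ => (y, p)) hψd
      ((hasMFDerivAt_id x).prodMk (hasMFDerivAt_const p x))
    have e0 := B.hasMFDerivAt_quatOrbit (p : M)
    rw [← hx] at e0
    have e2 := HasMFDerivAt.comp x e0 (hasMFDerivAt_mul_left x⁻¹ x)
    have e3 := DFunLike.congr_fun (hasMFDerivAt_unique e1 e2) c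
    refine e3.trans ?_
    have e4 : (mfderiv 𝓘(ℝ, ℍ[ℝ]) 𝓘(ℝ, E) (fun y : (ℍ[ℝ])ˣ => B.act y (p : M)) (x⁻¹ * x)
        : ℍ[ℝ] →L[ℝ] E) (((x⁻¹ : (ℍ[ℝ])ˣ) : ℍ[ℝ]) * c)
        = B.quatField (((x⁻¹ : (ℍ[ℝ])ˣ) : ℍ[ℝ]) * c) (p : M) := by
      rw [hx]
      rfl
    exact e4
  have h2 : ∀ u : X, dψ (0, u) = dval E X p u := by
    intro u
    have e1 := HasMFDerivAt.comp p (g := ψ) (f := fun p' : LevelSet μ => (x, p')) hψd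
      ((hasMFDerivAt_const x p).prodMk (hasMFDerivAt_id p))
    have e2 : (ψ ∘ fun p' : LevelSet μ => (x, p')) = Subtype.val := funext fun p' => by
      simp only [ψ, Function.comp_apply, inv_mul_cancel, B.one_act]
    rw [e2] at e1
    exact DFunLike.congr_fun (hasMFDerivAt_unique e1 (hL.hasMFDerivAt_val p)) u
  have hψ0 : ψ (x, p) = (p : M) := by simp only [ψ, inv_mul_cancel, B.one_act]
  have hB : HasMFDerivAt 𝓘(ℝ, E) 𝓘(ℝ, E) (B.act x) (ψ (x, p)) (B.push x (p : M)) := by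
    rw [hψ0]
    exact B.hasMFDerivAt_act x (p : M)
  have h3 := HasMFDerivAt.comp (x, p) hB hψd
  rw [← hψ] at h3
  refine (DFunLike.congr_fun h3.mfderiv a).trans ?_
  have h4 : dψ a = B.quatField (((x⁻¹ : (ℍ[ℝ])ˣ) : ℍ[ℝ]) * a.1) (p : M) + dval E X p a.2 := by
    have e : a = (a.1, 0) + (0, a.2) := by simp
    conv_lhs => rw [e]
    rw [map_add, h1, h2]
    rfl
  exact congrArg (B.push x (p : M) : E →L[ℝ] E) h4

namespace IsReductionData

variable {D : InductionData E' N X (LevelSet μ)} (hD : IsReductionData S B A D)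
  (hL : IsLevelManifold E X μ) (h : IsReductionSetting S B A μ)
  (hK : ∀ m, μ m = -qi → A.circleField m ≠ 0)
include hD hL h hK

theorem isQuotientMap : D.IsQuotientMap (E' := E) (sweep μ B) where
  contMDiff := hL.contMDiff_sweep
  submersion z w := by
    obtain ⟨w, rfl⟩ := B.push_surjective z.1 (z.2 : M) w
    let b : ℍ[ℝ] := mvfderiv 𝓘(ℝ, E) μ (z.2 : M) w
    have hb : b.re = 0 := by
      simp only [b]
      rw [h.mvfderiv_mu]
      simp
    let θ : ℍ[ℝ] := (1 / 2 : ℝ) • (b * qi)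
    have hθ : mvfderiv 𝓘(ℝ, E) μ (z.2 : M) (B.quatField θ (z.2 : M)) = b := by
      rw [h.mvfderiv_mu_quatField, z.2.2]
      simp only [θ]
      generalize b = c at hb
      ext <;> simp [hb] <;> ring
    obtain ⟨u, hu⟩ : ∃ u : X, dval E X z.2 u = w - B.quatField θ (z.2 : M) :=
      hL.range z.2 _ (by rw [map_sub, hθ, sub_self])
    refine ⟨((z.1 : ℍ[ℝ]) * θ, u), (hL.dq_sweep z ((z.1 : ℍ[ℝ]) * θ, u)).trans ?_⟩
    simp only [hu]
    rw [← mul_assoc, Units.inv_mul, one_mul, add_sub_cancel]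
  fibre a b := by
    obtain ⟨x, p⟩ := a
    obtain ⟨x', p'⟩ := b
    constructor
    · intro hab
      have h1 : (p : M) = B.act (x⁻¹ * x') (p' : M) := by
        rw [B.mul_act]
        change B.act x (p : M) = B.act x' (p' : M) at hab
        rw [← hab, ← B.mul_act, inv_mul_cancel, B.one_act]
      have h2 := h.equiv (x⁻¹ * x') (p' : M)
      rw [← h1, p.2, p'.2] at h2
      obtain ⟨ζ, hζ⟩ := exists_circleToQuat h2.symm
      refine ⟨ζ, Prod.ext ?_ (Subtype.ext ?_)⟩
      · exact (inv_mul_eq_iff_eq_mul.1 hζ)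
      · rw [hD.lift_act, h1, ← B.mul_act, hζ, ← map_mul, inv_mul_cancel, map_one, B.one_act]
    · rintro ⟨ζ, hζ⟩
      obtain ⟨rfl, rfl⟩ := Prod.mk.inj hζ
      change B.act x (p : M) = B.act (x * circleToQuat ζ) (D.lift.act ζ⁻¹ p : M)
      rw [hD.lift_act, ← B.mul_act, mul_assoc, ← map_mul, mul_inv_cancel, map_one, mul_one]

omit hK in
theorem range_sweep : Set.range (sweep μ B) = {m | μ m ≠ 0} := by
  have hqi : qi ≠ 0 := fun h0 => by
    have := congrArg QuaternionAlgebra.imI h0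
    simp at this
  ext m
  constructor
  · rintro ⟨⟨x, p⟩, rfl⟩
    change μ (B.act x (p : M)) ≠ 0
    rw [h.equiv, p.2]
    exact mul_ne_zero (mul_ne_zero x.ne_zero (neg_ne_zero.2 hqi)) (star_ne_zero.2 x.ne_zero)
  · intro hm
    obtain ⟨x, hx⟩ := exists_mul_neg_qi_mul_star hm (h.mom.re_eq m)
    refine ⟨(x, ⟨B.act x⁻¹ m, ?_⟩), ?_⟩
    · rw [h.equiv, ← hx]
      have h1 : ((x⁻¹ : (ℍ[ℝ])ˣ) : ℍ[ℝ]) * (x : ℍ[ℝ]) = 1 := Units.inv_mul x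
      have h2 : star (x : ℍ[ℝ]) * star ((x⁻¹ : (ℍ[ℝ])ˣ) : ℍ[ℝ]) = 1 := by
        rw [← star_mul, h1, star_one]
      rw [← mul_assoc, ← mul_assoc, h1, one_mul, mul_assoc, h2, mul_one]
    · change B.act x (B.act x⁻¹ m) = m
      rw [← B.mul_act, mul_inv_cancel, B.one_act]

theorem herm_dq_sweep (z : (ℍ[ℝ])ˣ × LevelSet μ) (a b : ℍ[ℝ] × X) :
    S.herm (sweep μ B z) (InductionData.dq X (sweep μ B) z a) (InductionData.dq X (sweep μ B) z b)
      = D.hermHP z a b := by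
  obtain ⟨x, p⟩ := z
  obtain ⟨θ, hθ⟩ : ∃ θ, ((x⁻¹ : (ℍ[ℝ])ˣ) : ℍ[ℝ]) * a.1 = θ := ⟨_, rfl⟩
  obtain ⟨θ', hθ'⟩ : ∃ θ, ((x⁻¹ : (ℍ[ℝ])ˣ) : ℍ[ℝ]) * b.1 = θ := ⟨_, rfl⟩
  have ha : a.1 = (x : ℍ[ℝ]) * θ := by rw [← hθ, ← mul_assoc, Units.mul_inv, one_mul]
  have hb : b.1 = (x : ℍ[ℝ]) * θ' := by rw [← hθ', ← mul_assoc, Units.mul_inv, one_mul]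
  have hx := hD.xi_eq p
  have hv := hD.v_eq hL h hK p
  have hr : -2 * D.rho (D.proj p) = sqY S B (p : M) := by
    rw [hD.rho_eq]
    ring
  have hh := hD.herm_eq p a.2 b.2
  rw [levelHerm, ← inv_inv (sqK S A (p : M)), ← hv] at hh
  rw [InductionData.hermHP_eq_hermF, hL.dq_sweep, hL.dq_sweep]
  simp only [hx, hr, ha, hb, hh, hD.herm_Kr hL h hK, hermF_reduction]
  rw [← ha, ← hb, hθ, hθ']
  refine (h.perm.herm_push x (p : M) _ _).trans ?_
  congr 2
  rw [S.herm_add_left, S.herm_add_right, S.herm_add_right, h.perm.quatField_eq θ, h.perm.quatField_eq θ',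
    S.herm_qsmul_left, S.herm_qsmul_right, S.herm_qsmul_left, S.herm_qsmul_right, S.herm_self, star_mul,
    S.star_herm, Quaternion.coe_mul_eq_smul, mul_smul_comm]
  simp only [sqY]
  abel

theorem isInduced : D.IsInduced (sweep μ B) S := by
  intro z a b
  have h1 : S.herm (sweep μ B z) _ _ = (D.metricHP z a b : ℍ[ℝ]) + D.omegaHP z a b :=
    hD.herm_dq_sweep hL h hK z a b
  have hre : (D.omegaHP z a b).re = 0 := by
    simp [InductionData.omegaHP]
    ring
  have h2 := congrArg QuaternionAlgebra.re h1
  rw [S.herm_re, Quaternion.re_add, hre, Quaternion.re_coe, add_zero] at h2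
  refine ⟨h2, ?_⟩
  rw [HyperkahlerStructure.herm, h2] at h1
  exact add_left_cancel h1

end IsReductionData

end LevelSet

/-- The converse construction: the reduction at the level `-i` and the original manifold. -/
theorem IsReductionSetting.exists_reduction_data {E : Type*} [NormedAddCommGroup E]
    [NormedSpace ℝ E] [FiniteDimensional ℝ E]
    {M : Type u} [TopologicalSpace M] [T2Space M] [SecondCountableTopology M]
    [ChartedSpace E M] [IsManifold 𝓘(ℝ, E) ∞ M]
    {S : HyperkahlerStructure E M} {B : QuatAction E M} {A : CircleAction E M} {μ : M → ℍ[ℝ]}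
    (h : IsReductionSetting S B A μ) (hfree : ∀ z m, μ m = -qi → A.act z m = m → z = 1) :
    ∃ (k : ℕ) (_ : ChartedSpace (EuclideanSpace ℝ (Fin k)) {m : M // μ m = -qi})
        (_ : IsManifold (𝓡 k) ∞ {m : M // μ m = -qi})
        (n : ℕ) (M' : Type u) (_ : TopologicalSpace M')
        (_ : ChartedSpace (EuclideanSpace ℝ (Fin n)) M') (_ : IsManifold (𝓡 n) ∞ M')
        (D : InductionData (EuclideanSpace ℝ (Fin n)) M'
          (EuclideanSpace ℝ (Fin k)) {m : M // μ m = -qi}),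
        T2Space M' ∧ SecondCountableTopology M' ∧
        IsReduction S A μ (-qi) D.hk D.princ D.proj ∧
        (∀ z p, (D.lift.act z p : M) = B.act (circleToQuat z) (p : M)) ∧
        (∀ m, 0 < D.v m) ∧ D.IsNormalized ∧ D.CurvatureEquation ∧
        D.IsQuotientMap (E' := E) (fun z => B.act z.1 (z.2 : M)) ∧
        Set.range (fun z : (ℍ[ℝ])ˣ × {m : M // μ m = -qi} => B.act z.1 (z.2 : M))
          = {m | μ m ≠ 0} ∧
        D.IsInduced (fun z => B.act z.1 (z.2 : M)) S := by
  have hK : ∀ m, μ m = -qi → A.circleField m ≠ 0 := fun m hm =>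
    A.toCircleFlow.gen_ne_zero fun z hz => hfree z m hm hz
  obtain ⟨k, cs, hman, hL⟩ := h.exists_levelManifold hK
  let C := (hL.princ h).toCircleFlow
  have hC : ∀ z p, C.act z p = p → z = 1 := fun z p hz =>
    hfree z (p : M) p.2 (congrArg Subtype.val hz)
  let s : Setoid (LevelSet μ) :=
    { r := fun p q => ∃ z, C.act z p = q
      iseqv := ⟨fun p => ⟨1, C.one_act p⟩, fun ⟨z, hz⟩ => ⟨z⁻¹, hz ▸ C.inv_act z _⟩,
        fun ⟨z, hz⟩ ⟨z', hz'⟩ => ⟨z' * z, by rw [C.mul_act, hz, hz']⟩⟩ }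
  have hs : ∀ p q, Quotient.mk s p = Quotient.mk s q ↔ ∃ z, C.act z p = q := fun p q => Quotient.eq
  obtain ⟨cs', hman', h1, h2⟩ := C.exists_quotient_manifold
    (X := EuclideanSpace ℝ (Fin k)) hs hC (by simp only [finrank_euclideanSpace_fin])
  obtain ⟨D, hD⟩ := hL.exists_inductionData h hK (E' := EuclideanSpace ℝ (Fin k))
    (pr := Quotient.mk s) ⟨h1, Quotient.mk_surjective, h2, hC, hs⟩
  have : SecondCountableTopology (LevelSet μ) :=
    TopologicalSpace.Subtype.secondCountableTopology {m : M | μ m = -qi}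
  exact ⟨k + 1, cs, hman, k, Quotient s, inferInstance, cs', hman', D, C.t2Space_quotient hs,
    TopologicalSpace.Quotient.secondCountableTopology (C.isOpenMap_mk hs),
    hD.isReduction hL h hK, hD.lift_act, hD.v_pos hL h hK, hD.isNormalized hL h hK,
    D.curvatureEquation_of_isInduced hL.contMDiff_sweep S (hD.isInduced hL h hK),
    hD.isQuotientMap hL h hK, hD.range_sweep hL h, hD.isInduced hL h hK⟩

/-- A family of maps that are the identity on open sets accumulating at `y₀` is uniformly close to
the identity, in the sense of derivatives, near `y₀`. -/
theorem exists_lipschitzOnWith_sub {E : Type*} [NormedAddCommGroup E] [NormedSpace ℝ E]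
    {Φ : ℝ × E → E} {y₀ : E} (hΦ : ∀ t, ContDiffAt ℝ ∞ Φ (t, y₀))
    (hid : ∃ᶠ y in 𝓝 y₀, ∀ᶠ y' in 𝓝 y, ∀ t, Φ (t, y') = y') {K : Set ℝ} (hK : IsCompact K) :
    ∃ r > 0, ∀ t ∈ K, ∀ a ∈ Metric.ball y₀ r, ∀ b ∈ Metric.ball y₀ r,
      ‖(Φ (t, a) - a) - (Φ (t, b) - b)‖ ≤ 1 / 2 * ‖a - b‖ := by
  let G : ℝ × E → E →L[ℝ] E := fun z => (fderiv ℝ Φ z).comp (ContinuousLinearMap.inr ℝ ℝ E)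
  have hG : ∀ t, ContinuousAt G (t, y₀) := fun t =>
    ((hΦ t).continuousAt_fderiv (by simp)).clm_comp continuousAt_const
  have hd : ∀ t y, DifferentiableAt ℝ Φ (t, y) →
      HasFDerivAt (fun y => Φ (t, y) - y) (G (t, y) - ContinuousLinearMap.id ℝ E) y := fun t y h =>
    (h.hasFDerivAt.comp y (hasFDerivAt_prodMk_right t y)).sub (hasFDerivAt_id y)
  have hdiff : ∀ t, ∀ᶠ z in 𝓝 (t, y₀), DifferentiableAt ℝ Φ z := fun t =>
    (((hΦ t).of_le (m := 1) (by simp)).eventually (by simp)).mono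
      fun z hz => hz.differentiableAt (by simp)
  have hG0 : ∀ t, G (t, y₀) = ContinuousLinearMap.id ℝ E := fun t => by
    have hc : Tendsto (fun y => G (t, y)) (𝓝 y₀) (𝓝 (G (t, y₀))) :=
      (hG t).comp (f := fun y => (t, y)) (by fun_prop)
    have hdt : ∀ᶠ y in 𝓝 y₀, DifferentiableAt ℝ Φ (t, y) :=
      (show Tendsto (fun y => (t, y)) (𝓝 y₀) (𝓝 (t, y₀)) from
        (by fun_prop : Continuous fun y : E => (t, y)).tendsto y₀).eventually (hdiff t)
    refine isClosed_singleton.mem_of_frequently_of_tendsto ((hid.and_eventually hdt).mono ?_) hc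
    rintro y ⟨h1, h2⟩
    have h3 : HasFDerivAt (fun y => Φ (t, y) - y) (0 : E →L[ℝ] E) y :=
      (hasFDerivAt_const (0 : E) y).congr_of_eventuallyEq
        (h1.mono fun y' hy' => by simp [hy' t])
    exact sub_eq_zero.1 ((hd t y h2).unique h3)
  have hev : ∀ᶠ y in 𝓝 y₀, ∀ t ∈ K, DifferentiableAt ℝ Φ (t, y) ∧
      ‖G (t, y) - ContinuousLinearMap.id ℝ E‖ ≤ 1 / 2 := by
    refine hK.eventually_forall_of_forall_eventually
      (P := fun y t => DifferentiableAt ℝ Φ (t, y) ∧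
        ‖G (t, y) - ContinuousLinearMap.id ℝ E‖ ≤ 1 / 2) fun t _ => ?_
    have hsw : Tendsto (fun z : E × ℝ => (z.2, z.1)) (𝓝 (y₀, t)) (𝓝 (t, y₀)) :=
      (by fun_prop : Continuous fun z : E × ℝ => (z.2, z.1)).tendsto (y₀, t)
    have h0 : Tendsto (fun z => ‖G z - ContinuousLinearMap.id ℝ E‖) (𝓝 (t, y₀)) (𝓝 0) := by
      have := ((hG t).sub (g := fun _ => ContinuousLinearMap.id ℝ E) continuousAt_const).norm.tendsto
      simpa [hG0 t] using this
    exact hsw.eventually ((hdiff t).and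
      ((h0.eventually (gt_mem_nhds (by norm_num : (0 : ℝ) < 1 / 2))).mono fun z hz => hz.le))
  obtain ⟨r, hr, hball⟩ := Metric.eventually_nhds_iff_ball.1 hev
  refine ⟨r, hr, fun t ht a ha b hb => ?_⟩
  exact (convex_ball y₀ r).norm_image_sub_le_of_norm_hasFDerivWithin_le
    (fun y hy => (hd t y (hball y hy t ht).1).hasFDerivWithinAt)
    (fun y hy => (hball y hy t ht).2) hb ha

section FixedPoints

variable {E : Type*} [NormedAddCommGroup E] [NormedSpace ℝ E]
  {M : Type*} [TopologicalSpace M] [T2Space M] [ChartedSpace E M] [IsManifold 𝓘(ℝ, E) ∞ M]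
  (A : CircleFlow 𝓘(ℝ, E) M)

/-- The interior of the fixed point set of a circle action is closed. -/
theorem CircleFlow.isClosed_interior_fixed : IsClosed (interior {m | ∀ z, A.act z m = m}) := by
  refine isClosed_of_closure_subset fun m hm => ?_
  have hfix : ∀ z, A.act z m = m := by
    have hcl : IsClosed {m | ∀ z, A.act z m = m} := by
      simp only [ofPred_forall]
      exact isClosed_iInter fun z => isClosed_eq (A.contMDiff_act_left z).continuous continuous_id
    exact closure_minimal interior_subset hcl hm
  let e := chartAt E m
  have hme : m ∈ e.source := mem_chart_source E m
  let Φ : ℝ × E → E := fun z => e (A.act (Circle.exp z.1) (e.symm z.2))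
  have hsymm : e.symm (e m) = m := e.left_inv hme
  have hΦ : ∀ t, ContDiffAt ℝ ∞ Φ (t, e m) := fun t => by
    rw [← contMDiffAt_iff_contDiffAt]
    have h1 : ContMDiffAt 𝓘(ℝ, ℝ × E) 𝓘(ℝ, E) ∞ (fun z : ℝ × E => e.symm z.2) (t, e m) :=
      ContMDiffAt.comp (g := e.symm) (f := Prod.snd) (t, e m)
        ((contMDiffOn_chart_symm (I := 𝓘(ℝ, E)) (x := m)).contMDiffAt
          (e.open_target.mem_nhds (e.map_source hme))) contDiffAt_snd.contMDiffAt
    have h2 : ContMDiffAt 𝓘(ℝ, ℝ × E) (𝓡 1) ∞ (fun z : ℝ × E => Circle.exp z.1) (t, e m) :=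
      ContMDiffAt.comp (g := Circle.exp) (f := Prod.fst) (t, e m)
        contMDiff_circleExp.contMDiffAt contDiffAt_fst.contMDiffAt
    have h3 : ContMDiffAt 𝓘(ℝ, ℝ × E) 𝓘(ℝ, E) ∞
        (fun z : ℝ × E => A.act (Circle.exp z.1) (e.symm z.2)) (t, e m) :=
      ContMDiffAt.comp (g := fun z : Circle × M => A.act z.1 z.2)
        (f := fun z : ℝ × E => (Circle.exp z.1, e.symm z.2)) (t, e m)
        A.contMDiff_act.contMDiffAt (h2.prodMk h1)
    refine ContMDiffAt.comp (g := e)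
      (f := fun z : ℝ × E => A.act (Circle.exp z.1) (e.symm z.2)) (t, e m) ?_ h3
    simp only [hsymm, hfix]
    exact (contMDiffOn_chart (I := 𝓘(ℝ, E)) (x := m)).contMDiffAt (e.open_source.mem_nhds hme)
  have hid : ∃ᶠ y in 𝓝 (e m), ∀ᶠ y' in 𝓝 y, ∀ t, Φ (t, y') = y' := by
    have h1 : ∃ᶠ m' in 𝓝 m, m' ∈ interior {m | ∀ z, A.act z m = m} := mem_closure_iff_frequently.1 hm
    have h2 := h1.and_eventually (e.open_source.mem_nhds hme)
    refine (e.continuousAt hme).tendsto.frequently (h2.mono ?_)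
    rintro m' ⟨h3, h4⟩
    have h5 : ∀ᶠ y' in 𝓝 (e m'), e.symm y' ∈ interior {m | ∀ z, A.act z m = m} :=
      (e.continuousAt_symm (e.map_source h4)).eventually
        (isOpen_interior.mem_nhds (by rwa [e.left_inv h4]))
    filter_upwards [h5, e.open_target.mem_nhds (e.map_source h4)] with y' h6 h7 t
    exact (congrArg e (interior_subset h6 _)).trans (e.right_inv h7)
  obtain ⟨r, hr, hlip⟩ := exists_lipschitzOnWith_sub hΦ hid (isCompact_Icc (a := -Real.pi) (b := Real.pi))
  have hU : ∀ᶠ y in 𝓝 m, y ∈ e.source ∧ e y ∈ Metric.ball (e m) r :=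
    (e.open_source.eventually_mem hme).and (e.continuousAt hme (Metric.ball_mem_nhds _ hr))
  have hV : ∀ᶠ y in 𝓝 m, ∀ z ∈ (univ : Set Circle),
      A.act z y ∈ e.source ∧ e (A.act z y) ∈ Metric.ball (e m) r := by
    refine isCompact_univ.eventually_forall_of_forall_eventually (P := fun y z =>
      A.act z y ∈ e.source ∧ e (A.act z y) ∈ Metric.ball (e m) r) fun z _ => ?_
    have hc : Tendsto (fun x : M × Circle => A.act x.2 x.1) (𝓝 (m, z)) (𝓝 m) := by
      have := (A.continuous_act.comp continuous_swap).tendsto (m, z)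
      simpa [hfix, Function.comp_def] using this
    exact hc.eventually hU
  refine mem_interior_iff_mem_nhds.2 (hV.mono fun y hy z => ?_)
  have hy1 : ∀ w, A.act w y ∈ e.source := fun w => (hy w (mem_univ w)).1
  have hy2 : ∀ w, e (A.act w y) ∈ Metric.ball (e m) r := fun w => (hy w (mem_univ w)).2
  let d : Circle → ℝ := fun w => ‖e (A.act w y) - e y‖
  have hstep : ∀ w, 3 / 2 * d w ≤ d (w * w) := fun w => by
    simp only [d]
    obtain ⟨t, ht, rfl⟩ : ∃ t ∈ Icc (-Real.pi) Real.pi, Circle.exp t = w :=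
      ⟨Complex.arg w, ⟨(Complex.neg_pi_lt_arg _).le, Complex.arg_le_pi _⟩, Circle.exp_arg w⟩
    have h1 := hlip t ht _ (hy2 (Circle.exp t)) _ (hy2 1)
    have hy0 := e.left_inv (hy1 1)
    rw [A.one_act] at hy0
    simp only [Φ, e.left_inv (hy1 _), A.one_act, hy0, ← A.mul_act] at h1
    generalize e (A.act (Circle.exp t * Circle.exp t) y) = a at h1 ⊢
    generalize e (A.act (Circle.exp t) y) = b at h1 ⊢
    have h2 := norm_sub_le (a - e y) (a - b - (b - e y))
    rw [show a - e y - (a - b - (b - e y)) = (2 : ℝ) • (b - e y) by rw [two_smul]; abel,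
      norm_smul, Real.norm_ofNat] at h2
    linarith
  have hpow : ∀ n : ℕ, ∀ w, (3 / 2 : ℝ) ^ n * d w ≤ 2 * r := fun n => by
    induction n with
    | zero =>
      intro w
      have h1 := mem_ball_iff_norm.1 (hy2 w)
      have h2 := mem_ball_iff_norm.1 (hy2 1)
      rw [A.one_act] at h2
      have h3 := norm_sub_le (e (A.act w y) - e m) (e y - e m)
      rw [sub_sub_sub_cancel_right] at h3
      simp only [pow_zero, one_mul, d]
      linarith
    | succ n ih =>
      intro w
      have := mul_le_mul_of_nonneg_left (hstep w) (by positivity : (0 : ℝ) ≤ (3 / 2) ^ n)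
      rw [pow_succ]
      linarith [ih (w * w)]
  have hd : d z = 0 := by
    by_contra hne
    have hpos : 0 < d z := lt_of_le_of_ne (norm_nonneg _) (Ne.symm hne)
    obtain ⟨n, hn⟩ := pow_unbounded_of_one_lt (2 * r / d z) (by norm_num : (1 : ℝ) < 3 / 2)
    rw [div_lt_iff₀ hpos] at hn
    linarith [hpow n z]
  have := hy1 1
  rw [A.one_act] at this
  exact e.injOn (hy1 z) this (sub_eq_zero.1 (norm_eq_zero.1 hd))

end FixedPoints

/-- The momentum map vanishes on no open set if the circle acts trivially on no component. -/
theorem IsReductionSetting.dense_mu_ne_zero {E : Type*} [NormedAddCommGroup E] [NormedSpace ℝ E]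
    [FiniteDimensional ℝ E] {M : Type*} [TopologicalSpace M] [T2Space M] [ChartedSpace E M]
    [IsManifold 𝓘(ℝ, E) ∞ M]
    {S : HyperkahlerStructure E M} {B : QuatAction E M} {A : CircleAction E M} {μ : M → ℍ[ℝ]}
    (h : IsReductionSetting S B A μ) (hA : ∀ m, ∃ m' ∈ connectedComponent m, ∃ z, A.act z m' ≠ m') :
    Dense {m | μ m ≠ 0} := by
  rw [← compl_compl {m | μ m ≠ 0}, ← interior_eq_empty_iff_dense_compl, ← not_nonempty_iff_eq_empty]
  rintro ⟨m, hm⟩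
  have hsub : interior {m | μ m ≠ 0}ᶜ ⊆ {m | ∀ z, A.act z m = m} := fun m' hm' => by
    refine A.toCircleFlow.act_eq_of_gen_eq_zero ?_
    by_contra hK
    have h0 : (fun m => imV (μ m)) =ᶠ[𝓝 m'] fun _ => 0 := by
      filter_upwards [isOpen_interior.mem_nhds hm'] with a ha
      rw [not_not.1 (interior_subset ha), map_zero]
    obtain ⟨u, hu⟩ := h.surjective_mfderiv_mu hK (1 : Fin 3 → ℝ)
    rw [h0.mfderiv_eq, mfderiv_const] at hu
    exact zero_ne_one (congrFun hu 0)
  have hcl : IsClopen (interior {m | ∀ z, A.act z m = m}) :=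
    ⟨A.toCircleFlow.isClosed_interior_fixed, isOpen_interior⟩
  obtain ⟨m', hm', z, hz⟩ := hA m
  exact hz (interior_subset (hcl.connectedComponent_subset
    (interior_maximal hsub isOpen_interior hm) hm') z)

end HyperkahlerInduction

end

theorem theorem1 :
    -- the construction of `ℋ(M) = ℍ* ×_{S¹} P` from `M` and `P`
    (∀ (E : Type*) [NormedAddCommGroup E] [NormedSpace ℝ E] [FiniteDimensional ℝ E]
      (M : Type*) [TopologicalSpace M] [T2Space M] [SecondCountableTopology M]
      [ChartedSpace E M] [IsManifold 𝓘(ℝ, E) ∞ M]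
      (F : Type*) [NormedAddCommGroup F] [NormedSpace ℝ F] [FiniteDimensional ℝ F]
      (P : Type*) [TopologicalSpace P] [T2Space P] [SecondCountableTopology P]
      [ChartedSpace F P] [IsManifold 𝓘(ℝ, F) ∞ P]
      (D : InductionData E M F P),
      (∀ m, 0 < D.v m) → D.IsNormalized →
      -- the orbit space is a smooth manifold, the quotient of `ℍ* × P`
      (∃ (n : ℕ) (_ : ChartedSpace (EuclideanSpace ℝ (Fin n)) D.OrbitSpace),
        IsManifold (𝓡 n) ∞ D.OrbitSpace ∧ T2Space D.OrbitSpace ∧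
        SecondCountableTopology D.OrbitSpace ∧
        D.IsQuotientMap (E' := EuclideanSpace ℝ (Fin n))
          (Quotient.mk D.orbitSetoid : (ℍ[ℝ])ˣ × P → D.OrbitSpace)) ∧
      -- statements about every model `N` of the quotient manifold
      (∀ (E' : Type*) [NormedAddCommGroup E'] [NormedSpace ℝ E'] [FiniteDimensional ℝ E']
        (N : Type*) [TopologicalSpace N] [ChartedSpace E' N] [IsManifold 𝓘(ℝ, E') ∞ N]
        (q : (ℍ[ℝ])ˣ × P → N),
        D.IsQuotientMap (E' := E') q → Function.Surjective q →
        ((∃ S : HyperkahlerStructure E' N, D.IsInduced q S) ↔ D.CurvatureEquation) ∧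
        (∀ S : HyperkahlerStructure E' N, D.IsInduced q S →
          (∃ A : QuatAction E' N, (∀ y x p, A.act y (q (x, p)) = q (y * x, p)) ∧
            IsPermuting S A ∧ IsTransitiveOnComplexStructures S A) ∧
          (∃ ρ : N → ℝ,
            (∀ (x : (ℍ[ℝ])ˣ) (p : P), ρ (q (x, p)) =
              -((4 * D.v (D.proj p) + D.w (D.proj p)) / 2) * ‖(x : ℍ[ℝ])‖ ^ 2) ∧
            S.IsHyperkahlerPotential ρ)))) ∧
    -- the converse
    (∀ (E : Type*) [NormedAddCommGroup E] [NormedSpace ℝ E] [FiniteDimensional ℝ E]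
      (M : Type u) [TopologicalSpace M] [T2Space M] [SecondCountableTopology M]
      [ChartedSpace E M] [IsManifold 𝓘(ℝ, E) ∞ M]
      (S : HyperkahlerStructure E M) (B : QuatAction E M) (A : CircleAction E M) (μ : M → ℍ[ℝ]),
      IsPermuting S B → IsTriholomorphic S A → IsHyperkahlerMomentumMap S A μ →
      (∀ x z m, B.act x (A.act z m) = A.act z (B.act x m)) →
      (∀ x m, μ (B.act x m) = (x : ℍ[ℝ]) * μ m * star (x : ℍ[ℝ])) →
      -- the circle acts freely on the level set
      (∀ z m, μ m = -qi → A.act z m = m → z = 1) →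
      IsOpen {m | μ m ≠ 0} ∧
      -- density, when the circle acts trivially on no connected component
      ((∀ m, ∃ m' ∈ connectedComponent m, ∃ z, A.act z m' ≠ m') → Dense {m | μ m ≠ 0}) ∧
      ∃ (k : ℕ) (_ : ChartedSpace (EuclideanSpace ℝ (Fin k)) {m : M // μ m = -qi})
        (_ : IsManifold (𝓡 k) ∞ {m : M // μ m = -qi})
        (n : ℕ) (M' : Type u) (_ : TopologicalSpace M')
        (_ : ChartedSpace (EuclideanSpace ℝ (Fin n)) M') (_ : IsManifold (𝓡 n) ∞ M')
        (D : InductionData (EuclideanSpace ℝ (Fin n)) M'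
          (EuclideanSpace ℝ (Fin k)) {m : M // μ m = -qi}),
        T2Space M' ∧ SecondCountableTopology M' ∧
        IsReduction S A μ (-qi) D.hk D.princ D.proj ∧
        (∀ z p, (D.lift.act z p : M) = B.act (circleToQuat z) (p : M)) ∧
        (∀ m, 0 < D.v m) ∧ D.IsNormalized ∧ D.CurvatureEquation ∧
        D.IsQuotientMap (E' := E) (fun z => B.act z.1 (z.2 : M)) ∧
        Set.range (fun z : (ℍ[ℝ])ˣ × {m : M // μ m = -qi} => B.act z.1 (z.2 : M))
          = {m | μ m ≠ 0} ∧
        D.IsInduced (fun z => B.act z.1 (z.2 : M)) S) := by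
  refine ⟨?_, ?_⟩
  · intro E _ _ _ M _ _ _ _ _ F _ _ _ P _ _ _ _ _ D hv hnorm
    refine ⟨D.exists_orbitSpace_manifold, ?_⟩
    intro E' _ _ _ N _ _ _ q hq hsurj
    refine ⟨⟨fun ⟨S, hS⟩ => D.curvatureEquation_of_isInduced hq.contMDiff S hS,
      fun hcurv => D.exists_isInduced hv hnorm hcurv hq hsurj⟩, fun S hS => ?_⟩
    obtain ⟨A, hA⟩ := hq.exists_quatAction hsurj
    have hperm := hS.isPermuting hq hsurj hA
    exact ⟨⟨A, hA, hperm, hperm.isTransitiveOnComplexStructures⟩,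
      _, fun x p => hS.radial_sq hq hA x p, hperm.isHyperkahlerPotential⟩
  · intro E _ _ _ M _ _ _ _ _ S B A μ hperm htri hmom hcomm hequiv hfree
    have h : IsReductionSetting S B A μ := ⟨hperm, htri, hmom, hcomm, hequiv⟩
    exact ⟨isOpen_ne_fun hmom.contMDiff.continuous continuous_const, h.dense_mu_ne_zero,
      h.exists_reduction_data hfree⟩
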